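/- Let $\mathfrak g=\mathfrak g_0\oplus\mathfrak g_1$ be a finite-dimensional complex Lie superalgebra with reductive even part, equipped with a nondegenerate even invariant supersymmetric bilinear form $(\cdot|\cdot)$ and a Cartan subalgebra $\mathfrak h\subset\mathfrak g_0$ acting diagonalizably on $\mathfrak g$, such that the zero weight space of $\mathfrak g$ is $\mathfrak h$ and the odd root spaces are one-dimensional (for instance $\mathfrak g=\mathfrak{gl}(m|n)$, $\mathfrak{osp}(M|2n)$, $D(2|1;a)$, $F(4)$ or $G(3)$). Let $\Delta=\Delta_0\cup\Delta_1$ be the sets of even and odd roots, $(\cdot|\cdot)$ the induced form on $\mathfrak h^*$, $W$ the Weyl group of $\mathfrak g_0$ and $\operatorname{sgn}$ its sign character. Fix a base $\Pi_0$ of $\Delta_0$ and a Weyl vector $\rho_0\in\mathfrak h^*$, i.e. $r_\alpha\rho_0=\rho_0-\alpha$ for $\alpha\in\Pi_0$. A compatible base $\Sigma$ is a base of $\Delta$ whose positive even roots are those $\Delta_0^+$ of $\Pi_0$; let $\Delta_1^+=\Delta_1^+(\Sigma)$ be its positive odd roots and put $$\rho=\rho_0-\tfrac12\sum_{\alpha\in\Delta_1^+}\alpha,\qquad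 R=\frac{\prod_{\alpha\in\Delta_0^+}(1-e^{-\alpha})}{\prod_{\alpha\in\Delta_1^+}(1+e^{-\alpha})}.$$ Let $P(\mathfrak g_0)=\{\lambda\in\mathfrak h^*\mid \lambda-w\lambda\in\mathbb Z\Delta_0\ \forall w\in W\}$, and let $P^{++}(\mathfrak g_0)$ be the set of $\lambda\in P(\mathfrak g_0)$ with $\lambda-w\lambda\in\mathbb Z_{\ge0}\Delta_0^+$ for all $w\in W$ and $w\lambda\neq\lambda$ for all $w\ne1$. Let $L_{\mathfrak g_0}(\mu)$ be the simple $\mathfrak g_0$-module of highest weight $\mu$ (it is finite-dimensional if and only if $\mu+\rho_0\in P^{++}(\mathfrak g_0)$), and let $\mathrm{Ch}(\mathfrak g_0)\subset\mathbb Z[\mathfrak h^*]$ be the $\mathbb Z$-span of the characters of the finite-dimensional $\mathfrak g_0$-modules on which $\mathfrak h$ acts diagonalizably, with the linear map $\dim$ sending $\mathrm{ch}\,N$ to $\dim N$. An iso-set is a linearly independent set $S\subset\Delta_1$ with $(S|S)=0$. For $\nu\in\mathfrak h^*$ put, in the field of fractions of $\mathbb Z[\mathfrak h^*]$, $$\mathrm{KW}(\nu,S)=\sum_{w\in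 W}\operatorname{sgn}(w)\,w\Bigl(\frac{e^{\nu}}{\prod_{\beta\in S}(1+e^{-\beta})}\Bigr),$$ and write $\mathrm{sum}(U)=\sum_{\beta\in U}\beta$. (1) Let $\Sigma$ be a compatible base, $\lambda\in P(\mathfrak g_0)$ and $S$ an iso-set with $(\lambda+\rho|S)=0$. Then $\mathrm{KW}(\lambda+\rho,S)/(Re^{\rho})$ lies in $\mathrm{Ch}(\mathfrak g_0)$. If moreover $S\subset\Delta_1^+$, then $$\dim\frac{\mathrm{KW}(\lambda+\rho,S)}{Re^\rho}=d_{\Sigma}(\lambda,S):=\sum_{U\subset\Delta_1^+\setminus S}\ \prod_{\alpha\in\Delta_0^+}\frac{(\lambda+\rho_0-\mathrm{sum}(U)\,|\,\alpha)}{(\rho_0|\alpha)}$$ and $$\frac{\mathrm{KW}(\lambda+\rho,S)}{Re^\rho}=\sum_{\mu:\ \mu+\rho_0\in P^{++}(\mathfrak g_0)} n_{\lambda\mu}\,\mathrm{ch}\,L_{\mathfrak g_0}(\mu),\qquad n_{\lambda\mu}=n_{\lambda\mu}^{\Sigma,S}:=\sum_{U\subset\Delta_1^+\setminus S}\ \sum_{w\in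 W}\operatorname{sgn}(w)\,\delta_{w(\mu+\rho_0),\,\lambda+\rho_0-\mathrm{sum}(U)}.$$ (2) Consequently, let $L$ be a finite-dimensional $\mathfrak g_0$-module on which $\mathfrak h$ acts diagonalizably (for instance the restriction to $\mathfrak g_0$ of a finite-dimensional simple $\mathfrak g$-module), and suppose that $$Re^{\rho}\,\mathrm{ch}\,L=\sum_{i=1}^k c_i\,\mathrm{KW}(\lambda_i+\rho_i,S_i)$$ with $c_i\in\mathbb Q$, compatible bases $\Sigma_i$ with associated $\rho_i$, $\lambda_i\in P(\mathfrak g_0)$, and iso-sets $S_i\subset\Delta_1^+(\Sigma_i)$ with $(\lambda_i+\rho_i|S_i)=0$. Then $$\dim L=\sum_i c_i\,d_{\Sigma_i}(\lambda_i,S_i),\qquad [L:L_{\mathfrak g_0}(\mu)]=\sum_i c_i\,n_{\lambda_i\mu}^{\Sigma_i,S_i}\quad\text{whenever }\mu+\rho_0\in P^{++}(\mathfrak g_0).$$ In particular, if $Re^\rho\,\mathrm{ch}\,L=j^{-1}\mathrm{KW}(\lambda+\rho,S)$ then $\dim L=j^{-1}d_\Sigma(\lambda,S)$ and $[L:L_{\mathfrak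 g_0}(\mu)]=j^{-1}n_{\lambda\mu}$. -/

import Mathlib

/-! Characters of the even part of a basic Lie superalgebra and Kac-Wakimoto terms.
The ground field is `ℂ`. -/

universe u v w

namespace KacWakimoto

noncomputable section

/-! ### Weight spaces and characters -/

section Weights

variable {g : Type u} [LieRing g] [LieAlgebra ℂ g] (H : LieSubalgebra ℂ g)
variable (V : Type v) [AddCommGroup V] [Module ℂ V] [LieRingModule g V] [LieModule ℂ g V]

/-- The weight space `V_ν = {v | x v = ν(x) v for all x ∈ 𝔥}`. -/
def wtSpace (ν : Module.Dual ℂ H) : Submodule ℂ V where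
  carrier := {v | ∀ x : H, ⁅(x : g), v⁆ = ν x • v}
  zero_mem' := by intro x; simp
  add_mem' := by
    intro a b ha hb x
    have h1 := ha x
    have h2 := hb x
    rw [lie_add, h1, h2, smul_add]
  smul_mem' := by
    intro c a ha x
    have h1 := ha x
    rw [lie_smul, h1, smul_comm]

/-- `𝔥` acts diagonalizably on `V`, i.e. `V` is the sum of its weight spaces. -/
def IsWeightModule : Prop := ⨆ ν : Module.Dual ℂ H, wtSpace H V ν = ⊤

variable {V} in
theorem wt_sum_eq_zero (s : Finset (Module.Dual ℂ H)) :
    ∀ v : Module.Dual ℂ H → V, (∀ ν ∈ s, v ν ∈ wtSpace H V ν) → ∑ ν ∈ s, v ν = 0 →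
      ∀ ν ∈ s, v ν = 0 := by
  classical
  induction s using Finset.induction_on with
  | empty => simp
  | insert a s ha ih =>
    intro v hv h0
    rw [Finset.sum_insert ha] at h0
    have key : ∀ ν ∈ s, v ν = 0 := by
      intro ν hν
      have hne : ν ≠ a := fun h => ha (h ▸ hν)
      obtain ⟨x, hx⟩ : ∃ x, ν x ≠ a x := by
        by_contra hcon
        push Not at hcon
        exact hne (LinearMap.ext hcon)
      have h1 := ih (fun ν => (ν x - a x) • v ν)
        (fun ν hν => Submodule.smul_mem _ _ (hv ν (Finset.mem_insert_of_mem hν))) (by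
          have e1 : ⁅(x : g), v a + ∑ ν ∈ s, v ν⁆ = a x • v a + ∑ ν ∈ s, ν x • v ν := by
            rw [lie_add, lie_sum, hv a (Finset.mem_insert_self _ _) x]
            congr 1
            exact Finset.sum_congr rfl fun ν hν => hv ν (Finset.mem_insert_of_mem hν) x
          have e2 : a x • (v a + ∑ ν ∈ s, v ν) = a x • v a + ∑ ν ∈ s, a x • v ν := by
            rw [smul_add, Finset.smul_sum]
          rw [h0, lie_zero] at e1
          rw [h0, smul_zero] at e2
          simp only [sub_smul, Finset.sum_sub_distrib]
          have := e1.symm.trans e2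
          rw [add_right_inj] at this
          exact sub_eq_zero.mpr this) ν hν
      exact (smul_eq_zero.mp h1).resolve_left (sub_ne_zero.mpr hx)
    intro ν hν
    rcases Finset.mem_insert.mp hν with rfl | h
    · rw [Finset.sum_eq_zero key, add_zero] at h0
      exact h0
    · exact key ν h

theorem iSupIndep_wtSpace : iSupIndep (wtSpace H V) := by
  classical
  refine iSupIndep_of_dfinsupp_lsum_injective _ ?_
  rw [← LinearMap.ker_eq_bot, LinearMap.ker_eq_bot']
  intro f hf
  ext ν
  rw [DFinsupp.lsum_apply_apply, DFinsupp.sumAddHom_apply, DFinsupp.sum] at hf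
  by_cases hν : ν ∈ f.support
  · exact wt_sum_eq_zero H f.support (fun ν => (f ν : V)) (fun ν _ => (f ν).2) hf ν hν
  · simpa using hν

theorem finite_weights [FiniteDimensional ℂ V] : {ν | wtSpace H V ν ≠ ⊥}.Finite :=
  WellFoundedGT.finite_ne_bot_of_iSupIndep (iSupIndep_wtSpace H V)

/-- The character `ch V = ∑_ν dim V_ν e^ν` of a finite-dimensional module, in the group ring
`ℤ[𝔥^*]` (`single ν 1` is `e^ν`). -/
def ch : AddMonoidAlgebra ℤ (Module.Dual ℂ H) :=
  ∑ᶠ ν : Module.Dual ℂ H,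
    AddMonoidAlgebra.single ν (Module.finrank ℂ (wtSpace H V ν) : ℤ)

/-- The linear map `dim` on `ℤ[𝔥^*]`, given by `e^ν ↦ 1`; see `dim_ch`. -/
def dim : AddMonoidAlgebra ℤ (Module.Dual ℂ H) →ₐ[ℤ] ℤ :=
  AddMonoidAlgebra.lift ℤ ℤ (Module.Dual ℂ H) 1

variable {V} in
/-- `dim (ch V) = dim V`. -/
theorem dim_ch [FiniteDimensional ℂ V] (hV : IsWeightModule H V) :
    dim H (ch H V) = Module.finrank ℂ V := by
  classical
  have hfin := finite_weights H V
  have hsupp : (Function.support fun ν : Module.Dual ℂ H =>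
      AddMonoidAlgebra.single ν (Module.finrank ℂ (wtSpace H V ν) : ℤ)) ⊆ hfin.toFinset := by
    intro ν hν
    simp only [Set.Finite.coe_toFinset, Set.mem_ofPred_eq]
    intro h0
    apply hν
    simp [h0]
  have hint : DirectSum.IsInternal (wtSpace H V) :=
    (DirectSum.isInternal_submodule_iff_iSupIndep_and_iSup_eq_top _).mpr
      ⟨iSupIndep_wtSpace H V, hV⟩
  have hint' := DirectSum.isInternal_ne_bot_iff.mpr hint
  have : Fintype {ν // wtSpace H V ν ≠ ⊥} := hfin.fintype
  rw [ch, finsum_eq_sum_of_support_subset _ hsupp, map_sum]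
  have e : Module.finrank ℂ V = ∑ ν : {ν // wtSpace H V ν ≠ ⊥},
      Module.finrank ℂ (wtSpace H V ν) := by
    rw [← (LinearEquiv.ofBijective (DirectSum.coeLinearMap _) hint').finrank_eq,
      Module.finrank_directSum]
  rw [e, Nat.cast_sum]
  simp only [dim, AddMonoidAlgebra.lift_single]
  rw [← Finset.sum_coe_sort]
  refine Fintype.sum_equiv (Equiv.subtypeEquivRight (by simp)) _ _ ?_
  intro x
  simp
  rfl

/-- The character ring `Ch(𝔤)`: the `ℤ`-span in `ℤ[𝔥^*]` of the characters of the
finite-dimensional modules on which `𝔥` acts diagonalizably. -/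
def charRing : AddSubgroup (AddMonoidAlgebra ℤ (Module.Dual ℂ H)) :=
  AddSubgroup.closure {f | ∃ (N : Type u) (_ : AddCommGroup N) (_ : Module ℂ N)
    (_ : LieRingModule g N) (_ : LieModule ℂ g N),
    FiniteDimensional ℂ N ∧ IsWeightModule H N ∧ f = ch H N}

end Weights

/-! ### Rational functions on the torus -/

section RatFun

variable {g : Type u} [LieRing g] [LieAlgebra ℂ g] (H : LieSubalgebra ℂ g)

/-- The field of fractions of `ℤ[𝔥^*]` (equivalently of `ℚ[𝔥^*]`). -/
abbrev RatFun : Type u := FractionRing (AddMonoidAlgebra ℤ (Module.Dual ℂ H))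

instance isDomain_groupRing : IsDomain (AddMonoidAlgebra ℤ (Module.Dual ℂ H)) :=
  haveI : Module ℚ (Module.Dual ℂ H) := Module.compHom _ (algebraMap ℚ ℂ)
  haveI : NoZeroDivisors (AddMonoidAlgebra ℤ (Module.Dual ℂ H)) := inferInstance
  NoZeroDivisors.to_isDomain _

/-- The embedding `ℤ[𝔥^*] → Frac ℤ[𝔥^*]`. -/
def toRat : AddMonoidAlgebra ℤ (Module.Dual ℂ H) →+* RatFun H :=
  algebraMap (AddMonoidAlgebra ℤ (Module.Dual ℂ H)) (RatFun H)

variable {H}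

/-- `e^ν` as a rational function. -/
def rexp (ν : Module.Dual ℂ H) : RatFun H := toRat H (AddMonoidAlgebra.single ν 1)

/-- The action of a linear automorphism of `𝔥^*` on rational functions, `e^ν ↦ e^{wν}`. -/
def actRat (w : Module.Dual ℂ H ≃ₗ[ℂ] Module.Dual ℂ H) : RatFun H ≃+* RatFun H :=
  IsFractionRing.ringEquivOfRingEquiv
    (AddMonoidAlgebra.domCongr ℤ ℤ w.toAddEquiv).toRingEquiv

end RatFun

/-! ### Basic Lie superalgebras -/

section Super

variable (g₀ : Type u) [LieRing g₀] [LieAlgebra ℂ g₀]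
variable (g₁ : Type v) [AddCommGroup g₁] [Module ℂ g₁] [LieRingModule g₀ g₁] [LieModule ℂ g₀ g₁]

/-- A Lie superalgebra `𝔤 = 𝔤₀ ⊕ 𝔤₁` whose even part is the Lie algebra `𝔤₀` and whose odd part
is the `𝔤₀`-module `𝔤₁`: it remains to give the symmetric bracket `𝔤₁ × 𝔤₁ → 𝔤₀` satisfying the
remaining two Jacobi identities. -/
structure LieSuperalgebra where
  oddBracket : g₁ →ₗ[ℂ] g₁ →ₗ[ℂ] g₀
  oddBracket_symm : ∀ a b, oddBracket a b = oddBracket b a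
  lie_oddBracket : ∀ (x : g₀) (a b : g₁),
    ⁅x, oddBracket a b⁆ = oddBracket ⁅x, a⁆ b + oddBracket a ⁅x, b⁆
  jacobi_odd : ∀ a b c : g₁,
    ⁅oddBracket a b, c⁆ + ⁅oddBracket b c, a⁆ + ⁅oddBracket c a, b⁆ = 0

/-- A Lie superalgebra with reductive even part, together with a Cartan subalgebra `𝔥 ⊆ 𝔤₀`
and a nondegenerate even invariant supersymmetric bilinear form `(· | ·)`, such that
`𝔥` acts diagonalizably on `𝔤₀ ⊕ 𝔤₁`, the weight space of weight zero of `𝔤₀ ⊕ 𝔤₁` is `𝔥`,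
and the odd root spaces are one-dimensional.  The superalgebras `𝔤𝔩(m|n)`, `𝔬𝔰𝔭(M|2n)`,
`D(2|1;a)`, `F(4)`, `G(3)` are of this kind. -/
structure BasicSuperalgebra extends LieSuperalgebra g₀ g₁ where
  reductive : LieAlgebra.HasCentralRadical ℂ g₀
  /-- the even part of the invariant form -/
  form₀ : LinearMap.BilinForm ℂ g₀
  /-- the odd part of the invariant form -/
  form₁ : LinearMap.BilinForm ℂ g₁
  form₀_symm : ∀ x y, form₀ x y = form₀ y x
  form₁_skew : ∀ a b, form₁ a b = -form₁ b a
  form₀_invariant : ∀ x y z, form₀ ⁅x, y⁆ z = form₀ x ⁅y, z⁆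
  form₁_invariant : ∀ (x : g₀) (a b : g₁), form₁ ⁅x, a⁆ b = -form₁ a ⁅x, b⁆
  form_mixed : ∀ (x : g₀) (a b : g₁), form₁ ⁅x, a⁆ b = form₀ x (oddBracket a b)
  form₀_nondegenerate : ∀ x, (∀ y, form₀ x y = 0) → x = 0
  form₁_nondegenerate : ∀ a, (∀ b, form₁ a b = 0) → a = 0
  /-- the Cartan subalgebra -/
  H : LieSubalgebra ℂ g₀
  weight_even : IsWeightModule H g₀
  weight_odd : IsWeightModule H g₁
  zero_weight_even : ∀ x, x ∈ wtSpace H g₀ 0 ↔ x ∈ H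
  zero_weight_odd : wtSpace H g₁ 0 = ⊥
  odd_root_space : ∀ ν, Module.finrank ℂ (wtSpace H g₁ ν) ≤ 1

end Super

namespace BasicSuperalgebra

variable {g₀ : Type u} [LieRing g₀] [LieAlgebra ℂ g₀]
variable {g₁ : Type v} [AddCommGroup g₁] [Module ℂ g₁] [LieRingModule g₀ g₁] [LieModule ℂ g₀ g₁]
variable (P : BasicSuperalgebra g₀ g₁)

/-- The space `𝔥^*`. -/
abbrev Wt : Type u := Module.Dual ℂ P.H

/-- The restriction of the form to `𝔥`. -/
def formH : LinearMap.BilinForm ℂ P.H :=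
  P.form₀.comp P.H.toSubmodule.subtype P.H.toSubmodule.subtype

theorem formH_nondegenerate : P.formH.Nondegenerate := by
  have hs : P.formH.IsRefl := fun x y h => by
    rw [← h]
    exact P.form₀_symm _ _
  refine hs.nondegenerate_iff_separatingLeft.mpr ?_
  intro x hx
  apply Subtype.ext
  refine P.form₀_nondegenerate _ fun y => ?_
  have hy : y ∈ ⨆ ν : P.Wt, wtSpace P.H g₀ ν := by
    rw [show ⨆ ν : P.Wt, wtSpace P.H g₀ ν = ⊤ from P.weight_even]
    trivial
  induction hy using Submodule.iSup_induction' with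
  | zero => simp
  | add a b _ _ ha hb => rw [map_add, ha, hb, add_zero]
  | mem ν y hy =>
    by_cases hν : ν = 0
    · subst hν
      exact hx ⟨y, (P.zero_weight_even y).mp hy⟩
    · obtain ⟨k, hk⟩ : ∃ k, ν k ≠ 0 := by
        by_contra hcon
        push Not at hcon
        exact hν (LinearMap.ext hcon)
      have h1 : P.form₀ ⁅(x : g₀), (k : g₀)⁆ y = P.form₀ x ⁅(k : g₀), y⁆ :=
        P.form₀_invariant _ _ _
      have h2 : ⁅(x : g₀), (k : g₀)⁆ = 0 := by
        have := (P.zero_weight_even k).mpr k.2 x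
        simpa using this
      rw [h2, hy k, map_zero, map_smul, LinearMap.zero_apply, smul_eq_mul] at h1
      exact (mul_eq_zero.mp h1.symm).resolve_left hk

variable [FiniteDimensional ℂ g₀] [FiniteDimensional ℂ g₁]

/-- The form `(λ|μ)` on `𝔥^*` induced by the form on `𝔥`: `(λ|μ) = λ(t_μ)` where `t_μ ∈ 𝔥` is
determined by `(t_μ|x) = μ(x)` for all `x ∈ 𝔥`. -/
def dualForm (l m : P.Wt) : ℂ := l ((P.formH.toDual P.formH_nondegenerate).symm m)

/-! ### Roots, bases and the Weyl group -/

open scoped Classical in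
/-- The even roots `Δ₀`. -/
def evenRoots : Finset P.Wt := (finite_weights P.H g₀).toFinset.erase 0

/-- The odd roots `Δ₁` (zero is not a weight of `𝔤₁`). -/
def oddRoots : Finset P.Wt := (finite_weights P.H g₁).toFinset

open scoped Classical in
/-- The set `Δ = Δ₀ ∪ Δ₁` of all roots. -/
def roots : Finset P.Wt := P.evenRoots ∪ P.oddRoots

/-- `B` is a base of the set of roots `D`: a linearly independent subset such that
`D ⊆ ℕB ∪ -ℕB`. -/
structure IsBase (D B : Finset P.Wt) : Prop where
  subset : B ⊆ D
  linearIndependent : LinearIndependent ℂ (fun a : B => (a : P.Wt))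
  pos_or_neg : ∀ a ∈ D, a ∈ AddSubmonoid.closure (B : Set P.Wt) ∨
    -a ∈ AddSubmonoid.closure (B : Set P.Wt)

open scoped Classical in
/-- The positive even roots `Δ₀⁺ = Δ₀ ∩ ℕB`. -/
def posEven (B : Finset P.Wt) : Finset P.Wt :=
  P.evenRoots.filter (· ∈ AddSubmonoid.closure (B : Set P.Wt))

open scoped Classical in
/-- The positive odd roots `Δ₁⁺ = Δ₁ ∩ ℕB`. -/
def posOdd (B : Finset P.Wt) : Finset P.Wt :=
  P.oddRoots.filter (· ∈ AddSubmonoid.closure (B : Set P.Wt))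

/-- `B` is a base of `Δ` compatible with the base `B₀` of `Δ₀`, i.e. both define the same
positive even roots. -/
def IsCompatibleBase (B₀ B : Finset P.Wt) : Prop :=
  P.IsBase P.roots B ∧ P.posEven B = P.posEven B₀

/-- The reflection `r_α(λ) = λ - 2(λ|α)/(α|α) α`. -/
def refl (a l : P.Wt) : P.Wt := l - (2 * P.dualForm l a / P.dualForm a a) • a

/-- The Weyl group of `𝔤₀`, generated by the reflections in the even roots. -/
def weyl : Subgroup (P.Wt ≃ₗ[ℂ] P.Wt) :=
  Subgroup.closure {s | ∃ a ∈ P.evenRoots, ∀ l, s l = P.refl a l}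

open scoped Classical in
/-- The sign of `w ∈ W`, i.e. its determinant on `𝔥^*`. -/
def sgn (w : P.weyl) : ℤ :=
  if LinearMap.det ((w : P.Wt ≃ₗ[ℂ] P.Wt) : P.Wt →ₗ[ℂ] P.Wt) = 1 then 1 else -1

/-- `P(𝔤₀) = {λ | λ - wλ ∈ ℤΔ₀ for all w ∈ W}`. -/
def integralWeights : Set P.Wt :=
  {l | ∀ w : P.weyl, l - (w : P.Wt ≃ₗ[ℂ] P.Wt) l ∈
    AddSubgroup.closure (P.evenRoots : Set P.Wt)}

/-- `P⁺⁺(𝔤₀)`: the `λ ∈ P(𝔤₀)` such that `λ - wλ ∈ ℤ_{≥0}Δ₀⁺` for all `w ∈ W` and `wλ ≠ λ`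
for all `w ≠ 1`. -/
def regularDominant (B₀ : Finset P.Wt) : Set P.Wt :=
  {l | l ∈ P.integralWeights ∧ ∀ w : P.weyl,
    l - (w : P.Wt ≃ₗ[ℂ] P.Wt) l ∈ AddSubmonoid.closure (P.posEven B₀ : Set P.Wt) ∧
      (w ≠ 1 → (w : P.Wt ≃ₗ[ℂ] P.Wt) l ≠ l)}

/-- `ρ₀` is a Weyl vector of `𝔤₀`: `r_α ρ₀ = ρ₀ - α` for each simple root `α ∈ B₀`. -/
def IsWeylVector (B₀ : Finset P.Wt) (r₀ : P.Wt) : Prop := ∀ a ∈ B₀, P.refl a r₀ = r₀ - a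

/-- `ρ = ρ₀ - ρ₁`, where `ρ₁` is half the sum of the positive odd roots. -/
def rho (r₀ : P.Wt) (B : Finset P.Wt) : P.Wt := r₀ - (1 / 2 : ℂ) • ∑ a ∈ P.posOdd B, a

/-! ### Kac-Wakimoto terms -/

/-- `R e^ρ` with `R = ∏_{α ∈ Δ₀⁺} (1 - e^{-α}) / ∏_{α ∈ Δ₁⁺} (1 + e^{-α})`. -/
def weylDenominator (r₀ : P.Wt) (B : Finset P.Wt) : RatFun P.H :=
  (∏ a ∈ P.posEven B, (1 - rexp (-a))) / (∏ a ∈ P.posOdd B, (1 + rexp (-a))) *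
    rexp (P.rho r₀ B)

/-- An iso-set: a linearly independent set of odd roots spanning an isotropic subspace. -/
structure IsIsoSet (S : Finset P.Wt) : Prop where
  subset : S ⊆ P.oddRoots
  linearIndependent : LinearIndependent ℂ (fun a : S => (a : P.Wt))
  isotropic : ∀ a ∈ S, ∀ b ∈ S, P.dualForm a b = 0

/-- `KW(λ, S) = ∑_{w ∈ W} sgn(w) w (e^λ / ∏_{β ∈ S} (1 + e^{-β}))`. -/
def KW (l : P.Wt) (S : Finset P.Wt) : RatFun P.H :=
  ∑ᶠ w : P.weyl, (P.sgn w : RatFun P.H) *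
    actRat (w : P.Wt ≃ₗ[ℂ] P.Wt) (rexp l / ∏ b ∈ S, (1 + rexp (-b)))

open scoped Classical in
/-- `∑_{U ⊆ Δ₁⁺ ∖ S} ∏_{α ∈ Δ₀⁺} (λ + ρ₀ - sum(U) | α) / (ρ₀ | α)`. -/
def dimSum (r₀ : P.Wt) (B : Finset P.Wt) (l : P.Wt) (S : Finset P.Wt) : ℂ :=
  ∑ U ∈ (P.posOdd B \ S).powerset, ∏ a ∈ P.posEven B,
    P.dualForm (l + r₀ - ∑ b ∈ U, b) a / P.dualForm r₀ a

open scoped Classical in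
/-- `n_{λμ} = ∑_{U ⊆ Δ₁⁺ ∖ S} ∑_{w ∈ W} sgn(w) δ_{w(μ + ρ₀), λ + ρ₀ - sum(U)}`. -/
def multCoeff (r₀ : P.Wt) (B : Finset P.Wt) (l : P.Wt) (S : Finset P.Wt) (m : P.Wt) : ℤ :=
  ∑ U ∈ (P.posOdd B \ S).powerset, ∑ᶠ w : P.weyl,
    if (w : P.Wt ≃ₗ[ℂ] P.Wt) (m + r₀) = l + r₀ - ∑ b ∈ U, b then P.sgn w else 0

/-! ### The simple highest weight modules of the even part -/

/-- The left ideal of `U(𝔤₀)` generated by the positive root vectors and by `x - μ(x)` for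
`x ∈ 𝔥`. -/
def vermaIdeal (B₀ : Finset P.Wt) (m : P.Wt) :
    Submodule (UniversalEnvelopingAlgebra ℂ g₀) (UniversalEnvelopingAlgebra ℂ g₀) :=
  Submodule.span _
    ({y | ∃ a ∈ P.posEven B₀, ∃ x ∈ wtSpace P.H g₀ a,
        y = UniversalEnvelopingAlgebra.ι ℂ x} ∪
     {y | ∃ x : P.H, y = UniversalEnvelopingAlgebra.ι ℂ (x : g₀) -
        algebraMap ℂ (UniversalEnvelopingAlgebra ℂ g₀) (m x)})

/-- The Verma module `M_{𝔤₀}(μ)`. -/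
abbrev Verma (B₀ : Finset P.Wt) (m : P.Wt) : Type u :=
  UniversalEnvelopingAlgebra ℂ g₀ ⧸ P.vermaIdeal B₀ m

/-- The simple module `L_{𝔤₀}(μ)` of highest weight `μ`: the quotient of the Verma module by the
sum of all its proper submodules. -/
def Simple (B₀ : Finset P.Wt) (m : P.Wt) : Type u :=
  P.Verma B₀ m ⧸ sSup {N : Submodule (UniversalEnvelopingAlgebra ℂ g₀) (P.Verma B₀ m) | N ≠ ⊤}

instance (B₀ : Finset P.Wt) (m : P.Wt) : AddCommGroup (P.Simple B₀ m) :=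
  inferInstanceAs (AddCommGroup (P.Verma B₀ m ⧸ _))

instance (B₀ : Finset P.Wt) (m : P.Wt) :
    Module (UniversalEnvelopingAlgebra ℂ g₀) (P.Simple B₀ m) :=
  inferInstanceAs (Module _ (P.Verma B₀ m ⧸ _))

instance (B₀ : Finset P.Wt) (m : P.Wt) : Module ℂ (P.Simple B₀ m) :=
  inferInstanceAs (Module ℂ (P.Verma B₀ m ⧸ _))

instance (B₀ : Finset P.Wt) (m : P.Wt) :
    IsScalarTower ℂ (UniversalEnvelopingAlgebra ℂ g₀) (P.Simple B₀ m) :=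
  inferInstanceAs (IsScalarTower ℂ _ (P.Verma B₀ m ⧸ _))

/-- `x ∈ 𝔤₀` acts on `L_{𝔤₀}(μ)` through its image in `U(𝔤₀)`. -/
instance (B₀ : Finset P.Wt) (m : P.Wt) : LieRingModule g₀ (P.Simple B₀ m) where
  bracket x v := UniversalEnvelopingAlgebra.ι ℂ x • v
  add_lie x y v := by
    rw [map_add, add_smul]
  lie_add x v v' := smul_add _ _ _
  leibniz_lie x y v := by
    change UniversalEnvelopingAlgebra.ι ℂ x • UniversalEnvelopingAlgebra.ι ℂ y • v =
      UniversalEnvelopingAlgebra.ι ℂ ⁅x, y⁆ • v +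
        UniversalEnvelopingAlgebra.ι ℂ y • UniversalEnvelopingAlgebra.ι ℂ x • v
    let _ : LieRing (UniversalEnvelopingAlgebra ℂ g₀) := LieRing.ofAssociativeRing
    rw [LieHom.map_lie, LieRing.of_associative_ring_bracket, sub_smul, mul_smul, mul_smul,
      sub_add_cancel]

instance (B₀ : Finset P.Wt) (m : P.Wt) : LieModule ℂ g₀ (P.Simple B₀ m) where
  smul_lie c x v := by
    change UniversalEnvelopingAlgebra.ι ℂ (c • x) • v = c • UniversalEnvelopingAlgebra.ι ℂ x • v
    rw [map_smul, smul_assoc]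
  lie_smul c x v := by
    change UniversalEnvelopingAlgebra.ι ℂ x • c • v = c • UniversalEnvelopingAlgebra.ι ℂ x • v
    exact smul_algebra_smul_comm _ _ _

end BasicSuperalgebra

/-! ### Multiplicities -/

section Multiplicity

variable {g : Type u} [LieRing g] [LieAlgebra ℂ g]
variable {N : Type w} [AddCommGroup N] [Module ℂ N] [LieRingModule g N] [LieModule ℂ g N]

/-- A composition series `0 = N₀ ⋖ N₁ ⋖ ... ⋖ N_k = N` of the module `N`. -/
structure CompSeries (g : Type u) [LieRing g] [LieAlgebra ℂ g]
    (N : Type w) [AddCommGroup N] [Module ℂ N] [LieRingModule g N] [LieModule ℂ g N] where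
  series : RelSeries {p : LieSubmodule ℂ g N × LieSubmodule ℂ g N | p.1 ⋖ p.2}
  head_eq : series.head = ⊥
  last_eq : series.last = ⊤

/-- The number of factors `N_{i+1} / N_i` of a composition series that are isomorphic to `L`;
this is the multiplicity `[N : L]`. -/
def CompSeries.mult (s : CompSeries g N)
    (L : Type v) [AddCommGroup L] [Module ℂ L] [LieRingModule g L] [LieModule ℂ g L] : ℕ :=
  Nat.card {i : Fin s.series.length // Nonempty
    ((s.series i.succ ⧸ (s.series i.castSucc).comap (s.series i.succ).incl) ≃ₗ⁅ℂ, g⁆ L)}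

end Multiplicity

end

end KacWakimoto

set_option linter.unusedSectionVars false
set_option linter.unusedSimpArgs false

/-! ### Conjugation by exponentials of nilpotent elements -/

section ExpConj

/-! Let D₀ = e^{ρ₀} ∏_{α ∈ Δ₀⁺} (1 - e^{-α}) (`evenDen`) and D₁ = ∏_{β ∈ T} (e^{β/2} + e^{-β/2})
(`oddDen`), where T contains one root of each pair ±β of odd roots. The product D₁ does not depend
on T, so it is W-invariant, and R e^ρ = D₀ / D₁ for every compatible base (`weylDenominator_eq`). If
S ⊆ T, supplying the factors of T ∖ S turns the denominator of e^ν / ∏_{β ∈ S} (1 + e^{-β}) into D₁.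
Expanding ∏_{β ∈ T ∖ S} (1 + e^{-β}) and alternating over W gives D₁ KW(ν, S) as a sum, over U ⊆ T ∖
S, of alternating sums of e^{ν + sum(T)/2 - sum(U)} (`IsHalf.KW_eq`). In KW / (R e^ρ) the factor D₁
cancels, and what remains concerns 𝔤₀ alone: divide W-anti-invariant elements of the group ring by
D₀.

An anti-invariant element with integral support is determined by its coefficients at regular
dominant weights (`IsBase.anti_ext`). By the Weyl character formula D₀ ch L(μ) is the alternating
sum of e^{μ+ρ₀}. So such an element is D₀ times an integral combination of the ch L(μ), the
multiplicities being its coefficients at μ + ρ₀ (`IsBase.exists_mem_charRing`). For S ⊆ Δ₁⁺ take T =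
Δ₁⁺; otherwise take any T containing S, which changes the exponents only by a sum of odd roots and
keeps them integral.

For dimensions, send e^m to exp((m|ρ₀)X). The alternating sum of e^n evaluated along ρ₀ equals that
of e^{ρ₀} evaluated along n, which is D₀ by the denominator formula, so its leading term is
X^{|Δ₀⁺|} ∏ (n|α). Comparing leading terms with D₀ gives the product formula
(`IsBase.hasDim_altSum`, `IsBase.dim_eq_of_hasDim`). For the second statement, rational coefficients
are cleared by a common denominator, and [N : L(μ)] is the coefficient of e^{μ+ρ₀} in D₀ ch N
(`IsBase.mult_eq_coeff`).

The structure theory of 𝔤₀ is derived from the invariant form. Reductivity makes even roots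
anisotropic, hence 𝔰𝔩₂-triples, root strings and a finite Weyl group. The invariant form need not be
definite, so norm arguments use the form ∑ h_a ⊗ h_a (`rootForm`), which takes integer values and is
positive on roots. The character formula comes from the trace of the matching Casimir operator on
weight spaces: it makes D₀ ch V an eigenvector of a Laplace operator. Nonvanishing of Verma modules
follows from an explicit module built on words in the simple roots. -/

theorem mul_exp_eq_exp_mul_of_commutator {A : Type*} [Ring A] [Algebra ℚ A] {a x y z : A}
    (ha : IsNilpotent a)
    (hxy : ∀ n : ℕ, x * a ^ n = a ^ n * x + (n : ℚ) • (a ^ (n - 1) * y) +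
      ((n : ℚ) * (n - 1)) • (a ^ (n - 2) * z)) :
    x * IsNilpotent.exp a = IsNilpotent.exp a * (x + y + z) := by
  obtain ⟨k, hk⟩ := ha
  have hk1 : a ^ (k + 1) = 0 := by rw [_root_.pow_succ, hk, zero_mul]
  -- The truncation lengths k, k + 1, k + 2 are chosen to absorb the index shifts by two, one and
  -- zero in the terms with z, y and x.
  have hk2 : a ^ (k + 2) = 0 := by rw [_root_.pow_succ, hk1, zero_mul]
  have e0 : IsNilpotent.exp a * z =
      ∑ n ∈ Finset.range k, (n.factorial : ℚ)⁻¹ • (a ^ n * z) := by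
    simp_rw [IsNilpotent.exp_eq_sum hk, Finset.sum_mul, smul_mul_assoc]
  have e1 : IsNilpotent.exp a * y =
      ∑ n ∈ Finset.range (k + 1), (n.factorial : ℚ)⁻¹ • (a ^ n * y) := by
    simp_rw [IsNilpotent.exp_eq_sum hk1, Finset.sum_mul, smul_mul_assoc]
  have e2 (b : A) : IsNilpotent.exp a * b =
      ∑ n ∈ Finset.range (k + 2), (n.factorial : ℚ)⁻¹ • (a ^ n * b) := by
    simp_rw [IsNilpotent.exp_eq_sum hk2, Finset.sum_mul, smul_mul_assoc]
  have e3 : x * IsNilpotent.exp a =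
      ∑ n ∈ Finset.range (k + 2), (n.factorial : ℚ)⁻¹ • (x * a ^ n) := by
    simp_rw [IsNilpotent.exp_eq_sum hk2, Finset.mul_sum, mul_smul_comm]
  rw [mul_add, mul_add, e0, e1, e2, e3]
  simp_rw [hxy, smul_add, Finset.sum_add_distrib, smul_smul]
  congr 1
  · congr 1
    rw [Finset.sum_range_succ']
    simp only [Nat.cast_zero, mul_zero, zero_smul, add_zero]
    refine Finset.sum_congr rfl fun n _ => ?_
    rw [Nat.factorial_succ, Nat.add_sub_cancel]
    congr 1
    have : ((n : ℚ) + 1) ≠ 0 := by positivity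
    push_cast
    field_simp
  · rw [Finset.sum_range_succ', Finset.sum_range_succ']
    simp only [Nat.cast_zero, zero_mul, mul_zero, zero_smul, add_zero, zero_add, Nat.cast_one,
      sub_self]
    refine Finset.sum_congr rfl fun n _ => ?_
    rw [Nat.factorial_succ, Nat.factorial_succ, show n + 1 + 1 - 2 = n by omega]
    congr 1
    have h1 : ((n : ℚ) + 1) ≠ 0 := by positivity
    have h2 : ((n : ℚ) + 1 + 1) ≠ 0 := by positivity
    push_cast
    field_simp
    ring

/-- Since a commutes with [x, a] = c a, the expansion stops at first order. It describes Cartan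
elements passing the exponential of a root vector. -/
theorem mul_exp_eq_exp_mul_of_commutator_eq_smul {A : Type*} [Ring A] [Algebra ℚ A]
    [Algebra ℂ A] {a x : A} (ha : IsNilpotent a) {c : ℂ} (h : x * a = a * x + c • a) :
    x * IsNilpotent.exp a = IsNilpotent.exp a * (x + c • a) := by
  have hp (n : ℕ) : x * a ^ n = a ^ n * x + n • (c • a ^ n) := by
    induction n with
    | zero => simp
    | succ n ih =>
      rw [_root_.pow_succ, ← mul_assoc, ih, add_mul, mul_assoc, h, mul_add, ← mul_assoc,
        mul_smul_comm, smul_mul_assoc, smul_mul_assoc, succ_nsmul, add_assoc]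
      congr 1
      rw [add_comm]
  have := mul_exp_eq_exp_mul_of_commutator (x := x) (y := c • a) (z := 0) ha (fun n => by
    rw [hp, mul_zero, smul_zero, add_zero, Nat.cast_smul_eq_nsmul]
    cases n with
    | zero => simp
    | succ n => rw [Nat.add_sub_cancel, mul_smul_comm, ← _root_.pow_succ])
  rwa [add_zero] at this

/-- The relations [x, a] = z and [z, a] = 2a stop the expansion at second order. The case in use is
a = -f, x = e, z = -h. -/
theorem mul_exp_eq_exp_mul_of_sl2 {A : Type*} [Ring A] [Algebra ℚ A] {a x z : A}
    (ha : IsNilpotent a) (h : x * a = a * x + z) (hz : z * a = a * z + 2 • a) :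
    x * IsNilpotent.exp a = IsNilpotent.exp a * (x + z + a) := by
  have hp (n : ℕ) : z * a ^ n = a ^ n * z + (2 * n) • a ^ n := by
    induction n with
    | zero => simp
    | succ n ih =>
      rw [_root_.pow_succ, ← mul_assoc, ih, add_mul, mul_assoc, hz, mul_add, ← mul_assoc,
        mul_smul_comm, smul_mul_assoc, add_assoc, ← add_smul]
      congr 2
      ring
  refine mul_exp_eq_exp_mul_of_commutator ha fun n => ?_
  cases n with
  | zero => simp
  | succ n =>
    have hn : x * a ^ (n + 1) = a ^ (n + 1) * x + (n + 1) • (a ^ n * z) +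
        ((n + 1) * n) • a ^ n := by
      induction n with
      | zero => simp [h]
      | succ n ih =>
        rw [_root_.pow_succ', ← mul_assoc, h, add_mul, mul_assoc, ih, mul_add, mul_add, hp,
          mul_smul_comm, mul_smul_comm, ← mul_assoc, ← mul_assoc, ← _root_.pow_succ',
          ← _root_.pow_succ']
        simp only [add_smul, one_smul, mul_add, add_mul, mul_one, one_mul, two_mul]
        abel
    rw [hn]
    congr 1
    · congr 1
      rw [Nat.add_sub_cancel, Nat.cast_smul_eq_nsmul]
    · cases n with
      | zero => simp
      | succ n =>
        rw [show n + 1 + 1 - 2 = n by omega, ← _root_.pow_succ, ← Nat.cast_smul_eq_nsmul ℚ]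
        congr 1
        push_cast
        ring

end ExpConj

namespace KacWakimoto

/-! ### Action of root vectors on weight spaces. -/

section Weights

variable {g : Type u} [LieRing g] [LieAlgebra ℂ g] {H : LieSubalgebra ℂ g}
variable {V : Type w} [AddCommGroup V] [Module ℂ V] [LieRingModule g V] [LieModule ℂ g V]

theorem lie_mem_wtSpace {a m : Module.Dual ℂ H} {x : g} {v : V} (hx : x ∈ wtSpace H g a)
    (hv : v ∈ wtSpace H V m) : ⁅x, v⁆ ∈ wtSpace H V (a + m) := by
  intro y
  rw [leibniz_lie, hx y, hv y, smul_lie, lie_smul, LinearMap.add_apply, add_smul]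

theorem toEnd_pow_mem_wtSpace {a m : Module.Dual ℂ H} {x : g} {v : V} (hx : x ∈ wtSpace H g a)
    (hv : v ∈ wtSpace H V m) (n : ℕ) :
    (LieModule.toEnd ℂ g V x ^ n) v ∈ wtSpace H V (m + n • a) := by
  induction n with
  | zero => simpa using hv
  | succ n ih =>
    rw [pow_succ', Module.End.mul_apply, LieModule.toEnd_apply_apply]
    convert lie_mem_wtSpace hx ih using 1
    rw [succ_nsmul, add_comm a, add_assoc]

theorem IsWeightModule.induction (hV : IsWeightModule H V) {p : V → Prop}
    (mem : ∀ m, ∀ v ∈ wtSpace H V m, p v) (zero : p 0)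
    (add : ∀ a b, p a → p b → p (a + b)) (v : V) : p v := by
  have hv : v ∈ ⨆ ν, wtSpace H V ν := by
    rw [show ⨆ ν, wtSpace H V ν = ⊤ from hV]; trivial
  exact Submodule.iSup_induction _ (motive := p) hv mem zero add

/-- The weights m + n a are pairwise distinct for a ≠ 0, and only finitely many weights occur. -/
theorem exists_toEnd_pow_eq_zero [FiniteDimensional ℂ V]
    {a m : Module.Dual ℂ H} (ha : a ≠ 0) {x : g} (hx : x ∈ wtSpace H g a) {v : V}
    (hv : v ∈ wtSpace H V m) : ∃ n, (LieModule.toEnd ℂ g V x ^ n) v = 0 := by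
  by_contra! hne
  have hinj : Function.Injective fun n : ℕ => m + n • a := by
    intro i j hij
    have hij : i • a = j • a := by simpa using hij
    by_contra hne'
    rw [← Nat.cast_smul_eq_nsmul ℂ i, ← Nat.cast_smul_eq_nsmul ℂ j, ← sub_eq_zero,
      ← sub_smul] at hij
    rcases smul_eq_zero.mp hij with h | h
    · exact hne' (by exact_mod_cast sub_eq_zero.mp h)
    · exact ha h
  refine Set.infinite_range_of_injective hinj ((finite_weights H V).subset ?_)
  rintro - ⟨n, rfl⟩ h
  have := toEnd_pow_mem_wtSpace hx hv n
  rw [h] at this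
  exact hne n ((Submodule.mem_bot ℂ).mp this)

theorem isNilpotent_toEnd_of_mem_wtSpace [FiniteDimensional ℂ V] (hV : IsWeightModule H V)
    {a : Module.Dual ℂ H} (ha : a ≠ 0) {x : g} (hx : x ∈ wtSpace H g a) :
    IsNilpotent (LieModule.toEnd ℂ g V x) := by
  rw [Module.End.isNilpotent_iff_of_finite]
  refine hV.induction (fun m v hv => exists_toEnd_pow_eq_zero ha hx hv) ⟨0, by simp⟩ ?_
  rintro p q ⟨i, hi⟩ ⟨j, hj⟩
  refine ⟨i + j, ?_⟩
  rw [map_add, pow_add, Module.End.mul_apply _ _ q, hj, map_zero, add_zero,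
    ← pow_add, add_comm, pow_add, Module.End.mul_apply, hi, map_zero]

end Weights

end KacWakimoto

namespace KacWakimoto

namespace BasicSuperalgebra

variable {g₀ : Type u} [LieRing g₀] [LieAlgebra ℂ g₀] [FiniteDimensional ℂ g₀]
variable {g₁ : Type v} [AddCommGroup g₁] [Module ℂ g₁] [LieRingModule g₀ g₁] [LieModule ℂ g₀ g₁]
  [FiniteDimensional ℂ g₁]
variable (P : BasicSuperalgebra g₀ g₁)

/-! ### The form on the dual of the Cartan subalgebra -/

/-- The element `t_μ ∈ 𝔥` with `(t_μ|x) = μ(x)`. -/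
noncomputable def tvec : P.Wt ≃ₗ[ℂ] P.H := (P.formH.toDual P.formH_nondegenerate).symm

theorem dualForm_eq (l m : P.Wt) : P.dualForm l m = l (P.tvec m) := rfl

theorem formH_tvec (m : P.Wt) (x : P.H) : P.form₀ (P.tvec m) x = m x := by
  have := P.formH.apply_toDual_symm_apply (hB := P.formH_nondegenerate) m x
  exact this

theorem dualForm_comm (l m : P.Wt) : P.dualForm l m = P.dualForm m l := by
  rw [dualForm_eq, dualForm_eq, ← P.formH_tvec, ← P.formH_tvec, P.form₀_symm]

theorem dualForm_add_left (l l' m : P.Wt) :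
    P.dualForm (l + l') m = P.dualForm l m + P.dualForm l' m := rfl

theorem dualForm_sub_left (l l' m : P.Wt) :
    P.dualForm (l - l') m = P.dualForm l m - P.dualForm l' m := rfl

theorem dualForm_smul_left (c : ℂ) (l m : P.Wt) :
    P.dualForm (c • l) m = c * P.dualForm l m := rfl

theorem dualForm_neg_left (l m : P.Wt) : P.dualForm (-l) m = -P.dualForm l m := rfl

theorem dualForm_sub_right (l m m' : P.Wt) :
    P.dualForm l (m - m') = P.dualForm l m - P.dualForm l m' := by
  simp only [dualForm_eq, map_sub]

theorem dualForm_smul_right (c : ℂ) (l m : P.Wt) :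
    P.dualForm l (c • m) = c * P.dualForm l m := by
  simp only [dualForm_eq, map_smul, smul_eq_mul]

theorem dualForm_neg_right (l m : P.Wt) : P.dualForm l (-m) = -P.dualForm l m := by
  simp only [dualForm_eq, map_neg]

/-! ### Root spaces -/

theorem mem_evenRoots {a : P.Wt} : a ∈ P.evenRoots ↔ a ≠ 0 ∧ wtSpace P.H g₀ a ≠ ⊥ := by
  simp [evenRoots]

theorem mem_oddRoots {a : P.Wt} : a ∈ P.oddRoots ↔ wtSpace P.H g₁ a ≠ ⊥ := by
  simp [oddRoots]

theorem coe_mem_wtSpace_zero (x : P.H) : (x : g₀) ∈ wtSpace P.H g₀ 0 :=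
  (P.zero_weight_even _).mpr x.2

theorem lie_coe_coe (x y : P.H) : ⁅(x : g₀), (y : g₀)⁆ = 0 := by
  simpa using P.coe_mem_wtSpace_zero y x

theorem form₀_eq_zero_of_mem {a b : P.Wt} (hab : a + b ≠ 0) {x y : g₀}
    (hx : x ∈ wtSpace P.H g₀ a) (hy : y ∈ wtSpace P.H g₀ b) : P.form₀ x y = 0 := by
  obtain ⟨k, hk⟩ : ∃ k, (a + b) k ≠ 0 := by
    by_contra! hcon
    exact hab (LinearMap.ext hcon)
  have h1 := P.form₀_invariant x (k : g₀) y
  rw [← lie_skew, hx k, hy k, map_neg, map_smul, map_smul, LinearMap.neg_apply,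
    LinearMap.smul_apply, smul_eq_mul, smul_eq_mul] at h1
  have h2 : (a + b) k * P.form₀ x y = 0 := by
    rw [LinearMap.add_apply]; linear_combination -h1
  exact (mul_eq_zero.mp h2).resolve_left hk

theorem form₁_eq_zero_of_mem {a b : P.Wt} (hab : a + b ≠ 0) {x y : g₁}
    (hx : x ∈ wtSpace P.H g₁ a) (hy : y ∈ wtSpace P.H g₁ b) : P.form₁ x y = 0 := by
  obtain ⟨k, hk⟩ : ∃ k, (a + b) k ≠ 0 := by
    by_contra! hcon
    exact hab (LinearMap.ext hcon)
  have h1 := P.form₁_invariant (k : g₀) x y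
  rw [hx k, hy k, map_smul, map_smul, LinearMap.smul_apply, smul_eq_mul, smul_eq_mul] at h1
  have h2 : (a + b) k * P.form₁ x y = 0 := by
    rw [LinearMap.add_apply]; linear_combination h1
  exact (mul_eq_zero.mp h2).resolve_left hk

theorem exists_form₀_eq_one {a : P.Wt} {x : g₀} (hx : x ∈ wtSpace P.H g₀ a) (h0 : x ≠ 0) :
    ∃ y ∈ wtSpace P.H g₀ (-a), P.form₀ x y = 1 := by
  by_contra! hcon
  refine h0 (P.form₀_nondegenerate x ?_)
  refine P.weight_even.induction ?_ (by simp) (fun a b ha hb => by rw [map_add, ha, hb, add_zero])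
  intro b y hy
  by_cases hb : a + b = 0
  · obtain rfl : b = -a := (neg_eq_of_add_eq_zero_right hb).symm
    by_contra hne
    refine hcon ((P.form₀ x y)⁻¹ • y) (Submodule.smul_mem _ _ hy) ?_
    rw [map_smul, smul_eq_mul, inv_mul_cancel₀ hne]
  · exact P.form₀_eq_zero_of_mem hb hx hy

theorem neg_mem_evenRoots {a : P.Wt} (ha : a ∈ P.evenRoots) : -a ∈ P.evenRoots := by
  rw [mem_evenRoots] at ha ⊢
  obtain ⟨x, hx, h0⟩ := (Submodule.ne_bot_iff _).mp ha.2
  obtain ⟨y, hy, hxy⟩ := P.exists_form₀_eq_one hx h0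
  refine ⟨neg_ne_zero.mpr ha.1, (Submodule.ne_bot_iff _).mpr ⟨y, hy, ?_⟩⟩
  rintro rfl
  simp at hxy

theorem neg_mem_oddRoots {a : P.Wt} (ha : a ∈ P.oddRoots) : -a ∈ P.oddRoots := by
  rw [mem_oddRoots] at ha ⊢
  obtain ⟨x, hx, h0⟩ := (Submodule.ne_bot_iff _).mp ha
  intro hbot
  refine h0 (P.form₁_nondegenerate x ?_)
  refine P.weight_odd.induction ?_ (by simp) (fun a b ha hb => by rw [map_add, ha, hb, add_zero])
  intro b y hy
  by_cases hb : a + b = 0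
  · obtain rfl : b = -a := (neg_eq_of_add_eq_zero_right hb).symm
    rw [hbot, Submodule.mem_bot] at hy
    rw [hy, map_zero]
  · exact P.form₁_eq_zero_of_mem hb hx hy

theorem zero_notMem_oddRoots : (0 : P.Wt) ∉ P.oddRoots := by
  rw [mem_oddRoots, P.zero_weight_odd]; simp

/-- The bracket has weight zero, so it lies in 𝔥; pairing it with k ∈ 𝔥 and using invariance gives
(x|y) a(k), which identifies it. -/
theorem lie_eq_smul_tvec {a : P.Wt} {x y : g₀} (hx : x ∈ wtSpace P.H g₀ a)
    (hy : y ∈ wtSpace P.H g₀ (-a)) : ⁅x, y⁆ = P.form₀ x y • (P.tvec a : g₀) := by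
  have hmem : ⁅x, y⁆ ∈ P.H := by
    rw [← P.zero_weight_even]
    simpa using lie_mem_wtSpace hx hy
  have key : P.tvec.symm ⟨⁅x, y⁆, hmem⟩ = P.form₀ x y • a := by
    refine LinearMap.ext fun k => ?_
    rw [← P.formH_tvec, LinearEquiv.apply_symm_apply, LinearMap.smul_apply, smul_eq_mul,
      P.form₀_symm, ← P.form₀_invariant, hx k, map_smul, LinearMap.smul_apply, smul_eq_mul,
      mul_comm]
  rw [LinearEquiv.symm_apply_eq, map_smul] at key
  exact congrArg Subtype.val key

theorem killingForm_eq_zero_of_mem {a b : P.Wt} (hab : a + b ≠ 0) {x y : g₀}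
    (hx : x ∈ wtSpace P.H g₀ a) (hy : y ∈ wtSpace P.H g₀ b) : killingForm ℂ g₀ x y = 0 := by
  obtain ⟨k, hk⟩ : ∃ k, (a + b) k ≠ 0 := by
    by_contra! hcon
    exact hab (LinearMap.ext hcon)
  have h1 := LieModule.traceForm_apply_lie_apply ℂ g₀ g₀ x (k : g₀) y
  rw [← lie_skew, hx k, hy k, map_neg, map_smul, map_smul, LinearMap.neg_apply,
    LinearMap.smul_apply, smul_eq_mul, smul_eq_mul] at h1
  have h2 : (a + b) k * killingForm ℂ g₀ x y = 0 := by
    rw [LinearMap.add_apply]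
    change _ * LieModule.traceForm ℂ g₀ g₀ x y = 0
    linear_combination -h1
  exact (mul_eq_zero.mp h2).resolve_left hk

theorem coe_mem_center_of_forall_root {x : P.H} (hx : ∀ a ∈ P.evenRoots, a x = 0) (y : g₀) :
    ⁅(x : g₀), y⁆ = 0 := by
  revert y
  refine P.weight_even.induction ?_ (by simp) (fun a b ha hb => by rw [lie_add, ha, hb, add_zero])
  intro b y hy
  rw [hy x]
  by_cases hb : b ∈ P.evenRoots
  · rw [hx b hb, zero_smul]
  · rw [mem_evenRoots, not_and_or, not_not, not_not] at hb
    rcases hb with rfl | hb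
    · simp
    · rw [hb, Submodule.mem_bot] at hy
      rw [hy, smul_zero]

/-! ### Even roots are anisotropic -/

/-- On the a-string M through b, t_a = [e, f] is a commutator of operators preserving M, so it has
trace zero. Since a(t_a) = 0 it acts on M ≠ 0 as the scalar b(t_a), which must vanish. -/
theorem apply_tvec_eq_zero_of_isotropic {a : P.Wt} (ha : a ∈ P.evenRoots)
    (h0 : P.dualForm a a = 0) {b : P.Wt} (hb : b ∈ P.evenRoots) : b (P.tvec a) = 0 := by
  obtain ⟨-, ha2⟩ := P.mem_evenRoots.mp ha
  obtain ⟨e, he, he0⟩ := (Submodule.ne_bot_iff _).mp ha2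
  obtain ⟨f, hf, hef⟩ := P.exists_form₀_eq_one he he0
  have hlie : ⁅e, f⁆ = (P.tvec a : g₀) := by rw [P.lie_eq_smul_tvec he hf, hef, one_smul]
  let M : Submodule ℂ g₀ := ⨆ k : ℤ, wtSpace P.H g₀ (b + k • a)
  have hstab (x : g₀) (c : P.Wt) (hx : x ∈ wtSpace P.H g₀ c) (z : ℤ) (hc : c = z • a) :
      ∀ v ∈ M, LieAlgebra.ad ℂ g₀ x v ∈ M := by
    intro v hv
    refine Submodule.iSup_induction _ (motive := fun v => LieAlgebra.ad ℂ g₀ x v ∈ M) hv ?_ ?_ ?_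
    · intro k v hv
      have : LieAlgebra.ad ℂ g₀ x v ∈ _ := lie_mem_wtSpace hx hv
      refine Submodule.mem_iSup_of_mem (k + z) ?_
      convert this using 1
      rw [hc, add_smul]; abel_nf
    · simp
    · intro p q hp hq
      rw [map_add]; exact M.add_mem hp hq
  have hE := hstab e a he 1 (by simp)
  have hF := hstab f (-a) hf (-1) (by simp)
  have hT := hstab (P.tvec a) 0 (P.coe_mem_wtSpace_zero _) 0 (by simp)
  have hcomm : (LieAlgebra.ad ℂ g₀ (P.tvec a)).restrict hT =
      (LieAlgebra.ad ℂ g₀ e).restrict hE * (LieAlgebra.ad ℂ g₀ f).restrict hF -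
        (LieAlgebra.ad ℂ g₀ f).restrict hF * (LieAlgebra.ad ℂ g₀ e).restrict hE := by
    ext v
    simp only [LinearMap.coe_restrict_apply, LieAlgebra.ad_apply, LinearMap.sub_apply,
      Module.End.mul_apply, Submodule.coe_sub, ← hlie]
    rw [lie_lie]
  have hscal : (LieAlgebra.ad ℂ g₀ (P.tvec a)).restrict hT = b (P.tvec a) • 1 := by
    ext ⟨v, hv⟩
    simp only [LinearMap.coe_restrict_apply, LieAlgebra.ad_apply, LinearMap.smul_apply,
      Module.End.one_apply, Submodule.coe_smul]
    refine Submodule.iSup_induction _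
      (motive := fun v => ⁅(P.tvec a : g₀), v⁆ = b (P.tvec a) • v) hv ?_ ?_ ?_
    · intro k v hv
      rw [hv, LinearMap.add_apply, LinearMap.smul_apply,
        show a (P.tvec a) = 0 from h0, smul_zero, add_zero]
    · simp
    · intro p q hp hq
      rw [lie_add, hp, hq, smul_add]
  have htr := congrArg (LinearMap.trace ℂ M) hcomm
  rw [hscal, map_sub, LinearMap.trace_mul_comm, sub_self, map_smul, LinearMap.trace_one,
    smul_eq_mul, mul_eq_zero] at htr
  refine htr.resolve_right ?_
  have hM : M ≠ ⊥ := by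
    obtain ⟨v, hv, hv0⟩ := (Submodule.ne_bot_iff _).mp (P.mem_evenRoots.mp hb).2
    exact (Submodule.ne_bot_iff _).mpr ⟨v, Submodule.mem_iSup_of_mem 0 (by simpa using hv), hv0⟩
  have : Nontrivial M := Submodule.nontrivial_iff_ne_bot.mpr hM
  exact_mod_cast (Module.finrank_pos (R := ℂ) (M := M)).ne'

/-- If a were isotropic, t_a would be killed by all roots and hence central. Then a root vector e of
weight a is orthogonal to everything under the Killing form, so it lies in the radical. By
reductivity the radical is the centre, contradicting [k, e] = a(k) e ≠ 0. -/
theorem dualForm_self_ne_zero {a : P.Wt} (ha : a ∈ P.evenRoots) : P.dualForm a a ≠ 0 := by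
  intro h0
  obtain ⟨ha1, ha2⟩ := P.mem_evenRoots.mp ha
  obtain ⟨e, he, he0⟩ := (Submodule.ne_bot_iff _).mp ha2
  obtain ⟨k, hk⟩ : ∃ k, a k ≠ 0 := by
    by_contra! hcon
    exact ha1 (LinearMap.ext hcon)
  have hcent : LieAlgebra.ad ℂ g₀ (P.tvec a) = 0 := by
    ext y
    exact P.coe_mem_center_of_forall_root
      (fun b hb => P.apply_tvec_eq_zero_of_isotropic ha h0 hb) y
  have hort : ∀ y, killingForm ℂ g₀ e y = 0 := by
    refine P.weight_even.induction ?_ (by simp)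
      (fun a b ha hb => by rw [map_add, ha, hb, add_zero])
    intro b y hy
    by_cases hab : a + b = 0
    · obtain rfl : b = -a := (neg_eq_of_add_eq_zero_right hab).symm
      -- Invariance of the Killing form κ gives a(k) κ(e, y) = κ(k, [e, y]), a multiple of κ(k,
      -- t_a), which vanishes because t_a is central.
      have h1 := LieModule.traceForm_apply_lie_apply ℂ g₀ g₀ (k : g₀) e y
      rw [he k, P.lie_eq_smul_tvec he hy, map_smul, map_smul, LinearMap.smul_apply, smul_eq_mul,
        smul_eq_mul] at h1
      have h2 : LieModule.traceForm ℂ g₀ g₀ (k : g₀) (P.tvec a) = 0 := by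
        rw [LieModule.traceForm_apply_apply, show LieModule.toEnd ℂ g₀ g₀ (P.tvec a) = 0 from hcent]
        simp
      rw [h2, mul_zero] at h1
      exact (mul_eq_zero.mp h1).resolve_left hk
    · exact P.killingForm_eq_zero_of_mem hab he hy
  have hrad : e ∈ LieAlgebra.radical ℂ g₀ := by
    refine LieAlgebra.killingCompl_top_le_radical ℂ g₀ ?_
    rw [LieIdeal.mem_killingCompl]
    intro y _
    rw [LieModule.traceForm_comm]
    exact hort y
  rw [P.reductive.radical_eq_center] at hrad
  have h3 := (LieModule.mem_maxTrivSubmodule ℂ g₀ g₀ e).mp hrad k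
  rw [he k, smul_eq_zero] at h3
  exact h3.elim hk he0

/-! ### Coroots and `sl₂`-triples -/

/-- The coroot `h_a = 2 t_a / (a|a)`. -/
noncomputable def cor (a : P.Wt) : P.H := (2 / P.dualForm a a) • P.tvec a

theorem apply_cor (l a : P.Wt) : l (P.cor a) = 2 * P.dualForm l a / P.dualForm a a := by
  rw [cor, map_smul, smul_eq_mul, ← dualForm_eq]; ring

theorem refl_apply (a l : P.Wt) : P.refl a l = l - l (P.cor a) • a := by
  rw [refl, apply_cor]

theorem root_apply_cor {a : P.Wt} (ha : a ∈ P.evenRoots) : a (P.cor a) = 2 := by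
  rw [apply_cor, mul_div_assoc, div_self (P.dualForm_self_ne_zero ha), mul_one]

theorem cor_neg (a : P.Wt) : P.cor (-a) = -P.cor a := by
  rw [cor, cor, map_neg, dualForm_neg_left, dualForm_neg_right, neg_neg, smul_neg]

theorem exists_isSl2Triple {a : P.Wt} (ha : a ∈ P.evenRoots) {e : g₀}
    (he : e ∈ wtSpace P.H g₀ a) (he0 : e ≠ 0) :
    ∃ f ∈ wtSpace P.H g₀ (-a), IsSl2Triple (P.cor a : g₀) e f := by
  obtain ⟨y, hy, hey⟩ := P.exists_form₀_eq_one he he0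
  refine ⟨(2 / P.dualForm a a) • y, Submodule.smul_mem _ _ hy, ?_, ?_, ?_, ?_⟩
  · intro h
    have h2 := P.root_apply_cor ha
    rw [show P.cor a = 0 from Subtype.ext h, map_zero] at h2
    norm_num at h2
  · rw [lie_smul, P.lie_eq_smul_tvec he hy, hey, one_smul]
    rfl
  · rw [he, P.root_apply_cor ha]
    exact ofNat_smul_eq_nsmul ℂ 2 e
  · rw [lie_smul, hy, LinearMap.neg_apply, P.root_apply_cor ha, neg_smul, smul_neg]
    congr 1
    rw [smul_comm]
    exact ofNat_smul_eq_nsmul ℂ 2 _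

theorem exists_isSl2Triple' {a : P.Wt} (ha : a ∈ P.evenRoots) :
    ∃ e ∈ wtSpace P.H g₀ a, ∃ f ∈ wtSpace P.H g₀ (-a), IsSl2Triple (P.cor a : g₀) e f := by
  obtain ⟨e, he, he0⟩ := (Submodule.ne_bot_iff _).mp (P.mem_evenRoots.mp ha).2
  exact ⟨e, he, P.exists_isSl2Triple ha he he0⟩

/-! ### Representations of the 𝔰𝔩₂-triple of an even root. -/

section Module

variable {V : Type w} [AddCommGroup V] [Module ℂ V] [LieRingModule g₀ V] [LieModule ℂ g₀ V]

/-- Apply e to v until the last nonzero vector. That vector is primitive, so its h-eigenvalue is a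
natural number. -/
theorem exists_primitive [FiniteDimensional ℂ V] {a : P.Wt} (ha : a ∈ P.evenRoots)
    {e f : g₀} (he : e ∈ wtSpace P.H g₀ a) (t : IsSl2Triple (P.cor a : g₀) e f)
    {m : P.Wt} {v : V} (hv : v ∈ wtSpace P.H V m) (hv0 : v ≠ 0) :
    ∃ n N : ℕ, m (P.cor a) + 2 * n = N ∧
      t.HasPrimitiveVectorWith ((LieModule.toEnd ℂ g₀ V e ^ n) v) (N : ℂ) := by
  obtain ⟨n, hn, hn'⟩ := Nat.exists_not_and_succ_of_not_zero_of_exists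
    (p := fun n => (LieModule.toEnd ℂ g₀ V e ^ n) v = 0) (by simpa using hv0)
    (exists_toEnd_pow_eq_zero (P.mem_evenRoots.mp ha).1 he hv)
  have hp : t.HasPrimitiveVectorWith ((LieModule.toEnd ℂ g₀ V e ^ n) v)
      (m (P.cor a) + 2 * n) := by
    refine ⟨hn, t.lie_h_pow_toEnd_e (hv _) n, ?_⟩
    rwa [IsSl2Triple.lie_e_pow_toEnd_e]
  obtain ⟨N, hN⟩ := hp.exists_nat
  exact ⟨n, N, hN, hN ▸ hp⟩

theorem exists_int_apply_cor [FiniteDimensional ℂ V] {a : P.Wt} (ha : a ∈ P.evenRoots)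
    {m : P.Wt} (hm : wtSpace P.H V m ≠ ⊥) : ∃ z : ℤ, m (P.cor a) = z := by
  obtain ⟨e, he, f, hf, t⟩ := P.exists_isSl2Triple' ha
  obtain ⟨v, hv, hv0⟩ := (Submodule.ne_bot_iff _).mp hm
  obtain ⟨n, N, h, -⟩ := P.exists_primitive ha he t hv hv0
  refine ⟨N - 2 * n, ?_⟩
  push_cast
  linear_combination h

/-- A vector of positive `h`-weight is not killed by `f`. -/
theorem lie_f_ne_zero [FiniteDimensional ℂ V] {a : P.Wt}
    {e f : g₀} (t : IsSl2Triple (P.cor a : g₀) e f)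
    {m : P.Wt} {v : V} (hv : v ∈ wtSpace P.H V m) (hv0 : v ≠ 0) {k : ℕ}
    (hk : m (P.cor a) = k) (hk0 : 0 < k) : ⁅f, v⁆ ≠ 0 := by
  intro h
  -- If f killed v, then v would be primitive for the opposite triple (-h, f, e) with eigenvalue -k,
  -- which would have to be a natural number.
  have hp : t.symm.HasPrimitiveVectorWith v (-(k : ℂ)) := ⟨hv0, by rw [neg_lie, hv, hk, neg_smul], h⟩
  obtain ⟨n, hn⟩ := hp.exists_nat
  have : ((n + k : ℕ) : ℂ) = 0 := by push_cast; rw [← hn]; ring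
  have : n + k = 0 := by exact_mod_cast this
  omega

-- The operator is s = exp(e) exp(-f) exp(e). Moving x ∈ 𝔥 through the three factors gives x s = s
-- (x - a(x) h), so s sends weight m to m - m(h) a.
open IsNilpotent in
theorem exists_reflection_equiv [FiniteDimensional ℂ V] (hV : IsWeightModule P.H V)
    {a : P.Wt} (ha : a ∈ P.evenRoots) :
    ∃ s : Module.End ℂ V, Function.Injective s ∧
      ∀ m, ∀ v ∈ wtSpace P.H V m, s v ∈ wtSpace P.H V (P.refl a m) := by
  obtain ⟨e, he, f, hf, t⟩ := P.exists_isSl2Triple' ha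
  have ha0 := (P.mem_evenRoots.mp ha).1
  let _ : Algebra ℚ (Module.End ℂ V) := Algebra.compHom _ (algebraMap ℚ ℂ)
  set E := LieModule.toEnd ℂ g₀ V e with hEdef
  set F := LieModule.toEnd ℂ g₀ V f with hFdef
  set K := LieModule.toEnd ℂ g₀ V (P.cor a) with hKdef
  have hE : IsNilpotent E := isNilpotent_toEnd_of_mem_wtSpace hV ha0 he
  have hF : IsNilpotent (-F) :=
    (isNilpotent_toEnd_of_mem_wtSpace hV (neg_ne_zero.mpr ha0) hf).neg
  have comm (x y : g₀) : LieModule.toEnd ℂ g₀ V x * LieModule.toEnd ℂ g₀ V y =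
      LieModule.toEnd ℂ g₀ V y * LieModule.toEnd ℂ g₀ V x + LieModule.toEnd ℂ g₀ V ⁅x, y⁆ := by
    ext v
    simp only [Module.End.mul_apply, LinearMap.add_apply, LieModule.toEnd_apply_apply]
    rw [leibniz_lie, add_comm]
  have hXE (x : P.H) : LieModule.toEnd ℂ g₀ V x * exp E =
      exp E * (LieModule.toEnd ℂ g₀ V x + a x • E) := by
    refine mul_exp_eq_exp_mul_of_commutator_eq_smul hE ?_
    rw [comm, he x, map_smul]
  have hXF (x : P.H) : LieModule.toEnd ℂ g₀ V x * exp (-F) =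
      exp (-F) * (LieModule.toEnd ℂ g₀ V x + (-a x) • (-F)) := by
    refine mul_exp_eq_exp_mul_of_commutator_eq_smul hF ?_
    rw [mul_neg, comm, hf x, map_smul, LinearMap.neg_apply, neg_mul, smul_neg, neg_add]
  have hEF : E * exp (-F) = exp (-F) * (E + (-K) + (-F)) := by
    refine mul_exp_eq_exp_mul_of_sl2 hF ?_ ?_
    · rw [mul_neg, comm, t.lie_e_f]; noncomm_ring
    · rw [neg_mul_neg, comm, t.lie_h_f_nsmul, map_neg, map_nsmul, neg_mul_neg, smul_neg]
  have hEE : E * exp E = exp E * E := by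
    have := mul_exp_eq_exp_mul_of_commutator_eq_smul (x := E) (c := 0) hE (by simp)
    simpa using this
  refine ⟨exp E * exp (-F) * exp E, ?_, ?_⟩
  · have hu : IsUnit (exp E * exp (-F) * exp E) :=
      ((isUnit_exp hE).mul (isUnit_exp hF)).mul (isUnit_exp hE)
    exact ((Module.End.isUnit_iff _).mp hu).1
  · intro m v hv x
    have key : LieModule.toEnd ℂ g₀ V x * (exp E * exp (-F) * exp E) =
        (exp E * exp (-F) * exp E) * (LieModule.toEnd ℂ g₀ V x - a x • K) := by
      have hK := hXE (P.cor a)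
      rw [P.root_apply_cor ha] at hK
      calc _ = (LieModule.toEnd ℂ g₀ V x * exp E) * exp (-F) * exp E := by simp only [mul_assoc]
        _ = exp E * ((LieModule.toEnd ℂ g₀ V x) * exp (-F) + a x • (E * exp (-F))) * exp E := by
          rw [hXE]
          simp only [mul_assoc, mul_smul_comm, smul_mul_assoc, mul_add, add_mul]
        _ = exp E * exp (-F) * (LieModule.toEnd ℂ g₀ V x * exp E + a x • (E * exp E) -
              a x • (K * exp E)) := by
          rw [hXF, hEF]
          simp only [mul_assoc, mul_smul_comm, smul_mul_assoc, mul_add, add_mul, smul_add,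
            smul_neg, neg_smul, neg_neg, mul_neg, neg_mul, mul_sub]
          abel
        _ = _ := by
          rw [hXE, hEE, hK]
          simp only [mul_assoc, mul_smul_comm, mul_add, add_mul, smul_add,
            smul_neg, neg_smul, neg_neg, mul_neg, neg_mul, mul_sub, two_smul]
          abel
    have := congrArg (fun φ : Module.End ℂ V => φ v) key
    simp only [Module.End.mul_apply, LinearMap.sub_apply, LinearMap.smul_apply,
      LieModule.toEnd_apply_apply, hKdef] at this
    simp only [Module.End.mul_apply]
    rw [this, hv x, hv (P.cor a), smul_smul, ← sub_smul, map_smul, map_smul, map_smul,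
      P.refl_apply, LinearMap.sub_apply, LinearMap.smul_apply, smul_eq_mul, mul_comm]

theorem refl_refl {a : P.Wt} (ha : a ∈ P.evenRoots) (l : P.Wt) : P.refl a (P.refl a l) = l := by
  simp only [refl_apply, LinearMap.sub_apply, LinearMap.smul_apply, P.root_apply_cor ha,
    smul_eq_mul, sub_smul]
  module

theorem finrank_wtSpace_refl [FiniteDimensional ℂ V] (hV : IsWeightModule P.H V)
    {a : P.Wt} (ha : a ∈ P.evenRoots) (m : P.Wt) :
    Module.finrank ℂ (wtSpace P.H V (P.refl a m)) = Module.finrank ℂ (wtSpace P.H V m) := by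
  obtain ⟨s, hs, hs'⟩ := P.exists_reflection_equiv hV ha
  have hle (m : P.Wt) : Module.finrank ℂ (wtSpace P.H V m) ≤
      Module.finrank ℂ (wtSpace P.H V (P.refl a m)) :=
    LinearMap.finrank_le_finrank_of_injective (f := s.restrict (hs' m))
      (fun x y h => Subtype.ext (hs (congrArg Subtype.val h)))
  refine le_antisymm ?_ (hle m)
  have := hle (P.refl a m)
  rwa [P.refl_refl ha] at this

end Module

/-! ### The root system of the even part -/

theorem dualForm_refl_refl {a : P.Wt} (ha : a ∈ P.evenRoots) (l m : P.Wt) :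
    P.dualForm (P.refl a l) (P.refl a m) = P.dualForm l m := by
  have h0 := P.dualForm_self_ne_zero ha
  simp only [refl, dualForm_sub_left, dualForm_sub_right, dualForm_smul_left, dualForm_smul_right]
  rw [P.dualForm_comm a m]
  field_simp
  ring

theorem refl_mem_evenRoots {a b : P.Wt} (ha : a ∈ P.evenRoots) (hb : b ∈ P.evenRoots) :
    P.refl a b ∈ P.evenRoots := by
  rw [mem_evenRoots] at hb ⊢
  refine ⟨fun h => hb.1 ?_, ?_⟩
  · rw [← P.refl_refl ha b, h]; simp [refl_apply]
  · rw [← Submodule.one_le_finrank_iff, P.finrank_wtSpace_refl P.weight_even ha,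
      Submodule.one_le_finrank_iff]
    exact hb.2

theorem refl_mem_oddRoots {a b : P.Wt} (ha : a ∈ P.evenRoots) (hb : b ∈ P.oddRoots) :
    P.refl a b ∈ P.oddRoots := by
  rw [mem_oddRoots] at hb ⊢
  rwa [← Submodule.one_le_finrank_iff, P.finrank_wtSpace_refl P.weight_odd ha,
    Submodule.one_le_finrank_iff]

theorem exists_int_root_cor {a b : P.Wt} (ha : a ∈ P.evenRoots) (hb : b ∈ P.evenRoots) :
    ∃ z : ℤ, b (P.cor a) = z :=
  P.exists_int_apply_cor ha (P.mem_evenRoots.mp hb).2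

/-- From x of weight a subtract the multiple of e that makes it orthogonal to f. The difference
commutes with f although its h-eigenvalue is 2, so it vanishes by `lie_f_ne_zero`. -/
theorem finrank_root_space {a : P.Wt} (ha : a ∈ P.evenRoots) :
    Module.finrank ℂ (wtSpace P.H g₀ a) = 1 := by
  obtain ⟨e, he, f, hf, t⟩ := P.exists_isSl2Triple' ha
  refine finrank_eq_one (⟨e, he⟩ : wtSpace P.H g₀ a)
    (fun h => t.e_ne_zero (congrArg Subtype.val h)) ?_
  rintro ⟨x, hx⟩
  have hef : P.form₀ e f ≠ 0 := by
    intro h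
    have := P.lie_eq_smul_tvec he hf
    rw [h, zero_smul, t.lie_e_f] at this
    exact t.h_ne_zero this
  refine ⟨P.form₀ x f / P.form₀ e f, Subtype.ext ?_⟩
  change (P.form₀ x f / P.form₀ e f) • e = x
  set y := x - (P.form₀ x f / P.form₀ e f) • e with hy
  have hyw : y ∈ wtSpace P.H g₀ a := Submodule.sub_mem _ hx (Submodule.smul_mem _ _ he)
  have hyf : ⁅f, y⁆ = 0 := by
    rw [← lie_skew, P.lie_eq_smul_tvec hyw hf, hy, map_sub, map_smul, LinearMap.sub_apply,
      LinearMap.smul_apply, smul_eq_mul, div_mul_cancel₀ _ hef, sub_self, zero_smul, neg_zero]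
  by_contra hne
  have hy0 : y ≠ 0 := fun h => hne (sub_eq_zero.mp h).symm
  exact P.lie_f_ne_zero t hyw hy0 (k := 2) (by rw [P.root_apply_cor ha]; norm_num) two_pos hyf

theorem exists_eq_smul_of_mem_root_space {a : P.Wt} (ha : a ∈ P.evenRoots) {x y : g₀}
    (hx : x ∈ wtSpace P.H g₀ a) (hx0 : x ≠ 0) (hy : y ∈ wtSpace P.H g₀ a) :
    ∃ c : ℂ, y = c • x := by
  obtain ⟨c, hc⟩ := (finrank_eq_one_iff_of_nonzero' (⟨x, hx⟩ : wtSpace P.H g₀ a)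
    (fun h => hx0 (congrArg Subtype.val h))).mp (P.finrank_root_space ha) ⟨y, hy⟩
  exact ⟨c, (congrArg Subtype.val hc).symm⟩

/-- For x of weight 2a, [e, x] has weight 3a and vanishes, while [f, x] is a multiple of e. Hence
[h, x] = [[e, f], x] = 0, contradicting [h, x] = 4x. -/
theorem two_smul_notMem_evenRoots {a : P.Wt} (ha : a ∈ P.evenRoots)
    (h3 : (3 : ℂ) • a ∉ P.evenRoots) : (2 : ℂ) • a ∉ P.evenRoots := by
  intro h2
  obtain ⟨e, he, f, hf, t⟩ := P.exists_isSl2Triple' ha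
  obtain ⟨x, hx, hx0⟩ := (Submodule.ne_bot_iff _).mp (P.mem_evenRoots.mp h2).2
  have hex : ⁅e, x⁆ = 0 := by
    have h := lie_mem_wtSpace he hx
    rw [show a + (2 : ℂ) • a = (3 : ℂ) • a by module] at h
    by_contra hne
    refine h3 (P.mem_evenRoots.mpr ⟨?_, (Submodule.ne_bot_iff _).mpr ⟨_, h, hne⟩⟩)
    exact smul_ne_zero (by norm_num) (P.mem_evenRoots.mp ha).1
  have hfx : ⁅f, x⁆ ∈ wtSpace P.H g₀ a := by
    have h := lie_mem_wtSpace hf hx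
    rwa [show -a + (2 : ℂ) • a = a by module] at h
  obtain ⟨c, hc⟩ := P.exists_eq_smul_of_mem_root_space ha he t.e_ne_zero hfx
  have := leibniz_lie e f x
  rw [hc, hex, lie_zero, add_zero, lie_smul, lie_self, smul_zero, t.lie_e_f, hx,
    LinearMap.smul_apply, P.root_apply_cor ha] at this
  rcases smul_eq_zero.mp this.symm with h | h
  · norm_num at h
  · exact hx0 h

/-- Both 2c and 2/c are integers with product 4, so 2c is ±1, ±2 or ±4. The extreme values would
make one root twice another up to sign; that is excluded because 3a fails integrality and so is not
a root. -/
theorem eq_one_or_neg_one_of_smul_mem {a : P.Wt} (ha : a ∈ P.evenRoots) {c : ℂ}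
    (hc : c • a ∈ P.evenRoots) : c = 1 ∨ c = -1 := by
  have hint (b : P.Wt) (hb : b ∈ P.evenRoots) (d : ℂ) (hd : d • b ∈ P.evenRoots) :
      ∃ z : ℤ, d * 2 = z := by
    obtain ⟨z, hz⟩ := P.exists_int_root_cor hb hd
    exact ⟨z, by rw [← hz, LinearMap.smul_apply, P.root_apply_cor hb, smul_eq_mul]⟩
  have h3 (b : P.Wt) (hb : b ∈ P.evenRoots) : (3 : ℂ) • b ∉ P.evenRoots := by
    intro h
    obtain ⟨z, hz⟩ := hint _ h (3⁻¹) (by rwa [smul_smul, inv_mul_cancel₀ (by norm_num), one_smul])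
    have : (3 : ℂ) * z = 2 := by rw [← hz]; norm_num
    have : (3 : ℤ) * z = 2 := by exact_mod_cast this
    omega
  have h2 (b : P.Wt) (hb : b ∈ P.evenRoots) : (2 : ℂ) • b ∉ P.evenRoots :=
    P.two_smul_notMem_evenRoots hb (h3 b hb)
  have hc0 : c ≠ 0 := by
    rintro rfl
    exact (P.mem_evenRoots.mp hc).1 (zero_smul _ _)
  obtain ⟨z, hz⟩ := hint a ha c hc
  obtain ⟨y, hy⟩ := hint _ hc c⁻¹ (by rwa [smul_smul, inv_mul_cancel₀ hc0, one_smul])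
  have hzy : z * y = 4 := by
    have : (z : ℂ) * y = 4 := by rw [← hz, ← hy]; field_simp; norm_num
    exact_mod_cast this
  have hdvd : z ∣ 4 := ⟨y, hzy.symm⟩
  have hle := Int.le_of_dvd (by norm_num) hdvd
  have hle' := Int.le_of_dvd (by norm_num) (neg_dvd.mpr hdvd)
  have hcz : c = z / 2 := by rw [← hz]; ring
  have hneg := P.neg_mem_evenRoots hc
  obtain rfl | rfl | rfl | rfl | rfl | rfl : z = 4 ∨ z = -4 ∨ z = 2 ∨ z = -2 ∨ z = 1 ∨ z = -1 := by
    have : z ≠ 3 := by rintro rfl; omega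
    have : z ≠ -3 := by rintro rfl; omega
    have : z ≠ 0 := by rintro rfl; omega
    omega
  · refine absurd hc ?_
    rw [hcz, show (((4 : ℤ) : ℂ) / 2) = 2 by norm_num]
    exact h2 a ha
  · refine absurd hneg ?_
    rw [hcz, ← neg_smul, show (-(((-4 : ℤ) : ℂ) / 2)) = 2 by norm_num]
    exact h2 a ha
  · left; rw [hcz]; norm_num
  · right; rw [hcz]; norm_num
  · refine absurd ha ?_
    rw [show a = (2 : ℂ) • c • a by rw [smul_smul, hcz]; norm_num]
    exact h2 _ hc
  · refine absurd ha ?_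
    rw [show a = (2 : ℂ) • -(c • a) by rw [← neg_smul, smul_smul, hcz]; norm_num]
    exact h2 _ hneg

theorem sub_mem_evenRoots {a b : P.Wt} (ha : a ∈ P.evenRoots) (hb : b ∈ P.evenRoots)
    (hab : b ≠ a) {k : ℕ} (hk : b (P.cor a) = k) (hk0 : 0 < k) : b - a ∈ P.evenRoots := by
  obtain ⟨e, he, f, hf, t⟩ := P.exists_isSl2Triple' ha
  obtain ⟨x, hx, hx0⟩ := (Submodule.ne_bot_iff _).mp (P.mem_evenRoots.mp hb).2
  have h1 := P.lie_f_ne_zero t hx hx0 hk hk0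
  have h2 := lie_mem_wtSpace hf hx
  rw [neg_add_eq_sub] at h2
  exact P.mem_evenRoots.mpr ⟨sub_ne_zero.mpr hab, (Submodule.ne_bot_iff _).mpr ⟨_, h2, h1⟩⟩

/-- If [x, y] = 0 then y is primitive with some eigenvalue m, and z of weight a + b has eigenvalue m
+ 2. Since [f, z] is a multiple of y, x kills [f, z]. Climb from z to a primitive u = x^n z; then
f^n u is a nonzero multiple of z, and x f^{n+1} u is (n+1)(N-n) f^n u ≠ 0, which contradicts x f z =
0. -/
theorem lie_ne_zero_of_add_mem {a b : P.Wt} (ha : a ∈ P.evenRoots) (hb : b ∈ P.evenRoots)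
    (hab : a + b ∈ P.evenRoots) {x y : g₀} (hx : x ∈ wtSpace P.H g₀ a) (hx0 : x ≠ 0)
    (hy : y ∈ wtSpace P.H g₀ b) (hy0 : y ≠ 0) : ⁅x, y⁆ ≠ 0 := by
  intro hxy
  obtain ⟨f, hf, t⟩ := P.exists_isSl2Triple ha hx hx0
  obtain ⟨m, hm⟩ : ∃ m : ℕ, b (P.cor a) = m :=
    IsSl2Triple.HasPrimitiveVectorWith.exists_nat (t := t) (m := y) ⟨hy0, hy _, hxy⟩
  obtain ⟨z, hz, hz0⟩ := (Submodule.ne_bot_iff _).mp (P.mem_evenRoots.mp hab).2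
  have hzw : (a + b) (P.cor a) = (m + 2 : ℕ) := by
    rw [LinearMap.add_apply, P.root_apply_cor ha, hm]; push_cast; ring
  have hfz : ⁅f, z⁆ ∈ wtSpace P.H g₀ b := by
    have := lie_mem_wtSpace hf hz
    rwa [neg_add_cancel_left] at this
  obtain ⟨c, hc⟩ := P.exists_eq_smul_of_mem_root_space hb hy hy0 hfz
  have hefz : ⁅x, ⁅f, z⁆⁆ = 0 := by rw [hc, lie_smul, hxy, smul_zero]
  obtain ⟨n, N, hN, hp⟩ := P.exists_primitive ha hx t hz hz0
  have hN' : N = m + 2 + 2 * n := by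
    rw [hzw] at hN; exact_mod_cast hN.symm
  set u := (LieModule.toEnd ℂ g₀ g₀ x ^ n) z
  have hu : (LieModule.toEnd ℂ g₀ g₀ f ^ n) u ∈ wtSpace P.H g₀ (a + b) := by
    have := toEnd_pow_mem_wtSpace hf (toEnd_pow_mem_wtSpace hx hz n) n
    convert this using 1
    rw [smul_neg]; abel_nf
  have hu0 : (LieModule.toEnd ℂ g₀ g₀ f ^ n) u ≠ 0 :=
    hp.pow_toEnd_f_ne_zero_of_eq_nat rfl (by omega)
  obtain ⟨d, hd⟩ := P.exists_eq_smul_of_mem_root_space hab hz hz0 hu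
  have h1 := hp.lie_e_pow_succ_toEnd_f n
  rw [_root_.pow_succ', Module.End.mul_apply, hd, map_smul, LieModule.toEnd_apply_apply, lie_smul,
    hefz, smul_zero, ← hd] at h1
  rcases smul_eq_zero.mp h1.symm with h | h
  · rcases mul_eq_zero.mp h with h | h
    · exact Nat.cast_add_one_ne_zero n h
    · have : N = n := by exact_mod_cast sub_eq_zero.mp h
      omega
  · exact hu0 h

theorem cor_refl {a : P.Wt} (ha : a ∈ P.evenRoots) (b : P.Wt) :
    P.cor (P.refl a b) = P.cor b - a (P.cor b) • P.cor a := by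
  rw [apply_cor, cor, P.dualForm_refl_refl ha, refl, map_sub, map_smul, cor, cor, smul_sub,
    smul_smul, smul_smul, P.dualForm_comm a b]
  congr 2
  ring

theorem cor_injOn {a b : P.Wt} (ha : a ∈ P.evenRoots) (hb : b ∈ P.evenRoots)
    (h : P.cor a = P.cor b) : a = b := by
  have ha0 := P.dualForm_self_ne_zero ha
  have hb0 := P.dualForm_self_ne_zero hb
  have hab : a = (P.dualForm a a / P.dualForm b b) • b := by
    apply P.tvec.injective
    have : P.tvec a = (P.dualForm a a / 2) • P.cor a := by
      rw [cor, smul_smul, div_mul_div_cancel₀ two_ne_zero, div_self ha0, one_smul]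
    rw [this, h, cor, map_smul, smul_smul, div_mul_div_cancel₀ two_ne_zero]
  have h1 := ha
  rw [hab] at h1
  rcases P.eq_one_or_neg_one_of_smul_mem hb h1 with h2 | h2
  · rw [hab, h2, one_smul]
  · rw [h2, neg_one_smul] at hab
    rw [hab, cor_neg] at h
    have h3 := congrArg b h
    rw [map_neg, P.root_apply_cor hb] at h3
    norm_num at h3

/-- The root pairing of the even roots and their coroots. -/
noncomputable def rootPairing : RootPairing P.evenRoots ℂ P.Wt P.H :=
  RootPairing.mk' (p := (LinearMap.id : P.Wt →ₗ[ℂ] P.H →ₗ[ℂ] ℂ))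
    (root := ⟨fun a => (a : P.Wt), Subtype.val_injective⟩)
    (coroot := ⟨fun a => P.cor a, fun a b h => Subtype.ext (P.cor_injOn a.2 b.2 h)⟩)
    (fun a => P.root_apply_cor a.2)
    (by
      rintro a - ⟨b, rfl⟩
      refine ⟨⟨P.refl a b, P.refl_mem_evenRoots a.2 b.2⟩, ?_⟩
      change P.refl a b = _
      rw [refl_apply]
      rfl)
    (by
      rintro a - ⟨b, rfl⟩
      refine ⟨⟨P.refl a b, P.refl_mem_evenRoots a.2 b.2⟩, ?_⟩
      change P.cor (P.refl a b) = _
      rw [P.cor_refl a.2]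
      rfl)

instance : P.rootPairing.IsCrystallographic :=
  ⟨fun i j => (P.exists_int_root_cor j.2 i.2).imp fun _ hz => hz.symm⟩

/-- Such an x lies in the kernel of the canonical form of the root pairing, and that kernel meets
the span of the roots trivially. -/
theorem eq_zero_of_forall_cor_eq_zero {x : P.Wt}
    (hx : x ∈ Submodule.span ℂ (P.evenRoots : Set P.Wt))
    (h : ∀ a ∈ P.evenRoots, x (P.cor a) = 0) : x = 0 := by
  have hd := P.rootPairing.disjoint_rootSpan_ker_rootForm
  rw [Submodule.disjoint_def] at hd
  refine hd x ?_ ?_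
  · refine Submodule.span_mono ?_ hx
    intro a ha
    exact ⟨⟨a, ha⟩, rfl⟩
  · rw [LinearMap.mem_ker]
    ext y
    rw [RootPairing.rootForm_apply_apply]
    refine Finset.sum_eq_zero fun a _ => ?_
    have : P.rootPairing.coroot' a x = 0 := h a a.2
    rw [this, zero_mul]

/-! ### The Weyl group -/

theorem eval_cor_root {a : P.Wt} (ha : a ∈ P.evenRoots) :
    Module.Dual.eval ℂ P.H (P.cor a) a = 2 := by
  rw [Module.Dual.eval_apply, P.root_apply_cor ha]

theorem reflection_eval_cor {a : P.Wt} (ha : a ∈ P.evenRoots) (l : P.Wt) :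
    Module.reflection (P.eval_cor_root ha) l = P.refl a l := by
  rw [Module.reflection_apply, refl_apply, Module.Dual.eval_apply]

/-- The reflection in an even root as an element of the Weyl group. -/
noncomputable def sR (a : P.evenRoots) : P.weyl :=
  ⟨Module.reflection (P.eval_cor_root a.2),
    Subgroup.subset_closure ⟨a, a.2, P.reflection_eval_cor a.2⟩⟩

theorem sR_apply (a : P.evenRoots) (l : P.Wt) :
    (P.sR a : P.Wt ≃ₗ[ℂ] P.Wt) l = P.refl a l := P.reflection_eval_cor a.2 l

theorem sR_mul_self (a : P.evenRoots) : P.sR a * P.sR a = 1 := by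
  refine Subtype.ext (LinearEquiv.ext fun l => ?_)
  change (P.sR a : P.Wt ≃ₗ[ℂ] P.Wt) ((P.sR a : P.Wt ≃ₗ[ℂ] P.Wt) l) = l
  rw [sR_apply, sR_apply, P.refl_refl a.2]

theorem weyl_induction {p : P.weyl → Prop} (one : p 1)
    (mul : ∀ a w, p w → p (P.sR a * w)) (w : P.weyl) : p w := by
  obtain ⟨w, hw⟩ := w
  have hgen (x : P.Wt ≃ₗ[ℂ] P.Wt) (hx : x ∈ {s : P.Wt ≃ₗ[ℂ] P.Wt |
      ∃ a ∈ P.evenRoots, ∀ l, s l = P.refl a l}) : ∃ a, x = P.sR a := by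
    obtain ⟨a, ha, h⟩ := hx
    exact ⟨⟨a, ha⟩, LinearEquiv.ext fun l => by rw [h, sR_apply]⟩
  induction hw using Subgroup.closure_induction_left with
  | one => exact one
  | mul_left x hx y hy ih =>
    obtain ⟨a, rfl⟩ := hgen x hx
    exact mul a ⟨y, hy⟩ ih
  | inv_mul_cancel x hx y hy ih =>
    obtain ⟨a, rfl⟩ := hgen x hx
    convert mul a ⟨y, hy⟩ ih using 1
    have : (P.sR a)⁻¹ = P.sR a := inv_eq_of_mul_eq_one_right (P.sR_mul_self a)
    refine Subtype.ext ?_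
    change ((P.sR a)⁻¹ : P.weyl).1 * y = _
    rw [this]
    rfl

theorem weyl_mul_apply (w w' : P.weyl) (l : P.Wt) :
    ((w * w' : P.weyl) : P.Wt ≃ₗ[ℂ] P.Wt) l = (w : P.Wt ≃ₗ[ℂ] P.Wt) ((w' : P.Wt ≃ₗ[ℂ] P.Wt) l) :=
  rfl

theorem weyl_inv_apply_apply (w : P.weyl) (l : P.Wt) :
    ((w⁻¹ : P.weyl) : P.Wt ≃ₗ[ℂ] P.Wt) ((w : P.Wt ≃ₗ[ℂ] P.Wt) l) = l := by
  rw [← weyl_mul_apply, inv_mul_cancel]; rfl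

theorem weyl_apply_inv_apply (w : P.weyl) (l : P.Wt) :
    (w : P.Wt ≃ₗ[ℂ] P.Wt) (((w⁻¹ : P.weyl) : P.Wt ≃ₗ[ℂ] P.Wt) l) = l := by
  rw [← weyl_mul_apply, mul_inv_cancel]; rfl

theorem dualForm_weyl (w : P.weyl) (l m : P.Wt) :
    P.dualForm ((w : P.Wt ≃ₗ[ℂ] P.Wt) l) ((w : P.Wt ≃ₗ[ℂ] P.Wt) m) = P.dualForm l m := by
  induction w using P.weyl_induction with
  | one => rfl
  | mul a w ih => rw [weyl_mul_apply, weyl_mul_apply, sR_apply, sR_apply,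
      P.dualForm_refl_refl a.2, ih]

theorem weyl_mem_evenRoots (w : P.weyl) {b : P.Wt} (hb : b ∈ P.evenRoots) :
    (w : P.Wt ≃ₗ[ℂ] P.Wt) b ∈ P.evenRoots := by
  induction w using P.weyl_induction with
  | one => exact hb
  | mul a w ih => rw [weyl_mul_apply, sR_apply]; exact P.refl_mem_evenRoots a.2 ih

theorem weyl_mem_oddRoots (w : P.weyl) {b : P.Wt} (hb : b ∈ P.oddRoots) :
    (w : P.Wt ≃ₗ[ℂ] P.Wt) b ∈ P.oddRoots := by
  induction w using P.weyl_induction with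
  | one => exact hb
  | mul a w ih => rw [weyl_mul_apply, sR_apply]; exact P.refl_mem_oddRoots a.2 ih

theorem finrank_wtSpace_weyl {V : Type w} [AddCommGroup V] [Module ℂ V] [LieRingModule g₀ V]
    [LieModule ℂ g₀ V] [FiniteDimensional ℂ V] (hV : IsWeightModule P.H V) (w : P.weyl)
    (m : P.Wt) : Module.finrank ℂ (wtSpace P.H V ((w : P.Wt ≃ₗ[ℂ] P.Wt) m)) =
      Module.finrank ℂ (wtSpace P.H V m) := by
  induction w using P.weyl_induction with
  | one => rfl
  | mul a w ih => rw [weyl_mul_apply, sR_apply, P.finrank_wtSpace_refl hV a.2, ih]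

theorem refl_weyl (w : P.weyl) (a l : P.Wt) :
    P.refl ((w : P.Wt ≃ₗ[ℂ] P.Wt) a) ((w : P.Wt ≃ₗ[ℂ] P.Wt) l) =
      (w : P.Wt ≃ₗ[ℂ] P.Wt) (P.refl a l) := by
  rw [refl, refl, dualForm_weyl, dualForm_weyl, map_sub, map_smul]

theorem weyl_apply_cor (w : P.weyl) (l a : P.Wt) :
    ((w : P.Wt ≃ₗ[ℂ] P.Wt) l) (P.cor ((w : P.Wt ≃ₗ[ℂ] P.Wt) a)) = l (P.cor a) := by
  rw [apply_cor, apply_cor, dualForm_weyl, dualForm_weyl]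

theorem weyl_conj_sR (w : P.weyl) (a : P.evenRoots) :
    w * P.sR a * w⁻¹ = P.sR ⟨(w : P.Wt ≃ₗ[ℂ] P.Wt) a, P.weyl_mem_evenRoots w a.2⟩ := by
  refine Subtype.ext (LinearEquiv.ext fun l => ?_)
  rw [weyl_mul_apply, weyl_mul_apply, sR_apply, sR_apply, ← refl_weyl, weyl_apply_inv_apply]

theorem weyl_apply_sub_mem_span (w : P.weyl) (l : P.Wt) :
    (w : P.Wt ≃ₗ[ℂ] P.Wt) l - l ∈ Submodule.span ℂ (P.evenRoots : Set P.Wt) := by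
  induction w using P.weyl_induction with
  | one => simp
  | mul a w ih =>
    rw [weyl_mul_apply, sR_apply, refl_apply, sub_right_comm]
    exact Submodule.sub_mem _ ih (Submodule.smul_mem _ _ (Submodule.subset_span a.2))

/-- Each wl - l lies in the span of the roots, and if w fixes the roots it pairs to zero with every
coroot. So W acts faithfully on the finite set of roots, whence W is finite. -/
theorem eq_one_of_forall_root {w : P.weyl}
    (hw : ∀ a ∈ P.evenRoots, (w : P.Wt ≃ₗ[ℂ] P.Wt) a = a) : w = 1 := by
  refine Subtype.ext (LinearEquiv.ext fun l => sub_eq_zero.mp ?_)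
  refine P.eq_zero_of_forall_cor_eq_zero (P.weyl_apply_sub_mem_span w l) fun a ha => ?_
  have := P.weyl_apply_cor w l a
  rw [hw a ha] at this
  rw [LinearMap.sub_apply, this]
  exact sub_self _

instance : Finite P.weyl := by
  let φ : P.weyl → (P.evenRoots → P.evenRoots) :=
    fun w a => ⟨(w : P.Wt ≃ₗ[ℂ] P.Wt) a, P.weyl_mem_evenRoots w a.2⟩
  refine Finite.of_injective φ fun w w' h => ?_
  have : w⁻¹ * w' = 1 := by
    refine P.eq_one_of_forall_root fun a ha => ?_
    have := congrArg Subtype.val (congrFun h ⟨a, ha⟩)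
    change (w : P.Wt ≃ₗ[ℂ] P.Wt) a = (w' : P.Wt ≃ₗ[ℂ] P.Wt) a at this
    rw [weyl_mul_apply, ← this, weyl_inv_apply_apply]
  exact (inv_mul_eq_one.mp this)

/-! ### The sign character -/

theorem det_sR (a : P.evenRoots) :
    LinearMap.det ((P.sR a : P.Wt ≃ₗ[ℂ] P.Wt) : P.Wt →ₗ[ℂ] P.Wt) = -1 := by
  have : ((P.sR a : P.Wt ≃ₗ[ℂ] P.Wt) : P.Wt →ₗ[ℂ] P.Wt) =
      LinearMap.transvection (-Module.Dual.eval ℂ P.H (P.cor a)) (a : P.Wt) := by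
    ext l : 1
    change (P.sR a : P.Wt ≃ₗ[ℂ] P.Wt) l = _
    rw [sR_apply, refl_apply, LinearMap.transvection.apply, LinearMap.neg_apply, neg_smul,
      sub_eq_add_neg]
    rfl
  rw [this, LinearMap.transvection.det, LinearMap.neg_apply, Module.Dual.eval_apply,
    P.root_apply_cor a.2]
  norm_num

/-- Reflections have determinant -1, so determinants on W are ±1 and the default value -1 in `sgn`
is the true determinant. This makes `sgn` multiplicative. -/
theorem det_weyl_eq (w : P.weyl) :
    LinearMap.det ((w : P.Wt ≃ₗ[ℂ] P.Wt) : P.Wt →ₗ[ℂ] P.Wt) = P.sgn w := by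
  have h : LinearMap.det ((w : P.Wt ≃ₗ[ℂ] P.Wt) : P.Wt →ₗ[ℂ] P.Wt) = 1 ∨
      LinearMap.det ((w : P.Wt ≃ₗ[ℂ] P.Wt) : P.Wt →ₗ[ℂ] P.Wt) = -1 := by
    induction w using P.weyl_induction with
    | one => left; exact LinearMap.det_id
    | mul a w ih =>
      have : (((P.sR a * w : P.weyl) : P.Wt ≃ₗ[ℂ] P.Wt) : P.Wt →ₗ[ℂ] P.Wt) =
        ((P.sR a : P.Wt ≃ₗ[ℂ] P.Wt) : P.Wt →ₗ[ℂ] P.Wt) ∘ₗ ((w : P.Wt ≃ₗ[ℂ] P.Wt) :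
          P.Wt →ₗ[ℂ] P.Wt) := rfl
      rw [this, LinearMap.det_comp, det_sR]
      rcases ih with h | h <;> rw [h] <;> norm_num
  rw [sgn]
  split_ifs with h1
  · rw [h1]; norm_num
  · rw [h.resolve_left h1]; norm_num

theorem sgn_mul (w w' : P.weyl) : P.sgn (w * w') = P.sgn w * P.sgn w' := by
  have : (P.sgn (w * w') : ℂ) = P.sgn w * P.sgn w' := by
    rw [← det_weyl_eq, ← det_weyl_eq, ← det_weyl_eq, ← LinearMap.det_comp]
    rfl
  exact_mod_cast this

theorem sgn_one : P.sgn 1 = 1 := by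
  have : (P.sgn 1 : ℂ) = 1 := by
    rw [← det_weyl_eq]; exact LinearMap.det_id
  exact_mod_cast this

theorem sgn_sR (a : P.evenRoots) : P.sgn (P.sR a) = -1 := by
  have : (P.sgn (P.sR a) : ℂ) = -1 := by rw [← det_weyl_eq, det_sR]
  exact_mod_cast this

theorem sgn_mul_self (w : P.weyl) : P.sgn w * P.sgn w = 1 := by
  rw [sgn]; split_ifs <;> norm_num

theorem sgn_inv (w : P.weyl) : P.sgn w⁻¹ = P.sgn w := by
  have h := P.sgn_mul w⁻¹ w
  rw [inv_mul_cancel, sgn_one] at h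
  calc P.sgn w⁻¹ = P.sgn w⁻¹ * (P.sgn w * P.sgn w) := by rw [sgn_mul_self, mul_one]
    _ = P.sgn w := by rw [← mul_assoc, ← h, one_mul]

/-! ### Positivity of the root form -/

/-- The Weyl invariant form `∑_a l(h_a) m(h_a)`. -/
noncomputable def rootForm (l m : P.Wt) : ℂ := ∑ a ∈ P.evenRoots, l (P.cor a) * m (P.cor a)

theorem rootForm_refl {b : P.Wt} (hb : b ∈ P.evenRoots) (l m : P.Wt) :
    P.rootForm (P.refl b l) (P.refl b m) = P.rootForm l m := by
  have h (l a : P.Wt) : P.refl b l (P.cor a) = l (P.cor (P.refl b a)) := by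
    rw [refl_apply, P.cor_refl hb, LinearMap.sub_apply, map_sub, map_smul, LinearMap.smul_apply,
      smul_eq_mul, smul_eq_mul, mul_comm]
  unfold rootForm
  simp_rw [h]
  exact Finset.sum_nbij' (P.refl b) (P.refl b) (fun a ha => P.refl_mem_evenRoots hb ha)
    (fun a ha => P.refl_mem_evenRoots hb ha) (fun a _ => P.refl_refl hb a)
    (fun a _ => P.refl_refl hb a) (fun a _ => rfl)

/-- Invariance under r_b together with r_b b = -b, as for any Weyl-invariant symmetric form. -/
theorem two_mul_rootForm {b : P.Wt} (hb : b ∈ P.evenRoots) (l : P.Wt) :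
    2 * P.rootForm b l = P.rootForm b b * l (P.cor b) := by
  have h := P.rootForm_refl hb b l
  have hbb : P.refl b b = -b := by rw [refl_apply, P.root_apply_cor hb]; module
  have e : P.rootForm (-b) (P.refl b l) = -P.rootForm b l + l (P.cor b) * P.rootForm b b := by
    simp only [rootForm, refl_apply, LinearMap.neg_apply, LinearMap.sub_apply,
      LinearMap.smul_apply, smul_eq_mul, Finset.mul_sum]
    rw [← Finset.sum_neg_distrib, ← Finset.sum_add_distrib]
    exact Finset.sum_congr rfl fun a _ => by ring
  rw [hbb, e] at h
  linear_combination -h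

/-- The value is a sum of squares of Cartan integers in which b itself contributes 4. Positivity is
thus a statement about integers, although the ground field is `ℂ`. -/
theorem exists_rootForm_self_pos {b : P.Wt} (hb : b ∈ P.evenRoots) :
    ∃ n : ℤ, 0 < n ∧ P.rootForm b b = n := by
  choose! z hz using fun a (ha : a ∈ P.evenRoots) => P.exists_int_root_cor ha hb
  refine ⟨∑ a ∈ P.evenRoots, z a * z a, ?_, ?_⟩
  · refine Finset.sum_pos' (fun a _ => mul_self_nonneg _) ⟨b, hb, ?_⟩
    have : z b = 2 := by
      have := hz b hb
      rw [P.root_apply_cor hb] at this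
      exact_mod_cast this.symm
    rw [this]; norm_num
  · rw [rootForm]
    push_cast
    exact Finset.sum_congr rfl fun a ha => by rw [hz a ha]

theorem rootForm_sum_left {ι : Type*} (s : Finset ι) (n : ι → ℕ) (f : ι → P.Wt) (l : P.Wt) :
    P.rootForm (∑ i ∈ s, n i • f i) l = ∑ i ∈ s, n i * P.rootForm (f i) l := by
  simp only [rootForm, LinearMap.sum_apply, LinearMap.smul_apply, Finset.sum_mul, Finset.mul_sum,
    nsmul_eq_mul]
  rw [Finset.sum_comm]
  exact Finset.sum_congr rfl fun i _ => Finset.sum_congr rfl fun a _ => by ring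

/-! ### Positive roots of a base -/

section Base

variable {P} {B : Finset P.Wt}

theorem mem_posEven {a : P.Wt} :
    a ∈ P.posEven B ↔ a ∈ P.evenRoots ∧ a ∈ AddSubmonoid.closure (B : Set P.Wt) := by
  simp [posEven]

theorem mem_posOdd {a : P.Wt} :
    a ∈ P.posOdd B ↔ a ∈ P.oddRoots ∧ a ∈ AddSubmonoid.closure (B : Set P.Wt) := by
  simp [posOdd]

theorem exists_functional (hB : LinearIndependent ℂ (fun a : B => (a : P.Wt))) (c : P.Wt → ℂ) :
    ∃ φ : P.Wt →ₗ[ℂ] ℂ, ∀ b ∈ B, φ b = c b := by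
  obtain ⟨φ, hφ⟩ := LinearMap.exists_extend
    ((Finsupp.linearCombination ℂ (fun b : B => c b)) ∘ₗ hB.repr)
  refine ⟨φ, fun b hb => ?_⟩
  have := LinearMap.congr_fun hφ ⟨b, Submodule.subset_span ⟨⟨b, hb⟩, rfl⟩⟩
  simp only [LinearMap.comp_apply, Submodule.subtype_apply] at this
  rw [this, hB.repr_eq_single ⟨b, hb⟩ _ rfl]
  simp

theorem exists_nat_apply {φ : P.Wt →ₗ[ℂ] ℂ} (hφ : ∀ b ∈ B, ∃ n : ℕ, φ b = n) {x : P.Wt}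
    (hx : x ∈ AddSubmonoid.closure (B : Set P.Wt)) : ∃ n : ℕ, φ x = n := by
  induction hx using AddSubmonoid.closure_induction with
  | mem x hx => exact hφ x hx
  | zero => exact ⟨0, by simp⟩
  | add x y _ _ hx hy =>
    obtain ⟨n, hn⟩ := hx
    obtain ⟨m, hm⟩ := hy
    exact ⟨n + m, by rw [map_add, hn, hm]; push_cast; rfl⟩

theorem exists_eq_sum {x : P.Wt} (hx : x ∈ AddSubmonoid.closure (B : Set P.Wt)) :
    ∃ n : P.Wt → ℕ, x = ∑ b ∈ B, n b • b := by
  obtain ⟨n, -, h⟩ := AddSubmonoid.mem_closure_finset.mp hx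
  exact ⟨n, h.symm⟩

/-- The height functional of a base. -/
noncomputable def htFun (hB : LinearIndependent ℂ (fun a : B => (a : P.Wt))) : P.Wt →ₗ[ℂ] ℂ :=
  (exists_functional hB (fun _ => 1)).choose

theorem htFun_apply (hB : LinearIndependent ℂ (fun a : B => (a : P.Wt))) {b : P.Wt} (hb : b ∈ B) :
    htFun hB b = 1 := (exists_functional hB (fun _ => 1)).choose_spec b hb

theorem exists_htFun_eq_nat (hB : LinearIndependent ℂ (fun a : B => (a : P.Wt))) {x : P.Wt}
    (hx : x ∈ AddSubmonoid.closure (B : Set P.Wt)) : ∃ n : ℕ, htFun hB x = n :=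
  exists_nat_apply (fun b hb => ⟨1, by rw [htFun_apply hB hb]; simp⟩) hx

theorem eq_zero_of_htFun_eq_zero (hB : LinearIndependent ℂ (fun a : B => (a : P.Wt))) {x : P.Wt}
    (hx : x ∈ AddSubmonoid.closure (B : Set P.Wt)) (h : htFun hB x = 0) : x = 0 := by
  obtain ⟨n, rfl⟩ := exists_eq_sum hx
  have h2 : ((∑ b ∈ B, n b : ℕ) : ℂ) = 0 := by
    rw [← h, map_sum]
    push_cast
    exact Finset.sum_congr rfl fun b hb => by rw [map_nsmul, htFun_apply hB hb]; simp
  have h3 : ∑ b ∈ B, n b = 0 := by exact_mod_cast h2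
  rw [Finset.sum_eq_zero_iff] at h3
  exact Finset.sum_eq_zero fun b hb => by rw [h3 b hb, zero_smul]

theorem eq_zero_of_mem_of_neg_mem (hB : LinearIndependent ℂ (fun a : B => (a : P.Wt)))
    {x : P.Wt} (hx : x ∈ AddSubmonoid.closure (B : Set P.Wt))
    (hx' : -x ∈ AddSubmonoid.closure (B : Set P.Wt)) : x = 0 := by
  obtain ⟨n, hn⟩ := exists_htFun_eq_nat hB hx
  obtain ⟨m, hm⟩ := exists_htFun_eq_nat hB hx'
  rw [map_neg, hn] at hm
  have : ((n + m : ℕ) : ℂ) = 0 := by push_cast; rw [← hm]; ring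
  have : n + m = 0 := by exact_mod_cast this
  refine eq_zero_of_htFun_eq_zero hB hx ?_
  rw [hn, show n = 0 by omega]; simp

end Base

/-! ### Positive even roots and simple reflections. -/

section EvenBase

variable {P}

/-- The product of the reflections in a list of roots. -/
noncomputable def wordProd (L : List P.evenRoots) : P.weyl := (L.map P.sR).prod

variable {B₀ : Finset P.Wt} (hB₀ : P.IsBase P.evenRoots B₀)

include hB₀

theorem IsBase.mem_posEven_of_mem {b : P.Wt} (hb : b ∈ B₀) : b ∈ P.posEven B₀ :=
  mem_posEven.mpr ⟨hB₀.subset hb, AddSubmonoid.subset_closure hb⟩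

theorem IsBase.closure_posEven :
    AddSubmonoid.closure (P.posEven B₀ : Set P.Wt) = AddSubmonoid.closure (B₀ : Set P.Wt) := by
  refine le_antisymm ?_ (AddSubmonoid.closure_mono fun b hb => hB₀.mem_posEven_of_mem hb)
  rw [AddSubmonoid.closure_le]
  exact fun a ha => (mem_posEven.mp ha).2

theorem IsBase.pos_or_neg' {a : P.Wt} (ha : a ∈ P.evenRoots) :
    a ∈ P.posEven B₀ ∨ -a ∈ P.posEven B₀ :=
  (hB₀.pos_or_neg a ha).imp (fun h => mem_posEven.mpr ⟨ha, h⟩)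
    (fun h => mem_posEven.mpr ⟨P.neg_mem_evenRoots ha, h⟩)

theorem IsBase.neg_notMem {a : P.Wt} (ha : a ∈ P.posEven B₀) : -a ∉ P.posEven B₀ := by
  intro h
  exact (P.mem_evenRoots.mp (mem_posEven.mp ha).1).1
    (eq_zero_of_mem_of_neg_mem hB₀.linearIndependent (mem_posEven.mp ha).2 (mem_posEven.mp h).2)

/-- A simple reflection permutes the other positive roots. -/
theorem IsBase.refl_mem_posEven {a b : P.Wt} (ha : a ∈ P.posEven B₀) (hb : b ∈ B₀) (hab : a ≠ b) :
    P.refl b a ∈ P.posEven B₀ := by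
  classical
  have hbr := hB₀.subset hb
  obtain ⟨har, hac⟩ := mem_posEven.mp ha
  refine (hB₀.pos_or_neg' (P.refl_mem_evenRoots hbr har)).resolve_right fun hneg => hab ?_
  obtain ⟨n, hn⟩ := exists_eq_sum hac
  -- The reflection in b changes only the coefficient of b. If the reflected root were negative, all
  -- other coefficients would be both nonnegative and nonpositive, leaving a proportional to b.
  have hzero : ∀ c ∈ B₀, c ≠ b → n c = 0 := by
    intro c hc hcb
    obtain ⟨φ, hφ⟩ := exists_functional hB₀.linearIndependent (fun d => if d = c then 1 else 0)
    have h1 : φ a = n c := by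
      rw [hn, map_sum, Finset.sum_eq_single c]
      · rw [map_nsmul, hφ c hc]; simp
      · intro d hd hdc
        rw [map_nsmul, hφ d hd, if_neg hdc, smul_zero]
      · exact fun h => absurd hc h
    obtain ⟨m, hm⟩ := exists_nat_apply (φ := φ) (fun d hd => by
      rw [hφ d hd]; split_ifs
      · exact ⟨1, by simp⟩
      · exact ⟨0, by simp⟩) (mem_posEven.mp hneg).2
    rw [map_neg, refl_apply, map_sub, map_smul, hφ b hb, if_neg hcb.symm, smul_zero, sub_zero,
      h1] at hm
    have : ((n c + m : ℕ) : ℂ) = 0 := by push_cast; rw [← hm]; ring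
    have : n c + m = 0 := by exact_mod_cast this
    omega
  rw [Finset.sum_eq_single b (fun c hc hcb => by rw [hzero c hc hcb, zero_smul])
    (fun h => absurd hb h), ← Nat.cast_smul_eq_nsmul ℂ] at hn
  have har' := har
  rw [hn] at har'
  rcases P.eq_one_or_neg_one_of_smul_mem hbr har' with h | h
  · rw [hn, h, one_smul]
  · exfalso
    have : ((n b + 1 : ℕ) : ℂ) = 0 := by push_cast; rw [h]; ring
    exact absurd this (Nat.cast_ne_zero.mpr (Nat.succ_ne_zero _))

/-- For x = ∑ n_b b, twice the norm of x in the root form is ∑ n_b (b, b) x(h_b) ≤ 0, while the norm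
is also the sum of squares of the integers x(h_a). Hence all x(h_a) vanish. -/
theorem IsBase.eq_zero_of_apply_cor_nonpos {x : P.Wt}
    (hx : x ∈ AddSubmonoid.closure (B₀ : Set P.Wt))
    (h : ∀ b ∈ B₀, ∃ k : ℤ, k ≤ 0 ∧ x (P.cor b) = k) : x = 0 := by
  obtain ⟨n, hn⟩ := exists_eq_sum hx
  have hint : ∀ a ∈ P.evenRoots, ∃ z : ℤ, x (P.cor a) = z := by
    intro a ha
    choose! z hz using fun b (hb : b ∈ B₀) => P.exists_int_root_cor ha (hB₀.subset hb)
    refine ⟨∑ b ∈ B₀, n b * z b, ?_⟩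
    rw [hn, LinearMap.sum_apply]
    push_cast
    exact Finset.sum_congr rfl fun b hb => by
      rw [LinearMap.smul_apply, hz b hb, nsmul_eq_mul]
  choose! z hz using hint
  choose! k hk using h
  choose! N hN using fun b (hb : b ∈ B₀) => P.exists_rootForm_self_pos (hB₀.subset hb)
  have h1 : P.rootForm x x = ((∑ a ∈ P.evenRoots, z a * z a : ℤ) : ℂ) := by
    rw [rootForm]; push_cast
    exact Finset.sum_congr rfl fun a ha => by rw [hz a ha]
  have h2 : 2 * P.rootForm x x = ((∑ b ∈ B₀, n b * (N b * k b) : ℤ) : ℂ) := by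
    nth_rewrite 1 [hn]
    rw [rootForm_sum_left, Finset.mul_sum]
    push_cast
    refine Finset.sum_congr rfl fun b hb => ?_
    have := P.two_mul_rootForm (hB₀.subset hb) x
    rw [(hk b hb).2, (hN b hb).2] at this
    linear_combination (n b : ℂ) * this
  rw [h1] at h2
  have h3 : 2 * ∑ a ∈ P.evenRoots, z a * z a = ∑ b ∈ B₀, n b * (N b * k b) := by exact_mod_cast h2
  have h4 : ∑ b ∈ B₀, n b * (N b * k b) ≤ 0 := Finset.sum_nonpos fun b hb =>
    mul_nonpos_of_nonneg_of_nonpos (by positivity)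
      (mul_nonpos_of_nonneg_of_nonpos (hN b hb).1.le (hk b hb).1)
  have h5 : ∑ a ∈ P.evenRoots, z a * z a = 0 :=
    le_antisymm (by omega) (Finset.sum_nonneg fun a _ => mul_self_nonneg _)
  rw [Finset.sum_eq_zero_iff_of_nonneg (fun a _ => mul_self_nonneg _)] at h5
  refine P.eq_zero_of_forall_cor_eq_zero ?_ fun a ha => ?_
  · rw [hn]
    exact Submodule.sum_mem _ fun b hb => Submodule.smul_of_tower_mem _ _
      (Submodule.subset_span (hB₀.subset hb))
  · rw [hz a ha, mul_self_eq_zero.mp (h5 a ha)]; simp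

theorem IsBase.exists_apply_cor_pos {a : P.Wt} (ha : a ∈ P.posEven B₀) :
    ∃ b ∈ B₀, ∃ k : ℕ, 0 < k ∧ a (P.cor b) = k := by
  by_contra! hcon
  obtain ⟨har, hac⟩ := mem_posEven.mp ha
  refine (P.mem_evenRoots.mp har).1 (hB₀.eq_zero_of_apply_cor_nonpos hac fun b hb => ?_)
  obtain ⟨z, hz⟩ := P.exists_int_root_cor (hB₀.subset hb) har
  refine ⟨z, ?_, hz⟩
  by_contra! hz0
  refine hcon b hb z.toNat (by omega) ?_
  rw [hz, ← Int.cast_natCast, Int.toNat_of_nonneg hz0.le]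

/-- Induction on positive roots along simple reflections. -/
theorem IsBase.induction_reflect {p : P.Wt → Prop} (mem : ∀ b ∈ B₀, p b)
    (refl : ∀ a ∈ P.posEven B₀, ∀ b ∈ B₀, p a → p (P.refl b a)) {a : P.Wt}
    (ha : a ∈ P.posEven B₀) : p a := by
  obtain ⟨n, hn⟩ := exists_htFun_eq_nat hB₀.linearIndependent (mem_posEven.mp ha).2
  induction n using Nat.strong_induction_on generalizing a with
  | _ n ih =>
    obtain ⟨b, hb, k, hk0, hk⟩ := hB₀.exists_apply_cor_pos ha
    by_cases hab : a = b
    · exact hab ▸ mem b hb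
    have hpos := hB₀.refl_mem_posEven ha hb hab
    obtain ⟨m, hm⟩ := exists_htFun_eq_nat hB₀.linearIndependent (mem_posEven.mp hpos).2
    -- Reflecting in a simple root that pairs to k > 0 with a lowers the height by k.
    have hmn : m < n := by
      have : ((m + k : ℕ) : ℂ) = n := by
        push_cast
        rw [← hm, refl_apply, map_sub, map_smul, hn, hk, htFun_apply _ hb]
        simp
      have : m + k = n := by exact_mod_cast this
      omega
    have := refl _ hpos b hb (ih m hmn hpos hm)
    rwa [P.refl_refl (hB₀.subset hb)] at this

/-- Induction on positive roots by adding simple roots. -/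
theorem IsBase.induction_add {p : P.Wt → Prop} (mem : ∀ b ∈ B₀, p b)
    (add : ∀ a ∈ P.posEven B₀, ∀ b ∈ B₀, b + a ∈ P.evenRoots → p a → p (b + a)) {a : P.Wt}
    (ha : a ∈ P.posEven B₀) : p a := by
  classical
  obtain ⟨n, hn⟩ := exists_htFun_eq_nat hB₀.linearIndependent (mem_posEven.mp ha).2
  induction n using Nat.strong_induction_on generalizing a with
  | _ n ih =>
    obtain ⟨b, hb, k, hk0, hk⟩ := hB₀.exists_apply_cor_pos ha
    by_cases hab : a = b
    · exact hab ▸ mem b hb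
    have hsub := P.sub_mem_evenRoots (hB₀.subset hb) (mem_posEven.mp ha).1 hab hk hk0
    have hpos : a - b ∈ P.posEven B₀ := by
      refine (hB₀.pos_or_neg' hsub).resolve_right fun hneg => ?_
      have h1 := hB₀.refl_mem_posEven ha hb hab
      -- Since a - b = r_b a + (k - 1) b is a positive root plus a nonnegative multiple of b, it
      -- cannot be negative.
      have h2 : P.refl b a + (k - 1) • b ∈ AddSubmonoid.closure (B₀ : Set P.Wt) :=
        add_mem (mem_posEven.mp h1).2 (nsmul_mem (AddSubmonoid.subset_closure hb) _)
      have h3 : P.refl b a + (k - 1) • b = a - b := by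
        rw [refl_apply, hk, ← Nat.cast_smul_eq_nsmul ℂ, Nat.cast_sub (by omega)]
        push_cast
        module
      rw [h3] at h2
      exact (P.mem_evenRoots.mp hsub).1
        (eq_zero_of_mem_of_neg_mem hB₀.linearIndependent h2 (mem_posEven.mp hneg).2)
    obtain ⟨m, hm⟩ := exists_htFun_eq_nat hB₀.linearIndependent (mem_posEven.mp hpos).2
    have hmn : m < n := by
      have : ((m + 1 : ℕ) : ℂ) = n := by
        push_cast
        rw [← hm, map_sub, hn, htFun_apply _ hb]
        simp
      have : m + 1 = n := by exact_mod_cast this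
      omega
    have := add _ hpos b hb (by rw [add_sub_cancel]; exact (mem_posEven.mp ha).1) (ih m hmn hpos hm)
    rwa [add_sub_cancel] at this

/-! ### Words in simple reflections -/

/-- Every positive root is reached from a simple one by simple reflections, and reflections
conjugate accordingly: the reflection in r_b a is r_b r_a r_b. -/
theorem IsBase.sR_eq_wordProd (a : P.evenRoots) :
    ∃ L : List P.evenRoots, (∀ b ∈ L, (b : P.Wt) ∈ B₀) ∧ P.sR a = wordProd L := by
  have hpos : ∀ a ∈ P.posEven B₀, ∀ ha : a ∈ P.evenRoots, ∃ L : List P.evenRoots,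
      (∀ b ∈ L, (b : P.Wt) ∈ B₀) ∧ P.sR ⟨a, ha⟩ = wordProd L := by
    intro a ha
    refine hB₀.induction_reflect (p := fun a => ∀ ha : a ∈ P.evenRoots, ∃ L : List P.evenRoots,
      (∀ b ∈ L, (b : P.Wt) ∈ B₀) ∧ P.sR ⟨a, ha⟩ = wordProd L) ?_ ?_ ha
    · intro b hb hb'
      exact ⟨[⟨b, hb'⟩], by simpa using hb, by simp [wordProd]⟩
    · intro a ha b hb ih hab
      obtain ⟨L, hL, h⟩ := ih (mem_posEven.mp ha).1
      refine ⟨⟨b, hB₀.subset hb⟩ :: L ++ [⟨b, hB₀.subset hb⟩], ?_, ?_⟩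
      · simp only [List.cons_append, List.mem_cons, List.mem_append, List.not_mem_nil, or_false]
        rintro c (rfl | hc | rfl)
        · exact hb
        · exact hL c hc
        · exact hb
      · have h1 := P.weyl_conj_sR (P.sR ⟨b, hB₀.subset hb⟩) ⟨a, (mem_posEven.mp ha).1⟩
        rw [inv_eq_of_mul_eq_one_right (P.sR_mul_self _)] at h1
        simp only [sR_apply] at h1
        rw [← h1, h]
        simp [wordProd, mul_assoc]
  rcases hB₀.pos_or_neg' a.2 with h | h
  · exact hpos a h a.2
  · obtain ⟨L, hL, h'⟩ := hpos _ h (P.neg_mem_evenRoots a.2)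
    refine ⟨L, hL, h' ▸ ?_⟩
    refine Subtype.ext (LinearEquiv.ext fun l => ?_)
    rw [sR_apply, sR_apply, refl_apply, refl_apply, cor_neg, map_neg, neg_smul_neg]

theorem IsBase.eq_wordProd (w : P.weyl) :
    ∃ L : List P.evenRoots, (∀ b ∈ L, (b : P.Wt) ∈ B₀) ∧ w = wordProd L := by
  induction w using P.weyl_induction with
  | one => exact ⟨[], by simp, by simp [wordProd]⟩
  | mul a w ih =>
    obtain ⟨L, hL, rfl⟩ := ih
    obtain ⟨L', hL', h⟩ := hB₀.sR_eq_wordProd a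
    refine ⟨L' ++ L, ?_, ?_⟩
    · intro b hb
      exact (List.mem_append.mp hb).elim (hL' b) (hL b)
    · rw [h]; simp [wordProd]

/-- Induction on the Weyl group along simple reflections. -/
theorem IsBase.weyl_induction {p : P.weyl → Prop} (one : p 1)
    (mul : ∀ b (hb : b ∈ B₀) w, p w → p (P.sR ⟨b, hB₀.subset hb⟩ * w)) (w : P.weyl) : p w := by
  obtain ⟨L, hL, rfl⟩ := hB₀.eq_wordProd w
  induction L with
  | nil => simpa [wordProd] using one
  | cons b L ih =>
    have := mul b (hL b (by simp)) _ (ih fun c hc => hL c (by simp [hc]))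
    simpa [wordProd] using this

/-- Apply the letters of the word to t from the right. At the first letter s that turns a positive
root negative, that root must be s itself. So the part v of the word behind s satisfies v r_t v⁻¹ =
r_s, and multiplying by r_t on the right deletes s. -/
theorem IsBase.exchange (L : List P.evenRoots) (hL : ∀ b ∈ L, (b : P.Wt) ∈ B₀)
    {t : P.evenRoots} (ht : (t : P.Wt) ∈ B₀)
    (hneg : -((wordProd L : P.weyl) : P.Wt ≃ₗ[ℂ] P.Wt) t ∈ P.posEven B₀) :
    ∃ L' : List P.evenRoots, (∀ b ∈ L', (b : P.Wt) ∈ B₀) ∧ L'.length < L.length ∧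
      wordProd L * P.sR t = wordProd L' := by
  induction L with
  | nil =>
    exfalso
    exact hB₀.neg_notMem (hB₀.mem_posEven_of_mem ht) (by simpa [wordProd] using hneg)
  | cons s L ih =>
    have hs := hL s (by simp)
    have hcons : (wordProd (s :: L) : P.weyl) = P.sR s * wordProd L := by simp [wordProd]
    have hroot := P.weyl_mem_evenRoots (wordProd L) t.2
    rcases hB₀.pos_or_neg' hroot with h | h
    · have hst : ((wordProd L : P.weyl) : P.Wt ≃ₗ[ℂ] P.Wt) t = s := by
        by_contra hne
        refine hB₀.neg_notMem (hB₀.refl_mem_posEven h hs hne) ?_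
        rwa [hcons, weyl_mul_apply, sR_apply] at hneg
      have h1 := P.weyl_conj_sR (wordProd L) t
      have h2 : (⟨_, P.weyl_mem_evenRoots (wordProd L) t.2⟩ : P.evenRoots) = s := Subtype.ext hst
      rw [h2] at h1
      refine ⟨L, fun b hb => hL b (by simp [hb]), by simp, ?_⟩
      rw [hcons, ← h1]
      rw [inv_mul_cancel_right, mul_assoc, sR_mul_self, mul_one]
    · obtain ⟨L', hL', hlen, heq⟩ := ih (fun b hb => hL b (by simp [hb])) h
      refine ⟨s :: L', ?_, by simpa using hlen, ?_⟩
      · intro b hb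
        rcases List.mem_cons.mp hb with rfl | hb
        · exact hs
        · exact hL' b hb
      · rw [hcons, mul_assoc, heq]; simp [wordProd]

/-- Write w = w₁ r_t. If w₁ t is positive then w t is negative; otherwise the exchange property
gives a shorter word for w. -/
theorem IsBase.exists_simple_neg {w : P.weyl} (hw : w ≠ 1) :
    ∃ b ∈ B₀, -(w : P.Wt ≃ₗ[ℂ] P.Wt) b ∈ P.posEven B₀ := by
  obtain ⟨L, hL, rfl⟩ := hB₀.eq_wordProd w
  generalize hn : L.length = n
  induction n using Nat.strong_induction_on generalizing L with
  | _ n ih =>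
    rcases List.eq_nil_or_concat L with rfl | ⟨L₁, t, rfl⟩
    · exact absurd (by simp [wordProd]) hw
    have ht : (t : P.Wt) ∈ B₀ := hL t (by simp)
    have hcons : (wordProd (L₁.concat t) : P.weyl) = wordProd L₁ * P.sR t := by simp [wordProd]
    rcases hB₀.pos_or_neg' (P.weyl_mem_evenRoots (wordProd L₁) t.2) with h | h
    · refine ⟨t, ht, ?_⟩
      rw [hcons, weyl_mul_apply, sR_apply, refl_apply, P.root_apply_cor t.2]
      rw [show (t : P.Wt) - (2 : ℂ) • (t : P.Wt) = -t by module, map_neg, neg_neg]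
      exact h
    · obtain ⟨L', hL', hlen, heq⟩ := hB₀.exchange L₁ (fun b hb => hL b (by simp [hb])) ht h
      rw [hcons, heq] at hw ⊢
      refine ih L'.length ?_ L' hL' hw rfl
      rw [← hn]; simp; omega

end EvenBase

/-! ### Integral and regular dominant weights -/

section Dominant

variable {P} {B₀ : Finset P.Wt} (hB₀ : P.IsBase P.evenRoots B₀)

include hB₀

theorem IsBase.exists_int_htFun {x : P.Wt}
    (hx : x ∈ AddSubgroup.closure (P.evenRoots : Set P.Wt)) :
    ∃ z : ℤ, htFun hB₀.linearIndependent x = z := by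
  induction hx using AddSubgroup.closure_induction with
  | mem x hx =>
    rcases hB₀.pos_or_neg x hx with h | h
    · obtain ⟨n, hn⟩ := exists_htFun_eq_nat hB₀.linearIndependent h
      exact ⟨n, by rw [hn]; simp⟩
    · obtain ⟨n, hn⟩ := exists_htFun_eq_nat hB₀.linearIndependent h
      refine ⟨-n, ?_⟩
      rw [map_neg] at hn
      push_cast
      rw [← hn, neg_neg]
  | zero => exact ⟨0, by simp⟩
  | add x y _ _ hx hy =>
    obtain ⟨z, hz⟩ := hx
    obtain ⟨z', hz'⟩ := hy
    exact ⟨z + z', by rw [map_add, hz, hz']; push_cast; rfl⟩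
  | neg x _ hx =>
    obtain ⟨z, hz⟩ := hx
    exact ⟨-z, by rw [map_neg, hz]; push_cast; rfl⟩

/-- In one direction l - r_b l = l(h_b) b has integral height. In the other, induction along simple
reflections changes the weight by integral multiples of roots at each step. -/
theorem IsBase.mem_integralWeights_iff {l : P.Wt} :
    l ∈ P.integralWeights ↔ ∀ b ∈ B₀, ∃ z : ℤ, l (P.cor b) = z := by
  constructor
  · intro h b hb
    have h1 := h (P.sR ⟨b, hB₀.subset hb⟩)
    rw [sR_apply, refl_apply, sub_sub_cancel] at h1
    obtain ⟨z, hz⟩ := hB₀.exists_int_htFun h1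
    rw [map_smul, htFun_apply _ hb, smul_eq_mul, mul_one] at hz
    exact ⟨z, hz⟩
  · intro h w
    have key : l - (w : P.Wt ≃ₗ[ℂ] P.Wt) l ∈ AddSubgroup.closure (P.evenRoots : Set P.Wt) ∧
        ∀ b ∈ B₀, ∃ z : ℤ, (w : P.Wt ≃ₗ[ℂ] P.Wt) l (P.cor b) = z := by
      induction w using hB₀.weyl_induction with
      | one => exact ⟨by simp, h⟩
      | mul b hb w ih =>
        rw [weyl_mul_apply, sR_apply, refl_apply]
        obtain ⟨z, hz⟩ := ih.2 b hb
        constructor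
        · rw [hz, sub_sub_eq_add_sub, add_sub_right_comm, Int.cast_smul_eq_zsmul]
          exact add_mem ih.1 (zsmul_mem (AddSubgroup.subset_closure (hB₀.subset hb)) z)
        · intro c hc
          obtain ⟨y, hy⟩ := ih.2 c hc
          obtain ⟨x, hx⟩ := P.exists_int_root_cor (hB₀.subset hc) (hB₀.subset hb)
          refine ⟨y - z * x, ?_⟩
          rw [LinearMap.sub_apply, LinearMap.smul_apply, hz, hy, hx]
          push_cast
          rfl
    exact key.1

theorem IsBase.add_mem_integralWeights {l m : P.Wt} (hl : l ∈ P.integralWeights)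
    (hm : m ∈ P.integralWeights) : l + m ∈ P.integralWeights := by
  rw [hB₀.mem_integralWeights_iff] at *
  intro b hb
  obtain ⟨z, hz⟩ := hl b hb
  obtain ⟨y, hy⟩ := hm b hb
  exact ⟨z + y, by rw [LinearMap.add_apply, hz, hy]; push_cast; rfl⟩

theorem IsBase.neg_mem_integralWeights {l : P.Wt} (hl : l ∈ P.integralWeights) :
    -l ∈ P.integralWeights := by
  rw [hB₀.mem_integralWeights_iff] at *
  intro b hb
  obtain ⟨z, hz⟩ := hl b hb
  exact ⟨-z, by rw [LinearMap.neg_apply, hz]; push_cast; rfl⟩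

theorem IsBase.sub_mem_integralWeights {l m : P.Wt} (hl : l ∈ P.integralWeights)
    (hm : m ∈ P.integralWeights) : l - m ∈ P.integralWeights := by
  rw [sub_eq_add_neg]
  exact hB₀.add_mem_integralWeights hl (hB₀.neg_mem_integralWeights hm)

theorem IsBase.sum_mem_integralWeights {s : Finset P.Wt} (h : ∀ a ∈ s, a ∈ P.integralWeights) :
    ∑ a ∈ s, a ∈ P.integralWeights := by
  refine Finset.sum_induction _ (· ∈ P.integralWeights)
    (fun _ _ => hB₀.add_mem_integralWeights) ?_ h
  exact hB₀.mem_integralWeights_iff.mpr fun b _ => ⟨0, by simp⟩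

theorem IsBase.mem_integralWeights_of_wtSpace {V : Type w} [AddCommGroup V] [Module ℂ V]
    [LieRingModule g₀ V] [LieModule ℂ g₀ V] [FiniteDimensional ℂ V] {m : P.Wt}
    (hm : wtSpace P.H V m ≠ ⊥) : m ∈ P.integralWeights :=
  hB₀.mem_integralWeights_iff.mpr fun _ hb => P.exists_int_apply_cor (hB₀.subset hb) hm

theorem IsBase.evenRoot_mem_integralWeights {a : P.Wt} (ha : a ∈ P.evenRoots) :
    a ∈ P.integralWeights :=
  hB₀.mem_integralWeights_of_wtSpace (P.mem_evenRoots.mp ha).2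

theorem IsBase.oddRoot_mem_integralWeights {a : P.Wt} (ha : a ∈ P.oddRoots) :
    a ∈ P.integralWeights :=
  hB₀.mem_integralWeights_of_wtSpace (P.mem_oddRoots.mp ha)

theorem IsBase.closure_mem_integralWeights {x : P.Wt}
    (hx : x ∈ AddSubmonoid.closure (B₀ : Set P.Wt)) : x ∈ P.integralWeights := by
  induction hx using AddSubmonoid.closure_induction with
  | mem x hx => exact hB₀.evenRoot_mem_integralWeights (hB₀.subset hx)
  | zero => exact hB₀.mem_integralWeights_iff.mpr fun b _ => ⟨0, by simp⟩
  | add x y _ _ hx hy => exact hB₀.add_mem_integralWeights hx hy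

omit hB₀ in
theorem weyl_mem_integralWeights {l : P.Wt} (hl : l ∈ P.integralWeights) (w : P.weyl) :
    (w : P.Wt ≃ₗ[ℂ] P.Wt) l ∈ P.integralWeights := by
  intro w'
  have h1 := hl w
  have h2 := hl (w' * w)
  have := sub_mem h2 h1
  rw [sub_sub_sub_cancel_left] at this
  exact this

/-- The number of positive roots sent to negative ones. -/
theorem IsBase.card_inversions_lt [DecidableEq P.Wt] {w : P.weyl} {b : P.Wt} (hb : b ∈ B₀)
    (hneg : -(w : P.Wt ≃ₗ[ℂ] P.Wt) b ∈ P.posEven B₀) :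
    ((P.posEven B₀).filter fun a =>
      -((w * P.sR ⟨b, hB₀.subset hb⟩ : P.weyl) : P.Wt ≃ₗ[ℂ] P.Wt) a ∈ P.posEven B₀).card <
    ((P.posEven B₀).filter fun a => -(w : P.Wt ≃ₗ[ℂ] P.Wt) a ∈ P.posEven B₀).card := by
  have hbp := hB₀.mem_posEven_of_mem hb
  have hbr := hB₀.subset hb
  have hbb : P.refl b b = -b := by rw [refl_apply, P.root_apply_cor hbr]; module
  have hsub : ((P.posEven B₀).filter fun a =>
      -((w * P.sR ⟨b, hB₀.subset hb⟩ : P.weyl) : P.Wt ≃ₗ[ℂ] P.Wt) a ∈ P.posEven B₀).image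
        (P.refl b) ⊆
      ((P.posEven B₀).filter fun a => -(w : P.Wt ≃ₗ[ℂ] P.Wt) a ∈ P.posEven B₀).erase b := by
    intro c hc
    obtain ⟨a, ha, rfl⟩ := Finset.mem_image.mp hc
    obtain ⟨ha, ha'⟩ := Finset.mem_filter.mp ha
    rw [weyl_mul_apply, sR_apply] at ha'
    have hab : a ≠ b := by
      rintro rfl
      rw [hbb, map_neg] at ha'
      exact hB₀.neg_notMem hneg ha'
    rw [Finset.mem_erase, Finset.mem_filter]
    refine ⟨fun h => ?_, hB₀.refl_mem_posEven ha hb hab, ha'⟩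
    have : a = -b := by rw [← P.refl_refl hbr a, h, hbb]
    exact hB₀.neg_notMem hbp (this ▸ ha)
  have hinj : Function.Injective (P.refl b) := fun x y h => by
    rw [← P.refl_refl hbr x, h, P.refl_refl hbr]
  rw [← Finset.card_image_of_injective _ hinj]
  refine (Finset.card_le_card hsub).trans_lt (Finset.card_erase_lt_of_mem ?_)
  exact Finset.mem_filter.mpr ⟨hbp, hneg⟩

/-- Induction on the number of inversions of w, through l - wl = (l - w r_b l) + l(h_b)(-wb) for a
simple b with wb negative. The last term is strictly positive when l(h_b) ≠ 0, which gives
regularity. -/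
theorem IsBase.sub_weyl_mem {l : P.Wt} (hl : ∀ b ∈ B₀, ∃ k : ℕ, l (P.cor b) = k) (w : P.weyl) :
    l - (w : P.Wt ≃ₗ[ℂ] P.Wt) l ∈ AddSubmonoid.closure (B₀ : Set P.Wt) ∧
    ((∀ b ∈ B₀, l (P.cor b) ≠ 0) → w ≠ 1 → (w : P.Wt ≃ₗ[ℂ] P.Wt) l ≠ l) := by
  classical
  generalize hn : ((P.posEven B₀).filter fun a =>
    -(w : P.Wt ≃ₗ[ℂ] P.Wt) a ∈ P.posEven B₀).card = n
  induction n using Nat.strong_induction_on generalizing w with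
  | _ n ih =>
    by_cases hw : w = 1
    · subst hw
      exact ⟨by simp, fun _ h => absurd rfl h⟩
    obtain ⟨b, hb, hneg⟩ := hB₀.exists_simple_neg hw
    obtain ⟨k, hk⟩ := hl b hb
    obtain ⟨h1, -⟩ := ih _ (hn ▸ hB₀.card_inversions_lt hb hneg) (w * P.sR ⟨b, hB₀.subset hb⟩) rfl
    have e : l - (w : P.Wt ≃ₗ[ℂ] P.Wt) l =
        (l - ((w * P.sR ⟨b, hB₀.subset hb⟩ : P.weyl) : P.Wt ≃ₗ[ℂ] P.Wt) l) +
          k • (-(w : P.Wt ≃ₗ[ℂ] P.Wt) b) := by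
      rw [weyl_mul_apply, sR_apply, refl_apply, hk, map_sub, map_smul,
        ← Nat.cast_smul_eq_nsmul ℂ k]
      module
    refine ⟨?_, fun hne _ heq => ?_⟩
    · rw [e]
      exact add_mem h1 (nsmul_mem (mem_posEven.mp hneg).2 _)
    · rw [heq, sub_self] at e
      obtain ⟨p, hp⟩ := exists_htFun_eq_nat hB₀.linearIndependent h1
      obtain ⟨q, hq⟩ := exists_htFun_eq_nat hB₀.linearIndependent (mem_posEven.mp hneg).2
      have h2 := congrArg (htFun hB₀.linearIndependent) e
      rw [map_zero, map_add, hp, map_nsmul, hq] at h2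
      have h3 : p + k * q = 0 := by
        have : ((p + k * q : ℕ) : ℂ) = 0 := by rw [h2]; push_cast; rw [nsmul_eq_mul]
        exact_mod_cast this
      have hk0 : k ≠ 0 := by
        rintro rfl
        exact hne b hb (by rw [hk]; simp)
      have hq0 : q ≠ 0 := by
        rintro rfl
        exact (P.mem_evenRoots.mp (mem_posEven.mp hneg).1).1
          (eq_zero_of_htFun_eq_zero hB₀.linearIndependent (mem_posEven.mp hneg).2
            (by rw [hq]; simp))
      have : k * q ≠ 0 := mul_ne_zero hk0 hq0
      omega

/-- Reduces the conditions over all of W to simple coroots: on the left only simple reflections are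
tested, and `IsBase.sub_weyl_mem` recovers the rest. -/
theorem IsBase.mem_regularDominant_iff {l : P.Wt} :
    l ∈ P.regularDominant B₀ ↔ ∀ b ∈ B₀, ∃ k : ℕ, 0 < k ∧ l (P.cor b) = k := by
  constructor
  · rintro ⟨hl, h⟩ b hb
    obtain ⟨h1, h2⟩ := h (P.sR ⟨b, hB₀.subset hb⟩)
    rw [hB₀.closure_posEven, sR_apply, refl_apply, sub_sub_cancel] at h1
    obtain ⟨k, hk⟩ := exists_htFun_eq_nat hB₀.linearIndependent h1
    rw [map_smul, htFun_apply _ hb, smul_eq_mul, mul_one] at hk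
    refine ⟨k, Nat.pos_of_ne_zero ?_, hk⟩
    rintro rfl
    refine h2 (fun h => ?_) ?_
    · have := P.sgn_sR ⟨b, hB₀.subset hb⟩
      rw [h, sgn_one] at this
      norm_num at this
    · rw [sR_apply, refl_apply, hk]; simp
  · intro h
    refine ⟨hB₀.mem_integralWeights_iff.mpr fun b hb => ?_, fun w => ?_⟩
    · obtain ⟨k, -, hk⟩ := h b hb
      exact ⟨k, by rw [hk]; simp⟩
    · obtain ⟨h1, h2⟩ := hB₀.sub_weyl_mem (l := l)
        (fun b hb => (h b hb).imp fun k hk => hk.2) w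
      rw [hB₀.closure_posEven]
      refine ⟨h1, h2 fun b hb => ?_⟩
      obtain ⟨k, hk0, hk⟩ := h b hb
      rw [hk]
      exact_mod_cast hk0.ne'

/-- Choose w minimizing the height of l - wl. A negative pairing of wl with a simple coroot would
let that reflection lower the height further. -/
theorem IsBase.exists_dominant {l : P.Wt} (hl : l ∈ P.integralWeights) :
    ∃ w : P.weyl, ∀ b ∈ B₀, ∃ k : ℕ, (w : P.Wt ≃ₗ[ℂ] P.Wt) l (P.cor b) = k := by
  choose z hz using fun w : P.weyl => hB₀.exists_int_htFun (hl w)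
  obtain ⟨w, hw⟩ := Finite.exists_min z
  refine ⟨w, fun b hb => ?_⟩
  obtain ⟨k, hk⟩ := hB₀.mem_integralWeights_iff.mp (weyl_mem_integralWeights hl w) b hb
  have h1 := hz (P.sR ⟨b, hB₀.subset hb⟩ * w)
  rw [weyl_mul_apply, sR_apply, refl_apply, sub_sub_eq_add_sub, add_sub_right_comm, map_add, hz w,
    map_smul, htFun_apply _ hb, hk, smul_eq_mul, mul_one] at h1
  have h2 : z w + k = z (P.sR ⟨b, hB₀.subset hb⟩ * w) := by exact_mod_cast h1
  have h3 := hw (P.sR ⟨b, hB₀.subset hb⟩ * w)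
  refine ⟨k.toNat, ?_⟩
  rw [hk, ← Int.cast_natCast, Int.toNat_of_nonneg (by omega)]

theorem IsBase.eq_of_regularDominant {l m : P.Wt} (hl : l ∈ P.regularDominant B₀)
    (hm : m ∈ P.regularDominant B₀) {w : P.weyl} (h : (w : P.Wt ≃ₗ[ℂ] P.Wt) l = m) : w = 1 := by
  have hlm : l = m := by
    have h1 := (hl.2 w).1
    have h2 := (hm.2 w⁻¹).1
    rw [← h, weyl_inv_apply_apply, hB₀.closure_posEven] at h2
    rw [hB₀.closure_posEven] at h1
    rw [← h]
    exact sub_eq_zero.mp (eq_zero_of_mem_of_neg_mem hB₀.linearIndependent h1 (by rwa [neg_sub]))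
  by_contra hw
  exact (hl.2 w).2 hw (h.trans hlm.symm)

/-! ### Weyl vectors -/

variable {r₀ : P.Wt} (hr₀ : P.IsWeylVector B₀ r₀)

include hr₀

theorem IsWeylVector.apply_cor {b : P.Wt} (hb : b ∈ B₀) : r₀ (P.cor b) = 1 := by
  have h := hr₀ b hb
  rw [refl_apply, sub_right_inj] at h
  have h0 := (P.mem_evenRoots.mp (hB₀.subset hb)).1
  have : (r₀ (P.cor b) - 1) • b = 0 := by rw [sub_smul, h, one_smul, sub_self]
  exact sub_eq_zero.mp ((smul_eq_zero.mp this).resolve_right h0)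

theorem IsWeylVector.mem_regularDominant : r₀ ∈ P.regularDominant B₀ :=
  hB₀.mem_regularDominant_iff.mpr fun b hb => ⟨1, one_pos, by rw [hr₀.apply_cor hB₀ hb]; simp⟩

theorem IsWeylVector.mem_integralWeights : r₀ ∈ P.integralWeights :=
  (hr₀.mem_regularDominant hB₀).1

/-- In the root form, twice the pairing with a = ∑ n_b b is ∑ n_b (b, b) > 0, and on a root the two
forms vanish together. This justifies the denominators of the dimension formula. -/
theorem IsWeylVector.dualForm_ne_zero {a : P.Wt} (ha : a ∈ P.posEven B₀) :
    P.dualForm r₀ a ≠ 0 := by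
  obtain ⟨har, hac⟩ := mem_posEven.mp ha
  obtain ⟨n, hn⟩ := exists_eq_sum hac
  choose! N hN using fun b (hb : b ∈ B₀) => P.exists_rootForm_self_pos (hB₀.subset hb)
  have h1 : 2 * P.rootForm a r₀ = ((∑ b ∈ B₀, n b * N b : ℤ) : ℂ) := by
    nth_rewrite 1 [hn]
    rw [rootForm_sum_left, Finset.mul_sum]
    push_cast
    refine Finset.sum_congr rfl fun b hb => ?_
    have := P.two_mul_rootForm (hB₀.subset hb) r₀
    rw [hr₀.apply_cor hB₀ hb, (hN b hb).2] at this
    linear_combination (n b : ℂ) * this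
  rw [P.two_mul_rootForm har, P.apply_cor] at h1
  intro h0
  rw [h0, mul_zero, zero_div, mul_zero] at h1
  have h2 : ∑ b ∈ B₀, n b * N b = 0 := by exact_mod_cast h1.symm
  rw [Finset.sum_eq_zero_iff_of_nonneg
    (fun b hb => mul_nonneg (by positivity) (hN b hb).1.le)] at h2
  refine (P.mem_evenRoots.mp har).1 ?_
  rw [hn]
  refine Finset.sum_eq_zero fun b hb => ?_
  have h3 := (mul_eq_zero.mp (h2 b hb)).resolve_right (hN b hb).1.ne'
  rw [show n b = 0 by exact_mod_cast h3, zero_smul]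

end Dominant

/-! ### The group ring of the weights -/

section GroupRing

open AddMonoidAlgebra

/-- The action of a linear automorphism of the space of weights on the group ring. -/
noncomputable def act (w : P.Wt ≃ₗ[ℂ] P.Wt) :
    AddMonoidAlgebra ℤ P.Wt ≃ₐ[ℤ] AddMonoidAlgebra ℤ P.Wt :=
  AddMonoidAlgebra.domCongr ℤ ℤ w.toAddEquiv

variable {P}

theorem act_single (w : P.Wt ≃ₗ[ℂ] P.Wt) (m : P.Wt) (c : ℤ) :
    P.act w (single m c) = single (w m) c := by
  rw [act, AddMonoidAlgebra.domCongr_single]; rfl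

theorem coeff_act_apply (w : P.Wt ≃ₗ[ℂ] P.Wt) (f : AddMonoidAlgebra ℤ P.Wt) (m : P.Wt) :
    (P.act w f).coeff (w m) = f.coeff m := by
  rw [act, AddMonoidAlgebra.coeff_domCongr]
  congr 1
  exact w.symm_apply_apply m

theorem act_mul_weyl (w w' : P.weyl) (f : AddMonoidAlgebra ℤ P.Wt) :
    P.act ((w * w' : P.weyl) : P.Wt ≃ₗ[ℂ] P.Wt) f = P.act w (P.act w' f) := by
  induction f using AddMonoidAlgebra.induction_linear with
  | zero => simp
  | add f g hf hg => simp only [map_add, hf, hg]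
  | single m c => simp only [act_single, weyl_mul_apply]

theorem act_one (f : AddMonoidAlgebra ℤ P.Wt) : P.act ((1 : P.weyl) : P.Wt ≃ₗ[ℂ] P.Wt) f = f := by
  induction f using AddMonoidAlgebra.induction_linear with
  | zero => simp
  | add f g hf hg => simp only [map_add, hf, hg]
  | single m c => rw [act_single]; rfl

/-- Anti-invariance under the Weyl group. -/
def IsAnti (f : AddMonoidAlgebra ℤ P.Wt) : Prop :=
  ∀ w : P.weyl, P.act w f = P.sgn w • f

theorem IsAnti.coeff {f : AddMonoidAlgebra ℤ P.Wt} (hf : IsAnti f) (w : P.weyl) (m : P.Wt) :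
    f.coeff ((w : P.Wt ≃ₗ[ℂ] P.Wt) m) = P.sgn w * f.coeff m := by
  have h := coeff_act_apply (w : P.Wt ≃ₗ[ℂ] P.Wt) f m
  rw [hf w, AddMonoidAlgebra.coeff_smul_apply, smul_eq_mul] at h
  rw [← h, ← mul_assoc, sgn_mul_self, one_mul]

theorem IsAnti.sub {f g : AddMonoidAlgebra ℤ P.Wt} (hf : IsAnti f) (hg : IsAnti g) :
    IsAnti (f - g) := fun w => by rw [map_sub, hf w, hg w, smul_sub]

theorem IsAnti.mul_invariant {f g : AddMonoidAlgebra ℤ P.Wt} (hf : IsAnti f)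
    (hg : ∀ w : P.weyl, P.act w g = g) : IsAnti (f * g) := fun w => by
  rw [map_mul, hf w, hg w, smul_mul_assoc]

noncomputable instance : Fintype P.weyl := Fintype.ofFinite _

variable (P) in
/-- The alternating sum `∑_w sgn(w) e^{wν}`. -/
noncomputable def altSum (m : P.Wt) : AddMonoidAlgebra ℤ P.Wt :=
  ∑ w : P.weyl, P.sgn w • single ((w : P.Wt ≃ₗ[ℂ] P.Wt) m) 1

theorem sum_sgn_smul_mul (φ : P.weyl → AddMonoidAlgebra ℤ P.Wt) (w : P.weyl) :
    ∑ w', P.sgn w' • φ (w * w') = P.sgn w • ∑ w', P.sgn w' • φ w' := by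
  rw [Finset.smul_sum, ← Equiv.sum_comp (Equiv.mulLeft w) (fun w' => P.sgn w • P.sgn w' • φ w')]
  refine Finset.sum_congr rfl fun w' _ => ?_
  rw [Equiv.coe_mulLeft, sgn_mul, smul_smul, ← mul_assoc, sgn_mul_self, one_mul]

theorem isAnti_altSum (m : P.Wt) : IsAnti (P.altSum m) := by
  intro w
  rw [altSum, ← sum_sgn_smul_mul, map_sum]
  refine Finset.sum_congr rfl fun w' _ => ?_
  rw [map_zsmul, act_single, weyl_mul_apply]

open scoped Classical in
theorem coeff_altSum (m n : P.Wt) : (P.altSum m).coeff n =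
    ∑ w : P.weyl, if (w : P.Wt ≃ₗ[ℂ] P.Wt) m = n then P.sgn w else 0 := by
  rw [altSum, AddMonoidAlgebra.coeff_sum, Finsupp.finsetSum_apply]
  refine Finset.sum_congr rfl fun w _ => ?_
  rw [AddMonoidAlgebra.coeff_smul_apply, coeff_single, Finsupp.single_apply]
  simp

theorem mem_integralWeights_of_coeff_altSum {m n : P.Wt} (hm : m ∈ P.integralWeights)
    (h : (P.altSum m).coeff n ≠ 0) : n ∈ P.integralWeights := by
  classical
  rw [coeff_altSum] at h
  obtain ⟨w, -, hw⟩ := Finset.exists_ne_zero_of_sum_ne_zero h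
  split_ifs at hw with h1
  · exact h1 ▸ weyl_mem_integralWeights hm w
  · exact absurd rfl hw

/-- `f` has leading term `c e^r`, all other terms lying in `r - C`. -/
def HasTop (C : AddSubmonoid P.Wt) (r : P.Wt) (c : ℤ) (f : AddMonoidAlgebra ℤ P.Wt) : Prop :=
  f.coeff r = c ∧ ∀ m, f.coeff m ≠ 0 → r - m ∈ C

theorem hasTop_single (C : AddSubmonoid P.Wt) (r : P.Wt) (c : ℤ) : HasTop C r c (single r c) := by
  classical
  refine ⟨by simp, fun m hm => ?_⟩
  rw [coeff_single, Finsupp.single_apply] at hm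
  split_ifs at hm with h
  · rw [h, sub_self]; exact C.zero_mem
  · exact absurd rfl hm

theorem hasTop_one_sub {C : AddSubmonoid P.Wt} {a : P.Wt} (ha : a ∈ C) (ha0 : a ≠ 0) :
    HasTop C 0 1 (1 - single (-a) 1) := by
  classical
  have h (m : P.Wt) : (1 - single (-a) 1 : AddMonoidAlgebra ℤ P.Wt).coeff m =
      (if 0 = m then 1 else 0) - (if -a = m then 1 else 0) := by
    rw [AddMonoidAlgebra.one_def, AddMonoidAlgebra.coeff_sub, Finsupp.sub_apply, coeff_single,
      coeff_single, Finsupp.single_apply, Finsupp.single_apply]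
  refine ⟨by rw [h]; simp [ha0], fun m hm => ?_⟩
  rw [h] at hm
  by_cases h1 : 0 = m
  · rw [← h1, sub_zero]; exact C.zero_mem
  · by_cases h2 : -a = m
    · rw [← h2, zero_sub, neg_neg]; exact ha
    · simp [h1, h2] at hm

/-- If r + s = a + b with r - a and s - b in the pointed cone C, both differences vanish. So only
the product of the two leading terms reaches e^{r+s}. -/
theorem HasTop.mul {C : AddSubmonoid P.Wt} (hC : ∀ x ∈ C, -x ∈ C → x = 0) {r s : P.Wt} {c d : ℤ}
    {f g : AddMonoidAlgebra ℤ P.Wt} (hf : HasTop C r c f) (hg : HasTop C s d g) :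
    HasTop C (r + s) (c * d) (f * g) := by
  classical
  constructor
  · rw [AddMonoidAlgebra.coeff_mul, Finsupp.sum, Finset.sum_eq_single r]
    · rw [Finsupp.sum, Finset.sum_eq_single s]
      · simp [hf.1, hg.1]
      · intro b _ hb
        rw [if_neg]
        rwa [add_right_inj]
      · intro h
        rw [Finsupp.notMem_support_iff] at h
        simp [h]
    · intro a ha hne
      refine Finset.sum_eq_zero fun b hb => ?_
      dsimp only
      rw [if_neg]
      intro h
      have h1 := hf.2 a (Finsupp.mem_support_iff.mp ha)
      have h2 := hg.2 b (Finsupp.mem_support_iff.mp hb)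
      have h3 : s - b = -(r - a) := by
        rw [eq_neg_iff_add_eq_zero, sub_add_sub_comm, sub_eq_zero, add_comm s, add_comm b, h]
      rw [h3] at h2
      exact hne (sub_eq_zero.mp (hC _ h1 h2)).symm
    · intro h
      rw [Finsupp.notMem_support_iff] at h
      rw [h]
      simp [Finsupp.sum]
  · intro m hm
    rw [AddMonoidAlgebra.coeff_mul, Finsupp.sum] at hm
    obtain ⟨a, ha, ha'⟩ := Finset.exists_ne_zero_of_sum_ne_zero hm
    obtain ⟨b, hb, hb'⟩ := Finset.exists_ne_zero_of_sum_ne_zero ha'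
    dsimp only at hb'
    split_ifs at hb' with h
    · rw [← h, add_sub_add_comm]
      exact C.add_mem (hf.2 a (Finsupp.mem_support_iff.mp ha))
        (hg.2 b (Finsupp.mem_support_iff.mp hb))
    · exact absurd rfl hb'

theorem hasTop_prod {ι : Type*} {C : AddSubmonoid P.Wt} (hC : ∀ x ∈ C, -x ∈ C → x = 0)
    (s : Finset ι) (f : ι → AddMonoidAlgebra ℤ P.Wt) (h : ∀ i ∈ s, HasTop C 0 1 (f i)) :
    HasTop C 0 1 (∏ i ∈ s, f i) := by
  classical
  induction s using Finset.induction_on with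
  | empty => exact hasTop_single C 0 1
  | insert a s ha ih =>
    rw [Finset.prod_insert ha]
    simpa using (h a (Finset.mem_insert_self _ _)).mul hC
      (ih fun i hi => h i (Finset.mem_insert_of_mem hi))

variable (P) in
/-- The Weyl denominator `e^{ρ₀} ∏_{a > 0} (1 - e^{-a})` of the even part. -/
noncomputable def evenDen (r : P.Wt) (B : Finset P.Wt) : AddMonoidAlgebra ℤ P.Wt :=
  single r 1 * ∏ a ∈ P.posEven B, (1 - single (-a) 1)

variable {B₀ : Finset P.Wt} (hB₀ : P.IsBase P.evenRoots B₀)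

include hB₀

/-- Any weight of the support can be moved to a dominant one, changing the coefficient only by a
sign. If the dominant weight lies on a wall, the reflection fixing it equates the coefficient with
its negative. -/
theorem IsBase.anti_eq_zero {f : AddMonoidAlgebra ℤ P.Wt} (hf : IsAnti f)
    (hint : ∀ m, f.coeff m ≠ 0 → m ∈ P.integralWeights)
    (hdom : ∀ m ∈ P.regularDominant B₀, f.coeff m = 0) : f = 0 := by
  refine AddMonoidAlgebra.ext (Finsupp.ext fun m => ?_)
  by_contra hm
  obtain ⟨w, hw⟩ := hB₀.exists_dominant (hint m hm)
  have h1 := hf.coeff w m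
  have h0 : f.coeff ((w : P.Wt ≃ₗ[ℂ] P.Wt) m) = 0 := by
    by_cases h : ∀ b ∈ B₀, ((w : P.Wt ≃ₗ[ℂ] P.Wt) m) (P.cor b) ≠ 0
    · refine hdom _ (hB₀.mem_regularDominant_iff.mpr fun b hb => ?_)
      obtain ⟨k, hk⟩ := hw b hb
      refine ⟨k, Nat.pos_of_ne_zero ?_, hk⟩
      rintro rfl
      exact h b hb (by rw [hk]; simp)
    · push Not at h
      obtain ⟨b, hb, h⟩ := h
      have h2 := hf.coeff (P.sR ⟨b, hB₀.subset hb⟩) ((w : P.Wt ≃ₗ[ℂ] P.Wt) m)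
      rw [sR_apply, refl_apply, h, zero_smul, sub_zero, sgn_sR] at h2
      linarith
  rw [h0] at h1
  rcases mul_eq_zero.mp h1.symm with h2 | h2
  · have := P.sgn_mul_self w
    rw [h2] at this
    norm_num at this
  · exact hm h2

theorem IsBase.anti_ext {f g : AddMonoidAlgebra ℤ P.Wt} (hf : IsAnti f) (hg : IsAnti g)
    (hfi : ∀ m, f.coeff m ≠ 0 → m ∈ P.integralWeights)
    (hgi : ∀ m, g.coeff m ≠ 0 → m ∈ P.integralWeights)
    (hdom : ∀ m ∈ P.regularDominant B₀, f.coeff m = g.coeff m) : f = g := by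
  refine sub_eq_zero.mp (hB₀.anti_eq_zero (hf.sub hg) (fun m hm => ?_) fun m hm => ?_)
  · by_contra hcon
    have h1 : f.coeff m = 0 := by by_contra h; exact hcon (hfi m h)
    have h2 : g.coeff m = 0 := by by_contra h; exact hcon (hgi m h)
    apply hm
    rw [AddMonoidAlgebra.coeff_sub, Finsupp.sub_apply, h1, h2, sub_zero]
  · rw [AddMonoidAlgebra.coeff_sub, Finsupp.sub_apply, hdom m hm, sub_self]

/-- Distinct regular dominant weights lie in different orbits, and their stabilizers are trivial. -/
theorem IsBase.coeff_altSum_regularDominant [DecidableEq P.Wt] {m n : P.Wt}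
    (hm : m ∈ P.regularDominant B₀)
    (hn : n ∈ P.regularDominant B₀) : (P.altSum m).coeff n = if m = n then 1 else 0 := by
  classical
  rw [coeff_altSum]
  split_ifs with h
  · rw [Finset.sum_eq_single 1]
    · rw [if_pos (by rw [← h]; rfl), sgn_one]
    · intro w _ hw
      rw [if_neg]
      intro h2
      exact hw (hB₀.eq_of_regularDominant hm hn h2)
    · simp
  · refine Finset.sum_eq_zero fun w _ => if_neg fun h2 => h ?_
    obtain rfl := hB₀.eq_of_regularDominant hm hn h2
    exact h2

/-- A simple reflection r_b permutes the factors with a ≠ b and sends e^{ρ₀}(1 - e^{-b}) to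
e^{ρ₀-b}(1 - e^b), its negative. -/
theorem IsBase.isAnti_evenDen {r₀ : P.Wt} (hr₀ : P.IsWeylVector B₀ r₀) :
    IsAnti (P.evenDen r₀ B₀) := by
  classical
  intro w
  refine hB₀.weyl_induction (p := fun w => P.act w (P.evenDen r₀ B₀) = P.sgn w • P.evenDen r₀ B₀)
    ?_ ?_ w
  · rw [act_one, sgn_one, one_smul]
  · intro b hb w ih
    rw [act_mul_weyl, ih, map_zsmul, sgn_mul, mul_comm, mul_smul]
    congr 1
    have hbp := hB₀.mem_posEven_of_mem hb
    have hrb (a : P.Wt) : (P.sR ⟨b, hB₀.subset hb⟩ : P.Wt ≃ₗ[ℂ] P.Wt) a = P.refl b a :=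
      P.sR_apply _ a
    have hbb : P.refl b b = -b := by rw [refl_apply, P.root_apply_cor (hB₀.subset hb)]; module
    have hprod : ∏ a ∈ (P.posEven B₀).erase b,
        P.act (P.sR ⟨b, hB₀.subset hb⟩ : P.Wt ≃ₗ[ℂ] P.Wt) (1 - single (-a) 1) =
        ∏ a ∈ (P.posEven B₀).erase b, (1 - single (-a) 1) := by
      have hmem (a : P.Wt) (ha : a ∈ (P.posEven B₀).erase b) :
          P.refl b a ∈ (P.posEven B₀).erase b := by
        obtain ⟨h1, h2⟩ := Finset.mem_erase.mp ha
        refine Finset.mem_erase.mpr ⟨fun h => ?_, hB₀.refl_mem_posEven h2 hb h1⟩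
        have := P.refl_refl (hB₀.subset hb) a
        rw [h, hbb] at this
        exact hB₀.neg_notMem hbp (this ▸ h2)
      refine Finset.prod_bij' (fun a _ => P.refl b a) (fun a _ => P.refl b a) hmem hmem
        (fun a _ => P.refl_refl (hB₀.subset hb) a) (fun a _ => P.refl_refl (hB₀.subset hb) a) ?_
      intro a _
      rw [map_sub, map_one, act_single, map_neg, hrb]
    rw [evenDen, map_mul, map_prod, ← Finset.mul_prod_erase _ _ hbp, hprod,
      ← Finset.mul_prod_erase _ _ hbp, map_sub, map_one, act_single, act_single, map_neg, hrb, hrb,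
      hbb, neg_neg, hr₀ b hb, sgn_sR, neg_one_smul, ← mul_assoc, ← mul_assoc, ← neg_mul]
    congr 1
    rw [mul_sub, mul_sub, single_mul_single, single_mul_single, mul_one, mul_one, mul_one,
      sub_add_cancel, ← sub_eq_add_neg, neg_sub]

theorem IsBase.pointed : ∀ x ∈ AddSubmonoid.closure (B₀ : Set P.Wt),
    -x ∈ AddSubmonoid.closure (B₀ : Set P.Wt) → x = 0 :=
  fun _ => eq_zero_of_mem_of_neg_mem hB₀.linearIndependent

theorem IsBase.hasTop_evenDen (r : P.Wt) :
    HasTop (AddSubmonoid.closure (B₀ : Set P.Wt)) r 1 (P.evenDen r B₀) := by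
  have := (hasTop_single (AddSubmonoid.closure (B₀ : Set P.Wt)) r 1).mul hB₀.pointed
    (hasTop_prod hB₀.pointed (P.posEven B₀) (fun a => 1 - single (-a) 1) fun a ha =>
      hasTop_one_sub (mem_posEven.mp ha).2 (P.mem_evenRoots.mp (mem_posEven.mp ha).1).1)
  simpa [evenDen] using this

theorem IsBase.mem_integralWeights_of_hasTop {r : P.Wt} {c : ℤ} {f : AddMonoidAlgebra ℤ P.Wt}
    (hf : HasTop (AddSubmonoid.closure (B₀ : Set P.Wt)) r c f) (hr : r ∈ P.integralWeights)
    {m : P.Wt} (hm : f.coeff m ≠ 0) : m ∈ P.integralWeights := by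
  have h1 : r - m ∈ P.integralWeights := by
    refine hB₀.closure_mem_integralWeights ?_
    exact hf.2 m hm
  rw [← sub_sub_cancel r m]
  exact hB₀.sub_mem_integralWeights hr h1

/-- The Weyl denominator formula. -/
theorem IsBase.evenDen_eq_altSum {r₀ : P.Wt} (hr₀ : P.IsWeylVector B₀ r₀) :
    P.evenDen r₀ B₀ = P.altSum r₀ := by
  classical
  have htop := hB₀.hasTop_evenDen r₀
  have hrd := hr₀.mem_regularDominant hB₀
  refine hB₀.anti_ext (hB₀.isAnti_evenDen hr₀) (isAnti_altSum _)
    (fun m hm => hB₀.mem_integralWeights_of_hasTop htop (hr₀.mem_integralWeights hB₀) hm)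
    (fun m hm => mem_integralWeights_of_coeff_altSum (hr₀.mem_integralWeights hB₀) hm) ?_
  intro m hm
  rw [hB₀.coeff_altSum_regularDominant hrd hm]
  split_ifs with h
  · rw [← h]; exact htop.1
  · by_contra hne
    apply h
    -- A regular dominant m in the support lies below ρ₀, and ρ₀ - m pairs to 1 - k ≤ 0 with each
    -- simple coroot, so m = ρ₀.
    refine sub_eq_zero.mp (hB₀.eq_zero_of_apply_cor_nonpos (htop.2 m hne) fun b hb => ?_)
    obtain ⟨k, hk0, hk⟩ := hB₀.mem_regularDominant_iff.mp hm b hb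
    refine ⟨1 - k, by omega, ?_⟩
    rw [LinearMap.sub_apply, hr₀.apply_cor hB₀ hb, hk]
    push_cast
    rfl

end GroupRing

/-! ### The Casimir operator -/

section Casimir

theorem rootForm_comm (l m : P.Wt) : P.rootForm l m = P.rootForm m l :=
  Finset.sum_congr rfl fun _ _ => mul_comm _ _

/-- The ratio of the root form and the invariant form on a root. -/
noncomputable def formRatio (a : P.Wt) : ℂ := P.rootForm a a / P.dualForm a a

theorem rootForm_eq_formRatio_mul {a : P.Wt} (ha : a ∈ P.evenRoots) (l : P.Wt) :
    P.rootForm l a = P.formRatio a * P.dualForm l a := by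
  have h := P.two_mul_rootForm ha l
  rw [apply_cor] at h
  rw [rootForm_comm, formRatio]
  have h0 := P.dualForm_self_ne_zero ha
  field_simp at h ⊢
  linear_combination h

theorem formRatio_neg (a : P.Wt) : P.formRatio (-a) = P.formRatio a := by
  simp [formRatio, rootForm, dualForm_neg_left, dualForm_neg_right]

theorem formRatio_eq_of_dualForm_ne_zero {a b : P.Wt} (ha : a ∈ P.evenRoots)
    (hb : b ∈ P.evenRoots) (h : P.dualForm a b ≠ 0) : P.formRatio a = P.formRatio b := by
  have h1 := P.rootForm_eq_formRatio_mul ha b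
  rw [rootForm_comm, P.rootForm_eq_formRatio_mul hb, P.dualForm_comm b a] at h1
  exact (mul_right_cancel₀ h h1).symm

/-- Roots that are not orthogonal have equal ratio, and a + b, having nonzero norm, is not
orthogonal to both a and b. So the ratio is constant along sums of roots, as needed to rescale the
Casimir element. -/
theorem formRatio_add {a b : P.Wt} (ha : a ∈ P.evenRoots) (hb : b ∈ P.evenRoots)
    (hab : a + b ∈ P.evenRoots) : P.formRatio (a + b) = P.formRatio a := by
  by_cases h1 : P.dualForm (a + b) a = 0
  · have h2 : P.dualForm (a + b) b ≠ 0 := by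
      intro h2
      apply P.dualForm_self_ne_zero hab
      rw [P.dualForm_comm, dualForm_add_left, P.dualForm_comm a, P.dualForm_comm b, h1, h2,
        add_zero]
    rw [P.formRatio_eq_of_dualForm_ne_zero hab hb h2]
    refine (P.formRatio_eq_of_dualForm_ne_zero ha hb ?_).symm
    intro h3
    rw [dualForm_add_left, P.dualForm_comm b a, h3, add_zero] at h1
    exact P.dualForm_self_ne_zero ha h1
  · exact P.formRatio_eq_of_dualForm_ne_zero hab ha h1

theorem sum_apply_cor_smul_cor {a : P.Wt} (ha : a ∈ P.evenRoots) :
    ∑ b ∈ P.evenRoots, a (P.cor b) • P.cor b = P.formRatio a • P.tvec a := by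
  rw [← sub_eq_zero, ← Module.forall_dual_apply_eq_zero_iff ℂ]
  intro l
  rw [map_sub, map_sum, map_smul, sub_eq_zero, smul_eq_mul]
  rw [← dualForm_eq, ← P.rootForm_eq_formRatio_mul ha, rootForm]
  exact Finset.sum_congr rfl fun b _ => by rw [map_smul, smul_eq_mul, mul_comm]

theorem exists_rootVectors : ∃ x y : P.Wt → g₀, ∀ a ∈ P.evenRoots,
    x a ∈ wtSpace P.H g₀ a ∧ y a ∈ wtSpace P.H g₀ (-a) ∧ P.form₀ (x a) (y a) = 1 := by
  have h (a : P.Wt) (ha : a ∈ P.evenRoots) : ∃ p : g₀ × g₀, p.1 ∈ wtSpace P.H g₀ a ∧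
      p.2 ∈ wtSpace P.H g₀ (-a) ∧ P.form₀ p.1 p.2 = 1 := by
    obtain ⟨x, hx, hx0⟩ := (Submodule.ne_bot_iff _).mp (P.mem_evenRoots.mp ha).2
    obtain ⟨y, hy, hxy⟩ := P.exists_form₀_eq_one hx hx0
    exact ⟨(x, y), hx, hy, hxy⟩
  choose! p hp using h
  exact ⟨fun a => (p a).1, fun a => (p a).2, hp⟩

/-- Root vectors of the even part. -/
noncomputable def rootVec : P.Wt → g₀ := P.exists_rootVectors.choose

/-- Root vectors dual to `rootVec`. -/
noncomputable def coVec : P.Wt → g₀ := P.exists_rootVectors.choose_spec.choose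

variable {P}

theorem rootVec_mem {a : P.Wt} (ha : a ∈ P.evenRoots) : P.rootVec a ∈ wtSpace P.H g₀ a :=
  (P.exists_rootVectors.choose_spec.choose_spec a ha).1

theorem coVec_mem {a : P.Wt} (ha : a ∈ P.evenRoots) : P.coVec a ∈ wtSpace P.H g₀ (-a) :=
  (P.exists_rootVectors.choose_spec.choose_spec a ha).2.1

theorem form₀_rootVec_coVec {a : P.Wt} (ha : a ∈ P.evenRoots) :
    P.form₀ (P.rootVec a) (P.coVec a) = 1 :=
  (P.exists_rootVectors.choose_spec.choose_spec a ha).2.2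

theorem lie_rootVec_coVec {a : P.Wt} (ha : a ∈ P.evenRoots) :
    ⁅P.rootVec a, P.coVec a⁆ = (P.tvec a : g₀) := by
  rw [P.lie_eq_smul_tvec (rootVec_mem ha) (coVec_mem ha), form₀_rootVec_coVec ha, one_smul]

theorem eq_smul_rootVec {a : P.Wt} (ha : a ∈ P.evenRoots) {z : g₀}
    (hz : z ∈ wtSpace P.H g₀ a) : z = P.form₀ z (P.coVec a) • P.rootVec a := by
  have h0 : P.rootVec a ≠ 0 := by
    intro h
    have := form₀_rootVec_coVec ha
    rw [h] at this
    simp at this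
  obtain ⟨c, rfl⟩ := P.exists_eq_smul_of_mem_root_space ha (rootVec_mem ha) h0 hz
  rw [map_smul, LinearMap.smul_apply, form₀_rootVec_coVec ha, smul_eq_mul, mul_one]

theorem eq_smul_coVec {a : P.Wt} (ha : a ∈ P.evenRoots) {z : g₀}
    (hz : z ∈ wtSpace P.H g₀ (-a)) : z = P.form₀ (P.rootVec a) z • P.coVec a := by
  have h0 : P.coVec a ≠ 0 := by
    intro h
    have := form₀_rootVec_coVec ha
    rw [h] at this
    simp at this
  obtain ⟨c, rfl⟩ := P.exists_eq_smul_of_mem_root_space (P.neg_mem_evenRoots ha) (coVec_mem ha)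
    h0 hz
  rw [map_smul, form₀_rootVec_coVec ha, smul_eq_mul, mul_one]

theorem eq_zero_of_mem_wtSpace_of_notMem {a : P.Wt} (ha : a ∉ P.evenRoots) (ha0 : a ≠ 0) {z : g₀}
    (hz : z ∈ wtSpace P.H g₀ a) : z = 0 := by
  by_contra h
  exact ha (P.mem_evenRoots.mpr ⟨ha0, (Submodule.ne_bot_iff _).mpr ⟨z, hz, h⟩⟩)

/-- Induction over the root space decomposition of the even part. -/
theorem root_induction {p : g₀ → Prop} (cartan : ∀ x : P.H, p x)
    (root : ∀ a ∈ P.evenRoots, ∀ z ∈ wtSpace P.H g₀ a, p z)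
    (add : ∀ x y, p x → p y → p (x + y)) (z : g₀) : p z := by
  refine P.weight_even.induction (fun a z hz => ?_) (cartan 0) add z
  by_cases ha0 : a = 0
  · subst ha0
    exact cartan ⟨z, (P.zero_weight_even z).mp hz⟩
  · by_cases ha : a ∈ P.evenRoots
    · exact root a ha z hz
    · rw [eq_zero_of_mem_wtSpace_of_notMem ha ha0 hz]
      exact cartan 0

variable (V : Type w) [AddCommGroup V] [Module ℂ V] [LieRingModule g₀ V] [LieModule ℂ g₀ V]

local notation "ρ" => LieModule.toEnd ℂ g₀ V

variable (P) in
/-- The Casimir operator of the form on the even part which induces the root form on weights. -/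
noncomputable def casimir : Module.End ℂ V :=
  ∑ b ∈ P.evenRoots, ρ (P.cor b) * ρ (P.cor b) +
    ∑ a ∈ P.evenRoots, P.formRatio a • (ρ (P.rootVec a) * ρ (P.coVec a))

theorem toEnd_mul_mul (z x y : g₀) : ρ z * (ρ x * ρ y) =
    ρ x * ρ y * ρ z + (ρ ⁅z, x⁆ * ρ y + ρ x * ρ ⁅z, y⁆) := by
  ext v
  simp only [Module.End.mul_apply, LinearMap.add_apply, LieModule.toEnd_apply_apply]
  rw [leibniz_lie z x, leibniz_lie z y, lie_add]
  abel

/-- The terms a = -c and a = c produce t_c. The others cancel in pairs under a ↦ c + a, by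
invariance of the form and because `formRatio` agrees on a and c + a. -/
theorem sum_lie_rootVec {c : P.Wt} (hc : c ∈ P.evenRoots) {z : g₀} (hz : z ∈ wtSpace P.H g₀ c) :
    ∑ a ∈ P.evenRoots, P.formRatio a •
      (ρ ⁅z, P.rootVec a⁆ * ρ (P.coVec a) + ρ (P.rootVec a) * ρ ⁅z, P.coVec a⁆) =
    P.formRatio c • (ρ (P.tvec c) * ρ z + ρ z * ρ (P.tvec c)) := by
  classical
  have hc0 := (P.mem_evenRoots.mp hc).1
  have hnc := P.neg_mem_evenRoots hc
  simp only [smul_add, Finset.sum_add_distrib]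
  have h1 : ∑ a ∈ P.evenRoots, P.formRatio a • (ρ ⁅z, P.rootVec a⁆ * ρ (P.coVec a)) =
      P.formRatio c • (ρ (P.tvec c) * ρ z) +
      ∑ a ∈ P.evenRoots.filter (fun a => c + a ∈ P.evenRoots),
        P.formRatio a • (ρ ⁅z, P.rootVec a⁆ * ρ (P.coVec a)) := by
    rw [← Finset.add_sum_erase _ _ hnc]
    congr 1
    · have hz' : z = P.form₀ z (P.rootVec (-c)) • P.coVec (-c) := by
        rw [P.form₀_symm]
        exact eq_smul_coVec hnc (by rwa [neg_neg])
      rw [formRatio_neg, P.lie_eq_smul_tvec hz (rootVec_mem hnc)]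
      congr 1
      conv_rhs => rw [hz']
      rw [map_smul, map_smul, smul_mul_assoc, mul_smul_comm]
    · refine (Finset.sum_subset ?_ ?_).symm
      · intro a ha
        obtain ⟨h1, h2⟩ := Finset.mem_filter.mp ha
        refine Finset.mem_erase.mpr ⟨?_, h1⟩
        rintro rfl
        rw [add_neg_cancel] at h2
        exact (P.mem_evenRoots.mp h2).1 rfl
      · intro a ha ha'
        obtain ⟨h1, h2⟩ := Finset.mem_erase.mp ha
        have h3 : c + a ∉ P.evenRoots := fun h => ha' (Finset.mem_filter.mpr ⟨h2, h⟩)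
        rw [eq_zero_of_mem_wtSpace_of_notMem h3
          (fun h => h1 (neg_eq_of_add_eq_zero_right h).symm) (lie_mem_wtSpace hz (rootVec_mem h2))]
        simp
  have h2 : ∑ a ∈ P.evenRoots, P.formRatio a • (ρ (P.rootVec a) * ρ ⁅z, P.coVec a⁆) =
      P.formRatio c • (ρ z * ρ (P.tvec c)) +
      ∑ a ∈ P.evenRoots.filter (fun a => a - c ∈ P.evenRoots),
        P.formRatio a • (ρ (P.rootVec a) * ρ ⁅z, P.coVec a⁆) := by
    rw [← Finset.add_sum_erase _ _ hc]
    congr 1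
    · rw [P.lie_eq_smul_tvec hz (coVec_mem hc)]
      congr 1
      conv_rhs => rw [eq_smul_rootVec hc hz]
      rw [map_smul, map_smul, smul_mul_assoc, mul_smul_comm]
    · refine (Finset.sum_subset ?_ ?_).symm
      · intro a ha
        obtain ⟨h1, h2⟩ := Finset.mem_filter.mp ha
        refine Finset.mem_erase.mpr ⟨?_, h1⟩
        rintro rfl
        rw [sub_self] at h2
        exact (P.mem_evenRoots.mp h2).1 rfl
      · intro a ha ha'
        obtain ⟨h1, h2⟩ := Finset.mem_erase.mp ha
        have h3 : c + -a ∉ P.evenRoots := fun h => ha' (Finset.mem_filter.mpr ⟨h2, by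
          have := P.neg_mem_evenRoots h
          rwa [neg_add, neg_neg, add_comm, ← sub_eq_add_neg] at this⟩)
        rw [eq_zero_of_mem_wtSpace_of_notMem h3
          (fun h => h1 (by rwa [← sub_eq_add_neg, sub_eq_zero, eq_comm] at h))
          (lie_mem_wtSpace hz (coVec_mem h2))]
        simp
  have h3 : ∑ a ∈ P.evenRoots.filter (fun a => c + a ∈ P.evenRoots),
        P.formRatio a • (ρ ⁅z, P.rootVec a⁆ * ρ (P.coVec a)) =
      -∑ a ∈ P.evenRoots.filter (fun a => a - c ∈ P.evenRoots),
        P.formRatio a • (ρ (P.rootVec a) * ρ ⁅z, P.coVec a⁆) := by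
    rw [← Finset.sum_neg_distrib]
    refine Finset.sum_bij' (fun a _ => c + a) (fun a _ => a - c) ?_ ?_ ?_ ?_ ?_
    · intro a ha
      obtain ⟨h1, h2⟩ := Finset.mem_filter.mp ha
      exact Finset.mem_filter.mpr ⟨h2, by rwa [add_sub_cancel_left]⟩
    · intro a ha
      obtain ⟨h1, h2⟩ := Finset.mem_filter.mp ha
      exact Finset.mem_filter.mpr ⟨h2, by rwa [add_sub_cancel]⟩
    · intro a _; exact add_sub_cancel_left c a
    · intro a _; exact add_sub_cancel c a
    · intro a ha
      obtain ⟨h1, h2⟩ := Finset.mem_filter.mp ha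
      have e1 := eq_smul_rootVec h2 (lie_mem_wtSpace hz (rootVec_mem h1))
      have e2 : ⁅z, P.coVec (c + a)⁆ ∈ wtSpace P.H g₀ (-a) := by
        have := lie_mem_wtSpace hz (coVec_mem h2)
        rwa [neg_add, add_neg_cancel_left] at this
      have e3 := eq_smul_coVec h1 e2
      have e4 : P.form₀ ⁅z, P.rootVec a⁆ (P.coVec (c + a)) =
          -P.form₀ (P.rootVec a) ⁅z, P.coVec (c + a)⁆ := by
        rw [← P.form₀_invariant, ← lie_skew, map_neg, LinearMap.neg_apply]
      rw [e1, e3, e4, add_comm c a, P.formRatio_add h1 hc (by rwa [add_comm]), map_smul, map_smul,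
        smul_mul_assoc, mul_smul_comm, neg_smul, smul_neg]
  rw [h1, h2, h3]
  abel

/-- For a root vector z of weight c, the commutator with ∑ h_b² is minus the contribution computed
in `sum_lie_rootVec`, because ∑ c(h_b) h_b is the multiple `formRatio c` of t_c. -/
theorem toEnd_mul_casimir (z : g₀) : ρ z * P.casimir V = P.casimir V * ρ z := by
  revert z
  refine root_induction (P := P) ?_ ?_ ?_
  · intro x
    rw [casimir, mul_add, add_mul, Finset.mul_sum, Finset.sum_mul, Finset.mul_sum, Finset.sum_mul]
    congr 1
    · refine Finset.sum_congr rfl fun b _ => ?_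
      rw [toEnd_mul_mul, P.lie_coe_coe]
      simp
    · refine Finset.sum_congr rfl fun a ha => ?_
      rw [mul_smul_comm, smul_mul_assoc, toEnd_mul_mul, rootVec_mem ha x, coVec_mem ha x, map_smul,
        map_smul, smul_mul_assoc, mul_smul_comm, LinearMap.neg_apply, neg_smul, add_neg_cancel,
        add_zero]
  · intro c hc z hz
    rw [casimir, mul_add, add_mul, Finset.mul_sum, Finset.sum_mul, Finset.mul_sum, Finset.sum_mul]
    simp only [mul_smul_comm, smul_mul_assoc, toEnd_mul_mul, smul_add]
    have h1 := sum_lie_rootVec V hc hz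
    have h2 : ∑ b ∈ P.evenRoots, (ρ ⁅z, (P.cor b : g₀)⁆ * ρ (P.cor b) +
        ρ (P.cor b) * ρ ⁅z, (P.cor b : g₀)⁆) =
        -(P.formRatio c • (ρ (P.tvec c) * ρ z) + P.formRatio c • (ρ z * ρ (P.tvec c))) := by
      have h3 (b : P.Wt) : ⁅z, (P.cor b : g₀)⁆ = -(c (P.cor b) • z) := by
        rw [← lie_skew, hz]
      have h4 : ∑ b ∈ P.evenRoots, c (P.cor b) • ρ (P.cor b) = P.formRatio c • ρ (P.tvec c) := by
        have := congrArg ((ρ : g₀ →ₗ[ℂ] Module.End ℂ V) ∘ₗ P.H.toSubmodule.subtype)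
          (P.sum_apply_cor_smul_cor hc)
        simp only [map_sum, map_smul] at this
        exact this
      simp only [h3, map_neg, map_smul, neg_mul, mul_neg, smul_mul_assoc, mul_smul_comm]
      rw [Finset.sum_add_distrib, Finset.sum_neg_distrib, Finset.sum_neg_distrib]
      rw [← smul_mul_assoc (P.formRatio c), ← mul_smul_comm (P.formRatio c) (ρ z), ← h4,
        Finset.sum_mul, Finset.mul_sum]
      simp only [smul_mul_assoc, mul_smul_comm]
      abel
    simp only [smul_add, Finset.sum_add_distrib] at h1 h2 ⊢
    linear_combination (norm := abel) h1 + h2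
  · intro x y hx hy
    rw [map_add, add_mul, mul_add, hx, hy]

end Casimir

/-! ### Highest weight vectors -/

section HighestWeight

variable {P}
variable {V : Type w} [AddCommGroup V] [Module ℂ V] [LieRingModule g₀ V] [LieModule ℂ g₀ V]

variable (P) in
/-- `v` has weight `m` and is killed by the positive root vectors. -/
structure IsHighest (B₀ : Finset P.Wt) (m : P.Wt) (v : V) : Prop where
  mem : v ∈ wtSpace P.H V m
  lie_eq_zero : ∀ a ∈ P.posEven B₀, ∀ x ∈ wtSpace P.H g₀ a, ⁅x, v⁆ = 0

/-- The vector obtained from `v` by applying successively negative root vectors. -/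
noncomputable def wordVec {B₀ : Finset P.Wt} (v : V) (L : List (P.posEven B₀)) : V :=
  L.foldr (fun a w => ⁅P.rootVec (-(a : P.Wt)), w⁆) v

/-- The sum of the roots of a word. -/
def wordSum {B₀ : Finset P.Wt} (L : List (P.posEven B₀)) : P.Wt := (L.map Subtype.val).sum

theorem wordSum_mem {B₀ : Finset P.Wt} (L : List (P.posEven B₀)) :
    wordSum L ∈ AddSubmonoid.closure (B₀ : Set P.Wt) := by
  refine AddSubmonoid.list_sum_mem _ fun a ha => ?_
  obtain ⟨b, -, rfl⟩ := List.mem_map.mp ha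
  exact (mem_posEven.mp b.2).2

theorem neg_mem_evenRoots_of_pos {B₀ : Finset P.Wt} (a : P.posEven B₀) :
    -(a : P.Wt) ∈ P.evenRoots := P.neg_mem_evenRoots (mem_posEven.mp a.2).1

theorem wordVec_mem_wtSpace {B₀ : Finset P.Wt} {v : V} {m : P.Wt} (hv : v ∈ wtSpace P.H V m)
    (L : List (P.posEven B₀)) : wordVec v L ∈ wtSpace P.H V (m - wordSum L) := by
  induction L with
  | nil => simpa [wordVec, wordSum] using hv
  | cons a L ih =>
    have := lie_mem_wtSpace (rootVec_mem (neg_mem_evenRoots_of_pos a)) ih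
    rw [show -(a : P.Wt) + (m - wordSum L) = m - wordSum (a :: L) by
      rw [wordSum, wordSum, List.map_cons, List.sum_cons]; abel] at this
    exact this

variable {B₀ : Finset P.Wt} (hB₀ : P.IsBase P.evenRoots B₀) {m : P.Wt} {v : V}

include hB₀

theorem IsBase.wordSum_eq_zero {L : List (P.posEven B₀)} (h : wordSum L = 0) : L = [] := by
  cases L with
  | nil => rfl
  | cons a L =>
    exfalso
    have h1 : wordSum (a :: L) = a + wordSum L := by
      rw [wordSum, wordSum, List.map_cons, List.sum_cons]
    rw [h1] at h
    have h2 := hB₀.pointed a (mem_posEven.mp a.2).2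
      (by rw [neg_eq_of_add_eq_zero_right h]; exact wordSum_mem L)
    exact (P.mem_evenRoots.mp (mem_posEven.mp a.2).1).1 h2

/-- Induction on the word, through z f w = [z, f] w + f z w with the claim known for every element
acting on the shorter word. This gives a spanning set of the generated submodule without ordering
the factors. -/
theorem IsBase.lie_wordVec_mem (hv : P.IsHighest B₀ m v) (z : g₀) (L : List (P.posEven B₀)) :
    ⁅z, wordVec v L⁆ ∈ Submodule.span ℂ (Set.range (wordVec (B₀ := B₀) v)) := by
  set W := Submodule.span ℂ (Set.range (wordVec (B₀ := B₀) v)) with hW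
  have hneg : ∀ a : P.posEven B₀, ∀ y ∈ wtSpace P.H g₀ (-(a : P.Wt)), ∀ w ∈ W, ⁅y, w⁆ ∈ W := by
    intro a y hy w hw
    rw [eq_smul_rootVec (neg_mem_evenRoots_of_pos a) hy, smul_lie]
    refine W.smul_mem _ ?_
    induction hw using Submodule.span_induction with
    | mem w hw =>
      obtain ⟨L, rfl⟩ := hw
      exact Submodule.subset_span ⟨a :: L, rfl⟩
    | zero => rw [lie_zero]; exact W.zero_mem
    | add x y _ _ hx hy => rw [lie_add]; exact W.add_mem hx hy
    | smul c x _ hx => rw [lie_smul]; exact W.smul_mem c hx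
  induction L generalizing z with
  | nil =>
    have hvW : v ∈ W := Submodule.subset_span ⟨[], rfl⟩
    change ⁅z, v⁆ ∈ W
    revert z
    refine root_induction (P := P) ?_ ?_ ?_
    · intro x
      rw [hv.mem x]
      exact W.smul_mem _ hvW
    · intro a ha z hz
      rcases hB₀.pos_or_neg' ha with h | h
      · rw [hv.lie_eq_zero a h z hz]; exact W.zero_mem
      · exact hneg ⟨-a, h⟩ z (by rwa [neg_neg]) v hvW
    · intro x y hx hy
      rw [add_lie]
      exact W.add_mem hx hy
  | cons a L ih =>
    change ⁅z, ⁅P.rootVec (-(a : P.Wt)), wordVec v L⁆⁆ ∈ W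
    rw [leibniz_lie]
    exact W.add_mem (ih _) (hneg a _ (rootVec_mem (neg_mem_evenRoots_of_pos a)) _ (ih z))

/-- The submodule generated by a highest weight vector. -/
noncomputable def IsBase.hwSub (hv : P.IsHighest B₀ m v) : LieSubmodule ℂ g₀ V where
  toSubmodule := Submodule.span ℂ (Set.range (wordVec (B₀ := B₀) v))
  lie_mem := by
    intro z w hw
    change w ∈ Submodule.span ℂ (Set.range (wordVec (B₀ := B₀) v)) at hw
    change ⁅z, w⁆ ∈ Submodule.span ℂ (Set.range (wordVec (B₀ := B₀) v))
    induction hw using Submodule.span_induction with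
    | mem w hw =>
      obtain ⟨L, rfl⟩ := hw
      exact hB₀.lie_wordVec_mem hv z L
    | zero => rw [lie_zero]; exact Submodule.zero_mem _
    | add x y _ _ hx hy => rw [lie_add]; exact Submodule.add_mem _ hx hy
    | smul c x _ hx => rw [lie_smul]; exact Submodule.smul_mem _ c hx

-- Independence of the weight spaces leaves no room: subspaces of them that already span V must be
-- all of them.
omit hB₀ in
theorem wtSpace_eq_of_le {A : P.Wt → Submodule ℂ V} (hA : ∀ n, A n ≤ wtSpace P.H V n)
    (htop : ⨆ n, A n = ⊤) (n : P.Wt) : wtSpace P.H V n = A n := by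
  refine le_antisymm (fun x hx => ?_) (hA n)
  have hx' : x ∈ A n ⊔ ⨆ (k) (_ : k ≠ n), A k := by
    have : (⨆ k, A k) ≤ A n ⊔ ⨆ (k) (_ : k ≠ n), A k := by
      refine iSup_le fun k => ?_
      by_cases hk : k = n
      · rw [hk]; exact le_sup_left
      · exact le_sup_of_le_right (le_iSup₂_of_le k hk le_rfl)
    exact this (htop ▸ trivial)
  obtain ⟨a, ha, b, hb, rfl⟩ := Submodule.mem_sup.mp hx'
  have hb1 : b ∈ wtSpace P.H V n := by
    have := Submodule.sub_mem _ hx (hA n ha)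
    rwa [add_sub_cancel_left] at this
  have hb2 : b ∈ ⨆ (k) (_ : k ≠ n), wtSpace P.H V k :=
    (iSup₂_mono fun k _ => hA k) hb
  have hb0 : b = 0 := by
    have := Submodule.disjoint_def.mp (iSupIndep_wtSpace P.H V n) b hb1 hb2
    exact this
  rw [hb0, add_zero]
  exact ha

section Generated

variable (hv : P.IsHighest B₀ m v) (htop : hB₀.hwSub hv = ⊤)

include htop

theorem IsBase.span_wordVec_eq_top : Submodule.span ℂ (Set.range (wordVec (B₀ := B₀) v)) = ⊤ :=
  congrArg LieSubmodule.toSubmodule htop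

theorem IsBase.wtSpace_eq_span (n : P.Wt) : wtSpace P.H V n =
    Submodule.span ℂ (wordVec v '' {L : List (P.posEven B₀) | m - wordSum L = n}) := by
  refine wtSpace_eq_of_le (A := fun n =>
    Submodule.span ℂ (wordVec v '' {L : List (P.posEven B₀) | m - wordSum L = n})) ?_ ?_ n
  · intro n
    rw [Submodule.span_le]
    rintro _ ⟨L, hL, rfl⟩
    exact (show m - wordSum L = n from hL) ▸ wordVec_mem_wtSpace hv.mem L
  · rw [eq_top_iff, ← hB₀.span_wordVec_eq_top hv htop, Submodule.span_le]
    rintro _ ⟨L, rfl⟩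
    exact Submodule.mem_iSup_of_mem (m - wordSum L) (Submodule.subset_span ⟨L, rfl, rfl⟩)

theorem IsBase.isWeightModule_of_generated : IsWeightModule P.H V := by
  rw [IsWeightModule, eq_top_iff, ← hB₀.span_wordVec_eq_top hv htop, Submodule.span_le]
  rintro _ ⟨L, rfl⟩
  exact Submodule.mem_iSup_of_mem (m - wordSum L) (wordVec_mem_wtSpace hv.mem L)

theorem IsBase.sub_mem_of_generated {n : P.Wt} (hn : wtSpace P.H V n ≠ ⊥) :
    m - n ∈ AddSubmonoid.closure (B₀ : Set P.Wt) := by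
  by_contra hcon
  apply hn
  rw [hB₀.wtSpace_eq_span hv htop, Submodule.span_eq_bot]
  rintro _ ⟨L, hL, rfl⟩
  exfalso
  apply hcon
  rw [← show m - wordSum L = n from hL, sub_sub_cancel]
  exact wordSum_mem L

theorem IsBase.wtSpace_top_eq : wtSpace P.H V m = Submodule.span ℂ {v} := by
  rw [hB₀.wtSpace_eq_span hv htop]
  congr 1
  ext x
  constructor
  · rintro ⟨L, hL, rfl⟩
    have : wordSum L = 0 := by
      have : m - wordSum L = m := hL
      rwa [sub_eq_self] at this
    rw [hB₀.wordSum_eq_zero this]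
    rfl
  · rintro rfl
    exact ⟨[], by simp [wordSum], rfl⟩

/-- Each letter has height at least one, so the words contributing to a given weight have bounded
length and are finitely many. -/
theorem IsBase.finiteDimensional_wtSpace (n : P.Wt) :
    FiniteDimensional ℂ (wtSpace P.H V n) := by
  rw [hB₀.wtSpace_eq_span hv htop]
  refine FiniteDimensional.span_of_finite ℂ (Set.Finite.image _ ?_)
  by_cases hne : {L : List (P.posEven B₀) | m - wordSum L = n}.Nonempty
  · obtain ⟨L₀, hL₀⟩ := hne
    obtain ⟨k, hk⟩ := exists_htFun_eq_nat hB₀.linearIndependent (wordSum_mem L₀)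
    refine (List.finite_length_le (P.posEven B₀) k).subset ?_
    intro L hL
    have hs : wordSum L = wordSum L₀ := by
      have h1 : m - wordSum L = m - wordSum L₀ :=
        (show m - wordSum L = n from hL).trans (show m - wordSum L₀ = n from hL₀).symm
      rwa [sub_right_inj] at h1
    rw [← hs] at hk
    have hlen : ∀ (L : List (P.posEven B₀)) (k : ℕ),
        htFun hB₀.linearIndependent (wordSum L) = k → L.length ≤ k := by
      intro L
      induction L with
      | nil => intro k _; exact Nat.zero_le _
      | cons a L ih =>
        intro k hk
        obtain ⟨i, hi⟩ := exists_htFun_eq_nat hB₀.linearIndependent (mem_posEven.mp a.2).2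
        obtain ⟨j, hj⟩ := exists_htFun_eq_nat hB₀.linearIndependent (wordSum_mem L)
        have hi0 : i ≠ 0 := by
          rintro rfl
          exact (P.mem_evenRoots.mp (mem_posEven.mp a.2).1).1
            (eq_zero_of_htFun_eq_zero hB₀.linearIndependent (mem_posEven.mp a.2).2
              (by rw [hi]; simp))
        rw [show wordSum (a :: L) = a + wordSum L by
          rw [wordSum, wordSum, List.map_cons, List.sum_cons], map_add, hi, hj] at hk
        have hk' : i + j = k := by exact_mod_cast hk
        have := ih j hj
        rw [List.length_cons]
        omega
    exact hlen L k hk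
  · rw [Set.not_nonempty_iff_eq_empty.mp hne]
    exact Set.finite_empty

end Generated

theorem IsBase.hwSub_eq_top [LieModule.IsIrreducible ℂ g₀ V] (hv : P.IsHighest B₀ m v)
    (hv0 : v ≠ 0) : hB₀.hwSub hv = ⊤ := by
  refine (eq_bot_or_eq_top _).resolve_left fun h => hv0 ?_
  have : v ∈ hB₀.hwSub hv := Submodule.subset_span ⟨[], rfl⟩
  rw [h] at this
  exact (LieSubmodule.mem_bot v).mp this

/-- A nonzero finite-dimensional weight module contains a highest weight vector. -/
theorem IsBase.exists_isHighest [FiniteDimensional ℂ V] [Nontrivial V] (hV : IsWeightModule P.H V) :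
    ∃ (m : P.Wt) (v : V), P.IsHighest B₀ m v ∧ v ≠ 0 := by
  have hne : (finite_weights P.H V).toFinset.Nonempty := by
    by_contra hcon
    rw [Finset.not_nonempty_iff_eq_empty] at hcon
    have h0 : ∀ n, wtSpace P.H V n = ⊥ := by
      intro n
      by_contra hn
      have : n ∈ (finite_weights P.H V).toFinset := by simpa using hn
      rw [hcon] at this
      simp at this
    have : (⨆ n, wtSpace P.H V n) = ⊥ := by simp [h0]
    rw [show ⨆ n, wtSpace P.H V n = ⊤ from hV] at this
    exact bot_ne_top this.symm
  obtain ⟨m, hm, hmax⟩ := Finset.exists_max_image (finite_weights P.H V).toFinset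
    (fun n => (htFun hB₀.linearIndependent n).re) hne
  have hm' : wtSpace P.H V m ≠ ⊥ := by simpa using hm
  obtain ⟨v, hv, hv0⟩ := (Submodule.ne_bot_iff _).mp hm'
  refine ⟨m, v, ⟨hv, fun a ha x hx => ?_⟩, hv0⟩
  by_contra hne0
  have h1 : a + m ∈ (finite_weights P.H V).toFinset := by
    simpa using (Submodule.ne_bot_iff _).mpr ⟨_, lie_mem_wtSpace hx hv, hne0⟩
  have h2 := hmax _ h1
  obtain ⟨k, hk⟩ := exists_htFun_eq_nat hB₀.linearIndependent (mem_posEven.mp ha).2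
  have hk0 : k ≠ 0 := by
    rintro rfl
    exact (P.mem_evenRoots.mp (mem_posEven.mp ha).1).1
      (eq_zero_of_htFun_eq_zero hB₀.linearIndependent (mem_posEven.mp ha).2 (by rw [hk]; simp))
  rw [map_add, hk, Complex.add_re, Complex.natCast_re] at h2
  have : (0 : ℝ) < k := by exact_mod_cast Nat.pos_of_ne_zero hk0
  linarith

/-- The highest weight of a finite-dimensional module is dominant. -/
theorem IsBase.exists_nat_of_isHighest [FiniteDimensional ℂ V] (hv : P.IsHighest B₀ m v)
    (hv0 : v ≠ 0) {b : P.Wt} (hb : b ∈ B₀) : ∃ k : ℕ, m (P.cor b) = k := by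
  obtain ⟨e, he, f, hf, t⟩ := P.exists_isSl2Triple' (hB₀.subset hb)
  have hp : t.HasPrimitiveVectorWith v (m (P.cor b)) :=
    ⟨hv0, hv.mem _, hv.lie_eq_zero b (hB₀.mem_posEven_of_mem hb) e he⟩
  exact hp.exists_nat

theorem IsBase.add_mem_regularDominant {r₀ : P.Wt} (hr₀ : P.IsWeylVector B₀ r₀)
    (h : ∀ b ∈ B₀, ∃ k : ℕ, m (P.cor b) = k) : m + r₀ ∈ P.regularDominant B₀ := by
  refine hB₀.mem_regularDominant_iff.mpr fun b hb => ?_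
  obtain ⟨k, hk⟩ := h b hb
  exact ⟨k + 1, Nat.succ_pos k, by rw [LinearMap.add_apply, hk, hr₀.apply_cor hB₀ hb]; push_cast; rfl⟩

end HighestWeight

/-! ### Weight-wise multipliers on the complex group ring -/

section Multiplier

open AddMonoidAlgebra

variable {P}

/-- Multiplication of the coefficient of `e^m` by `φ m`. -/
noncomputable def wmul (φ : P.Wt → ℂ) (f : AddMonoidAlgebra ℂ P.Wt) : AddMonoidAlgebra ℂ P.Wt :=
  .ofCoeff (Finsupp.ofSupportFinite (fun m => φ m * f.coeff m)
    (f.coeff.support.finite_toSet.subset fun m hm => by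
      simp only [Function.mem_support] at hm
      exact Finsupp.mem_support_iff.mpr (right_ne_zero_of_mul hm)))

theorem coeff_wmul (φ : P.Wt → ℂ) (f : AddMonoidAlgebra ℂ P.Wt) (m : P.Wt) :
    (wmul φ f).coeff m = φ m * f.coeff m := rfl

theorem wmul_zero (φ : P.Wt → ℂ) : wmul φ 0 = 0 := by
  ext m; simp [coeff_wmul]

theorem wmul_add (φ : P.Wt → ℂ) (f g : AddMonoidAlgebra ℂ P.Wt) :
    wmul φ (f + g) = wmul φ f + wmul φ g := by
  ext m; simp [coeff_wmul, mul_add]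

theorem wmul_sub (φ : P.Wt → ℂ) (f g : AddMonoidAlgebra ℂ P.Wt) :
    wmul φ (f - g) = wmul φ f - wmul φ g := by
  ext m; simp [coeff_wmul, mul_sub]

theorem wmul_single (φ : P.Wt → ℂ) (n : P.Wt) (c : ℂ) :
    wmul φ (single n c) = single n (φ n * c) := by
  classical
  ext m
  rw [coeff_wmul, coeff_single, coeff_single, Finsupp.single_apply, Finsupp.single_apply]
  split_ifs with h
  · rw [h]
  · rw [mul_zero]

/-- The derivation `e^m ↦ m(h) e^m`. -/
noncomputable def der (h : P.H) : AddMonoidAlgebra ℂ P.Wt → AddMonoidAlgebra ℂ P.Wt :=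
  wmul fun m => m h

theorem der_mul (h : P.H) (f g : AddMonoidAlgebra ℂ P.Wt) :
    der h (f * g) = der h f * g + f * der h g := by
  induction f using AddMonoidAlgebra.induction_linear with
  | zero => simp [der, wmul_zero]
  | add f f' hf hf' =>
    rw [add_mul, der, wmul_add, ← der, hf, hf', der, wmul_add]
    ring
  | single m c =>
    induction g using AddMonoidAlgebra.induction_linear with
    | zero => simp [der, wmul_zero]
    | add g g' hg hg' =>
      rw [mul_add, der, wmul_add, ← der, hg, hg', der, wmul_add]
      ring
    | single n d =>
      simp only [der, single_mul_single, wmul_single, LinearMap.add_apply]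
      rw [← single_add]
      congr 1
      ring

theorem der_prod_one_sub [DecidableEq P.Wt] (h : P.H) (s : Finset P.Wt) :
    der h (∏ a ∈ s, (1 - single (-a) 1)) =
      ∑ a ∈ s, a h • (single (-a) 1 * ∏ b ∈ s.erase a, (1 - single (-b) 1)) := by
  have h1 : der h (1 : AddMonoidAlgebra ℂ P.Wt) = 0 := by
    rw [AddMonoidAlgebra.one_def, der, wmul_single]; simp
  induction s using Finset.induction_on with
  | empty => simpa using h1
  | insert a s ha ih =>
    rw [Finset.prod_insert ha, der_mul, ih, Finset.sum_insert ha, Finset.erase_insert ha]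
    congr 1
    · rw [← smul_mul_assoc]
      congr 1
      rw [der, wmul_sub, ← der, h1, der, wmul_single, zero_sub, LinearMap.neg_apply, smul_single,
        smul_eq_mul, neg_mul, single_neg, neg_neg]
    · rw [Finset.mul_sum]
      refine Finset.sum_congr rfl fun b hb => ?_
      rw [Finset.erase_insert_of_ne (fun e : a = b => ha (e ▸ hb)), Finset.prod_insert
        (fun h => ha (Finset.mem_of_mem_erase h)), mul_smul_comm]
      congr 1
      ring

/-- The Laplace operator of the root form. -/
noncomputable def lap : AddMonoidAlgebra ℂ P.Wt → AddMonoidAlgebra ℂ P.Wt :=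
  wmul fun m => P.rootForm m m

theorem lap_eq (f : AddMonoidAlgebra ℂ P.Wt) :
    lap f = ∑ b ∈ P.evenRoots, der (P.cor b) (der (P.cor b) f) := by
  ext m
  rw [AddMonoidAlgebra.coeff_sum, Finsupp.finsetSum_apply]
  simp only [lap, der, coeff_wmul, rootForm, Finset.sum_mul, mul_assoc]

theorem lap_mul (f g : AddMonoidAlgebra ℂ P.Wt) :
    lap (f * g) = lap f * g + 2 * ∑ b ∈ P.evenRoots, der (P.cor b) f * der (P.cor b) g +
      f * lap g := by
  have hadd (h : P.H) (f g : AddMonoidAlgebra ℂ P.Wt) : der h (f + g) = der h f + der h g :=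
    wmul_add _ f g
  simp only [lap_eq, der_mul, hadd, Finset.sum_add_distrib, Finset.sum_mul, Finset.mul_sum, two_mul]
  ring

theorem sum_apply_cor_smul_der (a : P.Wt) (f : AddMonoidAlgebra ℂ P.Wt) :
    ∑ b ∈ P.evenRoots, a (P.cor b) • der (P.cor b) f = wmul (fun m => P.rootForm a m) f := by
  ext m
  rw [AddMonoidAlgebra.coeff_sum, Finsupp.finsetSum_apply]
  simp only [der, coeff_wmul, rootForm, Finset.sum_mul, coeff_smul_apply, smul_eq_mul, mul_assoc]

variable {B₀ : Finset P.Wt} (hB₀ : P.IsBase P.evenRoots B₀)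

include hB₀

/-- Twice a Weyl vector agrees with the sum of the positive roots on the coroots. -/
theorem IsBase.sum_posEven_apply_cor {r₀ : P.Wt} (hr₀ : P.IsWeylVector B₀ r₀) {c : P.Wt}
    (hc : c ∈ P.evenRoots) : (∑ a ∈ P.posEven B₀, a) (P.cor c) = 2 * r₀ (P.cor c) := by
  classical
  set d : P.Wt := ∑ a ∈ P.posEven B₀, a - (2 : ℂ) • r₀ with hd
  -- A simple reflection r_b lowers both the sum of the positive roots and 2ρ₀ by 2b. So d is
  -- W-fixed and pairs to zero with every coroot.
  have hs (b : P.Wt) (hb : b ∈ B₀) : P.refl b d = d := by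
    have hbp := hB₀.mem_posEven_of_mem hb
    have hbr := hB₀.subset hb
    have hadd (x y : P.Wt) : P.refl b (x + y) = P.refl b x + P.refl b y := by
      simp only [refl_apply, LinearMap.add_apply, add_smul]; abel
    have hbb : P.refl b b = -b := by rw [refl_apply, P.root_apply_cor hbr]; module
    have hmem (a : P.Wt) (ha : a ∈ (P.posEven B₀).erase b) :
        P.refl b a ∈ (P.posEven B₀).erase b := by
      obtain ⟨h1, h2⟩ := Finset.mem_erase.mp ha
      refine Finset.mem_erase.mpr ⟨fun h => ?_, hB₀.refl_mem_posEven h2 hb h1⟩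
      have := P.refl_refl hbr a
      rw [h, hbb] at this
      exact hB₀.neg_notMem hbp (this ▸ h2)
    have h1 : P.refl b (∑ a ∈ (P.posEven B₀).erase b, a) = ∑ a ∈ (P.posEven B₀).erase b, a := by
      have : P.refl b (∑ a ∈ (P.posEven B₀).erase b, a) =
          ∑ a ∈ (P.posEven B₀).erase b, P.refl b a := by
        have := map_sum (P.sR ⟨b, hbr⟩ : P.Wt ≃ₗ[ℂ] P.Wt) (fun a => a) ((P.posEven B₀).erase b)
        simpa only [sR_apply] using this
      rw [this]
      exact Finset.sum_bij' (fun a _ => P.refl b a) (fun a _ => P.refl b a) hmem hmem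
        (fun a _ => P.refl_refl hbr a) (fun a _ => P.refl_refl hbr a) (fun _ _ => rfl)
    have h2 : P.refl b (-((2 : ℂ) • r₀)) = -((2 : ℂ) • r₀) + (2 : ℂ) • b := by
      have := hr₀.apply_cor hB₀ hb
      rw [refl_apply, LinearMap.neg_apply, LinearMap.smul_apply, this]
      module
    rw [hd, ← Finset.add_sum_erase _ _ hbp, sub_eq_add_neg, hadd, hadd, h1, h2, hbb]
    module
  have hw (w : P.weyl) : (w : P.Wt ≃ₗ[ℂ] P.Wt) d = d := by
    refine hB₀.weyl_induction (p := fun w => (w : P.Wt ≃ₗ[ℂ] P.Wt) d = d) rfl ?_ w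
    intro b hb w ih
    rw [weyl_mul_apply, ih, sR_apply, hs b hb]
  have h3 := hw (P.sR ⟨c, hc⟩)
  rw [sR_apply, refl_apply, sub_eq_self] at h3
  have h4 := (smul_eq_zero.mp h3).resolve_right (P.mem_evenRoots.mp hc).1
  rw [hd, LinearMap.sub_apply, LinearMap.smul_apply, smul_eq_mul, sub_eq_zero] at h4
  exact h4

theorem IsBase.sum_rootForm {r₀ : P.Wt} (hr₀ : P.IsWeylVector B₀ r₀) (m : P.Wt) :
    ∑ a ∈ P.posEven B₀, P.rootForm a m = 2 * P.rootForm r₀ m := by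
  simp only [rootForm, Finset.mul_sum]
  rw [Finset.sum_comm]
  refine Finset.sum_congr rfl fun c hc => ?_
  rw [← Finset.sum_mul, ← mul_assoc, ← hB₀.sum_posEven_apply_cor hr₀ hc, LinearMap.sum_apply]

/-- The key identity of the character formula: if `f` satisfies the trace identity of the Casimir
operator, then its product with the denominator is an eigenvector of the Laplace operator. -/
theorem IsBase.lap_mul_eq {r₀ : P.Wt} (hr₀ : P.IsWeylVector B₀ r₀) {D f : AddMonoidAlgebra ℂ P.Wt}
    (hD : D = single r₀ 1 * ∏ a ∈ P.posEven B₀, (1 - single (-a) 1))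
    (hlap : lap D = P.rootForm r₀ r₀ • D) {c : ℂ} {T : P.Wt → AddMonoidAlgebra ℂ P.Wt}
    (hT : ∀ a ∈ P.posEven B₀, T a * (1 - single (-a) 1) = wmul (fun m => P.rootForm a m) f)
    (hc : c • f = lap f + ∑ a ∈ P.posEven B₀, (2 * T a - wmul (fun m => P.rootForm a m) f)) :
    lap (D * f) = (c + P.rootForm r₀ r₀) • (D * f) := by
  classical
  set Q : P.Wt → AddMonoidAlgebra ℂ P.Wt := fun a => wmul (fun m => P.rootForm a m) f with hQ
  -- E a is D without the factor 1 - e^{-a}, so e^{-a} E a = E a - D. This rewrites derivatives of D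
  -- without division.
  set E : P.Wt → AddMonoidAlgebra ℂ P.Wt := fun a =>
    single r₀ 1 * ∏ b ∈ (P.posEven B₀).erase a, (1 - single (-b) 1) with hE
  have hED (a : P.Wt) (ha : a ∈ P.posEven B₀) : D = E a * (1 - single (-a) 1) := by
    rw [hD, ← Finset.prod_erase_mul _ _ ha, hE, mul_assoc]
  have hder (h : P.H) : der h D = r₀ h • D + ∑ a ∈ P.posEven B₀, a h • (E a - D) := by
    have h1 : ∑ a ∈ P.posEven B₀, a h • (E a - D) =
        ∑ a ∈ P.posEven B₀, a h • (single (-a) 1 * E a) := by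
      refine Finset.sum_congr rfl fun a ha => ?_
      rw [hED a ha]
      congr 1
      ring
    rw [h1, hD, der_mul, der_prod_one_sub, der, wmul_single, mul_one, Finset.mul_sum]
    congr 1
    · rw [← smul_mul_assoc, smul_single, smul_eq_mul, mul_one]
    · refine Finset.sum_congr rfl fun a _ => ?_
      rw [mul_smul_comm]
      congr 1
      rw [hE]
      ring
  have hcross : ∑ b ∈ P.evenRoots, der (P.cor b) D * der (P.cor b) f =
      D * Q r₀ + ∑ a ∈ P.posEven B₀, (E a - D) * Q a := by
    simp only [hder, add_mul, Finset.sum_add_distrib, Finset.sum_mul, smul_mul_assoc]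
    rw [Finset.sum_comm]
    simp only [hQ, ← sum_apply_cor_smul_der, Finset.mul_sum, mul_smul_comm]
  -- After the terms with E a cancel, what remains is D(2 Q r₀ - ∑ Q a), which this identity makes
  -- zero.
  have hsum : ∑ a ∈ P.posEven B₀, Q a = 2 * Q r₀ := by
    ext m
    rw [AddMonoidAlgebra.coeff_sum, Finsupp.finsetSum_apply, two_mul, coeff_add, Finsupp.add_apply]
    simp only [hQ, coeff_wmul]
    rw [← Finset.sum_mul, hB₀.sum_rootForm hr₀]
    ring
  have hTD (a : P.Wt) (ha : a ∈ P.posEven B₀) : D * T a = E a * Q a := by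
    rw [hED a ha, mul_assoc, mul_comm (1 - _), hT a ha]
  have hcD : c • (D * f) = D * lap f + ∑ a ∈ P.posEven B₀, (2 * (E a * Q a) - D * Q a) := by
    rw [← mul_smul_comm, hc, mul_add, Finset.mul_sum]
    congr 1
    refine Finset.sum_congr rfl fun a ha => ?_
    rw [mul_sub, ← hTD a ha]
    ring
  rw [lap_mul, hcross, hlap, add_smul, hcD, smul_mul_assoc]
  simp only [Finset.sum_sub_distrib, sub_mul, ← Finset.mul_sum]
  rw [hsum]
  ring

end Multiplier

/-! ### Traces on weight spaces -/

section Trace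

variable {P}
variable {V : Type w} [AddCommGroup V] [Module ℂ V] [LieRingModule g₀ V] [LieModule ℂ g₀ V]

theorem exists_wtProj (hV : IsWeightModule P.H V) (n : P.Wt) :
    ∃ p : Module.End ℂ V, (∀ v ∈ wtSpace P.H V n, p v = v) ∧
      ∀ k, k ≠ n → ∀ v ∈ wtSpace P.H V k, p v = 0 := by
  have hc : IsCompl (wtSpace P.H V n) (⨆ (k) (_ : k ≠ n), wtSpace P.H V k) := by
    refine ⟨iSupIndep_wtSpace P.H V n, codisjoint_iff.mpr (eq_top_iff.mpr ?_)⟩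
    rw [← show ⨆ n, wtSpace P.H V n = ⊤ from hV]
    refine iSup_le fun k => ?_
    by_cases hk : k = n
    · rw [hk]; exact le_sup_left
    · exact le_sup_of_le_right (le_iSup₂_of_le k hk le_rfl)
  refine ⟨Submodule.projection _ _ hc, fun v hv => ?_, fun k hk v hv => ?_⟩
  · exact Submodule.projection_apply_of_mem_left hc hv
  · exact (Submodule.projection_apply_eq_zero_iff hc).mpr
      ((le_iSup₂_of_le (f := fun k (_ : k ≠ n) => wtSpace P.H V k) k hk le_rfl) hv)

/-- The projection onto a weight space. -/
noncomputable def wtProj (hV : IsWeightModule P.H V) (n : P.Wt) : Module.End ℂ V :=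
  (exists_wtProj hV n).choose

theorem wtProj_apply (hV : IsWeightModule P.H V) {n : P.Wt} {v : V} (hv : v ∈ wtSpace P.H V n) :
    wtProj hV n v = v := (exists_wtProj hV n).choose_spec.1 v hv

theorem wtProj_apply_of_ne (hV : IsWeightModule P.H V) {n k : P.Wt} (hk : k ≠ n) {v : V}
    (hv : v ∈ wtSpace P.H V k) : wtProj hV n v = 0 := (exists_wtProj hV n).choose_spec.2 k hk v hv

theorem wtProj_mem (hV : IsWeightModule P.H V) (n : P.Wt) (v : V) :
    wtProj hV n v ∈ wtSpace P.H V n := by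
  revert v
  refine hV.induction ?_ (by rw [map_zero]; exact Submodule.zero_mem _) ?_
  · intro k v hv
    by_cases hk : k = n
    · subst hk
      rw [wtProj_apply hV hv]; exact hv
    · rw [wtProj_apply_of_ne hV hk hv]; exact Submodule.zero_mem _
  · intro a b ha hb
    rw [map_add]
    exact Submodule.add_mem _ ha hb

theorem trace_wtProj [FiniteDimensional ℂ V] (hV : IsWeightModule P.H V) (n : P.Wt) :
    LinearMap.trace ℂ V (wtProj hV n) = Module.finrank ℂ (wtSpace P.H V n) := by
  have h : LinearMap.IsProj (wtSpace P.H V n) (wtProj hV n) :=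
    ⟨wtProj_mem hV n, fun v hv => wtProj_apply hV hv⟩
  exact h.trace

theorem toEnd_mul_wtProj (hV : IsWeightModule P.H V) {a : P.Wt} {x : g₀}
    (hx : x ∈ wtSpace P.H g₀ a) {n k : P.Wt} (hk : a + n = k) :
    LieModule.toEnd ℂ g₀ V x * wtProj hV n = wtProj hV k * LieModule.toEnd ℂ g₀ V x := by
  refine LinearMap.ext (hV.induction ?_ (by simp) (fun a b ha hb => by rw [map_add, ha, hb, map_add]))
  intro l v hv
  simp only [Module.End.mul_apply, LieModule.toEnd_apply_apply]
  by_cases hl : l = n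
  · subst hl
    rw [wtProj_apply hV hv, wtProj_apply hV (hk ▸ lie_mem_wtSpace hx hv)]
  · rw [wtProj_apply_of_ne hV hl hv, lie_zero, wtProj_apply_of_ne hV _ (lie_mem_wtSpace hx hv)]
    intro h
    rw [← hk, add_right_inj] at h
    exact hl h

theorem toEnd_coe_mul_wtProj (hV : IsWeightModule P.H V) (x : P.H) (n : P.Wt) :
    LieModule.toEnd ℂ g₀ V x * wtProj hV n = n x • wtProj hV n := by
  ext v
  exact wtProj_mem hV n v x

/-- The trace of `x_a y_a` on a weight space. -/
noncomputable def rootTrace (hV : IsWeightModule P.H V) (a n : P.Wt) : ℂ :=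
  LinearMap.trace ℂ V (LieModule.toEnd ℂ g₀ V (P.rootVec a) * LieModule.toEnd ℂ g₀ V (P.coVec a) *
    wtProj hV n)

variable [FiniteDimensional ℂ V] (hV : IsWeightModule P.H V)

theorem trace_coVec_mul_rootVec {a : P.Wt} (ha : a ∈ P.evenRoots) (n : P.Wt) :
    LinearMap.trace ℂ V (LieModule.toEnd ℂ g₀ V (P.coVec a) *
      LieModule.toEnd ℂ g₀ V (P.rootVec a) * wtProj hV n) =
    rootTrace hV a n - P.dualForm n a * Module.finrank ℂ (wtSpace P.H V n) := by
  have h : LieModule.toEnd ℂ g₀ V (P.coVec a) * LieModule.toEnd ℂ g₀ V (P.rootVec a) =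
      LieModule.toEnd ℂ g₀ V (P.rootVec a) * LieModule.toEnd ℂ g₀ V (P.coVec a) -
        LieModule.toEnd ℂ g₀ V (P.tvec a) := by
    ext v
    simp only [Module.End.mul_apply, LinearMap.sub_apply, LieModule.toEnd_apply_apply]
    rw [← lie_rootVec_coVec ha, lie_lie]
    abel
  rw [h, sub_mul, map_sub, toEnd_coe_mul_wtProj, map_smul, trace_wtProj, smul_eq_mul]
  rfl

/-- The operator y_a moves the projection from weight n + a to weight n, and the trace is cyclic.
This is the recursion behind Freudenthal's formula. -/
theorem rootTrace_add {a : P.Wt} (ha : a ∈ P.evenRoots) (n : P.Wt) :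
    rootTrace hV a (n + a) =
      rootTrace hV a n - P.dualForm n a * Module.finrank ℂ (wtSpace P.H V n) := by
  rw [← trace_coVec_mul_rootVec hV ha, rootTrace, mul_assoc,
    toEnd_mul_wtProj hV (coVec_mem ha) (k := n) (by abel), ← mul_assoc, LinearMap.trace_mul_comm,
    ← mul_assoc]

/-- The dual pair chosen for -a is (y_a, x_a) up to two scalars whose product is one. -/
theorem rootTrace_neg {a : P.Wt} (ha : a ∈ P.evenRoots) (n : P.Wt) :
    rootTrace hV (-a) n =
      rootTrace hV a n - P.dualForm n a * Module.finrank ℂ (wtSpace P.H V n) := by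
  have hna := P.neg_mem_evenRoots ha
  rw [← trace_coVec_mul_rootVec hV ha, rootTrace]
  have h1 := eq_smul_coVec ha (rootVec_mem hna)
  have h2 := eq_smul_rootVec ha (z := P.coVec (-a)) (by simpa using coVec_mem hna)
  have h3 : P.form₀ (P.rootVec a) (P.rootVec (-a)) * P.form₀ (P.coVec (-a)) (P.coVec a) = 1 := by
    have := form₀_rootVec_coVec hna
    rw [h1, h2, map_smul, map_smul, LinearMap.smul_apply, P.form₀_symm (P.coVec a),
      form₀_rootVec_coVec ha, smul_eq_mul, smul_eq_mul, mul_one, mul_comm] at this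
    exact this
  rw [h1, h2, map_smul, map_smul, smul_mul_assoc, mul_smul_comm, smul_smul, h3, one_smul]

theorem rootTrace_eq_zero (a : P.Wt) {n : P.Wt} (hn : wtSpace P.H V n = ⊥) :
    rootTrace hV a n = 0 := by
  have : wtProj hV n = 0 := by
    ext v
    have := wtProj_mem hV n v
    rw [hn] at this
    exact (Submodule.mem_bot ℂ).mp this
  rw [rootTrace, this, mul_zero, map_zero]

theorem trace_casimir_mul_wtProj (n : P.Wt) :
    LinearMap.trace ℂ V (P.casimir V * wtProj hV n) =
      P.rootForm n n * Module.finrank ℂ (wtSpace P.H V n) +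
        ∑ a ∈ P.evenRoots, P.formRatio a * rootTrace hV a n := by
  rw [casimir, add_mul, map_add, Finset.sum_mul, Finset.sum_mul, map_sum, map_sum, rootForm,
    Finset.sum_mul]
  congr 1
  · refine Finset.sum_congr rfl fun b _ => ?_
    rw [mul_assoc, toEnd_coe_mul_wtProj, mul_smul_comm, toEnd_coe_mul_wtProj, smul_smul, map_smul,
      trace_wtProj, smul_eq_mul]
  · refine Finset.sum_congr rfl fun a _ => ?_
    rw [smul_mul_assoc, map_smul, smul_eq_mul, rootTrace]

theorem coeff_ch (n : P.Wt) :
    (ch P.H V).coeff n = Module.finrank ℂ (wtSpace P.H V n) := by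
  classical
  have hfin := finite_weights P.H V
  have hsupp : (Function.support fun ν : P.Wt =>
      AddMonoidAlgebra.single ν (Module.finrank ℂ (wtSpace P.H V ν) : ℤ)) ⊆ hfin.toFinset := by
    intro ν hν
    simp only [Set.Finite.coe_toFinset, Set.mem_ofPred_eq]
    intro h0
    apply hν
    simp [h0]
  rw [ch, finsum_eq_sum_of_support_subset _ hsupp, AddMonoidAlgebra.coeff_sum,
    Finsupp.finsetSum_apply]
  simp only [AddMonoidAlgebra.coeff_single, Finsupp.single_apply]
  rw [Finset.sum_ite_eq']
  split_ifs with h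
  · rfl
  · have : wtSpace P.H V n = ⊥ := by simpa using h
    rw [this]
    simp

theorem act_ch (hV : IsWeightModule P.H V) (w : P.weyl) : P.act w (ch P.H V) = ch P.H V := by
  refine AddMonoidAlgebra.ext (Finsupp.ext fun n => ?_)
  have h := coeff_act_apply (w : P.Wt ≃ₗ[ℂ] P.Wt) (ch P.H V)
    (((w⁻¹ : P.weyl) : P.Wt ≃ₗ[ℂ] P.Wt) n)
  rw [weyl_apply_inv_apply] at h
  rw [h, coeff_ch, coeff_ch, P.finrank_wtSpace_weyl hV]

end Trace

/-! ### The Weyl character formula -/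

section CharacterFormula

open AddMonoidAlgebra

variable {P}

theorem rootForm_weyl (w : P.weyl) (l m : P.Wt) :
    P.rootForm ((w : P.Wt ≃ₗ[ℂ] P.Wt) l) ((w : P.Wt ≃ₗ[ℂ] P.Wt) m) = P.rootForm l m := by
  induction w using P.weyl_induction with
  | one => rfl
  | mul a w ih => rw [weyl_mul_apply, weyl_mul_apply, sR_apply, sR_apply, P.rootForm_refl a.2, ih]

theorem rootForm_add_left (l l' m : P.Wt) :
    P.rootForm (l + l') m = P.rootForm l m + P.rootForm l' m := by
  simp only [rootForm, LinearMap.add_apply, add_mul, Finset.sum_add_distrib]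

theorem rootForm_add_right (l m m' : P.Wt) :
    P.rootForm l (m + m') = P.rootForm l m + P.rootForm l m' := by
  simp only [rootForm, LinearMap.add_apply, mul_add, Finset.sum_add_distrib]

variable {B₀ : Finset P.Wt} (hB₀ : P.IsBase P.evenRoots B₀)

include hB₀

theorem IsBase.sum_evenRoots {M : Type*} [AddCommMonoid M] (f : P.Wt → M) :
    ∑ a ∈ P.evenRoots, f a = ∑ a ∈ P.posEven B₀, (f a + f (-a)) := by
  classical
  have h : P.evenRoots = P.posEven B₀ ∪ (P.posEven B₀).image (fun a => -a) := by
    ext a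
    rw [Finset.mem_union, Finset.mem_image]
    constructor
    · intro ha
      rcases hB₀.pos_or_neg' ha with h | h
      · exact Or.inl h
      · exact Or.inr ⟨-a, h, neg_neg a⟩
    · rintro (h | ⟨b, hb, rfl⟩)
      · exact (mem_posEven.mp h).1
      · exact P.neg_mem_evenRoots (mem_posEven.mp hb).1
  rw [h, Finset.sum_union, Finset.sum_image (fun a _ b _ hab => neg_injective hab),
    Finset.sum_add_distrib]
  rw [Finset.disjoint_left]
  rintro a ha hna
  obtain ⟨b, hb, rfl⟩ := Finset.mem_image.mp hna
  exact hB₀.neg_notMem hb ha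

/-- Distinct regular dominant weights which are comparable have different norms. -/
theorem IsBase.eq_of_rootForm_eq {l m : P.Wt} (hl : l ∈ P.regularDominant B₀)
    (hm : m ∈ P.regularDominant B₀) (hlm : l - m ∈ AddSubmonoid.closure (B₀ : Set P.Wt))
    (h : P.rootForm l l = P.rootForm m m) : l = m := by
  obtain ⟨n, hn⟩ := exists_eq_sum hlm
  choose! N hN0 hN using fun b (hb : b ∈ B₀) => P.exists_rootForm_self_pos (hB₀.subset hb)
  choose! k hk0 hk using hB₀.mem_regularDominant_iff.mp hl
  choose! k' hk0' hk' using hB₀.mem_regularDominant_iff.mp hm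
  -- Equal norms make l - m orthogonal to l + m, while expanding l - m in simple roots gives
  -- nonnegative terms that are positive wherever the coefficient is.
  have h1 : P.rootForm (l - m) (l + m) = 0 := by
    have e : P.rootForm l (l + m) = P.rootForm (l - m) (l + m) + P.rootForm m (l + m) := by
      rw [← rootForm_add_left, sub_add_cancel]
    rw [rootForm_add_right, rootForm_add_right m, h, P.rootForm_comm l m] at e
    linear_combination -e
  have h2 : 2 * P.rootForm (l - m) (l + m) =
      ((∑ b ∈ B₀, n b * (N b * (k b + k' b)) : ℤ) : ℂ) := by
    rw [hn, rootForm_sum_left, Finset.mul_sum]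
    push_cast
    refine Finset.sum_congr rfl fun b hb => ?_
    have := P.two_mul_rootForm (hB₀.subset hb) (l + m)
    rw [hN b hb, LinearMap.add_apply, hk b hb, hk' b hb] at this
    linear_combination (n b : ℂ) * this
  rw [h1, mul_zero] at h2
  have h3 : ∑ b ∈ B₀, (n b : ℤ) * (N b * (k b + k' b)) = 0 := by exact_mod_cast h2.symm
  have hpos (b : P.Wt) (hb : b ∈ B₀) : 0 < N b * ((k b : ℤ) + k' b) := by
    have := hk0 b hb
    exact mul_pos (hN0 b hb) (by positivity)
  rw [Finset.sum_eq_zero_iff_of_nonneg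
    (fun b hb => mul_nonneg (Int.natCast_nonneg _) (hpos b hb).le)] at h3
  rw [← sub_eq_zero, hn]
  refine Finset.sum_eq_zero fun b hb => ?_
  have := (mul_eq_zero.mp (h3 b hb)).resolve_right (hpos b hb).ne'
  rw [Int.natCast_eq_zero.mp this, zero_smul]

variable {V : Type w} [AddCommGroup V] [Module ℂ V] [LieRingModule g₀ V] [LieModule ℂ g₀ V]
  {m : P.Wt} {v : V}

/-- In the pair of terms for ±a, one has a positive root vector acting first and kills v; the other
gives [x_a, y_a] v = t_a v. Summing over positive roots produces 2(ρ₀, m). -/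
theorem IsBase.casimir_apply_highest {r₀ : P.Wt} (hr₀ : P.IsWeylVector B₀ r₀)
    (hv : P.IsHighest B₀ m v) :
    P.casimir V v = (P.rootForm m m + 2 * P.rootForm r₀ m) • v := by
  rw [casimir, LinearMap.add_apply, LinearMap.sum_apply, LinearMap.sum_apply, add_smul,
    ← hB₀.sum_rootForm hr₀, rootForm, Finset.sum_smul, Finset.sum_smul]
  congr 1
  · refine Finset.sum_congr rfl fun b _ => ?_
    rw [Module.End.mul_apply, LieModule.toEnd_apply_apply, LieModule.toEnd_apply_apply, hv.mem,
      lie_smul, hv.mem, smul_smul]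
  · rw [hB₀.sum_evenRoots]
    refine Finset.sum_congr rfl fun a ha => ?_
    have har := (mem_posEven.mp ha).1
    simp only [LinearMap.smul_apply, Module.End.mul_apply, LieModule.toEnd_apply_apply]
    rw [hv.lie_eq_zero a ha (P.coVec (-a)) (by simpa using coVec_mem (P.neg_mem_evenRoots har)),
      lie_zero, smul_zero, add_zero, leibniz_lie, hv.lie_eq_zero a ha _ (rootVec_mem har),
      lie_zero, add_zero, lie_rootVec_coVec har, hv.mem, smul_smul, rootForm_comm,
      P.rootForm_eq_formRatio_mul har]
    rfl

theorem IsBase.casimir_eq_smul {r₀ : P.Wt} (hr₀ : P.IsWeylVector B₀ r₀)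
    (hv : P.IsHighest B₀ m v) (htop : hB₀.hwSub hv = ⊤) :
    P.casimir V = (P.rootForm m m + 2 * P.rootForm r₀ m) • LinearMap.id := by
  refine LinearMap.ext_on_range (hB₀.span_wordVec_eq_top hv htop) fun L => ?_
  induction L with
  | nil => exact hB₀.casimir_apply_highest hr₀ hv
  | cons a L ih =>
    have h := LinearMap.congr_fun (toEnd_mul_casimir (P := P) V (P.rootVec (-(a : P.Wt))))
      (wordVec v L)
    rw [Module.End.mul_apply, Module.End.mul_apply, ih] at h
    change P.casimir V (LieModule.toEnd ℂ g₀ V (P.rootVec (-(a : P.Wt))) (wordVec v L)) = _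
    rw [← h]
    simp only [LinearMap.smul_apply, LinearMap.id_apply, map_smul]
    rfl

theorem IsBase.hasTop_ch [FiniteDimensional ℂ V] (hv : P.IsHighest B₀ m v) (hv0 : v ≠ 0)
    (htop : hB₀.hwSub hv = ⊤) :
    HasTop (AddSubmonoid.closure (B₀ : Set P.Wt)) m 1 (ch P.H V) := by
  constructor
  · rw [coeff_ch, hB₀.wtSpace_top_eq hv htop, finrank_span_singleton hv0]
    rfl
  · intro n hn
    refine hB₀.sub_mem_of_generated hv htop fun h => hn ?_
    rw [coeff_ch, h]
    simp

/-- The product of the denominator with the character is an eigenvector of the Laplace operator. -/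
theorem IsBase.rootForm_mul_coeff [FiniteDimensional ℂ V] {r₀ : P.Wt} (hr₀ : P.IsWeylVector B₀ r₀)
    (hv : P.IsHighest B₀ m v) (htop : hB₀.hwSub hv = ⊤) (n : P.Wt) :
    P.rootForm n n * ((P.evenDen r₀ B₀ * ch P.H V).coeff n : ℤ) =
      P.rootForm (m + r₀) (m + r₀) * ((P.evenDen r₀ B₀ * ch P.H V).coeff n : ℤ) := by
  classical
  have hV := hB₀.isWeightModule_of_generated hv htop
  set φ := AddMonoidAlgebra.mapRingHom P.Wt (Int.castRingHom ℂ) with hφ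
  have hcoeff (f : AddMonoidAlgebra ℤ P.Wt) (n : P.Wt) : (φ f).coeff n = (f.coeff n : ℤ) := by
    rw [hφ, AddMonoidAlgebra.coeff_mapRingHom]; rfl
  -- The denominator formula puts the support of D₀ in the orbit of ρ₀, where the norm is constant.
  have hlap : lap (φ (P.evenDen r₀ B₀)) = P.rootForm r₀ r₀ • φ (P.evenDen r₀ B₀) := by
    ext n
    rw [lap, coeff_wmul, AddMonoidAlgebra.coeff_smul_apply, smul_eq_mul, hcoeff]
    by_cases h : (P.evenDen r₀ B₀).coeff n = 0
    · rw [h]; simp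
    · congr 1
      rw [hB₀.evenDen_eq_altSum hr₀, coeff_altSum] at h
      obtain ⟨w, -, hw⟩ := Finset.exists_ne_zero_of_sum_ne_zero h
      split_ifs at hw with h1
      · rw [← h1, rootForm_weyl]
      · exact absurd rfl hw
  have hsupp (a : P.Wt) : (Function.support fun n => P.formRatio a * rootTrace hV a n).Finite := by
    refine (finite_weights P.H V).subset fun n hn => ?_
    intro h
    apply hn
    simp only [rootTrace_eq_zero hV a h, mul_zero]
  -- T a collects the traces of x_a y_a on all weight spaces. Multiplying it by 1 - e^{-a} is the
  -- recursion `rootTrace_add`, and the Casimir trace on each weight space gives the last hypothesis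
  -- of `IsBase.lap_mul_eq`.
  let T : P.Wt → AddMonoidAlgebra ℂ P.Wt := fun a =>
    .ofCoeff (Finsupp.ofSupportFinite (fun n => P.formRatio a * rootTrace hV a n) (hsupp a))
  have hTc (a n : P.Wt) : (T a).coeff n = P.formRatio a * rootTrace hV a n := rfl
  have key := hB₀.lap_mul_eq hr₀ (D := φ (P.evenDen r₀ B₀)) (f := φ (ch P.H V))
    (c := P.rootForm m m + 2 * P.rootForm r₀ m) (T := T) ?_ hlap ?_ ?_
  · have h1 := congrArg (fun f => f.coeff n) key
    simp only [lap, coeff_wmul, AddMonoidAlgebra.coeff_smul_apply, smul_eq_mul] at h1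
    rw [← map_mul, hcoeff] at h1
    rw [h1]
    congr 1
    rw [rootForm_add_left, rootForm_add_right, rootForm_add_right, P.rootForm_comm m r₀]
    ring
  · rw [evenDen, map_mul, map_prod]
    simp [hφ]
  · intro a ha
    have har := (mem_posEven.mp ha).1
    ext n
    rw [mul_sub, mul_one, AddMonoidAlgebra.coeff_sub, Finsupp.sub_apply,
      AddMonoidAlgebra.coeff_mul_single_eq_coeff_mul (n + a)
        (fun k _ => by rw [← sub_eq_add_neg, sub_eq_iff_eq_add]),
      coeff_wmul, hTc, hTc, hcoeff, coeff_ch, rootTrace_add hV har, rootForm_comm,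
      P.rootForm_eq_formRatio_mul har]
    push_cast
    ring
  · ext n
    have h1 := trace_casimir_mul_wtProj hV n
    rw [hB₀.casimir_eq_smul hr₀ hv htop, smul_mul_assoc, map_smul,
      show (LinearMap.id : Module.End ℂ V) * wtProj hV n = wtProj hV n from rfl, trace_wtProj,
      hB₀.sum_evenRoots, smul_eq_mul] at h1
    rw [AddMonoidAlgebra.coeff_smul_apply, smul_eq_mul, hcoeff, coeff_ch, AddMonoidAlgebra.coeff_add,
      Finsupp.add_apply, lap, coeff_wmul, hcoeff, coeff_ch, AddMonoidAlgebra.coeff_sum,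
      Finsupp.finsetSum_apply]
    push_cast
    rw [h1]
    congr 1
    refine Finset.sum_congr rfl fun a ha => ?_
    have har := (mem_posEven.mp ha).1
    rw [formRatio_neg, rootTrace_neg hV har, two_mul, AddMonoidAlgebra.coeff_sub, Finsupp.sub_apply,
      AddMonoidAlgebra.coeff_add, Finsupp.add_apply, coeff_wmul, hTc, hcoeff, coeff_ch,
      rootForm_comm, P.rootForm_eq_formRatio_mul har]
    push_cast
    ring

/-- The Weyl character formula. -/
theorem IsBase.evenDen_mul_ch [FiniteDimensional ℂ V] {r₀ : P.Wt} (hr₀ : P.IsWeylVector B₀ r₀)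
    (hv : P.IsHighest B₀ m v) (hv0 : v ≠ 0) (htop : hB₀.hwSub hv = ⊤) :
    P.evenDen r₀ B₀ * ch P.H V = P.altSum (m + r₀) := by
  classical
  have hV := hB₀.isWeightModule_of_generated hv htop
  have hdom := hB₀.add_mem_regularDominant hr₀
    (fun b hb => hB₀.exists_nat_of_isHighest hv hv0 hb)
  have ht := (hB₀.hasTop_evenDen r₀).mul hB₀.pointed (hB₀.hasTop_ch hv hv0 htop)
  rw [add_comm r₀ m] at ht
  refine hB₀.anti_ext ((hB₀.isAnti_evenDen hr₀).mul_invariant (act_ch hV)) (isAnti_altSum _)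
    (fun n hn => hB₀.mem_integralWeights_of_hasTop ht hdom.1 hn)
    (fun n hn => mem_integralWeights_of_coeff_altSum hdom.1 hn) ?_
  intro n hn
  rw [hB₀.coeff_altSum_regularDominant hdom hn]
  split_ifs with h
  · rw [← h, ht.1, one_mul]
  · by_contra hne
    apply h
    -- A weight n in the support lies below m + ρ₀ and, by the Laplace eigenvalue equation, has the
    -- same norm; for regular dominant n this forces equality.
    refine hB₀.eq_of_rootForm_eq hdom hn (ht.2 n hne) ?_
    have h1 := hB₀.rootForm_mul_coeff hr₀ hv htop n
    exact (mul_right_cancel₀ (Int.cast_ne_zero.mpr hne) h1).symm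

end CharacterFormula

end BasicSuperalgebra

end KacWakimoto

namespace KacWakimoto

/-! ### Triangular decompositions -/

section Triangular

open LieSubalgebra

variable {A : Type*} [LieRing A] [LieAlgebra ℂ A] {ι : Type*} {T : Type*} [AddCommGroup T]
  [Module ℂ T]

theorem lie_cartan_mem_lieSpan {e : ι → A} {h : T →ₗ[ℂ] A} {α : ι → T → ℂ}
    (he : ∀ x i, ⁅h x, e i⁆ = α i x • e i) (x : T) {z : A}
    (hz : z ∈ lieSpan ℂ A (Set.range e)) : ⁅h x, z⁆ ∈ lieSpan ℂ A (Set.range e) := by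
  induction hz using lieSpan_induction with
  | mem y hy =>
    obtain ⟨i, rfl⟩ := hy
    rw [he]
    exact LieSubalgebra.smul_mem _ _ (subset_lieSpan ⟨i, rfl⟩)
  | zero => rw [lie_zero]; exact zero_mem _
  | add y z _ _ hy hz => rw [lie_add]; exact add_mem hy hz
  | smul c y _ hy => rw [lie_smul]; exact LieSubalgebra.smul_mem _ _ hy
  | lie y z hy' hz' hy hz =>
    rw [leibniz_lie]
    exact add_mem (lie_mem _ hy hz') (lie_mem _ hy' hz)

/-- On generators the bracket lands in the Cartan part, which normalizes the subalgebra generated by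
the raising operators; the Leibniz rule propagates this. -/
theorem lie_lowering_mem_lieSpan {e f : ι → A} {h : T →ₗ[ℂ] A} {α : ι → T → ℂ} {c : ι → T}
    [DecidableEq ι] (he : ∀ x i, ⁅h x, e i⁆ = α i x • e i)
    (hfe : ∀ i j, ⁅f i, e j⁆ = if i = j then h (c i) else 0) (i : ι) {z : A}
    (hz : z ∈ lieSpan ℂ A (Set.range e)) :
    ⁅f i, z⁆ ∈ (lieSpan ℂ A (Set.range e)).toSubmodule ⊔ LinearMap.range h := by
  set N := lieSpan ℂ A (Set.range e) with hN
  have key : ∀ w ∈ N.toSubmodule ⊔ LinearMap.range h, ∀ z ∈ N, ⁅w, z⁆ ∈ N := by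
    intro w hw z hz
    obtain ⟨a, ha, b, ⟨x, rfl⟩, rfl⟩ := Submodule.mem_sup.mp hw
    rw [add_lie]
    exact add_mem (lie_mem _ ha hz) (lie_cartan_mem_lieSpan he x hz)
  have hle : ∀ z ∈ N, z ∈ N.toSubmodule ⊔ LinearMap.range h :=
    fun z hz => Submodule.mem_sup_left hz
  induction hz using lieSpan_induction with
  | mem y hy =>
    obtain ⟨j, rfl⟩ := hy
    rw [hfe]
    split_ifs
    · exact Submodule.mem_sup_right ⟨_, rfl⟩
    · exact Submodule.zero_mem _
  | zero => rw [lie_zero]; exact Submodule.zero_mem _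
  | add y z _ _ hy hz => rw [lie_add]; exact Submodule.add_mem _ hy hz
  | smul c y _ hy => rw [lie_smul]; exact Submodule.smul_mem _ _ hy
  | lie y z hy' hz' hy hz =>
    rw [leibniz_lie]
    refine Submodule.add_mem _ (hle _ (key _ hy _ hz')) (hle _ ?_)
    rw [← lie_skew]
    exact neg_mem (key _ hz _ hy')

/-- The sum of the subalgebras generated by raising and by lowering operators and of the Cartan
operators. -/
def triangularSum (e f : ι → A) (h : T →ₗ[ℂ] A) : Submodule ℂ A :=
  (lieSpan ℂ A (Set.range f)).toSubmodule ⊔ LinearMap.range h ⊔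
    (lieSpan ℂ A (Set.range e)).toSubmodule

/-- The sum is stable under each generator, hence under the subalgebras they generate. Only the
relations between Cartan, raising and lowering generators enter, no Serre relations. -/
theorem lie_mem_triangularSum {e f : ι → A} {h : T →ₗ[ℂ] A} {α : ι → T → ℂ} {c : ι → T}
    [DecidableEq ι] (hh : ∀ x y, ⁅h x, h y⁆ = 0) (he : ∀ x i, ⁅h x, e i⁆ = α i x • e i)
    (hf : ∀ x i, ⁅h x, f i⁆ = -α i x • f i)
    (hef : ∀ i j, ⁅e i, f j⁆ = if i = j then h (c i) else 0) {y z : A}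
    (hy : y ∈ triangularSum e f h) (hz : z ∈ triangularSum e f h) :
    ⁅y, z⁆ ∈ triangularSum e f h := by
  have hfe (i j : ι) : ⁅f i, e j⁆ = if i = j then h (-c i) else 0 := by
    rw [← lie_skew, hef]
    by_cases hij : i = j
    · subst hij; simp
    · rw [if_neg hij, if_neg (Ne.symm hij), neg_zero]
  set S := triangularSum e f h with hS
  have h1 : (lieSpan ℂ A (Set.range f)).toSubmodule ⊔ LinearMap.range h ≤ S := le_sup_left
  have h2 : (lieSpan ℂ A (Set.range e)).toSubmodule ⊔ LinearMap.range h ≤ S :=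
    sup_le le_sup_right (le_sup_right.trans h1)
  have dec : ∀ z ∈ S, ∃ p ∈ lieSpan ℂ A (Set.range f), ∃ x, ∃ q ∈ lieSpan ℂ A (Set.range e),
      z = p + h x + q := by
    intro z hz
    obtain ⟨a, ha, q, hq, rfl⟩ := Submodule.mem_sup.mp hz
    obtain ⟨p, hp, b, ⟨x, rfl⟩, rfl⟩ := Submodule.mem_sup.mp ha
    exact ⟨p, hp, x, q, hq, rfl⟩
  have hN : ∀ p ∈ lieSpan ℂ A (Set.range f), p ∈ S := fun p hp => h1 (Submodule.mem_sup_left hp)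
  have hP : ∀ p ∈ lieSpan ℂ A (Set.range e), p ∈ S := fun p hp => h2 (Submodule.mem_sup_left hp)
  have hhS : ∀ x, ∀ z ∈ S, ⁅h x, z⁆ ∈ S := by
    intro x z hz
    obtain ⟨p, hp, y, q, hq, rfl⟩ := dec z hz
    rw [lie_add, lie_add, hh, add_zero]
    exact S.add_mem (hN _ (lie_cartan_mem_lieSpan (α := fun i x => -α i x) hf x hp))
      (hP _ (lie_cartan_mem_lieSpan he x hq))
  have heS : ∀ i, ∀ z ∈ S, ⁅e i, z⁆ ∈ S := by
    intro i z hz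
    obtain ⟨p, hp, y, q, hq, rfl⟩ := dec z hz
    rw [lie_add, lie_add, ← lie_skew (e i) (h y), he]
    exact S.add_mem (S.add_mem (h1 (lie_lowering_mem_lieSpan (α := fun i x => -α i x) hf hef i hp))
      (hP _ (neg_mem (LieSubalgebra.smul_mem _ _ (subset_lieSpan ⟨i, rfl⟩)))))
      (hP _ (lie_mem _ (subset_lieSpan ⟨i, rfl⟩) hq))
  have hfS : ∀ i, ∀ z ∈ S, ⁅f i, z⁆ ∈ S := by
    intro i z hz
    obtain ⟨p, hp, y, q, hq, rfl⟩ := dec z hz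
    rw [lie_add, lie_add, ← lie_skew (f i) (h y), hf]
    exact S.add_mem (S.add_mem (hN _ (lie_mem _ (subset_lieSpan ⟨i, rfl⟩) hp))
      (hN _ (neg_mem (LieSubalgebra.smul_mem _ _ (subset_lieSpan ⟨i, rfl⟩)))))
      (h2 (lie_lowering_mem_lieSpan he hfe i hq))
  have hspan : ∀ g : ι → A, (∀ i, ∀ z ∈ S, ⁅g i, z⁆ ∈ S) →
      ∀ y ∈ lieSpan ℂ A (Set.range g), ∀ z ∈ S, ⁅y, z⁆ ∈ S := by
    intro g hg y hy
    induction hy using lieSpan_induction with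
    | mem y hy => obtain ⟨i, rfl⟩ := hy; exact hg i
    | zero => intro z _; rw [zero_lie]; exact S.zero_mem
    | add x y _ _ hx hy => intro z hz; rw [add_lie]; exact S.add_mem (hx z hz) (hy z hz)
    | smul c y _ hy => intro z hz; rw [smul_lie]; exact S.smul_mem _ (hy z hz)
    | lie x y _ _ hx hy =>
      intro z hz
      rw [lie_lie]
      exact S.sub_mem (hx _ (hy z hz)) (hy _ (hx z hz))
  obtain ⟨p, hp, x, q, hq, rfl⟩ := dec y hy
  rw [add_lie, add_lie]
  exact S.add_mem (S.add_mem (hspan f hfS p hp z hz) (hhS x z hz)) (hspan e heS q hq z hz)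

end Triangular

end KacWakimoto

namespace KacWakimoto

namespace BasicSuperalgebra

variable {g₀ : Type u} [LieRing g₀] [LieAlgebra ℂ g₀] [FiniteDimensional ℂ g₀]
variable {g₁ : Type v} [AddCommGroup g₁] [Module ℂ g₁] [LieRingModule g₀ g₁] [LieModule ℂ g₀ g₁]
  [FiniteDimensional ℂ g₁]
variable (P : BasicSuperalgebra g₀ g₁)

/-! ### Existence of highest weight modules -/

section Existence

variable {P} {B₀ : Finset P.Wt}

/-- The free module on the words in the simple roots. -/
abbrev WordModule (B₀ : Finset P.Wt) : Type _ := List B₀ →₀ ℂ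

/-- The weight of a word. -/
def listWt (m : P.Wt) (L : List B₀) : P.Wt := m - (L.map Subtype.val).sum

/-- The lowering operators. -/
noncomputable def opF (b : B₀) : Module.End ℂ (WordModule B₀) :=
  Finsupp.lmapDomain ℂ ℂ (List.cons b)

/-- The operators of the Cartan subalgebra. -/
noncomputable def opH (m : P.Wt) : P.H →ₗ[ℂ] Module.End ℂ (WordModule B₀) where
  toFun x := Finsupp.linearCombination ℂ fun L => listWt m L x • Finsupp.single L 1
  map_add' x y := by
    ext L : 2
    simp [add_smul]
  map_smul' c x := by
    ext L : 2
    simp [mul_smul]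

open scoped Classical in
/-- The image of a word under a raising operator. -/
noncomputable def wordE (m : P.Wt) (c : B₀) : List B₀ → WordModule B₀
  | [] => 0
  -- Forced by e_c f_b = f_b e_c + δ_{cb} h_c, with e_c killing the empty word.
  | b :: L => opF b (wordE m c L) +
      if c = b then listWt m L (P.cor c) • Finsupp.single L 1 else 0

/-- The raising operators. -/
noncomputable def opE (m : P.Wt) (c : B₀) : Module.End ℂ (WordModule B₀) :=
  Finsupp.linearCombination ℂ (wordE m c)

theorem opF_single (b : B₀) (L : List B₀) :
    opF b (Finsupp.single L 1) = Finsupp.single (b :: L) (1 : ℂ) := by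
  rw [opF, Finsupp.lmapDomain_apply, Finsupp.mapDomain_single]

theorem opH_single (m : P.Wt) (x : P.H) (L : List B₀) :
    opH m x (Finsupp.single L 1) = listWt m L x • Finsupp.single L (1 : ℂ) := by
  simp [opH]

theorem opE_single (m : P.Wt) (c : B₀) (L : List B₀) :
    opE m c (Finsupp.single L 1) = wordE m c L := by
  simp [opE]

theorem wordModule_hom_ext {M : Type*} [AddCommGroup M] [Module ℂ M] {φ ψ : WordModule B₀ →ₗ[ℂ] M}
    (h : ∀ L : List B₀, φ (Finsupp.single L 1) = ψ (Finsupp.single L 1)) : φ = ψ :=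
  Finsupp.lhom_ext' fun L => LinearMap.ext_ring (h L)

theorem listWt_cons (m : P.Wt) (b : B₀) (L : List B₀) :
    listWt m (b :: L) = listWt m L - b := by
  rw [listWt, listWt, List.map_cons, List.sum_cons]; abel

theorem opH_opH (m : P.Wt) (x y : P.H) :
    opH (B₀ := B₀) m x * opH m y - opH m y * opH m x = 0 := by
  refine wordModule_hom_ext fun L => ?_
  simp only [LinearMap.sub_apply, Module.End.mul_apply, opH_single, map_smul, LinearMap.zero_apply]
  rw [smul_comm, sub_self]

theorem opH_opF (m : P.Wt) (x : P.H) (b : B₀) :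
    opH m x * opF b - opF b * opH m x = -(b : P.Wt) x • opF b := by
  refine wordModule_hom_ext fun L => ?_
  simp only [LinearMap.sub_apply, Module.End.mul_apply, opH_single, opF_single, map_smul,
    LinearMap.smul_apply, listWt_cons, sub_smul]
  module

theorem opE_opF [DecidableEq B₀] (m : P.Wt) (c b : B₀) :
    opE m c * opF b - opF b * opE m c = if c = b then opH m (P.cor c) else 0 := by
  refine wordModule_hom_ext fun L => ?_
  simp only [LinearMap.sub_apply, Module.End.mul_apply, opF_single, opE_single, wordE]
  rw [add_sub_cancel_left]
  split_ifs
  · rw [opH_single]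
  · rfl

/-- A raising operator adds c to the weight of a word, by induction on the word from its recursive
definition. -/
theorem opH_opE (m : P.Wt) (x : P.H) (c : B₀) :
    opH m x * opE m c - opE m c * opH m x = (c : P.Wt) x • opE m c := by
  classical
  have key (L : List B₀) : opH m x (wordE m c L) = (listWt m L x + (c : P.Wt) x) • wordE m c L := by
    induction L with
    | nil => simp [wordE]
    | cons b L ih =>
      have h1 : opH m x (opF b (wordE m c L)) =
          opF b (opH m x (wordE m c L)) - (b : P.Wt) x • opF b (wordE m c L) := by
        have := LinearMap.congr_fun (opH_opF m x b) (wordE m c L)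
        simp only [LinearMap.sub_apply, Module.End.mul_apply, LinearMap.smul_apply] at this
        rw [sub_eq_iff_eq_add] at this
        rw [this]
        module
      rw [wordE, map_add, h1, ih, map_smul, listWt_cons, LinearMap.sub_apply]
      split_ifs with h
      · subst h
        rw [map_smul, opH_single]
        module
      · rw [map_zero]
        module
  refine wordModule_hom_ext fun L => ?_
  simp only [LinearMap.sub_apply, Module.End.mul_apply, opH_single, opE_single, map_smul,
    LinearMap.smul_apply, key]
  module

/-- The span of the nonempty words. -/
noncomputable def augmentation (B₀ : Finset P.Wt) : Submodule ℂ (WordModule B₀) :=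
  LinearMap.ker (Finsupp.lapply [])

theorem opF_mem (b : B₀) (t : WordModule B₀) : opF b t ∈ augmentation B₀ := by
  rw [augmentation, LinearMap.mem_ker, Finsupp.lapply_apply, opF, Finsupp.lmapDomain_apply]
  refine Finsupp.mapDomain_of_notMem_range _ _ ?_
  rintro ⟨L, hL⟩
  exact List.cons_ne_nil _ _ hL

variable (hB₀ : P.IsBase P.evenRoots B₀)

include hB₀

theorem IsBase.sub_notMem {b c : P.Wt} (hb : b ∈ B₀) (hc : c ∈ B₀) (hbc : b ≠ c) :
    b - c ∉ P.evenRoots := by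
  have key : ∀ b ∈ B₀, ∀ c ∈ B₀, b ≠ c → b - c ∉ AddSubmonoid.closure (B₀ : Set P.Wt) := by
    classical
    intro b hb c hc hbc h
    obtain ⟨φ, hφ⟩ := exists_functional hB₀.linearIndependent (fun x => if x = c then 1 else 0)
    obtain ⟨n, hn⟩ := exists_nat_apply (φ := φ)
      (fun x hx => by
        rw [hφ x hx]
        split_ifs
        · exact ⟨1, by simp⟩
        · exact ⟨0, by simp⟩) h
    rw [map_sub, hφ b hb, hφ c hc, if_neg hbc, if_pos rfl] at hn
    have : ((n + 1 : ℕ) : ℂ) = 0 := by push_cast; rw [← hn]; ring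
    exact absurd (Nat.cast_eq_zero.mp this) (Nat.succ_ne_zero n)
  intro h
  rcases hB₀.pos_or_neg _ h with h | h
  · exact key b hb c hc hbc h
  · rw [neg_sub] at h
    exact key c hc b hb (Ne.symm hbc) h

theorem IsBase.exists_simple_vectors : ∃ e f : B₀ → g₀,
    (∀ b : B₀, e b ∈ wtSpace P.H g₀ b) ∧ (∀ b : B₀, f b ∈ wtSpace P.H g₀ (-(b : P.Wt))) ∧
    (∀ b, e b ≠ 0) ∧ (∀ b, f b ≠ 0) ∧ ∀ b, ⁅e b, f b⁆ = (P.cor b : g₀) := by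
  have h (b : B₀) := P.exists_isSl2Triple' (hB₀.subset b.2)
  choose e he f hf t using h
  exact ⟨e, f, he, hf, fun b => (t b).e_ne_zero, fun b => (t b).f_ne_zero, fun b => (t b).lie_e_f⟩

/-- The root spaces of the positive roots are generated by those of the simple roots. -/
theorem IsBase.root_space_le {A : LieSubalgebra ℂ g₀} {ε : ℤ} (hε : ε = 1 ∨ ε = -1)
    (hA : ∀ b ∈ B₀, ∀ x ∈ wtSpace P.H g₀ (ε • b), x ∈ A) {a : P.Wt} (ha : a ∈ P.posEven B₀) :
    ∀ x ∈ wtSpace P.H g₀ (ε • a), x ∈ A := by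
  have hroot (a : P.Wt) (ha : a ∈ P.evenRoots) : ε • a ∈ P.evenRoots := by
    rcases hε with rfl | rfl
    · rwa [one_smul]
    · rw [neg_smul, one_smul]; exact P.neg_mem_evenRoots ha
  refine hB₀.induction_add (p := fun a => ∀ x ∈ wtSpace P.H g₀ (ε • a), x ∈ A) hA ?_ ha
  intro a ha b hb hab ih x hx
  have har := (mem_posEven.mp ha).1
  have hbr := hB₀.subset hb
  obtain ⟨y, hy, hy0⟩ := (Submodule.ne_bot_iff _).mp (P.mem_evenRoots.mp (hroot a har)).2
  obtain ⟨z, hz, hz0⟩ := (Submodule.ne_bot_iff _).mp (P.mem_evenRoots.mp (hroot b hbr)).2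
  have h1 := hroot _ hab
  rw [smul_add] at h1 hx
  -- The bracket of nonzero vectors of weights b and a is nonzero whenever b + a is a root, so it
  -- spans the one-dimensional root space.
  obtain ⟨c, rfl⟩ := P.exists_eq_smul_of_mem_root_space h1 (lie_mem_wtSpace hz hy)
    (P.lie_ne_zero_of_add_mem (hroot b hbr) (hroot a har) h1 hz hz0 hy hy0) hx
  exact A.smul_mem _ (A.lie_mem (hA b hb z hz) (ih y hy))

end Existence

/-! ### From the module of words to a highest weight module of 𝔤₀. -/

section Existence

variable {P} {B₀ : Finset P.Wt} (hB₀ : P.IsBase P.evenRoots B₀)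

/-- The sum of the weight spaces of nonzero weights in `C`. -/
def nilSum (P : BasicSuperalgebra g₀ g₁) (C : AddSubmonoid P.Wt) : Submodule ℂ g₀ :=
  ⨆ (k : P.Wt) (_ : k ∈ C ∧ k ≠ 0), wtSpace P.H g₀ k

theorem mem_nilSum {C : AddSubmonoid P.Wt} {k : P.Wt} (hk : k ∈ C) (hk0 : k ≠ 0) {x : g₀}
    (hx : x ∈ wtSpace P.H g₀ k) : x ∈ nilSum P C :=
  (le_iSup₂_of_le (f := fun (k : P.Wt) (_ : k ∈ C ∧ k ≠ 0) => wtSpace P.H g₀ k) k ⟨hk, hk0⟩ le_rfl)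
    hx

theorem nilSum_induction {C : AddSubmonoid P.Wt} {p : g₀ → Prop}
    (mem : ∀ k ∈ C, k ≠ 0 → ∀ x ∈ wtSpace P.H g₀ k, p x) (zero : p 0)
    (add : ∀ x y, p x → p y → p (x + y)) {x : g₀} (hx : x ∈ nilSum P C) : p x := by
  refine Submodule.iSup_induction _ (motive := p) hx (fun k x hx => ?_) zero add
  by_cases hk : k ∈ C ∧ k ≠ 0
  · rw [iSup_pos hk] at hx
    exact mem k hk.1 hk.2 x hx
  · rw [iSup_neg hk, Submodule.mem_bot] at hx
    rwa [hx]

theorem lie_mem_nilSum {C : AddSubmonoid P.Wt} (hC : ∀ x ∈ C, -x ∈ C → x = 0) {x y : g₀}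
    (hx : x ∈ nilSum P C) (hy : y ∈ nilSum P C) : ⁅x, y⁆ ∈ nilSum P C := by
  refine nilSum_induction (p := fun x => ⁅x, y⁆ ∈ nilSum P C) ?_ ?_ ?_ hx
  · intro k hk hk0 x hx
    refine nilSum_induction (p := fun y => ⁅x, y⁆ ∈ nilSum P C) ?_ ?_ ?_ hy
    · intro l hl hl0 y hy
      refine mem_nilSum (C.add_mem hk hl) ?_ (lie_mem_wtSpace hx hy)
      intro h
      exact hk0 (hC k hk ((neg_eq_of_add_eq_zero_right h).symm ▸ hl))
    · rw [lie_zero]; exact Submodule.zero_mem _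
    · intro a b ha hb; rw [lie_add]; exact Submodule.add_mem _ ha hb
  · rw [zero_lie]; exact Submodule.zero_mem _
  · intro a b ha hb; rw [add_lie]; exact Submodule.add_mem _ ha hb

include hB₀

open LieSubalgebra in
/-- An extension of the even part acting on the module of words, whose kernel preserves the
augmentation submodule. -/
theorem IsBase.exists_extension (m : P.Wt) {e f : B₀ → g₀}
    (he : ∀ b : B₀, e b ∈ wtSpace P.H g₀ b) (hf : ∀ b : B₀, f b ∈ wtSpace P.H g₀ (-(b : P.Wt)))
    (hef : ∀ b, ⁅e b, f b⁆ = (P.cor b : g₀)) :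
    ∃ S : Submodule ℂ (Module.End ℂ (WordModule B₀) × g₀),
      (∀ y ∈ S, ∀ z ∈ S, (y.1 * z.1 - z.1 * y.1, ⁅y.2, z.2⁆) ∈ S) ∧
      (∀ b, (opE m b, e b) ∈ S) ∧ (∀ b, (opF b, f b) ∈ S) ∧ (∀ x : P.H, (opH m x, (x : g₀)) ∈ S) ∧
      ∀ X, (X, 0) ∈ S → X (Finsupp.single [] 1) ∈ augmentation B₀ := by
  classical
  let _ : LieRing (Module.End ℂ (WordModule B₀)) := LieRing.ofAssociativeRing
  have hbr (y z : Module.End ℂ (WordModule B₀) × g₀) :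
      ⁅y, z⁆ = (y.1 * z.1 - z.1 * y.1, ⁅y.2, z.2⁆) := rfl
  -- The operators on words need not satisfy the Serre relations, so they do not define an action of
  -- 𝔤₀. Each is paired with the element it should represent, and the pairs (X, 0) in the resulting
  -- subalgebra measure the failure.
  let E : B₀ → Module.End ℂ (WordModule B₀) × g₀ := fun b => (opE m b, e b)
  let F : B₀ → Module.End ℂ (WordModule B₀) × g₀ := fun b => (opF b, f b)
  let K : P.H →ₗ[ℂ] Module.End ℂ (WordModule B₀) × g₀ :=
    (opH m).prod P.H.toSubmodule.subtype
  have hKH (x y : P.H) : ⁅K x, K y⁆ = 0 := by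
    rw [hbr]
    exact Prod.ext (opH_opH m x y) (P.lie_coe_coe x y)
  have hKE (x : P.H) (b : B₀) : ⁅K x, E b⁆ = (b : P.Wt) x • E b := by
    rw [hbr]
    exact Prod.ext (opH_opE m x b) (he b x)
  have hKF (x : P.H) (b : B₀) : ⁅K x, F b⁆ = -(b : P.Wt) x • F b := by
    rw [hbr]
    exact Prod.ext (opH_opF m x b) (hf b x)
  have hEF (b c : B₀) : ⁅E b, F c⁆ = if b = c then K (P.cor b) else 0 := by
    rw [hbr]
    refine Prod.ext ?_ ?_
    · refine (opE_opF m b c).trans ?_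
      split_ifs <;> rfl
    · change ⁅e b, f c⁆ = _
      split_ifs with h
      · subst h
        exact hef b
      · have hne : (b : P.Wt) ≠ c := fun h' => h (Subtype.ext h')
        refine eq_zero_of_mem_wtSpace_of_notMem (P := P) (hB₀.sub_notMem b.2 c.2 hne)
          (sub_ne_zero.mpr hne) ?_
        rw [sub_eq_add_neg]
        exact lie_mem_wtSpace (he b) (hf c)
  have hb0 (b : B₀) : (b : P.Wt) ≠ 0 := (P.mem_evenRoots.mp (hB₀.subset b.2)).1
  have hbC (b : B₀) : (b : P.Wt) ∈ AddSubmonoid.closure (B₀ : Set P.Wt) :=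
    AddSubmonoid.subset_closure b.2
  set C := AddSubmonoid.closure (B₀ : Set P.Wt) with hC
  let C' : AddSubmonoid P.Wt := C.comap (-AddMonoidHom.id P.Wt)
  have hC' : ∀ x ∈ C', -x ∈ C' → x = 0 := by
    intro x hx hx'
    have := hB₀.pointed (-x) hx hx'
    exact neg_eq_zero.mp this
  have hpos : ∀ z ∈ lieSpan ℂ _ (Set.range E),
      z.1 (Finsupp.single [] 1) = 0 ∧ z.2 ∈ nilSum P C := by
    intro z hz
    induction hz using lieSpan_induction with
    | mem z hz =>
      obtain ⟨b, rfl⟩ := hz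
      exact ⟨opE_single m b [], mem_nilSum (hbC b) (hb0 b) (he b)⟩
    | zero => exact ⟨rfl, Submodule.zero_mem _⟩
    | add y z _ _ hy hz =>
      refine ⟨?_, Submodule.add_mem _ hy.2 hz.2⟩
      rw [Prod.fst_add, LinearMap.add_apply, hy.1, hz.1, add_zero]
    | smul c y _ hy =>
      refine ⟨?_, Submodule.smul_mem _ _ hy.2⟩
      rw [Prod.smul_fst, LinearMap.smul_apply, hy.1, smul_zero]
    | lie y z _ _ hy hz =>
      rw [hbr]
      refine ⟨?_, lie_mem_nilSum hB₀.pointed hy.2 hz.2⟩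
      rw [LinearMap.sub_apply, Module.End.mul_apply, Module.End.mul_apply, hy.1, hz.1, map_zero,
        map_zero, sub_zero]
  have hneg : ∀ z ∈ lieSpan ℂ _ (Set.range F),
      (∀ t, z.1 t ∈ augmentation B₀) ∧ z.2 ∈ nilSum P C' := by
    intro z hz
    induction hz using lieSpan_induction with
    | mem z hz =>
      obtain ⟨b, rfl⟩ := hz
      refine ⟨opF_mem b, mem_nilSum ?_ (neg_ne_zero.mpr (hb0 b)) (hf b)⟩
      change - -(b : P.Wt) ∈ C
      rw [neg_neg]
      exact hbC b
    | zero => exact ⟨fun t => Submodule.zero_mem _, Submodule.zero_mem _⟩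
    | add y z _ _ hy hz =>
      exact ⟨fun t => Submodule.add_mem _ (hy.1 t) (hz.1 t), Submodule.add_mem _ hy.2 hz.2⟩
    | smul c y _ hy =>
      exact ⟨fun t => Submodule.smul_mem _ _ (hy.1 t), Submodule.smul_mem _ _ hy.2⟩
    | lie y z _ _ hy hz =>
      exact ⟨fun t => Submodule.sub_mem _ (hy.1 _) (hz.1 _), lie_mem_nilSum hC' hy.2 hz.2⟩
  refine ⟨triangularSum E F K, ?_, ?_, ?_, ?_, ?_⟩
  · intro y hy z hz
    exact lie_mem_triangularSum (α := fun (b : B₀) (x : P.H) => (b : P.Wt) x)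
      (c := fun b : B₀ => P.cor b) hKH hKE hKF hEF hy hz
  · exact fun b => Submodule.mem_sup_right (subset_lieSpan ⟨b, rfl⟩)
  · exact fun b => Submodule.mem_sup_left (Submodule.mem_sup_left (subset_lieSpan ⟨b, rfl⟩))
  · exact fun x => Submodule.mem_sup_left (Submodule.mem_sup_right ⟨x, rfl⟩)
  · intro X hX
    obtain ⟨a, ha, q, hq, haq⟩ := Submodule.mem_sup.mp hX
    obtain ⟨p, hp, k, ⟨x, rfl⟩, rfl⟩ := Submodule.mem_sup.mp ha
    obtain ⟨hq1, hq2⟩ := hpos q hq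
    obtain ⟨hp1, hp2⟩ := hneg p hp
    have h2 : p.2 + (x : g₀) + q.2 = 0 := congrArg Prod.snd haq
    have h1 : p.1 + opH m x + q.1 = X := congrArg Prod.fst haq
    -- The second components have negative, zero and positive weights and sum to zero, so the Cartan
    -- part vanishes. The raising part kills the empty word, and the lowering part sends it to
    -- nonempty words.
    have hx0 : x = 0 := by
      have hle (D : AddSubmonoid P.Wt) : nilSum P D ≤ ⨆ (k) (_ : k ≠ 0), wtSpace P.H g₀ k :=
        iSup₂_le fun k hk => le_iSup₂_of_le k hk.2 le_rfl
      have hx' : (x : g₀) ∈ ⨆ (k) (_ : k ≠ 0), wtSpace P.H g₀ k := by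
        have : (x : g₀) = -(p.2 + q.2) := by
          rw [eq_neg_iff_add_eq_zero, ← h2]; abel
        rw [this]
        exact Submodule.neg_mem _ (Submodule.add_mem _ (hle _ hp2) (hle _ hq2))
      exact Subtype.ext (Submodule.disjoint_def.mp (iSupIndep_wtSpace P.H g₀ 0) _
        (P.coe_mem_wtSpace_zero x) hx')
    rw [← h1, hx0, map_zero, add_zero, LinearMap.add_apply, hq1, add_zero]
    exact hp1 _

/-- There is a nonzero vector of any given highest weight in some module. -/
theorem IsBase.exists_highest_module (m : P.Wt) :
    ∃ (M : Type u) (_ : AddCommGroup M) (_ : Module ℂ M) (_ : LieRingModule g₀ M)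
      (_ : LieModule ℂ g₀ M) (v : M), P.IsHighest B₀ m v ∧ v ≠ 0 := by
  obtain ⟨e, f, he, hf, he0, hf0, hef⟩ := hB₀.exists_simple_vectors
  obtain ⟨S, hS, hE, hF, hK, haug⟩ := hB₀.exists_extension m he hf hef
  -- Extended from the empty word by X f_b t = [X, f_b] t + f_b X t: the commutator is again paired
  -- with 0, and f_b produces only nonempty words.
  have hI : ∀ (t : WordModule B₀) X, (X, 0) ∈ S → X t ∈ augmentation B₀ := by
    intro t
    induction t using Finsupp.induction_linear with
    | zero => intro X _; rw [map_zero]; exact Submodule.zero_mem _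
    | add s t hs ht =>
      intro X hX
      rw [map_add]
      exact Submodule.add_mem _ (hs X hX) (ht X hX)
    | single L c =>
      intro X hX
      rw [← Finsupp.smul_single_one, map_smul]
      refine Submodule.smul_mem _ _ ?_
      induction L generalizing X with
      | nil => exact haug X hX
      | cons b L ih =>
        have h1 := hS _ hX _ (hF b)
        rw [zero_lie] at h1
        have h2 := Submodule.add_mem _ (ih _ h1) (opF_mem b (X (Finsupp.single L 1)))
        simpa [Module.End.mul_apply, opF_single] using h2
  -- Dividing by the images of all defects X makes the action of 𝔤₀ well defined. The empty word
  -- survives because R contains only combinations of nonempty words.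
  let R : Submodule ℂ (WordModule B₀) := Submodule.span ℂ {y | ∃ X t, (X, 0) ∈ S ∧ y = X t}
  have hRI : R ≤ augmentation B₀ := by
    rw [Submodule.span_le]
    rintro _ ⟨X, t, hX, rfl⟩
    exact hI t X hX
  have hR : ∀ y ∈ S, R ≤ R.comap y.1 := by
    intro y hy
    rw [Submodule.span_le]
    rintro _ ⟨X, t, hX, rfl⟩
    have h1 := hS _ hy _ hX
    rw [lie_zero] at h1
    have h2 := R.add_mem (Submodule.subset_span ⟨_, t, h1, rfl⟩)
      (Submodule.subset_span ⟨X, y.1 t, hX, rfl⟩)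
    change y.1 (X t) ∈ R
    simpa [Module.End.mul_apply] using h2
  have hsurj : Function.Surjective ((LinearMap.snd ℂ (Module.End ℂ (WordModule B₀)) g₀) ∘ₗ
      S.subtype) := by
    let A : LieSubalgebra ℂ g₀ :=
      { S.map (LinearMap.snd ℂ (Module.End ℂ (WordModule B₀)) g₀) with
        lie_mem' := by
          rintro _ _ ⟨y, hy, rfl⟩ ⟨z, hz, rfl⟩
          exact ⟨_, hS y hy z hz, rfl⟩ }
    have hA : ∀ x, x ∈ A := by
      refine root_induction (P := P) (fun x => ⟨_, hK x, rfl⟩) ?_ (fun x y hx hy => A.add_mem hx hy)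
      intro a ha z hz
      rcases hB₀.pos_or_neg' ha with h | h
      · refine hB₀.root_space_le (A := A) (ε := 1) (Or.inl rfl) ?_ h z (by rwa [one_smul])
        intro b hb x hx
        rw [one_smul] at hx
        obtain ⟨c, rfl⟩ := P.exists_eq_smul_of_mem_root_space (hB₀.subset hb) (he ⟨b, hb⟩)
          (he0 ⟨b, hb⟩) hx
        exact A.smul_mem _ ⟨_, hE ⟨b, hb⟩, rfl⟩
      · refine hB₀.root_space_le (A := A) (ε := -1) (Or.inr rfl) ?_ h z (by simpa using hz)
        intro b hb x hx
        rw [neg_smul, one_smul] at hx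
        obtain ⟨c, rfl⟩ := P.exists_eq_smul_of_mem_root_space (P.neg_mem_evenRoots (hB₀.subset hb))
          (hf ⟨b, hb⟩) (hf0 ⟨b, hb⟩) hx
        exact A.smul_mem _ ⟨_, hF ⟨b, hb⟩, rfl⟩
    intro x
    obtain ⟨y, hy, hyx⟩ := hA x
    exact ⟨⟨y, hy⟩, hyx⟩
  -- Any linear section will do: two lifts of the same element act identically modulo R.
  obtain ⟨s, hs⟩ := LinearMap.exists_rightInverse_of_surjective _
    (LinearMap.range_eq_top.mpr hsurj)
  have hs' (x : g₀) : (s x).1.2 = x := LinearMap.congr_fun hs x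
  have hdiff : ∀ y ∈ S, ∀ z ∈ S, y.2 = z.2 → ∀ t, y.1 t - z.1 t ∈ R := by
    intro y hy z hz hyz t
    have h1 : y + (-1 : ℂ) • z ∈ S := S.add_mem hy (S.smul_mem _ hz)
    have h2 : y + (-1 : ℂ) • z = (y.1 - z.1, 0) := by
      refine Prod.ext ?_ ?_
      · refine LinearMap.ext fun t => ?_
        change y.1 t + (-1 : ℂ) • z.1 t = y.1 t - z.1 t
        rw [neg_one_smul, sub_eq_add_neg]
      · rw [Prod.snd_add, Prod.smul_snd, neg_one_smul, hyz, add_neg_cancel]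
    rw [h2] at h1
    exact Submodule.subset_span ⟨_, t, h1, rfl⟩
  let ρ : g₀ → Module.End ℂ (WordModule B₀ ⧸ R) := fun x => R.mapQ R (s x).1.1 (hR _ (s x).2)
  have hρ (x : g₀) (t : WordModule B₀) : ρ x (R.mkQ t) = R.mkQ ((s x).1.1 t) := rfl
  have hρ' : ∀ y ∈ S, ∀ t, ρ y.2 (R.mkQ t) = R.mkQ (y.1 t) := by
    intro y hy t
    rw [hρ, ← sub_eq_zero, ← map_sub, Submodule.mkQ_apply, Submodule.Quotient.mk_eq_zero]
    exact hdiff _ (s y.2).2 _ hy (hs' _) t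
  let i1 : LieRingModule g₀ (WordModule B₀ ⧸ R) :=
    { bracket := fun x v => ρ x v
      add_lie := by
        intro x y v
        obtain ⟨t, rfl⟩ := R.mkQ_surjective v
        change ρ (x + y) (R.mkQ t) = ρ x (R.mkQ t) + ρ y (R.mkQ t)
        rw [hρ, hρ, hρ, map_add s, ← map_add R.mkQ]
        rfl
      lie_add := fun x v v' => map_add (ρ x) v v'
      leibniz_lie := by
        intro x y v
        obtain ⟨t, rfl⟩ := R.mkQ_surjective v
        have h1 := hρ' _ (hS _ (s x).2 _ (s y).2) t
        simp only [hs'] at h1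
        change ρ x (ρ y (R.mkQ t)) = ρ ⁅x, y⁆ (R.mkQ t) + ρ y (ρ x (R.mkQ t))
        rw [h1, hρ, hρ, hρ, hρ, ← map_add]
        congr 1
        simp [Module.End.mul_apply] }
  let i2 : LieModule ℂ g₀ (WordModule B₀ ⧸ R) :=
    { smul_lie := by
        intro c x v
        obtain ⟨t, rfl⟩ := R.mkQ_surjective v
        change ρ (c • x) (R.mkQ t) = c • ρ x (R.mkQ t)
        rw [hρ, hρ, map_smul s, ← map_smul R.mkQ]
        rfl
      lie_smul := fun c x v => map_smul (ρ x) c v }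
  have hact : ∀ y ∈ S, ∀ t, ⁅y.2, R.mkQ t⁆ = R.mkQ (y.1 t) := hρ'
  refine ⟨WordModule B₀ ⧸ R, inferInstance, inferInstance, i1, i2, R.mkQ (Finsupp.single [] 1),
    ⟨?_, ?_⟩, ?_⟩
  · intro x
    rw [hact _ (hK x), opH_single, map_smul, listWt, List.map_nil, List.sum_nil, sub_zero]
  · intro a ha x hx
    let A : LieSubalgebra ℂ g₀ :=
      { carrier := {x | ⁅x, R.mkQ (Finsupp.single [] 1)⁆ = 0}
        zero_mem' := zero_lie _
        add_mem' := by
          intro x y hx hy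
          change ⁅x + y, R.mkQ (Finsupp.single [] 1)⁆ = 0
          rw [add_lie, show ⁅x, R.mkQ (Finsupp.single [] 1)⁆ = 0 from hx,
            show ⁅y, R.mkQ (Finsupp.single [] 1)⁆ = 0 from hy, add_zero]
        smul_mem' := by
          intro c x hx
          change ⁅c • x, R.mkQ (Finsupp.single [] 1)⁆ = 0
          rw [smul_lie, show ⁅x, R.mkQ (Finsupp.single [] 1)⁆ = 0 from hx, smul_zero]
        lie_mem' := by
          intro x y hx hy
          change ⁅⁅x, y⁆, R.mkQ (Finsupp.single [] 1)⁆ = 0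
          rw [lie_lie, show ⁅x, R.mkQ (Finsupp.single [] 1)⁆ = 0 from hx,
            show ⁅y, R.mkQ (Finsupp.single [] 1)⁆ = 0 from hy, lie_zero, lie_zero, sub_zero] }
    refine hB₀.root_space_le (A := A) (ε := 1) (Or.inl rfl) ?_ ha x (by rwa [one_smul])
    intro b hb x hx
    rw [one_smul] at hx
    obtain ⟨c, rfl⟩ := P.exists_eq_smul_of_mem_root_space (hB₀.subset hb) (he ⟨b, hb⟩)
      (he0 ⟨b, hb⟩) hx
    refine A.smul_mem _ ?_
    change ⁅e ⟨b, hb⟩, R.mkQ (Finsupp.single [] 1)⁆ = 0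
    rw [hact _ (hE ⟨b, hb⟩), opE_single, wordE, map_zero]
  · intro h
    rw [Submodule.mkQ_apply, Submodule.Quotient.mk_eq_zero] at h
    have := hRI h
    rw [augmentation, LinearMap.mem_ker, Finsupp.lapply_apply, Finsupp.single_eq_same] at this
    exact one_ne_zero this

end Existence

end BasicSuperalgebra

end KacWakimoto

namespace KacWakimoto

/-! ### Modules over the universal enveloping algebra -/

section Enveloping

open UniversalEnvelopingAlgebra

variable {g : Type u} [LieRing g] [LieAlgebra ℂ g]

/-- The universal property lifts 𝔤 → S to an algebra map whose composite with the inclusion is the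
identity. -/
theorem mem_subalgebra_of_ι_mem (S : Subalgebra ℂ (UniversalEnvelopingAlgebra ℂ g))
    (h : ∀ x, ι ℂ x ∈ S) (y : UniversalEnvelopingAlgebra ℂ g) : y ∈ S := by
  let _ : LieRing (UniversalEnvelopingAlgebra ℂ g) := LieRing.ofAssociativeRing
  let _ : LieRing S := LieRing.ofAssociativeRing
  let φ : g →ₗ⁅ℂ⁆ S :=
    { toFun := fun x => ⟨ι ℂ x, h x⟩
      map_add' := fun x y => Subtype.ext (map_add (ι ℂ) x y)
      map_smul' := fun c x => Subtype.ext (map_smul (ι ℂ) c x)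
      map_lie' := fun {x y} => Subtype.ext (LieHom.map_lie (ι ℂ) x y) }
  have hid : S.val.comp (lift ℂ φ) = AlgHom.id ℂ _ := by
    refine UniversalEnvelopingAlgebra.hom_ext (R := ℂ) (LieHom.ext fun x => ?_)
    simp [φ]
  have := AlgHom.congr_fun hid y
  rw [AlgHom.id_apply] at this
  rw [← this]
  exact (lift ℂ φ y).2

variable {M : Type w} [AddCommGroup M] [Module ℂ M] [Module (UniversalEnvelopingAlgebra ℂ g) M]
  [IsScalarTower ℂ (UniversalEnvelopingAlgebra ℂ g) M] [LieRingModule g M] [LieModule ℂ g M]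

/-- A submodule over the enveloping algebra, as a Lie submodule. -/
def lieSubmoduleOf (hM : ∀ (x : g) (v : M), ⁅x, v⁆ = ι ℂ x • v)
    (N : Submodule (UniversalEnvelopingAlgebra ℂ g) M) : LieSubmodule ℂ g M where
  toSubmodule := N.restrictScalars ℂ
  lie_mem := by
    intro x v hv
    rw [hM]
    exact N.smul_mem _ hv

/-- A Lie submodule, as a submodule over the enveloping algebra. -/
def ueaSubmoduleOf (hM : ∀ (x : g) (v : M), ⁅x, v⁆ = ι ℂ x • v) (N : LieSubmodule ℂ g M) :
    Submodule (UniversalEnvelopingAlgebra ℂ g) M where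
  carrier := N
  zero_mem' := N.zero_mem
  add_mem' := N.add_mem
  smul_mem' := by
    intro y v hv
    let S : Subalgebra ℂ (UniversalEnvelopingAlgebra ℂ g) :=
      { carrier := {y | ∀ v ∈ N, y • v ∈ N}
        mul_mem' := by
          intro a b ha hb v hv
          rw [mul_smul]
          exact ha _ (hb v hv)
        add_mem' := by
          intro a b ha hb v hv
          rw [add_smul]
          exact N.add_mem (ha v hv) (hb v hv)
        algebraMap_mem' := by
          intro c v hv
          rw [algebraMap_smul]
          exact N.smul_mem c hv }
    refine mem_subalgebra_of_ι_mem S (fun x v hv => ?_) y v hv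
    rw [← hM]
    exact N.lie_mem hv

theorem mem_ueaSubmoduleOf (hM : ∀ (x : g) (v : M), ⁅x, v⁆ = ι ℂ x • v) (N : LieSubmodule ℂ g M)
    (v : M) : v ∈ ueaSubmoduleOf hM N ↔ v ∈ N := Iff.rfl

end Enveloping

/-! ### Quotients of weight modules -/

section Quotient

variable {g : Type u} [LieRing g] [LieAlgebra ℂ g] {H : LieSubalgebra ℂ g}
variable {V : Type w} [AddCommGroup V] [Module ℂ V] [LieRingModule g V] [LieModule ℂ g V]

theorem map_mem_wtSpace {V' : Type*} [AddCommGroup V'] [Module ℂ V'] [LieRingModule g V']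
    [LieModule ℂ g V'] (φ : V →ₗ⁅ℂ,g⁆ V') {n : Module.Dual ℂ H} {v : V} (hv : v ∈ wtSpace H V n) :
    φ v ∈ wtSpace H V' n := by
  intro x
  rw [← LieModuleHom.map_lie, hv x, map_smul]

theorem map_mem_iSup_wtSpace {V' : Type*} [AddCommGroup V'] [Module ℂ V'] [LieRingModule g V']
    [LieModule ℂ g V'] (φ : V →ₗ⁅ℂ,g⁆ V') {n : Module.Dual ℂ H} {v : V}
    (hv : v ∈ ⨆ (k) (_ : k ≠ n), wtSpace H V k) : φ v ∈ ⨆ (k) (_ : k ≠ n), wtSpace H V' k := by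
  refine Submodule.iSup_induction _ (motive := fun v => φ v ∈ ⨆ (k) (_ : k ≠ n), wtSpace H V' k)
    hv ?_ (by rw [map_zero]; exact Submodule.zero_mem _)
    (fun a b ha hb => by rw [map_add]; exact Submodule.add_mem _ ha hb)
  intro k v hv
  by_cases hk : k ≠ n
  · rw [iSup_pos hk] at hv
    exact (le_iSup₂_of_le (f := fun k (_ : k ≠ n) => wtSpace H V' k) k hk le_rfl)
      (map_mem_wtSpace φ hv)
  · rw [iSup_neg hk, Submodule.mem_bot] at hv
    rw [hv, map_zero]
    exact Submodule.zero_mem _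

/-- Lie submodules are graded by weights. -/
theorem mem_of_add_mem_of_wtSpace (N : LieSubmodule ℂ g V) {n : Module.Dual ℂ H} {y z : V}
    (hy : y ∈ wtSpace H V n) (hz : z ∈ ⨆ (k) (_ : k ≠ n), wtSpace H V k) (hyz : y + z ∈ N) :
    y ∈ N := by
  rw [← LieSubmodule.Quotient.mk_eq_zero' (N := N)]
  have h1 : LieSubmodule.Quotient.mk' N y ∈ wtSpace H (V ⧸ N) n := map_mem_wtSpace _ hy
  have h2 : LieSubmodule.Quotient.mk' N z ∈ ⨆ (k) (_ : k ≠ n), wtSpace H (V ⧸ N) k :=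
    map_mem_iSup_wtSpace _ hz
  have h3 : LieSubmodule.Quotient.mk' N y = -LieSubmodule.Quotient.mk' N z := by
    rw [eq_neg_iff_add_eq_zero, ← map_add]
    exact (LieSubmodule.Quotient.mk_eq_zero N).mpr hyz
  -- In V ⧸ N the image of y equals minus that of z, so it lies both in the weight space of n and in
  -- the sum of the others.
  refine Submodule.disjoint_def.mp (iSupIndep_wtSpace H (V ⧸ N) n) _ h1 ?_
  change LieSubmodule.Quotient.mk' N y ∈ _
  rw [h3]
  exact Submodule.neg_mem _ h2

theorem IsWeightModule.exists_add (hV : IsWeightModule H V) (n : Module.Dual ℂ H) (v : V) :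
    ∃ y ∈ wtSpace H V n, ∃ z ∈ ⨆ (k) (_ : k ≠ n), wtSpace H V k, y + z = v := by
  have h : (⊤ : Submodule ℂ V) ≤ wtSpace H V n ⊔ ⨆ (k) (_ : k ≠ n), wtSpace H V k := by
    rw [← show ⨆ n, wtSpace H V n = ⊤ from hV]
    refine iSup_le fun k => ?_
    by_cases hk : k = n
    · rw [hk]; exact le_sup_left
    · exact le_sup_of_le_right (le_iSup₂_of_le k hk le_rfl)
  obtain ⟨y, hy, z, hz, h⟩ := Submodule.mem_sup.mp (h (Submodule.mem_top (x := v)))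
  exact ⟨y, hy, z, hz, h⟩

end Quotient

end KacWakimoto

namespace KacWakimoto

namespace BasicSuperalgebra

variable {g₀ : Type u} [LieRing g₀] [LieAlgebra ℂ g₀] [FiniteDimensional ℂ g₀]
variable {g₁ : Type v} [AddCommGroup g₁] [Module ℂ g₁] [LieRingModule g₀ g₁] [LieModule ℂ g₀ g₁]
  [FiniteDimensional ℂ g₁]
variable (P : BasicSuperalgebra g₀ g₁)

/-! ### Verma modules and their simple quotients -/

section Simple

open UniversalEnvelopingAlgebra

instance (B₀ : Finset P.Wt) (m : P.Wt) : LieRingModule g₀ (P.Verma B₀ m) where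
  bracket x v := ι ℂ x • v
  add_lie x y v := by
    rw [map_add, add_smul]
  lie_add x v v' := smul_add _ _ _
  leibniz_lie x y v := by
    change ι ℂ x • ι ℂ y • v = ι ℂ ⁅x, y⁆ • v + ι ℂ y • ι ℂ x • v
    let _ : LieRing (UniversalEnvelopingAlgebra ℂ g₀) := LieRing.ofAssociativeRing
    rw [LieHom.map_lie, LieRing.of_associative_ring_bracket, sub_smul, mul_smul, mul_smul,
      sub_add_cancel]

instance (B₀ : Finset P.Wt) (m : P.Wt) : LieModule ℂ g₀ (P.Verma B₀ m) where
  smul_lie c x v := by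
    change ι ℂ (c • x) • v = c • ι ℂ x • v
    rw [map_smul, smul_assoc]
  lie_smul c x v := by
    change ι ℂ x • c • v = c • ι ℂ x • v
    exact smul_algebra_smul_comm _ _ _

variable {P} {B₀ : Finset P.Wt}

theorem verma_lie (m : P.Wt) (x : g₀) (v : P.Verma B₀ m) : ⁅x, v⁆ = ι ℂ x • v := rfl

theorem simple_lie (m : P.Wt) (x : g₀) (v : P.Simple B₀ m) : ⁅x, v⁆ = ι ℂ x • v := rfl

variable (B₀) in
/-- The canonical generator of the Verma module. -/
noncomputable def vermaVec (m : P.Wt) : P.Verma B₀ m := Submodule.Quotient.mk 1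

theorem smul_vermaVec (m : P.Wt) (y : UniversalEnvelopingAlgebra ℂ g₀) :
    y • vermaVec B₀ m = Submodule.Quotient.mk y := by
  rw [vermaVec, ← Submodule.Quotient.mk_smul, smul_eq_mul, mul_one]

theorem isHighest_vermaVec (m : P.Wt) : P.IsHighest B₀ m (vermaVec B₀ m) := by
  constructor
  · intro x
    rw [verma_lie, ← sub_eq_zero, ← algebraMap_smul (UniversalEnvelopingAlgebra ℂ g₀) (m x),
      ← sub_smul, smul_vermaVec, Submodule.Quotient.mk_eq_zero]
    exact Submodule.subset_span (Or.inr ⟨x, rfl⟩)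
  · intro a ha x hx
    rw [verma_lie, smul_vermaVec, Submodule.Quotient.mk_eq_zero]
    exact Submodule.subset_span (Or.inl ⟨a, ha, x, hx, rfl⟩)

theorem eq_top_of_vermaVec_mem {m : P.Wt}
    {N : Submodule (UniversalEnvelopingAlgebra ℂ g₀) (P.Verma B₀ m)} (h : vermaVec B₀ m ∈ N) :
    N = ⊤ := by
  rw [eq_top_iff]
  rintro v -
  obtain ⟨y, rfl⟩ := Submodule.Quotient.mk_surjective _ v
  rw [← smul_vermaVec]
  exact N.smul_mem y h

/-- The map from the Verma module determined by a highest weight vector. -/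
theorem exists_verma_hom {M : Type w} [AddCommGroup M] [Module ℂ M] [LieRingModule g₀ M]
    [LieModule ℂ g₀ M] {m : P.Wt} {v : M} (hv : P.IsHighest B₀ m v) :
    ∃ φ : P.Verma B₀ m →ₗ⁅ℂ,g₀⁆ M, φ (vermaVec B₀ m) = v := by
  let _ : LieRing (Module.End ℂ M) := LieRing.ofAssociativeRing
  let Φ : UniversalEnvelopingAlgebra ℂ g₀ →ₐ[ℂ] Module.End ℂ M :=
    UniversalEnvelopingAlgebra.lift ℂ (LieModule.toEnd ℂ g₀ M)
  have hΦ (x : g₀) (w : M) : Φ (ι ℂ x) w = ⁅x, w⁆ := by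
    have : Φ (ι ℂ x) = LieModule.toEnd ℂ g₀ M x := UniversalEnvelopingAlgebra.lift_ι_apply ℂ _ x
    rw [this, LieModule.toEnd_apply_apply]
  let ψ : UniversalEnvelopingAlgebra ℂ g₀ →ₗ[ℂ] M := (LinearMap.applyₗ v) ∘ₗ Φ.toLinearMap
  have hψ (y : UniversalEnvelopingAlgebra ℂ g₀) : ψ y = Φ y v := rfl
  have hker : (P.vermaIdeal B₀ m).restrictScalars ℂ ≤ LinearMap.ker ψ := by
    intro y hy
    rw [LinearMap.mem_ker, hψ]
    have hy' : y ∈ P.vermaIdeal B₀ m := hy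
    clear hy
    rw [vermaIdeal] at hy'
    induction hy' using Submodule.span_induction with
    | mem y hy =>
      rcases hy with ⟨a, ha, x, hx, rfl⟩ | ⟨x, rfl⟩
      · rw [hΦ, hv.lie_eq_zero a ha x hx]
      · rw [map_sub, LinearMap.sub_apply, hΦ, AlgHom.commutes, Module.algebraMap_end_apply,
          hv.mem x, sub_self]
    | zero => rw [map_zero, LinearMap.zero_apply]
    | add x y _ _ hx hy => rw [map_add, LinearMap.add_apply, hx, hy, add_zero]
    | smul c y _ hy => rw [smul_eq_mul, map_mul, Module.End.mul_apply, hy, map_zero]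
  let χ : P.Verma B₀ m →ₗ[ℂ] M := ((P.vermaIdeal B₀ m).restrictScalars ℂ).liftQ ψ hker
  have hχ (y : UniversalEnvelopingAlgebra ℂ g₀) : χ (Submodule.Quotient.mk y) = Φ y v := rfl
  refine ⟨{ χ with map_lie' := ?_ }, ?_⟩
  · intro x w
    obtain ⟨y, rfl⟩ := Submodule.Quotient.mk_surjective _ w
    change χ (ι ℂ x • Submodule.Quotient.mk y) = ⁅x, χ (Submodule.Quotient.mk y)⁆
    rw [← Submodule.Quotient.mk_smul, hχ, hχ, smul_eq_mul, map_mul, Module.End.mul_apply, hΦ]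
  · change χ (Submodule.Quotient.mk 1) = v
    rw [hχ, map_one, Module.End.one_apply]

variable (hB₀ : P.IsBase P.evenRoots B₀)

include hB₀

/-- The universal map to the module built from words sends the generator to a nonzero vector; this
takes the place of the Poincaré-Birkhoff-Witt theorem. -/
theorem IsBase.vermaVec_ne_zero (m : P.Wt) : vermaVec B₀ m ≠ 0 := by
  obtain ⟨M, _, _, _, _, v, hv, hv0⟩ := hB₀.exists_highest_module m
  obtain ⟨φ, hφ⟩ := exists_verma_hom hv
  intro h
  rw [h, map_zero] at hφ
  exact hv0 hφ.symm

theorem IsBase.hwSub_vermaVec (m : P.Wt) : hB₀.hwSub (isHighest_vermaVec (B₀ := B₀) m) = ⊤ := by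
  have h : ueaSubmoduleOf (verma_lie m) (hB₀.hwSub (isHighest_vermaVec (B₀ := B₀) m)) = ⊤ :=
    eq_top_of_vermaVec_mem (Submodule.subset_span ⟨[], rfl⟩)
  rw [eq_top_iff]
  rintro v -
  rw [← mem_ueaSubmoduleOf (verma_lie m), h]
  trivial

/-- Proper submodules of a Verma module do not meet the highest weight space. -/
theorem IsBase.le_iSup_of_ne_top {m : P.Wt}
    {N : Submodule (UniversalEnvelopingAlgebra ℂ g₀) (P.Verma B₀ m)} (hN : N ≠ ⊤)
    {v : P.Verma B₀ m} (hv : v ∈ N) : v ∈ ⨆ (k) (_ : k ≠ m), wtSpace P.H (P.Verma B₀ m) k := by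
  have htop := hB₀.hwSub_vermaVec m
  obtain ⟨y, hy, z, hz, rfl⟩ :=
    (hB₀.isWeightModule_of_generated (isHighest_vermaVec m) htop).exists_add m v
  -- The component of weight m of an element of N again lies in N; being a multiple of the
  -- generator, it must vanish if N is proper.
  have hyN : y ∈ N := mem_of_add_mem_of_wtSpace (lieSubmoduleOf (verma_lie m) N) hy hz hv
  rw [hB₀.wtSpace_top_eq (isHighest_vermaVec m) htop, Submodule.mem_span_singleton] at hy
  obtain ⟨c, rfl⟩ := hy
  by_cases hc : c = 0
  · rwa [hc, zero_smul, zero_add]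
  · exfalso
    apply hN
    refine eq_top_of_vermaVec_mem ?_
    have := N.smul_mem (algebraMap ℂ _ c⁻¹) hyN
    rwa [algebraMap_smul, smul_smul, inv_mul_cancel₀ hc, one_smul] at this

/-- Missing the top weight is preserved under sums, so the sum of all proper submodules is still
proper. -/
theorem IsBase.mem_iSup_of_mem_sSup {m : P.Wt} {v : P.Verma B₀ m}
    (hv : v ∈ sSup {N : Submodule (UniversalEnvelopingAlgebra ℂ g₀) (P.Verma B₀ m) | N ≠ ⊤}) :
    v ∈ ⨆ (k) (_ : k ≠ m), wtSpace P.H (P.Verma B₀ m) k := by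
  rw [sSup_eq_iSup'] at hv
  exact Submodule.iSup_induction _
    (motive := fun v => v ∈ ⨆ (k) (_ : k ≠ m), wtSpace P.H (P.Verma B₀ m) k) hv
    (fun N v hv => hB₀.le_iSup_of_ne_top N.2 hv) (Submodule.zero_mem _)
    (fun a b ha hb => Submodule.add_mem _ ha hb)

theorem IsBase.eq_zero_of_mem_iSup {V : Type w} [AddCommGroup V] [Module ℂ V] [LieRingModule g₀ V]
    [LieModule ℂ g₀ V] {m : P.Wt} {v : V} (hv : v ∈ wtSpace P.H V m)
    (hv' : v ∈ ⨆ (k) (_ : k ≠ m), wtSpace P.H V k) : v = 0 :=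
  Submodule.disjoint_def.mp (iSupIndep_wtSpace P.H V m) v hv hv'

omit hB₀ in
variable (B₀) in
/-- The projection of the Verma module onto its simple quotient. -/
noncomputable def vermaProj (m : P.Wt) :
    P.Verma B₀ m →ₗ[UniversalEnvelopingAlgebra ℂ g₀] P.Simple B₀ m :=
  Submodule.mkQ _

variable (B₀) in
/-- The highest weight vector of the simple module. -/
noncomputable def simpleVec (m : P.Wt) : P.Simple B₀ m := vermaProj B₀ m (vermaVec B₀ m)

omit hB₀ in
theorem vermaProj_surjective (m : P.Wt) : Function.Surjective (vermaProj B₀ m) :=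
  Submodule.mkQ_surjective _

omit hB₀ in
theorem isHighest_simpleVec (m : P.Wt) : P.IsHighest B₀ m (simpleVec B₀ m) := by
  have h := isHighest_vermaVec (B₀ := B₀) m
  constructor
  · intro x
    have h1 := h.mem x
    rw [simple_lie, simpleVec, ← map_smul, ← verma_lie, h1,
      ← algebraMap_smul (UniversalEnvelopingAlgebra ℂ g₀) (m x), map_smul, algebraMap_smul]
  · intro a ha x hx
    rw [simple_lie, simpleVec, ← map_smul, ← verma_lie, h.lie_eq_zero a ha x hx, map_zero]

theorem IsBase.simpleVec_ne_zero (m : P.Wt) : simpleVec B₀ m ≠ 0 := by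
  intro h
  have h1 : vermaVec B₀ m ∈
      sSup {N : Submodule (UniversalEnvelopingAlgebra ℂ g₀) (P.Verma B₀ m) | N ≠ ⊤} :=
    (Submodule.Quotient.mk_eq_zero _).mp h
  exact hB₀.vermaVec_ne_zero m
    (hB₀.eq_zero_of_mem_iSup (isHighest_vermaVec m).mem (hB₀.mem_iSup_of_mem_sSup h1))

/-- The preimage of a proper submodule is proper in the Verma module, hence contained in the sum
that was divided out. -/
theorem IsBase.isIrreducible_simple (m : P.Wt) :
    LieModule.IsIrreducible ℂ g₀ (P.Simple B₀ m) := by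
  have : Nontrivial (P.Simple B₀ m) := ⟨_, _, hB₀.simpleVec_ne_zero m⟩
  refine LieModule.IsIrreducible.mk fun N hN => ?_
  by_contra hne
  apply hN
  rw [eq_bot_iff]
  intro v hv
  obtain ⟨x, rfl⟩ := vermaProj_surjective m v
  let N' := (ueaSubmoduleOf (simple_lie m) N).comap (vermaProj B₀ m)
  have hN' : N' ≠ ⊤ := by
    intro h
    apply hne
    rw [eq_top_iff]
    rintro y -
    obtain ⟨z, rfl⟩ := vermaProj_surjective m y
    have : z ∈ N' := h ▸ trivial
    exact this
  have hx : x ∈ sSup {N : Submodule (UniversalEnvelopingAlgebra ℂ g₀) (P.Verma B₀ m) | N ≠ ⊤} :=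
    (le_sSup (show N' ∈ {N | N ≠ ⊤} from hN')) hv
  have : vermaProj B₀ m x = 0 := (Submodule.Quotient.mk_eq_zero _).mpr hx
  rw [this]
  exact (LieSubmodule.mem_bot _).mpr rfl

theorem IsBase.hwSub_simpleVec (m : P.Wt) : hB₀.hwSub (isHighest_simpleVec (B₀ := B₀) m) = ⊤ := by
  have := hB₀.isIrreducible_simple m
  exact hB₀.hwSub_eq_top (isHighest_simpleVec m) (hB₀.simpleVec_ne_zero m)

/-- An irreducible module of highest weight `m` is isomorphic to `L(m)`. -/
theorem IsBase.nonempty_simple_equiv {V : Type w} [AddCommGroup V] [Module ℂ V]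
    [LieRingModule g₀ V] [LieModule ℂ g₀ V] [LieModule.IsIrreducible ℂ g₀ V] {m : P.Wt} {v : V}
    (hv : P.IsHighest B₀ m v) (hv0 : v ≠ 0) : Nonempty (V ≃ₗ⁅ℂ,g₀⁆ P.Simple B₀ m) := by
  obtain ⟨φ, hφ⟩ := exists_verma_hom hv
  have hle : ∀ x ∈ sSup {N : Submodule (UniversalEnvelopingAlgebra ℂ g₀) (P.Verma B₀ m) | N ≠ ⊤},
      φ x = 0 := by
    intro x hx
    rw [sSup_eq_iSup'] at hx
    refine Submodule.iSup_induction _ (motive := fun x => φ x = 0) hx ?_ (map_zero φ)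
      (fun a b ha hb => by rw [map_add, ha, hb, add_zero])
    rintro ⟨N, hN⟩ x hx
    -- By irreducibility a proper N maps to zero or onto V. In the latter case v would be the image
    -- of a vector without component of weight m.
    rcases eq_bot_or_eq_top ((lieSubmoduleOf (verma_lie m) N).map φ) with h | h
    · have : φ x ∈ (lieSubmoduleOf (verma_lie m) N).map φ := LieSubmodule.mem_map_of_mem hx
      rw [h] at this
      exact (LieSubmodule.mem_bot _).mp this
    · exfalso
      have hvm : v ∈ (lieSubmoduleOf (verma_lie m) N).map φ := h ▸ LieSubmodule.mem_top v
      obtain ⟨y, hy, hyv⟩ := (LieSubmodule.mem_map v).mp hvm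
      refine hv0 (hB₀.eq_zero_of_mem_iSup hv.mem ?_)
      rw [← hyv]
      exact map_mem_iSup_wtSpace φ (hB₀.le_iSup_of_ne_top hN hy)
  let χ : P.Simple B₀ m →ₗ[ℂ] V := Submodule.liftQ (Submodule.restrictScalars ℂ
    (sSup {N : Submodule (UniversalEnvelopingAlgebra ℂ g₀) (P.Verma B₀ m) | N ≠ ⊤}))
    (φ : P.Verma B₀ m →ₗ[ℂ] V) hle
  have hχ (x : P.Verma B₀ m) : χ (vermaProj B₀ m x) = φ x := rfl
  let ψ : P.Simple B₀ m →ₗ⁅ℂ,g₀⁆ V :=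
    { χ with
      map_lie' := by
        intro x w
        obtain ⟨y, rfl⟩ := vermaProj_surjective m w
        change χ (ι ℂ x • vermaProj B₀ m y) = ⁅x, χ (vermaProj B₀ m y)⁆
        rw [← map_smul, hχ, hχ, ← verma_lie, LieModuleHom.map_lie] }
  have hψ : ψ (simpleVec B₀ m) = v := hφ
  have := hB₀.isIrreducible_simple m
  have hinj : Function.Injective ψ := by
    rw [← LieModuleHom.ker_eq_bot]
    refine (eq_bot_or_eq_top ψ.ker).resolve_right fun h => hv0 ?_
    have : simpleVec B₀ m ∈ ψ.ker := h ▸ LieSubmodule.mem_top _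
    rw [LieModuleHom.mem_ker, hψ] at this
    exact this
  have hsurj : Function.Surjective ψ := by
    rw [← LieModuleHom.range_eq_top]
    refine (eq_bot_or_eq_top ψ.range).resolve_left fun h => hv0 ?_
    have : v ∈ ψ.range := (LieModuleHom.mem_range ψ v).mpr ⟨_, hψ⟩
    rw [h] at this
    exact (LieSubmodule.mem_bot _).mp this
  let E := Equiv.ofBijective ψ ⟨hinj, hsurj⟩
  exact ⟨LieModuleEquiv.symm { ψ with
    invFun := E.symm
    left_inv := E.left_inv
    right_inv := E.right_inv }⟩

end Simple

/-! ### Finite-dimensionality of simple modules with dominant highest weight -/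

section Finite

variable {P}
variable {V : Type w} [AddCommGroup V] [Module ℂ V] [LieRingModule g₀ V] [LieModule ℂ g₀ V]

/-- If `f` is locally nilpotent on `v` and `ad f` is nilpotent on `x`, then `f` is locally nilpotent
on `⁅x, v⁆`. -/
theorem exists_toEnd_pow_lie_eq_zero (f : g₀) (i j : ℕ) (x : g₀) (v : V)
    (hx : (LieModule.toEnd ℂ g₀ g₀ f ^ i) x = 0) (hv : (LieModule.toEnd ℂ g₀ V f ^ j) v = 0) :
    ∃ n, (LieModule.toEnd ℂ g₀ V f ^ n) ⁅x, v⁆ = 0 := by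
  generalize hN : i + j = N
  induction N generalizing i j x v with
  | zero =>
    obtain rfl : i = 0 := by omega
    rw [pow_zero, Module.End.one_apply] at hx
    exact ⟨0, by rw [hx, zero_lie, map_zero]⟩
  | succ N ih =>
    rcases i with _ | i
    · rw [pow_zero, Module.End.one_apply] at hx
      exact ⟨0, by rw [hx, zero_lie, map_zero]⟩
    rcases j with _ | j
    · rw [pow_zero, Module.End.one_apply] at hv
      exact ⟨0, by rw [hv, lie_zero, map_zero]⟩
    -- Leibniz: f [x, v] = [[f, x], v] + [x, f v], and each term lowers one of the two nilpotency
    -- orders.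
    obtain ⟨p, hp⟩ := ih i (j + 1) ⁅f, x⁆ v (by
      rwa [_root_.pow_succ, Module.End.mul_apply, LieModule.toEnd_apply_apply] at hx) hv (by omega)
    obtain ⟨q, hq⟩ := ih (i + 1) j x ⁅f, v⁆ hx (by
      rwa [_root_.pow_succ, Module.End.mul_apply, LieModule.toEnd_apply_apply] at hv) (by omega)
    refine ⟨p + q + 1, ?_⟩
    rw [_root_.pow_succ, Module.End.mul_apply, LieModule.toEnd_apply_apply, leibniz_lie, map_add,
      pow_add, Module.End.mul_apply _ _ ⁅x, ⁅f, v⁆⁆, hq, map_zero, add_zero, ← pow_add, add_comm,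
      pow_add, Module.End.mul_apply, hp, map_zero]

/-- Local nilpotency of an ad-nilpotent element on one nonzero vector of an irreducible module
extends to the whole module. -/
theorem exists_toEnd_pow_eq_zero_of_irreducible [LieModule.IsIrreducible ℂ g₀ V] {f : g₀}
    (hf : IsNilpotent (LieModule.toEnd ℂ g₀ g₀ f)) {v : V} (hv0 : v ≠ 0) {k : ℕ}
    (hv : (LieModule.toEnd ℂ g₀ V f ^ k) v = 0) (u : V) :
    ∃ n, (LieModule.toEnd ℂ g₀ V f ^ n) u = 0 := by
  obtain ⟨i, hi⟩ := hf
  let N : LieSubmodule ℂ g₀ V :=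
    { carrier := {u | ∃ n, (LieModule.toEnd ℂ g₀ V f ^ n) u = 0}
      zero_mem' := ⟨0, map_zero _⟩
      add_mem' := by
        rintro a b ⟨p, hp⟩ ⟨q, hq⟩
        refine ⟨p + q, ?_⟩
        rw [map_add, pow_add, Module.End.mul_apply _ _ b, hq, map_zero, add_zero, ← pow_add,
          add_comm, pow_add, Module.End.mul_apply, hp, map_zero]
      smul_mem' := by
        rintro c a ⟨p, hp⟩
        exact ⟨p, by rw [map_smul, hp, smul_zero]⟩
      lie_mem := by
        rintro x u ⟨j, hj⟩
        exact exists_toEnd_pow_lie_eq_zero f i j x u (by rw [hi, LinearMap.zero_apply]) hj }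
  have hN : N = ⊤ := (eq_bot_or_eq_top N).resolve_left fun h => hv0 (by
    have : v ∈ N := ⟨k, hv⟩
    rw [h] at this
    exact (LieSubmodule.mem_bot v).mp this)
  have : u ∈ N := hN ▸ LieSubmodule.mem_top u
  exact this

/-- Root strings of weights: the reflected weight occurs. -/
theorem wtSpace_sub_ne_bot {h : P.H} {e f : g₀} (t : IsSl2Triple (h : g₀) e f) {a n : P.Wt}
    (he : e ∈ wtSpace P.H g₀ a) (hf : f ∈ wtSpace P.H g₀ (-a))
    (hnil : ∀ u : V, ∃ i, (LieModule.toEnd ℂ g₀ V e ^ i) u = 0) {k : ℕ} (hk : n h = k)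
    (hn : wtSpace P.H V n ≠ ⊥) : wtSpace P.H V (n - k • a) ≠ ⊥ := by
  obtain ⟨v, hv, hv0⟩ := (Submodule.ne_bot_iff _).mp hn
  obtain ⟨i, hi, hi'⟩ := Nat.exists_not_and_succ_of_not_zero_of_exists
    (p := fun n => (LieModule.toEnd ℂ g₀ V e ^ n) v = 0) (by simpa using hv0) (hnil v)
  set u := (LieModule.toEnd ℂ g₀ V e ^ i) v with hu
  have hp : t.HasPrimitiveVectorWith u ((k : ℂ) + 2 * i) := by
    refine ⟨hi, ?_, ?_⟩
    · rw [← hk]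
      exact t.lie_h_pow_toEnd_e (hv _) i
    · rwa [hu, IsSl2Triple.lie_e_pow_toEnd_e]
  have hne : ∀ j ≤ k + 2 * i, (LieModule.toEnd ℂ g₀ V f ^ j) u ≠ 0 := by
    intro j
    induction j with
    | zero => intro _; simpa using hi
    | succ j ih =>
      intro hj h0
      have h1 := hp.lie_e_pow_succ_toEnd_f j
      rw [h0, lie_zero] at h1
      rcases smul_eq_zero.mp h1.symm with h2 | h2
      · rcases mul_eq_zero.mp h2 with h3 | h3
        · exact Nat.cast_add_one_ne_zero j h3
        · have : ((k + 2 * i : ℕ) : ℂ) = j := by push_cast; linear_combination h3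
          have : k + 2 * i = j := by exact_mod_cast this
          omega
      · exact ih (by omega) h2
  -- The primitive vector u = e^i v has h-eigenvalue k + 2i, so f^{k+i} u ≠ 0; its weight is n + i a
  -- - (k + i) a = n - k a.
  refine (Submodule.ne_bot_iff _).mpr ⟨_, ?_, hne (k + i) (by omega)⟩
  have := toEnd_pow_mem_wtSpace hf (toEnd_pow_mem_wtSpace he hv i) (k + i)
  rwa [show n + i • a + (k + i) • -a = n - k • a by
    rw [smul_neg, add_smul]; abel] at this

variable {B₀ : Finset P.Wt} (hB₀ : P.IsBase P.evenRoots B₀) {m : P.Wt} {v : V}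

include hB₀

/-- Otherwise f^{k+1} v would be another highest weight vector, generating V by irreducibility, and
the larger weight m could not occur below its weight. -/
theorem IsBase.toEnd_pow_eq_zero [LieModule.IsIrreducible ℂ g₀ V] (hv : P.IsHighest B₀ m v)
    (hv0 : v ≠ 0) {b : P.Wt} (hb : b ∈ B₀) {e f : g₀} (he : e ∈ wtSpace P.H g₀ b)
    (hf : f ∈ wtSpace P.H g₀ (-b)) (t : IsSl2Triple (P.cor b : g₀) e f) {k : ℕ}
    (hk : m (P.cor b) = k) : (LieModule.toEnd ℂ g₀ V f ^ (k + 1)) v = 0 := by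
  by_contra hu0
  set u := (LieModule.toEnd ℂ g₀ V f ^ (k + 1)) v with hu
  have humem : u ∈ wtSpace P.H V (m + (k + 1) • -b) := toEnd_pow_mem_wtSpace hf hv.mem _
  have hp : t.HasPrimitiveVectorWith v (k : ℂ) :=
    ⟨hv0, hk ▸ hv.mem _, hv.lie_eq_zero b (hB₀.mem_posEven_of_mem hb) e he⟩
  let A : LieSubalgebra ℂ g₀ :=
    { carrier := {x | ⁅x, u⁆ = 0}
      zero_mem' := zero_lie u
      add_mem' := by
        intro x y hx hy
        change ⁅x + y, u⁆ = 0
        rw [add_lie, show ⁅x, u⁆ = 0 from hx, show ⁅y, u⁆ = 0 from hy, add_zero]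
      smul_mem' := by
        intro c x hx
        change ⁅c • x, u⁆ = 0
        rw [smul_lie, show ⁅x, u⁆ = 0 from hx, smul_zero]
      lie_mem' := by
        intro x y hx hy
        change ⁅⁅x, y⁆, u⁆ = 0
        rw [lie_lie, show ⁅x, u⁆ = 0 from hx, show ⁅y, u⁆ = 0 from hy, lie_zero, lie_zero, sub_zero] }
  have hA : ∀ c ∈ B₀, ∀ x ∈ wtSpace P.H g₀ ((1 : ℤ) • c), x ∈ A := by
    intro c hc x hx
    rw [one_smul] at hx
    change ⁅x, u⁆ = 0
    by_cases hcb : c = b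
    · subst hcb
      obtain ⟨d, rfl⟩ := P.exists_eq_smul_of_mem_root_space (hB₀.subset hc) he t.e_ne_zero hx
      rw [smul_lie, hu, hp.lie_e_pow_succ_toEnd_f k, sub_self, mul_zero, zero_smul, smul_zero]
    · have hxf : ⁅x, f⁆ = 0 := by
        have h1 := lie_mem_wtSpace hx hf
        rw [← sub_eq_add_neg] at h1
        exact eq_zero_of_mem_wtSpace_of_notMem (hB₀.sub_notMem hc hb hcb) (sub_ne_zero.mpr hcb) h1
      have : ∀ j, ⁅x, (LieModule.toEnd ℂ g₀ V f ^ j) v⁆ = 0 := by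
        intro j
        induction j with
        | zero =>
          rw [pow_zero, Module.End.one_apply]
          exact hv.lie_eq_zero c (hB₀.mem_posEven_of_mem hc) x hx
        | succ j ih =>
          rw [_root_.pow_succ', Module.End.mul_apply, LieModule.toEnd_apply_apply, leibniz_lie, hxf,
            zero_lie, ih, lie_zero, add_zero]
      exact this _
  have huh : P.IsHighest B₀ (m + (k + 1) • -b) u := by
    refine ⟨humem, fun a ha x hx => ?_⟩
    exact hB₀.root_space_le (Or.inl rfl) hA ha x (by rwa [one_smul])
  have hm : wtSpace P.H V m ≠ ⊥ := (Submodule.ne_bot_iff _).mpr ⟨v, hv.mem, hv0⟩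
  have h1 := hB₀.sub_mem_of_generated huh (hB₀.hwSub_eq_top huh hu0) hm
  rw [smul_neg, add_sub_cancel_left] at h1
  have h2 := hB₀.pointed _ (AddSubmonoid.nsmul_mem _ (AddSubmonoid.subset_closure hb) (k + 1)) h1
  rw [← Nat.cast_smul_eq_nsmul ℂ, smul_eq_zero] at h2
  rcases h2 with h2 | h2
  · exact Nat.cast_ne_zero.mpr (Nat.succ_ne_zero k) h2
  · exact (P.mem_evenRoots.mp (hB₀.subset hb)).1 h2

/-- The sum is fixed by all reflections and lies in the span of the roots. -/
theorem IsBase.sum_weyl_eq_zero {x : P.Wt} (hx : x ∈ AddSubmonoid.closure (B₀ : Set P.Wt)) :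
    ∑ w : P.weyl, (w : P.Wt ≃ₗ[ℂ] P.Wt) x = 0 := by
  refine P.eq_zero_of_forall_cor_eq_zero (Submodule.sum_mem _ fun w _ => ?_) fun a ha => ?_
  · have hspan : x ∈ Submodule.span ℂ (P.evenRoots : Set P.Wt) := by
      induction hx using AddSubmonoid.closure_induction with
      | mem x hx => exact Submodule.subset_span (hB₀.subset hx)
      | zero => exact Submodule.zero_mem _
      | add x y _ _ hx hy => exact Submodule.add_mem _ hx hy
    have := Submodule.add_mem _ (P.weyl_apply_sub_mem_span w x) hspan
    rwa [sub_add_cancel] at this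
  · set y := ∑ w : P.weyl, (w : P.Wt ≃ₗ[ℂ] P.Wt) x with hy
    have h1 : (P.sR ⟨a, ha⟩ : P.Wt ≃ₗ[ℂ] P.Wt) y = y := by
      rw [hy, map_sum]
      exact Fintype.sum_equiv (Equiv.mulLeft (P.sR ⟨a, ha⟩)) _ _ fun w => rfl
    rw [sR_apply, refl_apply, sub_eq_self, smul_eq_zero] at h1
    exact h1.resolve_right (P.mem_evenRoots.mp ha).1

omit hB₀ in
theorem finite_of_htFun_le (hB : LinearIndependent ℂ (fun a : B₀ => (a : P.Wt))) (K : ℕ) :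
    {x : P.Wt | x ∈ AddSubmonoid.closure (B₀ : Set P.Wt) ∧
      ∃ n ≤ K, htFun hB x = (n : ℕ)}.Finite := by
  refine (Set.finite_range fun n : B₀ → Fin (K + 1) => ∑ b : B₀, (n b : ℕ) • (b : P.Wt)).subset ?_
  rintro x ⟨hx, n, hn, hxn⟩
  obtain ⟨c, rfl⟩ := exists_eq_sum hx
  have hsum : ∑ b ∈ B₀, c b = n := by
    rw [map_sum] at hxn
    have : (((∑ b ∈ B₀, c b : ℕ)) : ℂ) = n := by
      rw [← hxn, Nat.cast_sum]
      refine Finset.sum_congr rfl fun b hb => ?_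
      rw [map_nsmul, htFun_apply hB hb, nsmul_one]
    exact_mod_cast this
  have hle (b : B₀) : c b < K + 1 := by
    have := Finset.single_le_sum (f := c) (fun _ _ => Nat.zero_le _) b.2
    omega
  refine ⟨fun b => ⟨c b, hle b⟩, ?_⟩
  exact Finset.sum_coe_sort B₀ fun b => c b • b

/-! ### Weyl symmetry and boundedness of the weights for dominant highest weight. -/

section Dominant

variable [LieModule.IsIrreducible ℂ g₀ V] (hv : P.IsHighest B₀ m v) (hv0 : v ≠ 0)
  (hm : ∀ b ∈ B₀, ∃ k : ℕ, m (P.cor b) = k)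

include hv hv0 hm

theorem IsBase.wtSpace_refl_ne_bot {n : P.Wt} (hn : wtSpace P.H V n ≠ ⊥) {b : P.Wt} (hb : b ∈ B₀) :
    wtSpace P.H V (P.refl b n) ≠ ⊥ := by
  obtain ⟨e, he, f, hf, t⟩ := P.exists_isSl2Triple' (hB₀.subset hb)
  have hb0 := (P.mem_evenRoots.mp (hB₀.subset hb)).1
  obtain ⟨k, hk⟩ := hm b hb
  have henil : ∀ u : V, ∃ i, (LieModule.toEnd ℂ g₀ V e ^ i) u = 0 :=
    exists_toEnd_pow_eq_zero_of_irreducible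
      (isNilpotent_toEnd_of_mem_wtSpace P.weight_even hb0 he) hv0 (k := 1) (by
        rw [pow_one, LieModule.toEnd_apply_apply]
        exact hv.lie_eq_zero b (hB₀.mem_posEven_of_mem hb) e he)
  have hfnil : ∀ u : V, ∃ i, (LieModule.toEnd ℂ g₀ V f ^ i) u = 0 :=
    exists_toEnd_pow_eq_zero_of_irreducible
      (isNilpotent_toEnd_of_mem_wtSpace P.weight_even (neg_ne_zero.mpr hb0) hf) hv0
      (hB₀.toEnd_pow_eq_zero hv hv0 hb he hf t hk)
  have hmi : m ∈ P.integralWeights := hB₀.mem_integralWeights_iff.mpr fun b hb => by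
    obtain ⟨k, hk⟩ := hm b hb
    exact ⟨k, by rw [hk]; simp⟩
  have hni : n ∈ P.integralWeights := by
    have h1 := hB₀.closure_mem_integralWeights
      (hB₀.sub_mem_of_generated hv (hB₀.hwSub_eq_top hv hv0) hn)
    have := hB₀.sub_mem_integralWeights hmi h1
    rwa [sub_sub_cancel] at this
  obtain ⟨z, hz⟩ := hB₀.mem_integralWeights_iff.mp hni b hb
  rw [refl_apply, hz]
  rcases Int.eq_nat_or_neg z with ⟨j, rfl | rfl⟩
  · have := wtSpace_sub_ne_bot t he hf henil (k := j) (by rw [hz]; simp) hn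
    rwa [← Nat.cast_smul_eq_nsmul ℂ] at this
  -- A negative pairing is treated with the opposite triple (-h, f, e) and the root -b.
  · have h1 : (-(P.cor b : g₀)) = ((-P.cor b : P.H) : g₀) := rfl
    have := wtSpace_sub_ne_bot (h := -P.cor b) (a := -b) t.symm hf (by rwa [neg_neg]) hfnil (k := j)
      (by rw [map_neg, hz]; simp) hn
    rw [← Nat.cast_smul_eq_nsmul ℂ] at this
    convert this using 2
    push_cast
    rw [neg_smul, smul_neg]

theorem IsBase.wtSpace_weyl_ne_bot {n : P.Wt} (hn : wtSpace P.H V n ≠ ⊥) (w : P.weyl) :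
    wtSpace P.H V ((w : P.Wt ≃ₗ[ℂ] P.Wt) n) ≠ ⊥ := by
  induction w using hB₀.weyl_induction with
  | one => exact hn
  | mul b hb w ih =>
    rw [weyl_mul_apply, sR_apply]
    exact hB₀.wtSpace_refl_ne_bot hv hv0 hm ih hb

/-- An irreducible module with dominant integral highest weight is finite-dimensional. -/
theorem IsBase.finiteDimensional_of_dominant : FiniteDimensional ℂ V := by
  have htop := hB₀.hwSub_eq_top hv hv0
  set ht := htFun hB₀.linearIndependent with hht
  have hsub {n : P.Wt} (hn : wtSpace P.H V n ≠ ⊥) (w : P.weyl) :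
      m - (w : P.Wt ≃ₗ[ℂ] P.Wt) n ∈ AddSubmonoid.closure (B₀ : Set P.Wt) :=
    hB₀.sub_mem_of_generated hv htop (hB₀.wtSpace_weyl_ne_bot hv hv0 hm hn w)
  have hm0 : wtSpace P.H V m ≠ ⊥ := (Submodule.ne_bot_iff _).mpr ⟨v, hv.mem, hv0⟩
  -- The W-average of m - n vanishes, so the sum over w of m - wn does not depend on n. Every
  -- summand lies in the positive cone, so the height of m - n is bounded by a constant.
  have hsum {n : P.Wt} (hn : wtSpace P.H V n ≠ ⊥) :
      ∑ w : P.weyl, (m - (w : P.Wt ≃ₗ[ℂ] P.Wt) n) =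
        ∑ w : P.weyl, (m - (w : P.Wt ≃ₗ[ℂ] P.Wt) m) := by
    rw [Finset.sum_sub_distrib, Finset.sum_sub_distrib]
    congr 1
    have h1 := hB₀.sum_weyl_eq_zero (hsub hn 1)
    simp only [map_sub, Finset.sum_sub_distrib] at h1
    exact (sub_eq_zero.mp h1).symm
  choose K hK using fun w => exists_htFun_eq_nat hB₀.linearIndependent (hsub hm0 w)
  have hfin : {n : P.Wt | wtSpace P.H V n ≠ ⊥}.Finite := by
    refine ((finite_of_htFun_le hB₀.linearIndependent (∑ w, K w)).preimage
      (f := fun n => m - n) (fun a _ b _ h => sub_right_injective h)).subset ?_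
    intro n hn
    choose N hN using fun w => exists_htFun_eq_nat hB₀.linearIndependent (hsub hn w)
    have h1 : ∑ w, N w = ∑ w, K w := by
      have := congrArg ht (hsum hn)
      rw [map_sum, map_sum] at this
      simp only [hht, hN, hK] at this
      exact_mod_cast this
    refine ⟨hsub hn 1, N 1, ?_, hN 1⟩
    rw [← h1]
    exact Finset.single_le_sum (f := N) (fun _ _ => Nat.zero_le _) (Finset.mem_univ 1)
  have : Finite {n : P.Wt | wtSpace P.H V n ≠ ⊥} := hfin
  have hfd (n : {n : P.Wt | wtSpace P.H V n ≠ ⊥}) : FiniteDimensional ℂ (wtSpace P.H V n) :=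
    hB₀.finiteDimensional_wtSpace hv htop n
  have htop' : ⨆ n : {n : P.Wt | wtSpace P.H V n ≠ ⊥}, wtSpace P.H V n = ⊤ := by
    rw [eq_top_iff, ← show ⨆ n, wtSpace P.H V n = ⊤ from hB₀.isWeightModule_of_generated hv htop]
    refine iSup_le fun n => ?_
    by_cases hn : wtSpace P.H V n = ⊥
    · rw [hn]; exact bot_le
    · exact le_iSup (fun n : {n : P.Wt | wtSpace P.H V n ≠ ⊥} => wtSpace P.H V n) ⟨n, hn⟩
  have hfd' := Submodule.finiteDimensional_iSup
    (fun n : {n : P.Wt | wtSpace P.H V n ≠ ⊥} => wtSpace P.H V n)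
  rw [htop'] at hfd'
  exact Module.Finite.equiv (Submodule.topEquiv (R := ℂ) (M := V))

end Dominant

theorem IsBase.finiteDimensional_simple {r₀ : P.Wt} (hr₀ : P.IsWeylVector B₀ r₀)
    (hm : m + r₀ ∈ P.regularDominant B₀) : FiniteDimensional ℂ (P.Simple B₀ m) := by
  have := hB₀.isIrreducible_simple m
  refine hB₀.finiteDimensional_of_dominant (isHighest_simpleVec m) (hB₀.simpleVec_ne_zero m) ?_
  intro b hb
  obtain ⟨k, hk0, hk⟩ := hB₀.mem_regularDominant_iff.mp hm b hb
  rw [LinearMap.add_apply, hr₀.apply_cor hB₀ hb] at hk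
  refine ⟨k - 1, ?_⟩
  rw [Nat.cast_sub hk0]
  push_cast
  linear_combination hk

theorem IsBase.isWeightModule_simple (m : P.Wt) : IsWeightModule P.H (P.Simple B₀ m) :=
  hB₀.isWeightModule_of_generated (isHighest_simpleVec m) (hB₀.hwSub_simpleVec m)

/-- Weyl's character formula for `L(m)`. -/
theorem IsBase.evenDen_mul_ch_simple {r₀ : P.Wt} (hr₀ : P.IsWeylVector B₀ r₀)
    (hm : m + r₀ ∈ P.regularDominant B₀) :
    P.evenDen r₀ B₀ * ch P.H (P.Simple B₀ m) = P.altSum (m + r₀) := by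
  have := hB₀.finiteDimensional_simple hr₀ hm
  exact hB₀.evenDen_mul_ch hr₀ (isHighest_simpleVec m) (hB₀.simpleVec_ne_zero m)
    (hB₀.hwSub_simpleVec m)

end Finite

/-! ### Additivity of characters and composition series -/

section CompSeries

variable {P}
variable {V : Type w} [AddCommGroup V] [Module ℂ V] [LieRingModule g₀ V] [LieModule ℂ g₀ V]

theorem ch_ext {V' : Type*} [AddCommGroup V'] [Module ℂ V'] [LieRingModule g₀ V']
    [LieModule ℂ g₀ V'] [FiniteDimensional ℂ V] (E : V ≃ₗ⁅ℂ,g₀⁆ V') : ch P.H V = ch P.H V' := by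
  have : FiniteDimensional ℂ V' := Module.Finite.equiv (E : V ≃ₗ[ℂ] V')
  ext n
  rw [coeff_ch, coeff_ch, Nat.cast_inj]
  refine le_antisymm
    (LinearMap.finrank_le_finrank_of_injective
      (f := (E : V →ₗ[ℂ] V').restrict fun v hv => map_mem_wtSpace (H := P.H) E.toLieModuleHom hv) ?_)
    (LinearMap.finrank_le_finrank_of_injective
      (f := (E.symm : V' →ₗ[ℂ] V).restrict
        fun v hv => map_mem_wtSpace (H := P.H) E.symm.toLieModuleHom hv) ?_)
  · intro x y h
    exact Subtype.ext (E.injective (congrArg Subtype.val h))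
  · intro x y h
    exact Subtype.ext (E.symm.injective (congrArg Subtype.val h))

theorem isWeightModule_of_surjective {V' : Type*} [AddCommGroup V'] [Module ℂ V']
    [LieRingModule g₀ V'] [LieModule ℂ g₀ V'] (hV : IsWeightModule P.H V) {ψ : V →ₗ⁅ℂ,g₀⁆ V'}
    (hψ : Function.Surjective ψ) :
    IsWeightModule P.H V' ∧
      ∀ n, wtSpace P.H V' n = (wtSpace P.H V n).map (ψ : V →ₗ[ℂ] V') := by
  have hle (n : P.Wt) : (wtSpace P.H V n).map (ψ : V →ₗ[ℂ] V') ≤ wtSpace P.H V' n := by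
    rintro _ ⟨v, hv, rfl⟩
    exact map_mem_wtSpace ψ hv
  have htop : ⨆ n, (wtSpace P.H V n).map (ψ : V →ₗ[ℂ] V') = ⊤ := by
    rw [← Submodule.map_iSup, show ⨆ n, wtSpace P.H V n = ⊤ from hV, Submodule.map_top,
      LinearMap.range_eq_top]
    exact hψ
  refine ⟨?_, wtSpace_eq_of_le hle htop⟩
  rw [IsWeightModule, eq_top_iff, ← htop]
  exact iSup_mono hle

/-- Each weight component of a vector of M lies again in M, since Lie submodules are graded. -/
theorem isWeightModule_submodule (hV : IsWeightModule P.H V) (M : LieSubmodule ℂ g₀ V) :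
    IsWeightModule P.H M := by
  rw [IsWeightModule, eq_top_iff]
  rintro ⟨x, hx⟩ -
  have hx' : x ∈ ⨆ n, wtSpace P.H V n := by
    rw [show ⨆ n, wtSpace P.H V n = ⊤ from hV]; trivial
  obtain ⟨f, hf, hsum⟩ := (Submodule.mem_iSup_iff_exists_finsupp _ _).mp hx'
  have hmem (n : P.Wt) : f n ∈ M := by
    classical
    have h1 : f n + ∑ k ∈ f.support.erase n, f k = x := by
      rw [← hsum, Finsupp.sum]
      by_cases hn : n ∈ f.support
      · exact Finset.add_sum_erase _ f hn
      · rw [Finset.erase_eq_of_notMem hn, Finsupp.notMem_support_iff.mp hn, zero_add]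
    refine mem_of_add_mem_of_wtSpace M (hf n) (Submodule.sum_mem _ fun k hk => ?_) (h1 ▸ hx)
    exact (le_iSup₂_of_le (f := fun k (_ : k ≠ n) => wtSpace P.H V k) k
      (Finset.ne_of_mem_erase hk) le_rfl) (hf k)
  have hx2 : (⟨x, hx⟩ : M) = ∑ n ∈ f.support, ⟨f n, hmem n⟩ := by
    refine Subtype.ext (hsum.symm.trans ?_)
    exact (map_sum (M.incl : M →ₗ[ℂ] V) (fun n => ⟨f n, hmem n⟩) f.support).symm
  rw [hx2]
  refine Submodule.sum_mem _ fun n _ => Submodule.mem_iSup_of_mem n ?_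
  intro y
  exact Subtype.ext (hf n y)

/-- Characters are additive on short exact sequences. -/
theorem ch_eq_add {V' V'' : Type*} [AddCommGroup V'] [Module ℂ V'] [LieRingModule g₀ V']
    [LieModule ℂ g₀ V'] [AddCommGroup V''] [Module ℂ V''] [LieRingModule g₀ V'']
    [LieModule ℂ g₀ V''] [FiniteDimensional ℂ V'] [FiniteDimensional ℂ V] [FiniteDimensional ℂ V'']
    (hV : IsWeightModule P.H V) {φ : V' →ₗ⁅ℂ,g₀⁆ V} {ψ : V →ₗ⁅ℂ,g₀⁆ V''}
    (hφ : Function.Injective φ) (hψ : Function.Surjective ψ)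
    (hex : ∀ v, ψ v = 0 ↔ ∃ y, φ y = v) : ch P.H V = ch P.H V' + ch P.H V'' := by
  ext n
  rw [AddMonoidAlgebra.coeff_add, Finsupp.add_apply, coeff_ch, coeff_ch, coeff_ch, ← Nat.cast_add,
    Nat.cast_inj]
  let ψn : wtSpace P.H V n →ₗ[ℂ] wtSpace P.H V'' n :=
    (ψ : V →ₗ[ℂ] V'').restrict fun v hv => map_mem_wtSpace ψ hv
  let φn : wtSpace P.H V' n →ₗ[ℂ] wtSpace P.H V n :=
    (φ : V' →ₗ[ℂ] V).restrict fun v hv => map_mem_wtSpace φ hv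
  have hψn : LinearMap.range ψn = ⊤ := by
    rw [LinearMap.range_eq_top]
    rintro ⟨y, hy⟩
    have hy' := hy
    rw [(isWeightModule_of_surjective hV hψ).2 n] at hy'
    obtain ⟨v, hv, rfl⟩ := hy'
    exact ⟨⟨v, hv⟩, rfl⟩
  have hφn : Function.Injective φn := by
    intro x y h
    exact Subtype.ext (hφ (congrArg Subtype.val h))
  have hker : LinearMap.ker ψn = LinearMap.range φn := by
    ext ⟨v, hv⟩
    rw [LinearMap.mem_ker, LinearMap.mem_range]
    constructor
    · intro h
      obtain ⟨y, rfl⟩ := (hex v).mp (congrArg Subtype.val h)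
      refine ⟨⟨y, fun x => hφ ?_⟩, rfl⟩
      rw [LieModuleHom.map_lie, hv x, map_smul]
    · rintro ⟨⟨y, hy⟩, h⟩
      exact Subtype.ext ((hex v).mpr ⟨y, congrArg Subtype.val h⟩)
  have h1 := LinearMap.finrank_range_add_finrank_ker ψn
  rw [hψn, hker, finrank_top, LinearMap.finrank_range_of_inj hφn] at h1
  rw [← h1, add_comm]

theorem ch_eq_zero [Subsingleton V] : ch P.H V = 0 := by
  ext n
  rw [coeff_ch, Module.finrank_zero_of_subsingleton]
  rfl

theorem isIrreducible_of_covBy {A B : LieSubmodule ℂ g₀ V} (h : A ⋖ B) :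
    LieModule.IsIrreducible ℂ g₀ (B ⧸ A.comap B.incl) := by
  have hmk (b : B) : LieSubmodule.Quotient.mk' (A.comap B.incl) b = 0 ↔ (b : V) ∈ A :=
    LieSubmodule.Quotient.mk_eq_zero _
  have : Nontrivial (B ⧸ A.comap B.incl) := by
    obtain ⟨b, hb, hbA⟩ := SetLike.exists_of_lt h.lt
    exact ⟨LieSubmodule.Quotient.mk' _ ⟨b, hb⟩, 0, fun h0 => hbA ((hmk _).mp h0)⟩
  refine LieModule.IsIrreducible.mk fun K hK => ?_
  let C : LieSubmodule ℂ g₀ V := (K.comap (LieSubmodule.Quotient.mk' (A.comap B.incl))).map B.incl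
  have hC (b : B) : (b : V) ∈ C ↔ LieSubmodule.Quotient.mk' (A.comap B.incl) b ∈ K := by
    constructor
    · intro hb
      obtain ⟨c, hc, hcb⟩ := (LieSubmodule.mem_map _).mp hb
      rw [← show c = b from Subtype.ext hcb]
      exact hc
    · intro hb
      exact (LieSubmodule.mem_map _).mpr ⟨b, hb, rfl⟩
  have hCB : C ≤ B := by
    intro x hx
    obtain ⟨c, -, rfl⟩ := (LieSubmodule.mem_map _).mp hx
    exact c.2
  have hAC : A ≤ C := by
    intro x hx
    refine (hC ⟨x, h.le hx⟩).mpr ?_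
    rw [(hmk ⟨x, h.le hx⟩).mpr hx]
    exact K.zero_mem
  rcases h.eq_or_eq hAC hCB with h1 | h1
  · exfalso
    apply hK
    rw [eq_bot_iff]
    intro q hq
    obtain ⟨b, rfl⟩ := LieSubmodule.Quotient.surjective_mk' _ q
    rw [LieSubmodule.mem_bot, hmk, ← h1]
    exact (hC b).mpr hq
  · rw [eq_top_iff]
    rintro q -
    obtain ⟨b, rfl⟩ := LieSubmodule.Quotient.surjective_mk' _ q
    refine (hC b).mp ?_
    rw [h1]
    exact b.2

theorem ch_eq_sum_factors [FiniteDimensional ℂ V] (hV : IsWeightModule P.H V)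
    (s : CompSeries g₀ V) :
    ch P.H V = ∑ i : Fin s.series.length,
      ch P.H (s.series i.succ ⧸ (s.series i.castSucc).comap (s.series i.succ).incl) := by
  have hstep (i : Fin s.series.length) : ch P.H (s.series i.succ) = ch P.H (s.series i.castSucc) +
      ch P.H (s.series i.succ ⧸ (s.series i.castSucc).comap (s.series i.succ).incl) := by
    have hcov : s.series i.castSucc ⋖ s.series i.succ := s.series.step i
    refine ch_eq_add (isWeightModule_submodule hV _) (φ := LieSubmodule.inclusion hcov.le)
      (ψ := LieSubmodule.Quotient.mk' _) (LieSubmodule.inclusion_injective _)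
      (LieSubmodule.Quotient.surjective_mk' _) fun v => ?_
    rw [LieSubmodule.Quotient.mk_eq_zero]
    constructor
    · intro h
      exact ⟨⟨v, h⟩, rfl⟩
    · rintro ⟨y, rfl⟩
      exact y.2
  -- Splitting off the first or the last term of the same sum makes the characters of the filtration
  -- telescope.
  have h1 := Fin.sum_univ_succ fun i => ch P.H (s.series i)
  have h2 := Fin.sum_univ_castSucc fun i => ch P.H (s.series i)
  have h3 : ch P.H (s.series 0) = 0 := by
    have h0 : s.series 0 = ⊥ := s.head_eq
    have : Subsingleton (s.series 0) := by rw [h0]; infer_instance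
    exact ch_eq_zero
  have h4 : ch P.H (s.series (Fin.last _)) = ch P.H V := by
    have h0 : s.series (Fin.last _) = ⊤ := s.last_eq
    rw [h0]
    exact ch_ext (LieModuleEquiv.ofTop ℂ g₀ V)
  simp only [hstep, Finset.sum_add_distrib] at h1
  rw [h3, zero_add] at h1
  rw [h4, h1] at h2
  exact (add_left_cancel h2).symm

variable {B₀ : Finset P.Wt} (hB₀ : P.IsBase P.evenRoots B₀)

include hB₀

/-- The multiplicity of `L(m)` is a coefficient of the product of the character with the Weyl
denominator. -/
theorem IsBase.mult_eq_coeff {r₀ : P.Wt} (hr₀ : P.IsWeylVector B₀ r₀) [FiniteDimensional ℂ V]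
    (hV : IsWeightModule P.H V) (s : CompSeries g₀ V) {m : P.Wt}
    (hm : m + r₀ ∈ P.regularDominant B₀) :
    (s.mult (P.Simple B₀ m) : ℤ) = (P.evenDen r₀ B₀ * ch P.H V).coeff (m + r₀) := by
  classical
  let Q (i : Fin s.series.length) :=
    s.series i.succ ⧸ (s.series i.castSucc).comap (s.series i.succ).incl
  have hirr (i : Fin s.series.length) : LieModule.IsIrreducible ℂ g₀ (Q i) :=
    isIrreducible_of_covBy (s.series.step i)
  have hwt (i : Fin s.series.length) : IsWeightModule P.H (Q i) :=
    (isWeightModule_of_surjective (isWeightModule_submodule hV _) (LieSubmodule.Quotient.surjective_mk' _)).1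
  -- An irreducible factor has some highest weight n, and D₀ times its character is the alternating
  -- sum of e^{n+ρ₀}; its coefficient at m + ρ₀ detects n = m.
  have key (i : Fin s.series.length) : (P.evenDen r₀ B₀ * ch P.H (Q i)).coeff (m + r₀) =
      if Nonempty (Q i ≃ₗ⁅ℂ,g₀⁆ P.Simple B₀ m) then 1 else 0 := by
    have := hirr i
    have : Nontrivial (Q i) := LieModule.nontrivial_of_isIrreducible ℂ g₀ (Q i)
    obtain ⟨n, v, hv, hv0⟩ := hB₀.exists_isHighest (hwt i)
    have hn : n + r₀ ∈ P.regularDominant B₀ := hB₀.add_mem_regularDominant hr₀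
      fun b hb => hB₀.exists_nat_of_isHighest hv hv0 hb
    have hch := hB₀.evenDen_mul_ch hr₀ hv hv0 (hB₀.hwSub_eq_top hv hv0)
    rw [hch, hB₀.coeff_altSum_regularDominant hn hm]
    refine if_congr ⟨fun h => ?_, fun ⟨E⟩ => ?_⟩ rfl rfl
    · rw [← add_right_cancel h]
      exact hB₀.nonempty_simple_equiv hv hv0
    · rw [ch_ext (P := P) E, hB₀.evenDen_mul_ch_simple hr₀ hm] at hch
      have h1 := congrArg (fun f => f.coeff (m + r₀)) hch
      simp only [hB₀.coeff_altSum_regularDominant hn hm,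
        hB₀.coeff_altSum_regularDominant hm hm, if_true] at h1
      by_contra hne
      rw [if_neg hne] at h1
      exact one_ne_zero h1
  rw [ch_eq_sum_factors hV s, Finset.mul_sum, AddMonoidAlgebra.coeff_sum, Finsupp.finsetSum_apply,
    Finset.sum_congr rfl fun i _ => key i, Finset.sum_boole, CompSeries.mult,
    Nat.card_eq_fintype_card, Fintype.card_subtype]

end CompSeries

/-! ### The odd denominator and Kac-Wakimoto terms -/

section OddDenominator

open AddMonoidAlgebra

variable {P}

variable (P) in
/-- `T` contains exactly one of `a`, `-a` for each odd root `a`. -/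
structure IsHalf (T : Finset P.Wt) : Prop where
  subset : T ⊆ P.oddRoots
  mem_iff : ∀ a ∈ P.oddRoots, a ∈ T ↔ -a ∉ T

variable (P) in
/-- `∏_{a ∈ T} (e^{a/2} + e^{-a/2})`. -/
noncomputable def oddDen (T : Finset P.Wt) : AddMonoidAlgebra ℤ P.Wt :=
  ∏ a ∈ T, (single ((1 / 2 : ℂ) • a) 1 + single (-((1 / 2 : ℂ) • a)) 1)

theorem single_sum (T : Finset P.Wt) (φ : P.Wt → P.Wt) :
    (single (∑ a ∈ T, φ a) 1 : AddMonoidAlgebra ℤ P.Wt) = ∏ a ∈ T, single (φ a) 1 := by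
  classical
  induction T using Finset.induction_on with
  | empty => rfl
  | insert a T ha ih => rw [Finset.sum_insert ha, Finset.prod_insert ha, ← ih, single_mul_single,
      mul_one]

theorem oddDen_eq_mul (T : Finset P.Wt) :
    P.oddDen T = single ((1 / 2 : ℂ) • ∑ a ∈ T, a) 1 * ∏ a ∈ T, (1 + single (-a) 1) := by
  rw [oddDen, Finset.smul_sum, single_sum, ← Finset.prod_mul_distrib]
  refine Finset.prod_congr rfl fun a _ => ?_
  rw [mul_add, mul_one, single_mul_single, mul_one]
  congr 2
  module

/-- Passing from one half of the odd roots to another. -/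
theorem IsHalf.prod_eq {M : Type*} [CommMonoid M] {T T' : Finset P.Wt} [DecidableEq P.Wt]
    (hT : P.IsHalf T) (hT' : P.IsHalf T') (φ : P.Wt → M) :
    ∏ a ∈ T', φ a = ∏ a ∈ T, φ (if a ∈ T' then a else -a) := by
  symm
  have hneg {T : Finset P.Wt} (hT : P.IsHalf T) {a : P.Wt} (ha : a ∈ P.oddRoots) (h : a ∉ T) :
      -a ∈ T := by
    by_contra hcon
    exact h ((hT.mem_iff a ha).mpr hcon)
  refine Finset.prod_bij (fun a _ => if a ∈ T' then a else -a) ?_ ?_ ?_ fun _ _ => rfl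
  · intro a ha
    split_ifs with h
    · exact h
    · exact hneg hT' (hT.subset ha) h
  · intro a ha b hb hab
    have h1 : -a ∉ T := (hT.mem_iff a (hT.subset ha)).mp ha
    have h2 : -b ∉ T := (hT.mem_iff b (hT.subset hb)).mp hb
    split_ifs at hab with h3 h4 h4
    · exact hab
    · rw [hab] at ha; exact absurd ha h2
    · rw [← hab] at hb; exact absurd hb h1
    · exact neg_injective hab
  · intro b hb
    have hb' := hT'.subset hb
    by_cases h : b ∈ T
    · exact ⟨b, h, if_pos hb⟩
    · refine ⟨-b, hneg hT hb' h, ?_⟩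
      rw [if_neg ((hT'.mem_iff b hb').mp hb), neg_neg]

/-- Each factor is symmetric under a ↦ -a. -/
theorem IsHalf.oddDen_eq {T T' : Finset P.Wt} (hT : P.IsHalf T) (hT' : P.IsHalf T') :
    P.oddDen T' = P.oddDen T := by
  classical
  rw [oddDen, hT.prod_eq hT', oddDen]
  refine Finset.prod_congr rfl fun a _ => ?_
  split_ifs
  · rfl
  · rw [smul_neg, neg_neg, add_comm]

/-- Changing the half shifts the half-sum by a sum of odd roots, which is an integral weight
although the half-sums themselves need not be. -/
theorem IsHalf.sum_eq {T T' : Finset P.Wt} [DecidableEq P.Wt] (hT : P.IsHalf T)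
    (hT' : P.IsHalf T') : (1 / 2 : ℂ) • ∑ a ∈ T, a - (1 / 2 : ℂ) • ∑ a ∈ T', a =
      ∑ a ∈ T.filter (· ∉ T'), a := by
  have h := hT.prod_eq hT' (M := Multiplicative P.Wt) fun a => Multiplicative.ofAdd a
  have h' : ∑ a ∈ T', a = ∑ a ∈ T, if a ∈ T' then a else -a := h
  rw [h', ← smul_sub, ← Finset.sum_sub_distrib, Finset.sum_filter, Finset.smul_sum]
  refine Finset.sum_congr rfl fun a _ => ?_
  by_cases ha : a ∈ T'
  · simp [ha]
  · simp only [ha, if_false, not_false_eq_true, if_true]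
    module

/-- The Weyl group carries one half of the odd roots to another, and the product does not depend on
the half. -/
theorem IsHalf.act_oddDen {T : Finset P.Wt} (hT : P.IsHalf T) (w : P.weyl) :
    P.act w (P.oddDen T) = P.oddDen T := by
  classical
  have hinj : Function.Injective (w : P.Wt ≃ₗ[ℂ] P.Wt) := LinearEquiv.injective _
  have hw : P.IsHalf (T.image (w : P.Wt ≃ₗ[ℂ] P.Wt)) := by
    constructor
    · intro a ha
      obtain ⟨b, hb, rfl⟩ := Finset.mem_image.mp ha
      exact P.weyl_mem_oddRoots w (hT.subset hb)
    · intro a ha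
      obtain ⟨b, rfl⟩ : ∃ b, (w : P.Wt ≃ₗ[ℂ] P.Wt) b = a := LinearEquiv.surjective _ a
      have hb : b ∈ P.oddRoots := by
        have := P.weyl_mem_oddRoots w⁻¹ ha
        rwa [weyl_inv_apply_apply] at this
      rw [← map_neg, hinj.mem_finset_image, hinj.mem_finset_image, hT.mem_iff b hb]
  refine Eq.trans ?_ (hT.oddDen_eq hw)
  rw [oddDen, oddDen, Finset.prod_image hinj.injOn, map_prod]
  refine Finset.prod_congr rfl fun a _ => ?_
  rw [map_add, act_single, act_single, map_neg, map_smul]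

theorem isHalf_posOdd {B : Finset P.Wt} (hB : P.IsBase P.roots B) : P.IsHalf (P.posOdd B) := by
  refine ⟨fun a ha => (mem_posOdd.mp ha).1, fun a ha => ?_⟩
  have ha' := P.neg_mem_oddRoots ha
  rw [mem_posOdd, mem_posOdd]
  constructor
  · rintro ⟨-, h1⟩ ⟨-, h2⟩
    have := eq_zero_of_mem_of_neg_mem hB.linearIndependent h1 h2
    rw [this] at ha
    exact P.zero_notMem_oddRoots ha
  · intro h
    refine ⟨ha, (hB.pos_or_neg a ?_).resolve_right fun h2 => h ⟨ha', h2⟩⟩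
    classical
    rw [roots]
    exact Finset.mem_union_right _ ha

theorem neg_notMem_of_isIsoSet {S : Finset P.Wt} (hS : P.IsIsoSet S) {a : P.Wt} (ha : a ∈ S) :
    -a ∉ S := by
  intro hna
  have h0 : a ≠ 0 := by
    rintro rfl
    exact P.zero_notMem_oddRoots (hS.subset ha)
  have hne : (⟨a, ha⟩ : S) ≠ ⟨-a, hna⟩ := by
    intro h
    have h2 : (2 : ℂ) • a = 0 := by
      rw [two_smul]
      nth_rewrite 2 [show a = -a from congrArg Subtype.val h]
      exact add_neg_cancel a
    exact h0 ((smul_eq_zero.mp h2).resolve_left two_ne_zero)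
  have hinj : Function.Injective (![⟨a, ha⟩, ⟨-a, hna⟩] : Fin 2 → S) := by
    intro i j hij
    fin_cases i <;> fin_cases j
    · rfl
    · exact absurd hij hne
    · exact absurd hij hne.symm
    · rfl
  have h1 := hS.linearIndependent.comp _ hinj
  have h2 : LinearIndependent ℂ ![a, -a] := by
    convert h1 using 1
    ext i
    fin_cases i <;> rfl
  have h3 := LinearIndependent.pair_iff.mp h2 1 1 (by simp)
  exact one_ne_zero h3.1

/-- An iso-set is contained in a half of the odd roots. -/
theorem exists_isHalf {S T : Finset P.Wt} (hS : P.IsIsoSet S) (hT : P.IsHalf T) :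
    ∃ T', P.IsHalf T' ∧ S ⊆ T' := by
  classical
  -- Keep T on the pairs ±a not met by S and use S on the others; independence of S excludes
  -- opposite pairs within S.
  refine ⟨S ∪ T.filter (fun a => a ∉ S ∧ -a ∉ S), ⟨?_, ?_⟩, Finset.subset_union_left⟩
  · exact Finset.union_subset hS.subset ((Finset.filter_subset _ _).trans hT.subset)
  · intro a ha
    have h1 := hT.mem_iff a ha
    have h2 : a ∈ S → -a ∉ S := neg_notMem_of_isIsoSet hS
    simp only [Finset.mem_union, Finset.mem_filter, neg_neg]
    tauto

open scoped Classical in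
variable (P) in
/-- `∑_{U ⊆ T ∖ S} ∑_{w} sgn(w) e^{w(ν - sum(U))}`. -/
noncomputable def kwNum (n : P.Wt) (T S : Finset P.Wt) : AddMonoidAlgebra ℤ P.Wt :=
  ∑ U ∈ (T \ S).powerset, P.altSum (n - ∑ b ∈ U, b)

theorem isAnti_kwNum (n : P.Wt) (T S : Finset P.Wt) : IsAnti (P.kwNum n T S) := by
  intro w
  rw [kwNum, map_sum, Finset.smul_sum]
  exact Finset.sum_congr rfl fun U _ => isAnti_altSum _ w

theorem IsBase.mem_integralWeights_of_coeff_kwNum {B₀ : Finset P.Wt}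
    (hB₀ : P.IsBase P.evenRoots B₀) {n : P.Wt} (hn : n ∈ P.integralWeights) {T S : Finset P.Wt}
    (hT : P.IsHalf T) {m : P.Wt} (hm : (P.kwNum n T S).coeff m ≠ 0) : m ∈ P.integralWeights := by
  classical
  rw [kwNum, AddMonoidAlgebra.coeff_sum, Finsupp.finsetSum_apply] at hm
  obtain ⟨U, hU, hne⟩ := Finset.exists_ne_zero_of_sum_ne_zero hm
  refine mem_integralWeights_of_coeff_altSum
    (hB₀.sub_mem_integralWeights hn (hB₀.sum_mem_integralWeights fun a ha => ?_)) hne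
  exact hB₀.oddRoot_mem_integralWeights
    (hT.subset (Finset.mem_sdiff.mp (Finset.mem_powerset.mp hU ha)).1)

theorem toRat_injective : Function.Injective (toRat P.H) :=
  IsFractionRing.injective (AddMonoidAlgebra ℤ (Module.Dual ℂ P.H)) (RatFun P.H)

theorem toRat_ne_zero {f : AddMonoidAlgebra ℤ P.Wt} (hf : f ≠ 0) : toRat P.H f ≠ 0 :=
  (map_ne_zero_iff _ toRat_injective).mpr hf

theorem actRat_toRat (w : P.Wt ≃ₗ[ℂ] P.Wt) (f : AddMonoidAlgebra ℤ P.Wt) :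
    actRat w (toRat P.H f) = toRat P.H (P.act w f) := by
  rw [actRat, toRat, IsFractionRing.ringEquivOfRingEquiv_algebraMap]
  rfl

theorem one_add_single_ne_zero {a : P.Wt} (ha : a ≠ 0) :
    (1 + single a 1 : AddMonoidAlgebra ℤ P.Wt) ≠ 0 := by
  classical
  intro h
  have := congrArg (fun f : AddMonoidAlgebra ℤ P.Wt => f.coeff 0) h
  rw [AddMonoidAlgebra.one_def] at this
  simp [coeff_single, Finsupp.single_apply, ha] at this

theorem one_sub_single_ne_zero {a : P.Wt} (ha : a ≠ 0) :
    (1 - single a 1 : AddMonoidAlgebra ℤ P.Wt) ≠ 0 := by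
  classical
  intro h
  have := congrArg (fun f : AddMonoidAlgebra ℤ P.Wt => f.coeff 0) h
  rw [AddMonoidAlgebra.one_def] at this
  simp [coeff_single, Finsupp.single_apply, ha] at this

theorem single_ne_zero' (a : P.Wt) : (single a 1 : AddMonoidAlgebra ℤ P.Wt) ≠ 0 := by
  simp

theorem prod_one_add_ne_zero {T : Finset P.Wt} (hT : T ⊆ P.oddRoots) :
    ∏ a ∈ T, (1 + single (-a) 1 : AddMonoidAlgebra ℤ P.Wt) ≠ 0 := by
  refine Finset.prod_ne_zero_iff.mpr fun a ha => one_add_single_ne_zero (neg_ne_zero.mpr ?_)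
  rintro rfl
  exact P.zero_notMem_oddRoots (hT ha)

theorem IsHalf.oddDen_ne_zero {T : Finset P.Wt} (hT : P.IsHalf T) : P.oddDen T ≠ 0 := by
  rw [oddDen_eq_mul]
  exact mul_ne_zero (single_ne_zero' _) (prod_one_add_ne_zero hT.subset)

theorem evenDen_ne_zero (r : P.Wt) (B : Finset P.Wt) : P.evenDen r B ≠ 0 := by
  refine mul_ne_zero (single_ne_zero' _) (Finset.prod_ne_zero_iff.mpr fun a ha =>
    one_sub_single_ne_zero (neg_ne_zero.mpr ?_))
  rintro rfl
  exact (P.mem_evenRoots.mp (mem_posEven.mp ha).1).1 rfl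

theorem prod_one_add_eq_sum (n : P.Wt) (T : Finset P.Wt) :
    single n 1 * ∏ a ∈ T, (1 + single (-a) 1 : AddMonoidAlgebra ℤ P.Wt) =
      ∑ U ∈ T.powerset, single (n - ∑ b ∈ U, b) 1 := by
  classical
  rw [Finset.prod_one_add, Finset.mul_sum]
  refine Finset.sum_congr rfl fun U _ => ?_
  rw [← single_sum, single_mul_single, mul_one, Finset.sum_neg_distrib, sub_eq_add_neg]

/-- Kac-Wakimoto terms as quotients of elements of the group ring. -/
theorem IsHalf.KW_eq {T : Finset P.Wt} (hT : P.IsHalf T) {S : Finset P.Wt} (hST : S ⊆ T)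
    (n : P.Wt) : P.KW n S =
      toRat P.H (P.kwNum (n + (1 / 2 : ℂ) • ∑ a ∈ T, a) T S) / toRat P.H (P.oddDen T) := by
  classical
  have hD := toRat_ne_zero hT.oddDen_ne_zero
  have hS := toRat_ne_zero (prod_one_add_ne_zero (hST.trans hT.subset))
  set n' := n + (1 / 2 : ℂ) • ∑ a ∈ T, a with hn'
  -- Numerator and denominator are multiplied by the factors of T ∖ S and by e^{sum(T)/2}, which
  -- completes the denominator to the W-invariant `oddDen`.
  have h1 : rexp n / ∏ b ∈ S, (1 + rexp (-b)) =
      toRat P.H (∑ U ∈ (T \ S).powerset, single (n' - ∑ b ∈ U, b) 1) / toRat P.H (P.oddDen T) := by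
    have e1 : ∏ b ∈ S, (1 + rexp (-b)) = toRat P.H (∏ a ∈ S, (1 + single (-a) 1)) := by
      rw [map_prod]
      refine Finset.prod_congr rfl fun a _ => ?_
      rw [map_add, map_one]
      rfl
    rw [e1, div_eq_div_iff hS hD, rexp, ← map_mul, ← map_mul, ← prod_one_add_eq_sum, oddDen_eq_mul,
      mul_assoc, Finset.prod_sdiff hST, ← mul_assoc, single_mul_single, mul_one]
  rw [KW, finsum_eq_sum_of_fintype, h1, kwNum]
  simp only [map_div₀, actRat_toRat, hT.act_oddDen]
  simp only [← mul_div_assoc, ← Finset.sum_div]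
  congr 1
  simp only [map_sum, Finset.mul_sum]
  rw [Finset.sum_comm]
  refine Finset.sum_congr rfl fun U _ => ?_
  rw [altSum, map_sum]
  refine Finset.sum_congr rfl fun w _ => ?_
  rw [act_single, map_zsmul, zsmul_eq_mul]

/-- The shift of ρ₀ by half the sum of the odd positive roots is exactly what symmetrizes the odd
factors. -/
theorem weylDenominator_eq {B₀ B : Finset P.Wt} (hB : P.IsCompatibleBase B₀ B) (r₀ : P.Wt) :
    P.weylDenominator r₀ B =
      toRat P.H (P.evenDen r₀ B₀) / toRat P.H (P.oddDen (P.posOdd B)) := by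
  have hT := isHalf_posOdd hB.1
  have hD := toRat_ne_zero hT.oddDen_ne_zero
  have hS := toRat_ne_zero (prod_one_add_ne_zero hT.subset)
  have e1 : ∏ a ∈ P.posOdd B, (1 + rexp (-a)) =
      toRat P.H (∏ a ∈ P.posOdd B, (1 + single (-a) 1)) := by
    rw [map_prod]
    refine Finset.prod_congr rfl fun a _ => ?_
    rw [map_add, map_one]
    rfl
  have e2 : ∏ a ∈ P.posEven B, (1 - rexp (-a)) =
      toRat P.H (∏ a ∈ P.posEven B₀, (1 - single (-a) 1)) := by
    rw [map_prod, hB.2]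
    refine Finset.prod_congr rfl fun a _ => ?_
    rw [map_sub, map_one]
    rfl
  rw [weylDenominator, e1, e2, div_mul_eq_mul_div, div_eq_div_iff hS hD, rexp, ← map_mul, ← map_mul,
    ← map_mul, oddDen_eq_mul, evenDen, rho]
  congr 1
  have : (single r₀ 1 : AddMonoidAlgebra ℤ P.Wt) =
      single (r₀ - (1 / 2 : ℂ) • ∑ a ∈ P.posOdd B, a) 1 *
        single ((1 / 2 : ℂ) • ∑ a ∈ P.posOdd B, a) 1 := by
    rw [single_mul_single, mul_one, sub_add_cancel]
  rw [this]
  ring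

end OddDenominator

/-! ### Dimensions -/

section Dimension

open AddMonoidAlgebra PowerSeries

variable {P}

variable (P) in
/-- The ring homomorphism `e^m ↦ exp((m|n) X)`. -/
noncomputable def expEval (n : P.Wt) : AddMonoidAlgebra ℤ P.Wt →ₐ[ℤ] PowerSeries ℂ :=
  AddMonoidAlgebra.lift ℤ (PowerSeries ℂ) P.Wt
    { toFun := fun m => rescale (P.dualForm m.toAdd n) (PowerSeries.exp ℂ)
      map_one' := by
        have h : P.dualForm 0 n = 0 := rfl
        rw [toAdd_one, h, rescale_zero, RingHom.comp_apply, constantCoeff_exp, map_one]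
      map_mul' := fun a b => by
        rw [toAdd_mul, dualForm_add_left, exp_mul_exp_eq_exp_add] }

theorem expEval_single (n m : P.Wt) :
    P.expEval n (single m 1) = rescale (P.dualForm m n) (PowerSeries.exp ℂ) := by
  exact (AddMonoidAlgebra.lift_single _ _ _).trans (one_smul ℤ _)

theorem constantCoeff_expEval (n : P.Wt) (f : AddMonoidAlgebra ℤ P.Wt) :
    constantCoeff (P.expEval n f) = ((dim P.H f : ℤ) : ℂ) := by
  induction f using AddMonoidAlgebra.induction_linear with
  | zero => simp
  | add f g hf hg => rw [map_add, map_add, hf, hg, map_add, Int.cast_add]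
  | single m c =>
    have h : (single m c : AddMonoidAlgebra ℤ P.Wt) = c • single m 1 := by simp
    rw [h, map_zsmul, map_zsmul, map_zsmul, expEval_single, dim, AddMonoidAlgebra.lift_single,
      ← coeff_zero_eq_constantCoeff_apply, coeff_rescale]
    simp

/-- Substitute w⁻¹ for w and use invariance of the form. This reciprocity turns any alternating sum
into the denominator evaluated in another direction. -/
theorem expEval_altSum_comm (n r : P.Wt) :
    P.expEval r (P.altSum n) = P.expEval n (P.altSum r) := by
  rw [altSum, altSum, map_sum, map_sum]
  refine Fintype.sum_equiv (Equiv.inv P.weyl) _ _ fun w => ?_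
  rw [map_zsmul, map_zsmul, expEval_single, expEval_single, Equiv.inv_apply, sgn_inv]
  congr 3
  rw [← P.dualForm_weyl w⁻¹, weyl_inv_apply_apply, dualForm_comm]

theorem exists_eq_X_mul (c : ℂ) :
    ∃ G : PowerSeries ℂ, 1 - rescale (-c) (PowerSeries.exp ℂ) = X * G ∧ constantCoeff G = c := by
  obtain ⟨G, hG⟩ : X ∣ 1 - rescale (-c) (PowerSeries.exp ℂ) := by
    rw [X_dvd_iff, map_sub, ← coeff_zero_eq_constantCoeff_apply,
      ← coeff_zero_eq_constantCoeff_apply, coeff_rescale]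
    simp
  refine ⟨G, hG, ?_⟩
  have h1 := congrArg (PowerSeries.coeff 1) hG
  rw [show (1 : ℕ) = 0 + 1 from rfl, coeff_succ_X_mul, map_sub, coeff_rescale, coeff_exp, coeff_one] at h1
  rw [← coeff_zero_eq_constantCoeff_apply, ← h1]
  simp

/-- `1 - e^{-a}` evaluated along `n`, divided by `X`. -/
noncomputable def rootFactor (n a : P.Wt) : PowerSeries ℂ :=
  (exists_eq_X_mul (P.dualForm a n)).choose

theorem expEval_evenDen (n r : P.Wt) (B : Finset P.Wt) :
    P.expEval n (P.evenDen r B) = X ^ (P.posEven B).card *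
      (rescale (P.dualForm r n) (PowerSeries.exp ℂ) * ∏ a ∈ P.posEven B, rootFactor n a) := by
  rw [evenDen, map_mul, expEval_single, map_prod, mul_left_comm, ← Finset.prod_const,
    ← Finset.prod_mul_distrib]
  congr 1
  refine Finset.prod_congr rfl fun a _ => ?_
  rw [map_sub, map_one, expEval_single, dualForm_neg_left]
  exact (exists_eq_X_mul (P.dualForm a n)).choose_spec.1

theorem constantCoeff_rootFactor (n a : P.Wt) :
    constantCoeff (rootFactor n a) = P.dualForm a n :=
  (exists_eq_X_mul (P.dualForm a n)).choose_spec.2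

variable (P) in
/-- The leading term of `f` along `r₀` is `q` times that of the Weyl denominator. -/
def HasDim (r₀ : P.Wt) (B₀ : Finset P.Wt) (f : AddMonoidAlgebra ℤ P.Wt) (q : ℂ) : Prop :=
  ∃ G : PowerSeries ℂ, P.expEval r₀ f = X ^ (P.posEven B₀).card * G ∧
    constantCoeff G = q * ∏ a ∈ P.posEven B₀, P.dualForm r₀ a

theorem HasDim.zsmul {r₀ : P.Wt} {B₀ : Finset P.Wt} {f : AddMonoidAlgebra ℤ P.Wt} {q : ℂ}
    (h : P.HasDim r₀ B₀ f q) (c : ℤ) : P.HasDim r₀ B₀ (c • f) (c * q) := by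
  obtain ⟨G, hG, hq⟩ := h
  refine ⟨c • G, ?_, ?_⟩
  · rw [map_zsmul, hG, mul_smul_comm]
  · rw [map_zsmul, hq, zsmul_eq_mul, mul_assoc]

theorem hasDim_sum {ι : Type*} {r₀ : P.Wt} {B₀ : Finset P.Wt} (s : Finset ι)
    {f : ι → AddMonoidAlgebra ℤ P.Wt} {q : ι → ℂ} (h : ∀ i ∈ s, P.HasDim r₀ B₀ (f i) (q i)) :
    P.HasDim r₀ B₀ (∑ i ∈ s, f i) (∑ i ∈ s, q i) := by
  choose! G hG hq using h
  refine ⟨∑ i ∈ s, G i, ?_, ?_⟩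
  · rw [map_sum, Finset.mul_sum]
    exact Finset.sum_congr rfl hG
  · rw [map_sum, Finset.sum_mul]
    exact Finset.sum_congr rfl hq

variable {B₀ : Finset P.Wt} (hB₀ : P.IsBase P.evenRoots B₀) {r₀ : P.Wt}
  (hr₀ : P.IsWeylVector B₀ r₀)

include hB₀ hr₀

/-- By reciprocity and the denominator formula, evaluation along r₀ equals D₀ evaluated along n,
where each factor 1 - exp(-(a|n)X) has leading term (a|n)X. -/
theorem IsBase.hasDim_altSum (n : P.Wt) : P.HasDim r₀ B₀ (P.altSum n)
    (∏ a ∈ P.posEven B₀, P.dualForm n a / P.dualForm r₀ a) := by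
  refine ⟨rescale (P.dualForm r₀ n) (PowerSeries.exp ℂ) * ∏ a ∈ P.posEven B₀, rootFactor n a,
    ?_, ?_⟩
  · rw [expEval_altSum_comm, ← hB₀.evenDen_eq_altSum hr₀, expEval_evenDen]
  · rw [map_mul, map_prod, ← Finset.prod_mul_distrib, ← coeff_zero_eq_constantCoeff_apply,
      coeff_rescale]
    simp only [pow_zero, one_mul, coeff_zero_eq_constantCoeff_apply, constantCoeff_exp]
    refine Finset.prod_congr rfl fun a ha => ?_
    rw [constantCoeff_rootFactor, div_mul_cancel₀ _ (hr₀.dualForm_ne_zero hB₀ ha), dualForm_comm]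

/-- Cancelling the power of X common to both sides leaves dim x times ∏ (r₀|a) as the constant term.
A limit of quotients is thereby avoided. -/
theorem IsBase.dim_eq_of_hasDim {x : AddMonoidAlgebra ℤ P.Wt} {q : ℂ}
    (h : P.HasDim r₀ B₀ (P.evenDen r₀ B₀ * x) q) : ((dim P.H x : ℤ) : ℂ) = q := by
  obtain ⟨G, hG, hq⟩ := h
  rw [map_mul, expEval_evenDen, mul_assoc] at hG
  have h1 := congrArg constantCoeff (mul_left_cancel₀ (pow_ne_zero _ X_ne_zero) hG)
  rw [hq, map_mul, map_mul, map_prod, constantCoeff_expEval, ← coeff_zero_eq_constantCoeff_apply,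
    coeff_rescale] at h1
  simp only [pow_zero, one_mul, coeff_zero_eq_constantCoeff_apply, constantCoeff_exp,
    constantCoeff_rootFactor] at h1
  have h2 : ∏ a ∈ P.posEven B₀, P.dualForm a r₀ = ∏ a ∈ P.posEven B₀, P.dualForm r₀ a :=
    Finset.prod_congr rfl fun a _ => P.dualForm_comm _ _
  rw [h2, mul_comm] at h1
  exact mul_right_cancel₀ (Finset.prod_ne_zero_iff.mpr fun a ha => hr₀.dualForm_ne_zero hB₀ ha) h1

theorem IsBase.hasDim_kwNum {B : Finset P.Wt} (hB : P.IsCompatibleBase B₀ B) (l : P.Wt)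
    (S : Finset P.Wt) :
    P.HasDim r₀ B₀ (P.kwNum (l + r₀) (P.posOdd B) S) (P.dimSum r₀ B l S) := by
  rw [kwNum, dimSum, hB.2]
  exact hasDim_sum _ fun U _ => hB₀.hasDim_altSum hr₀ _

end Dimension

/-! ### Multiplicities -/

section Multiplicity

open AddMonoidAlgebra

variable {P}

/-- In `multCoeff` the group element moves m + r₀, in `altSum` it moves the exponent; the two differ
by inverting w, which preserves the sign. -/
theorem multCoeff_eq (r₀ : P.Wt) (B : Finset P.Wt) (l : P.Wt) (S : Finset P.Wt) (m : P.Wt) :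
    P.multCoeff r₀ B l S m = (P.kwNum (l + r₀) (P.posOdd B) S).coeff (m + r₀) := by
  classical
  rw [multCoeff, kwNum, AddMonoidAlgebra.coeff_sum, Finsupp.finsetSum_apply]
  refine Finset.sum_congr (by congr!) fun U _ => ?_
  rw [finsum_eq_sum_of_fintype, coeff_altSum]
  refine Fintype.sum_equiv (Equiv.inv P.weyl) _ _ fun w => ?_
  rw [Equiv.inv_apply, sgn_inv]
  refine if_congr ⟨fun h => ?_, fun h => ?_⟩ rfl rfl
  · rw [← h, weyl_inv_apply_apply]
  · rw [← h, weyl_apply_inv_apply]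

theorem KW_eq_kwNum {B : Finset P.Wt} (hB : P.IsBase P.roots B) (r₀ l : P.Wt) {S : Finset P.Wt}
    (hS : S ⊆ P.posOdd B) : P.KW (l + P.rho r₀ B) S =
      toRat P.H (P.kwNum (l + r₀) (P.posOdd B) S) / toRat P.H (P.oddDen (P.posOdd B)) := by
  rw [(isHalf_posOdd hB).KW_eq hS, add_assoc, rho, sub_add_cancel]

variable {B₀ : Finset P.Wt} (hB₀ : P.IsBase P.evenRoots B₀) {r₀ : P.Wt}
  (hr₀ : P.IsWeylVector B₀ r₀)

include hB₀ hr₀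

/-- Anti-invariant elements are multiples of the Weyl denominator by virtual characters. -/
theorem IsBase.exists_mem_charRing {f : AddMonoidAlgebra ℤ P.Wt} (hf : IsAnti f)
    (hint : ∀ m, f.coeff m ≠ 0 → m ∈ P.integralWeights) :
    ∃ x ∈ charRing P.H, P.evenDen r₀ B₀ * x = f ∧
      x = ∑ᶠ (m : P.Wt) (_ : m + r₀ ∈ P.regularDominant B₀),
        f.coeff (m + r₀) • ch P.H (P.Simple B₀ m) := by
  classical
  -- The regular dominant part of the support, shifted by r₀: the only indices with a nonzero term
  -- in the finite-support sum.
  let s : Finset P.Wt := (f.coeff.support.filter (· ∈ P.regularDominant B₀)).image (· - r₀)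
  have hs {m : P.Wt} : m ∈ s ↔ f.coeff (m + r₀) ≠ 0 ∧ m + r₀ ∈ P.regularDominant B₀ := by
    simp only [s, Finset.mem_image, Finset.mem_filter, Finsupp.mem_support_iff]
    constructor
    · rintro ⟨n, h, rfl⟩
      rwa [sub_add_cancel]
    · intro h
      exact ⟨m + r₀, h, add_sub_cancel_right m r₀⟩
  have hx : ∑ᶠ (m : P.Wt) (_ : m + r₀ ∈ P.regularDominant B₀),
      f.coeff (m + r₀) • ch P.H (P.Simple B₀ m) =
        ∑ m ∈ s, f.coeff (m + r₀) • ch P.H (P.Simple B₀ m) := by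
    rw [finsum_eq_sum_of_support_subset (s := s)]
    · refine Finset.sum_congr rfl fun m hm => ?_
      rw [finsum_eq_if, if_pos (hs.mp hm).2]
    · intro m hm
      rw [Function.mem_support, finsum_eq_if] at hm
      rw [Finset.mem_coe, hs]
      split_ifs at hm with h
      · refine ⟨fun h0 => hm ?_, h⟩
        rw [h0, zero_smul]
      · exact absurd rfl hm
  have hmul : P.evenDen r₀ B₀ * ∑ m ∈ s, f.coeff (m + r₀) • ch P.H (P.Simple B₀ m) =
      ∑ m ∈ s, f.coeff (m + r₀) • P.altSum (m + r₀) := by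
    rw [Finset.mul_sum]
    refine Finset.sum_congr rfl fun m hm => ?_
    rw [mul_smul_comm, hB₀.evenDen_mul_ch_simple hr₀ (hs.mp hm).2]
  refine ⟨_, ?_, ?_, hx.symm⟩
  · refine AddSubgroup.sum_mem _ fun m hm => AddSubgroup.zsmul_mem _ ?_ _
    have := hB₀.finiteDimensional_simple hr₀ (hs.mp hm).2
    exact AddSubgroup.subset_closure ⟨P.Simple B₀ m, inferInstance, inferInstance, inferInstance,
      inferInstance, this, hB₀.isWeightModule_simple m, rfl⟩
  · rw [hmul]
    have hcoeff (n : P.Wt) : (∑ m ∈ s, f.coeff (m + r₀) • P.altSum (m + r₀)).coeff n =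
        ∑ m ∈ s, f.coeff (m + r₀) * (P.altSum (m + r₀)).coeff n := by
      rw [AddMonoidAlgebra.coeff_sum, Finsupp.finsetSum_apply]
      exact Finset.sum_congr rfl fun m _ => AddMonoidAlgebra.coeff_smul_apply _ _ _
    -- Both sides are anti-invariant with integral support, and at a regular dominant weight at most
    -- one alternating sum contributes.
    refine hB₀.anti_ext ?_ hf ?_ hint ?_
    · intro w
      rw [map_sum, Finset.smul_sum]
      refine Finset.sum_congr rfl fun m _ => ?_
      rw [map_zsmul, isAnti_altSum _ w, smul_comm]
    · intro n hn
      rw [hcoeff] at hn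
      obtain ⟨m, hm, hne⟩ := Finset.exists_ne_zero_of_sum_ne_zero hn
      exact mem_integralWeights_of_coeff_altSum (hs.mp hm).2.1 (right_ne_zero_of_mul hne)
    · intro n hn
      rw [hcoeff, Finset.sum_congr rfl fun m hm => by
        rw [hB₀.coeff_altSum_regularDominant (hs.mp hm).2 hn]]
      by_cases h0 : f.coeff n = 0
      · rw [h0]
        refine Finset.sum_eq_zero fun m hm => ?_
        split_ifs with h
        · rw [h, h0, zero_mul]
        · rw [mul_zero]
      · have hmem : n - r₀ ∈ s := hs.mpr (by rw [sub_add_cancel]; exact ⟨h0, hn⟩)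
        rw [Finset.sum_eq_single_of_mem _ hmem, sub_add_cancel, if_pos rfl, mul_one]
        intro m _ hne
        rw [if_neg, mul_zero]
        intro h
        exact hne (by rw [← h, add_sub_cancel_right])

/-- `KW(λ + ρ, S) / R e^ρ` is a virtual character. -/
theorem IsBase.exists_KW_div {B : Finset P.Wt} (hB : P.IsCompatibleBase B₀ B) {l : P.Wt}
    (hl : l ∈ P.integralWeights) {S : Finset P.Wt} (hS : P.IsIsoSet S) :
    ∃ x ∈ charRing P.H,
      toRat P.H x = P.KW (l + P.rho r₀ B) S / P.weylDenominator r₀ B ∧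
      (S ⊆ P.posOdd B → ((dim P.H x : ℤ) : ℂ) = P.dimSum r₀ B l S ∧
        x = ∑ᶠ (m : P.Wt) (_ : m + r₀ ∈ P.regularDominant B₀),
          P.multCoeff r₀ B l S m • ch P.H (P.Simple B₀ m)) := by
  classical
  have hT := isHalf_posOdd hB.1
  have hE := toRat_ne_zero (evenDen_ne_zero r₀ B₀)
  have hO := toRat_ne_zero hT.oddDen_ne_zero
  -- T is the set of positive odd roots when it contains S, so that the explicit formulas apply;
  -- otherwise any half of the odd roots containing S suffices for membership.
  obtain ⟨T, hT', hST, hTpos⟩ : ∃ T, P.IsHalf T ∧ S ⊆ T ∧ (S ⊆ P.posOdd B → T = P.posOdd B) := by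
    by_cases h : S ⊆ P.posOdd B
    · exact ⟨P.posOdd B, hT, h, fun _ => rfl⟩
    · obtain ⟨T, hT', hST⟩ := exists_isHalf hS hT
      exact ⟨T, hT', hST, fun h' => absurd h' h⟩
  have hn : l + P.rho r₀ B + (1 / 2 : ℂ) • ∑ a ∈ T, a =
      l + r₀ + ∑ a ∈ T.filter (· ∉ P.posOdd B), a := by
    rw [← hT'.sum_eq hT, rho]
    abel
  have hint : l + P.rho r₀ B + (1 / 2 : ℂ) • ∑ a ∈ T, a ∈ P.integralWeights := by
    rw [hn]
    refine hB₀.add_mem_integralWeights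
      (hB₀.add_mem_integralWeights hl (hr₀.mem_integralWeights hB₀))
      (hB₀.sum_mem_integralWeights fun a ha => ?_)
    exact hB₀.oddRoot_mem_integralWeights (hT'.subset (Finset.mem_filter.mp ha).1)
  obtain ⟨x, hx, hmul, hsum⟩ := hB₀.exists_mem_charRing hr₀ (isAnti_kwNum _ T S)
    fun m hm => hB₀.mem_integralWeights_of_coeff_kwNum hint hT' hm
  refine ⟨x, hx, ?_, fun hSpos => ?_⟩
  · rw [hT'.KW_eq hST, weylDenominator_eq hB, hT.oddDen_eq hT', ← hmul, map_mul,
      div_div_div_cancel_right₀ hO, mul_div_cancel_left₀ _ hE]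
  · obtain rfl := hTpos hSpos
    rw [show l + P.rho r₀ B + (1 / 2 : ℂ) • ∑ a ∈ P.posOdd B, a = l + r₀ by
      rw [add_assoc, rho, sub_add_cancel]] at hmul hsum
    refine ⟨hB₀.dim_eq_of_hasDim hr₀ ?_, ?_⟩
    · rw [hmul]
      exact hB₀.hasDim_kwNum hr₀ hB l S
    · simp only [multCoeff_eq]
      exact hsum

omit hB₀ hr₀ in
variable (P) in
theorem charZero_ratFun : CharZero (RatFun P.H) := by
  refine charZero_of_injective_ringHom (f := (toRat P.H).comp (singleZeroRingHom (R := ℤ))) ?_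
  refine toRat_injective.comp fun a b h => ?_
  have h1 := congrArg (fun f : AddMonoidAlgebra ℤ P.Wt => f.coeff 0) h
  change (single 0 a : AddMonoidAlgebra ℤ P.Wt).coeff 0 =
    (single 0 b : AddMonoidAlgebra ℤ P.Wt).coeff 0 at h1
  rwa [coeff_single, coeff_single, Finsupp.single_eq_same, Finsupp.single_eq_same] at h1

omit hB₀ hr₀ in
/-- Clearing denominators in a rational combination of Kac-Wakimoto terms. -/
theorem exists_int_combination {B : Finset P.Wt} (hB : P.IsCompatibleBase B₀ B)
    {y : AddMonoidAlgebra ℤ P.Wt} {k : ℕ} {c : Fin k → ℚ} {B' : Fin k → Finset P.Wt}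
    {l : Fin k → P.Wt} {S : Fin k → Finset P.Wt}
    (hB' : ∀ i, P.IsCompatibleBase B₀ (B' i)) (hS : ∀ i, S i ⊆ P.posOdd (B' i))
    (h : P.weylDenominator r₀ B * toRat P.H y =
      ∑ i, (c i : RatFun P.H) * P.KW (l i + P.rho r₀ (B' i)) (S i)) :
    ∃ (D : ℤ) (z : Fin k → ℤ), D ≠ 0 ∧ (∀ i, (D : ℚ) * c i = z i) ∧
      P.evenDen r₀ B₀ * (D • y) =
        ∑ i, z i • P.kwNum (l i + r₀) (P.posOdd (B' i)) (S i) := by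
  classical
  have := P.charZero_ratFun
  have hT := isHalf_posOdd hB.1
  have hO := toRat_ne_zero hT.oddDen_ne_zero
  -- D is the product of all denominators, and z i is the numerator of c i times the other
  -- denominators, so that z i = D c i.
  let D : ℤ := ∏ i, ((c i).den : ℤ)
  let z (i : Fin k) : ℤ := (c i).num * ∏ j ∈ Finset.univ.erase i, ((c j).den : ℤ)
  have hz (i : Fin k) : (D : ℚ) * c i = z i := by
    have h1 : D = (c i).den * ∏ j ∈ Finset.univ.erase i, ((c j).den : ℤ) :=
      (Finset.mul_prod_erase _ _ (Finset.mem_univ i)).symm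
    have h2 : ((c i).den : ℚ) * c i = (c i).num := Rat.den_mul_eq_num (c i)
    simp only [z]
    rw [h1, Int.cast_mul, Int.cast_mul, ← h2]
    push_cast
    ring
  refine ⟨D, z, ?_, hz, toRat_injective ?_⟩
  · exact Finset.prod_ne_zero_iff.mpr fun i _ => by exact_mod_cast (c i).den_ne_zero
  · have h1 : toRat P.H (P.evenDen r₀ B₀) * toRat P.H y =
        ∑ i, (c i : RatFun P.H) * toRat P.H (P.kwNum (l i + r₀) (P.posOdd (B' i)) (S i)) := by
      have h2 (i : Fin k) := KW_eq_kwNum (hB' i).1 r₀ (l i) (hS i)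
      simp only [h2, hT.oddDen_eq (isHalf_posOdd (hB' _).1), weylDenominator_eq hB,
        ← mul_div_assoc, ← Finset.sum_div] at h
      rw [div_mul_eq_mul_div] at h
      exact (div_left_inj' hO).mp h
    rw [mul_smul_comm, map_zsmul, map_mul, h1, map_sum, zsmul_eq_mul, Finset.mul_sum]
    refine Finset.sum_congr rfl fun i _ => ?_
    rw [map_zsmul, zsmul_eq_mul, ← mul_assoc]
    congr 1
    exact_mod_cast congrArg (fun q : ℚ => (q : RatFun P.H)) (hz i)

end Multiplicity

end BasicSuperalgebra

end KacWakimoto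

/-! ### Virtual characters from Kac-Wakimoto terms, and the formulas for modules. -/

theorem mainTheorem9
    {g₀ : Type u} [LieRing g₀] [LieAlgebra ℂ g₀] [FiniteDimensional ℂ g₀]
    {g₁ : Type v} [AddCommGroup g₁] [Module ℂ g₁] [LieRingModule g₀ g₁] [LieModule ℂ g₀ g₁]
    [FiniteDimensional ℂ g₁]
    (P : KacWakimoto.BasicSuperalgebra g₀ g₁)
    (B₀ : Finset P.Wt) (hB₀ : P.IsBase P.evenRoots B₀)
    (r₀ : P.Wt) (hr₀ : P.IsWeylVector B₀ r₀) :
    -- membership in the character ring, dimension and multiplicities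
    (∀ B : Finset P.Wt, P.IsCompatibleBase B₀ B →
      ∀ l ∈ P.integralWeights, ∀ S : Finset P.Wt, P.IsIsoSet S →
        (∀ b ∈ S, P.dualForm (l + P.rho r₀ B) b = 0) →
        ∃ x ∈ KacWakimoto.charRing P.H,
          KacWakimoto.toRat P.H x = P.KW (l + P.rho r₀ B) S / P.weylDenominator r₀ B ∧
          (S ⊆ P.posOdd B →
            ((KacWakimoto.dim P.H x : ℤ) : ℂ) = P.dimSum r₀ B l S ∧
            x = ∑ᶠ (m : P.Wt) (_ : m + r₀ ∈ P.regularDominant B₀),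
              P.multCoeff r₀ B l S m • KacWakimoto.ch P.H (P.Simple B₀ m))) ∧
    -- the resulting formulas for a module whose character is a combination of such terms
    (∀ B : Finset P.Wt, P.IsCompatibleBase B₀ B →
      ∀ (N : Type w) [AddCommGroup N] [Module ℂ N] [LieRingModule g₀ N] [LieModule ℂ g₀ N]
        [FiniteDimensional ℂ N], KacWakimoto.IsWeightModule P.H N →
      ∀ (k : ℕ) (c : Fin k → ℚ) (B' : Fin k → Finset P.Wt) (l : Fin k → P.Wt)
        (S : Fin k → Finset P.Wt),
        (∀ i, P.IsCompatibleBase B₀ (B' i) ∧ l i ∈ P.integralWeights ∧ P.IsIsoSet (S i) ∧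
          S i ⊆ P.posOdd (B' i) ∧ ∀ b ∈ S i, P.dualForm (l i + P.rho r₀ (B' i)) b = 0) →
        P.weylDenominator r₀ B * KacWakimoto.toRat P.H (KacWakimoto.ch P.H N) =
          ∑ i, (c i : KacWakimoto.RatFun P.H) * P.KW (l i + P.rho r₀ (B' i)) (S i) →
        (Module.finrank ℂ N : ℂ) = ∑ i, (c i : ℂ) * P.dimSum r₀ (B' i) (l i) (S i) ∧
        ∀ m : P.Wt, m + r₀ ∈ P.regularDominant B₀ →
          ∀ s : KacWakimoto.CompSeries g₀ N,
            (s.mult (P.Simple B₀ m) : ℚ) =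
              ∑ i, c i * P.multCoeff r₀ (B' i) (l i) (S i) m) := by
  refine ⟨fun B hB l hl S hS _ => hB₀.exists_KW_div hr₀ hB hl hS, ?_⟩
  intro B hB N _ _ _ _ _ hN k c B' l S hdata h
  obtain ⟨D, z, hD, hz, hmul⟩ := KacWakimoto.BasicSuperalgebra.exists_int_combination hB
    (fun i => (hdata i).1) (fun i => (hdata i).2.2.2.1) h
  constructor
  -- The relation between D₀ · D ch N and the integral combination of numerators is compared at its
  -- leading term along r₀.
  · have h1 : ((KacWakimoto.dim P.H (D • KacWakimoto.ch P.H N) : ℤ) : ℂ) =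
        ∑ i, (z i : ℂ) * P.dimSum r₀ (B' i) (l i) (S i) := by
      refine hB₀.dim_eq_of_hasDim hr₀ ?_
      rw [hmul]
      exact KacWakimoto.BasicSuperalgebra.hasDim_sum _ fun i _ =>
        (hB₀.hasDim_kwNum hr₀ (hdata i).1 (l i) (S i)).zsmul (z i)
    rw [map_zsmul, KacWakimoto.dim_ch P.H hN, smul_eq_mul, Int.cast_mul, Int.cast_natCast] at h1
    have hD' : (D : ℂ) ≠ 0 := Int.cast_ne_zero.mpr hD
    refine mul_left_cancel₀ hD' (h1.trans ?_)
    rw [Finset.mul_sum]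
    refine Finset.sum_congr rfl fun i _ => ?_
    have h2 : (D : ℂ) * (c i : ℂ) = z i := by
      exact_mod_cast congrArg (fun q : ℚ => (q : ℂ)) (hz i)
    rw [← mul_assoc, h2]
  · intro m hm s
    -- The same relation read at e^{m+r₀} gives D times the multiplicity on one side and the z i
    -- times the multiplicity coefficients on the other.
    have h1 := congrArg (fun f => f.coeff (m + r₀)) hmul
    simp only [mul_smul_comm, AddMonoidAlgebra.coeff_sum, Finsupp.finsetSum_apply,
      AddMonoidAlgebra.coeff_smul_apply, smul_eq_mul, ← hB₀.mult_eq_coeff hr₀ hN s hm,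
      ← KacWakimoto.BasicSuperalgebra.multCoeff_eq] at h1
    have hD' : (D : ℚ) ≠ 0 := Int.cast_ne_zero.mpr hD
    refine mul_left_cancel₀ hD' ?_
    rw [Finset.mul_sum]
    simp only [← mul_assoc, hz]
    exact_mod_cast h1
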